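/- Let $k$ be a commutative ring, $\mathcal V$ the category of $k$-modules and $G$ a group. All categories below are small, $\mathcal V\text{-}\mathrm{Cat}$ is the 2-category of $k$-linear categories, $k$-linear functors and natural transformations, and $\otimes$ is its tensor product ($k$-linear functors out of $A\otimes B$ are functors of two variables that are $k$-bilinear on homs). *Braided monoidales.* $G^{\mathrm{aut}}$ is the groupoid whose objects are the elements of $G$ and whose morphisms $a\to b$ are the $g\in G$ with $ga=bg$. $\mathrm{Ps}(G^{\mathrm{aut}},\mathcal V\text{-}\mathrm{Cat})$ is the bicategory of pseudofunctors, pseudonatural transformations and modifications; it is braided monoidal under the convolution $(S\star T)c=\sum_{ab=c}Sa\otimes Tb$, with unit concentrated at $1\in G$ and with braiding $Sa\otimes Tb\to T(aba^{-1})\otimes Sa$, $(A,B)\mapsto (a B,A)$, where $gB$ denotes the action of $g\in G$ on an object $B$ through the morphism $b\to gbg^{-1}$. A braided monoidale in it is therefore a pseudofunctor $M$ with $k$-linear functors $\square: Ma\otimes Mb\to M(ab)$, an object $I\in M1$, isomorphisms $gA\,\square\, gB\cong g(A\,\square\, B)$ and $I\cong gI$ making these pseudonatural, natural associativity and unit isomorphisms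 that are modifications and satisfy the pentagon and triangle axioms, and natural isomorphisms $A\,\square\, B\cong aB\,\square\, A$ ($A\in Ma$, $B\in Mb$) that form a modification and satisfy the two hexagon axioms. Braided monoidales form a bicategory, with braided strong monoidal pseudonatural transformations as 1-cells and monoidal modifications as 2-cells. *$G$-braided categories (Turaev–Virelizier).* A $G$-graded category over $k$ is a $k$-linear monoidal category $\mathcal C$ with finite direct sums and with pairwise disjoint full subcategories $\mathcal C_a$ ($a\in G$), each with finite direct sums, such that every object is a direct sum $\bigoplus_a X_a$ with $X_a\in\mathcal C_a$ and $a$ in a finite subset of $G$; $X\otimes Y\in\mathcal C_{ab}$ if $X\in\mathcal C_a$, $Y\in\mathcal C_b$; $\mathcal C(X,Y)=0$ if $X\in\mathcal C_a$, $Y\in\mathcal C_b$, $a\neq b$; and the tensor unit is in $\mathcal C_1$. A $G$-crossed category is a $G$-graded category with $k$-linear strong monoidal equivalences $\phi_a:\mathcal C\to\mathcal C$ ($a\in G$), with $\phi_a(\mathcal C_b)\subseteq\mathcal C_{a^{-1}ba}$, and monoidal natural isomorphisms $\phi_a\phi_b\cong\phi_{ba}$ and $1_{\mathcal C}\cong\phi_1$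 that satisfy the associativity and unit conditions. A $G$-braided category is a $G$-crossed category with natural isomorphisms $\gamma_{X,Y}:X\otimes Y\to Y\otimes\phi_{b}(X)$ for $X\in\mathcal C$, $Y\in\mathcal C_b$, such that, up to the above constraints, (i) $\gamma_{X,Y\otimes Z}=(1_Y\otimes\gamma_{\phi_{b}X,Z})(\gamma_{X,Y}\otimes 1_Z)$ for $Y\in\mathcal C_b$ and $Z$ homogeneous; (ii) $\gamma_{X\otimes Y,Z}=(\gamma_{X,Z}\otimes 1_{\phi_{c}Y})(1_X\otimes\gamma_{Y,Z})$ for $Z\in\mathcal C_c$; (iii) $\phi_a(\gamma_{X,Y})=\gamma_{\phi_aX,\phi_aY}$ for $a\in G$ and $Y$ homogeneous. $G$-braided categories form a bicategory: the 1-cells are $k$-linear strong monoidal functors that preserve the subcategories of index $a$ for every $a\in G$, with coherent monoidal natural isomorphisms $F\phi_a\cong\phi_aF$, and that are compatible with the $G$-braidings; the 2-cells are the monoidal natural transformations compatible with the $\phi_a$. **Proposition.** There is a pseudofunctor $F$ from the bicategory of $G$-braided categories over $k$ to the bicategory of braided monoidales in $\mathrm{Ps}(G^{\mathrm{aut}},\mathcal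 V\text{-}\mathrm{Cat})$ such that: 1. $(F\mathcal C)a=\mathcal C_a$ for every $G$-braided category $\mathcal C$ and every $a\in G$. 2. $F$ is an equivalence on hom-categories, and a braided monoidale $M$ is equivalent to $F\mathcal C$ for some $\mathcal C$ if and only if each $k$-linear category $Ma$ ($a\in G$) has finite direct sums. Thus $F$ is a biequivalence from $G$-braided categories to braided monoidales whose values $Ma$ have finite direct sums. 3. For every braided monoidale $M$ there are a $G$-braided category $\mathcal C$ and a 1-cell of braided monoidales $\eta:M\to F\mathcal C$ such that each $\eta_a:Ma\to\mathcal C_a$ is fully faithful and every object of $\mathcal C_a$ is a finite direct sum of objects in the image of $\eta_a$ (so $\eta$ exhibits $F\mathcal C$ as the completion of $M$ under finite direct sums). -/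

import Mathlib

open CategoryTheory Bicategory
open scoped Pseudofunctor.StrongTrans

universe w v u

set_option linter.checkUnivs false in
/-- A small `k`-linear category, i.e. a small category enriched in `k`-modules. -/
structure LinCat (k : Type w) [CommRing k] where
  carrier : Type u
  [category : Category.{v} carrier]
  [preadditive : Preadditive carrier]
  [linear : Linear k carrier]

namespace LinCat

attribute [instance] LinCat.category LinCat.preadditive LinCat.linear

variable {k : Type w} [CommRing k]

instance : CoeSort (LinCat.{w, v, u} k) (Type u) := ⟨LinCat.carrier⟩

/-- The linear category on a type that carries the structure. -/
abbrev of (k : Type w) [CommRing k] (C : Type u) [Category.{v} C] [Preadditive C] [Linear k C] :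
    LinCat.{w, v, u} k := ⟨C⟩

/-- A `k`-linear functor. -/
structure Hom (C D : LinCat.{w, v, u} k) where
  toFunctor : C ⥤ D
  [additive : toFunctor.Additive]
  [linear : toFunctor.Linear k]

attribute [instance] Hom.additive Hom.linear

/-- A natural transformation between `k`-linear functors. -/
@[ext]
structure Hom₂ {C D : LinCat.{w, v, u} k} (F G : Hom C D) where
  toNatTrans : F.toFunctor ⟶ G.toFunctor

@[simps id_toFunctor comp_toFunctor]
instance : CategoryStruct (LinCat.{w, v, u} k) where
  Hom C D := Hom C D
  id C := ⟨𝟭 C⟩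
  comp F G := ⟨F.toFunctor ⋙ G.toFunctor⟩

@[simps id_toNatTrans comp_toNatTrans]
instance homCategory (C D : LinCat.{w, v, u} k) : Category (C ⟶ D) where
  Hom F G := Hom₂ F G
  id F := ⟨𝟙 _⟩
  comp α β := ⟨α.toNatTrans ≫ β.toNatTrans⟩

@[ext]
theorem hom₂_ext {C D : LinCat.{w, v, u} k} {F G : C ⟶ D} {α β : F ⟶ G}
    (h : ∀ X, α.toNatTrans.app X = β.toNatTrans.app X) : α = β :=
  Hom₂.ext (NatTrans.ext (funext h))

/-- A natural isomorphism of underlying functors is an invertible 2-cell. -/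
@[simps]
def isoMk {C D : LinCat.{w, v, u} k} {F G : C ⟶ D} (α : F.toFunctor ≅ G.toFunctor) : F ≅ G where
  hom := ⟨α.hom⟩
  inv := ⟨α.inv⟩

/-- The bicategory of small `k`-linear categories. -/
@[simps! whiskerLeft_toNatTrans whiskerRight_toNatTrans associator_hom_toNatTrans
  associator_inv_toNatTrans leftUnitor_hom_toNatTrans leftUnitor_inv_toNatTrans
  rightUnitor_hom_toNatTrans rightUnitor_inv_toNatTrans]
instance : Bicategory (LinCat.{w, v, u} k) where
  homCategory C D := homCategory C D
  whiskerLeft F _ _ α := Hom₂.mk (Functor.whiskerLeft F.toFunctor α.toNatTrans)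
  whiskerRight α G := Hom₂.mk (Functor.whiskerRight α.toNatTrans G.toFunctor)
  associator F G H := isoMk (Functor.associator F.toFunctor G.toFunctor H.toFunctor)
  leftUnitor F := isoMk (F := 𝟙 _ ≫ F) (Functor.leftUnitor F.toFunctor)
  rightUnitor F := isoMk (F := F ≫ 𝟙 _) (Functor.rightUnitor F.toFunctor)

section

variable {C D E E' : LinCat.{w, v, u} k}

@[ext]
theorem ext_app {F G : C ⟶ D} {α β : F ⟶ G}
    (h : ∀ X, α.toNatTrans.app X = β.toNatTrans.app X) : α = β :=
  Hom₂.ext (NatTrans.ext (funext h))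

@[simp]
theorem id_app (F : C ⟶ D) (X : C) : (𝟙 F : F ⟶ F).toNatTrans.app X = 𝟙 (F.toFunctor.obj X) := rfl

@[simp]
theorem comp_app {F G H : C ⟶ D} (α : F ⟶ G) (β : G ⟶ H) (X : C) :
    (α ≫ β).toNatTrans.app X = α.toNatTrans.app X ≫ β.toNatTrans.app X := rfl

@[simp]
theorem whiskerLeft_app (F : C ⟶ D) {G H : D ⟶ E} (α : G ⟶ H) (X : C) :
    (F ◁ α).toNatTrans.app X = α.toNatTrans.app (F.toFunctor.obj X) := rfl

@[simp]
theorem whiskerRight_app {F G : C ⟶ D} (α : F ⟶ G) (H : D ⟶ E) (X : C) :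
    (α ▷ H).toNatTrans.app X = H.toFunctor.map (α.toNatTrans.app X) := rfl

@[simp]
theorem associator_hom_app (F : C ⟶ D) (G : D ⟶ E) (H : E ⟶ E') (X : C) :
    (α_ F G H).hom.toNatTrans.app X = 𝟙 _ := rfl

@[simp]
theorem associator_inv_app (F : C ⟶ D) (G : D ⟶ E) (H : E ⟶ E') (X : C) :
    (α_ F G H).inv.toNatTrans.app X = 𝟙 _ := rfl

@[simp]
theorem leftUnitor_hom_app (F : C ⟶ D) (X : C) : (λ_ F).hom.toNatTrans.app X = 𝟙 _ := rfl

@[simp]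
theorem leftUnitor_inv_app (F : C ⟶ D) (X : C) : (λ_ F).inv.toNatTrans.app X = 𝟙 _ := rfl

@[simp]
theorem rightUnitor_hom_app (F : C ⟶ D) (X : C) : (ρ_ F).hom.toNatTrans.app X = 𝟙 _ := rfl

@[simp]
theorem rightUnitor_inv_app (F : C ⟶ D) (X : C) : (ρ_ F).inv.toNatTrans.app X = 𝟙 _ := rfl

end

/-- The natural isomorphism underlying an invertible 2-cell. -/
@[simps]
def natIso {C D : LinCat.{w, v, u} k} {F G : C ⟶ D} (α : F ≅ G) :
    F.toFunctor ≅ G.toFunctor where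
  hom := α.hom.toNatTrans
  inv := α.inv.toNatTrans
  hom_inv_id := congrArg Hom₂.toNatTrans α.hom_inv_id
  inv_hom_id := congrArg Hom₂.toNatTrans α.inv_hom_id

/-- A `k`-linear functor `A ⊗ B ⥤ C` out of the tensor product of `k`-linear categories, i.e. a
functor of two variables that is `k`-bilinear on hom-modules. -/
structure BilinFunctor (A B C : LinCat.{w, v, u} k) where
  obj : A → B → C
  map {X X' : A} {Y Y' : B} (f : X ⟶ X') (g : Y ⟶ Y') : obj X Y ⟶ obj X' Y'
  map_id (X : A) (Y : B) : map (𝟙 X) (𝟙 Y) = 𝟙 (obj X Y)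
  map_comp {X X' X'' : A} {Y Y' Y'' : B} (f : X ⟶ X') (f' : X' ⟶ X'') (g : Y ⟶ Y')
    (g' : Y' ⟶ Y'') : map (f ≫ f') (g ≫ g') = map f g ≫ map f' g'
  map_add_left {X X' : A} {Y Y' : B} (f f' : X ⟶ X') (g : Y ⟶ Y') :
    map (f + f') g = map f g + map f' g
  map_add_right {X X' : A} {Y Y' : B} (f : X ⟶ X') (g g' : Y ⟶ Y') :
    map f (g + g') = map f g + map f g'
  map_smul_left {X X' : A} {Y Y' : B} (r : k) (f : X ⟶ X') (g : Y ⟶ Y') :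
    map (r • f) g = r • map f g
  map_smul_right {X X' : A} {Y Y' : B} (r : k) (f : X ⟶ X') (g : Y ⟶ Y') :
    map f (r • g) = r • map f g

attribute [simp] BilinFunctor.map_id

end LinCat

/-- The groupoid of automorphisms in the group `G`: its objects are the elements of `G`. -/
@[ext]
structure GAut (G : Type u) where
  el : G

namespace GAut

variable {G : Type u} [Group G]

/-- A morphism `a ⟶ b` is an element `g` with `g * a = b * g`. -/
instance : Category (GAut G) where
  Hom a b := {g : G // g * a.el = b.el * g}
  id a := ⟨1, by simp⟩
  comp {a b c} f g := ⟨g.1 * f.1, by rw [mul_assoc, f.2, ← mul_assoc, g.2, mul_assoc]⟩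
  id_comp f := Subtype.ext (mul_one _)
  comp_id f := Subtype.ext (one_mul _)
  assoc f g h := Subtype.ext (mul_assoc _ _ _).symm

/-- The 1-cell of the locally discrete bicategory given by `g` with `g * a = b * g`. -/
def arr {a b : G} (g : G) (h : g * a = b * g) :
    LocallyDiscrete.mk (GAut.mk a) ⟶ LocallyDiscrete.mk (GAut.mk b) :=
  Quiver.Hom.toLoc (show GAut.mk a ⟶ GAut.mk b from ⟨g, h⟩)

end GAut

/-- Objects of `Ps(G^aut, 𝒱-Cat)`. The bicategory structure is that of pseudofunctors,
pseudonatural transformations and modifications. -/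
abbrev PsGAut (k : Type w) [CommRing k] (G : Type u) [Group G] :=
  Pseudofunctor (LocallyDiscrete (GAut G)) (LinCat.{w, v, u} k)

namespace PsGAut

variable {k : Type w} [CommRing k] {G : Type u} [Group G]

section

variable (F : PsGAut.{w, v, u} k G)

/-- The value at `a`. -/
abbrev fib (a : G) : LinCat.{w, v, u} k := F.obj ⟨⟨a⟩⟩

/-- The action of `g : a ⟶ b`. -/
def act {a b : G} (g : G) (h : g * a = b * g) : fib F a ⥤ fib F b :=
  (F.map (GAut.arr g h)).toFunctor

/-- The unit constraint `1 A ≅ A`. -/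
def actOne {a : G} (h : (1 : G) * a = a * 1) (A : fib F a) : (act F 1 h).obj A ≅ A :=
  (LinCat.natIso (F.mapId' (GAut.arr 1 h) rfl)).app A

/-- The composition constraint `g (f A) ≅ (g f) A`. -/
def actMul {a b c f g e : G} (hf : f * a = b * f) (hg : g * b = c * g) (he : e * a = c * e)
    (hm : g * f = e) (A : fib F a) :
    (act F g hg).obj ((act F f hf).obj A) ≅ (act F e he).obj A :=
  (LinCat.natIso (F.mapComp' (GAut.arr f hf) (GAut.arr g hg) (GAut.arr e he)
    (by subst hm; rfl))).symm.app A

end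

variable {F F' F'' : PsGAut.{w, v, u} k G}

/-- The component at `a` of a pseudonatural transformation. -/
def comp (T : F ⟶ F') (a : G) : fib F a ⥤ fib F' a := (T.app ⟨⟨a⟩⟩).toFunctor

/-- The pseudonaturality constraint `T (g A) ≅ g (T A)`. -/
def compAct (T : F ⟶ F') {a b : G} (g : G) (h : g * a = b * g) (A : fib F a) :
    (comp T b).obj ((act F g h).obj A) ≅ (act F' g h).obj ((comp T a).obj A) :=
  (LinCat.natIso (T.naturality (GAut.arr g h))).app A

/-- The component at `A` of a modification. -/
def modApp {T T' : F ⟶ F'} (θ : T ⟶ T') {a : G} (A : fib F a) :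
    (comp T a).obj A ⟶ (comp T' a).obj A :=
  (θ.as.app ⟨⟨a⟩⟩).toNatTrans.app A

end PsGAut

/-- A monoidale in `Ps(G^aut, 𝒱-Cat)` for the convolution tensor product
`(S ⋆ T) c = ∑_{a * b = c} S a ⊗ T b`. A product `c = a * b` is recorded by a proof of
`a * b = c`, so that a morphism out of a convolution is a family indexed by such proofs. -/
structure Monoidale (k : Type w) [CommRing k] (G : Type u) [Group G] where
  ps : PsGAut.{w, v, u} k G
  /-- The component `M a ⊗ M b ⥤ M c` of the multiplication `M ⋆ M ⟶ M`. -/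
  tensor {a b c : G} (h : a * b = c) : LinCat.BilinFunctor (ps.fib a) (ps.fib b) (ps.fib c)
  unit : ps.fib 1
  /-- The multiplication is pseudonatural. -/
  tensorAct {a b c a' b' c' g : G} (h : a * b = c) (h' : a' * b' = c') (ha : g * a = a' * g)
    (hb : g * b = b' * g) (hc : g * c = c' * g) (A : ps.fib a) (B : ps.fib b) :
    (tensor h').obj ((ps.act g ha).obj A) ((ps.act g hb).obj B) ≅
      (ps.act g hc).obj ((tensor h).obj A B)
  tensorAct_naturality {a b c a' b' c' g : G} (h : a * b = c) (h' : a' * b' = c')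
    (ha : g * a = a' * g) (hb : g * b = b' * g) (hc : g * c = c' * g) {A A' : ps.fib a}
    {B B' : ps.fib b} (x : A ⟶ A') (y : B ⟶ B') :
    (tensor h').map ((ps.act g ha).map x) ((ps.act g hb).map y) ≫
        (tensorAct h h' ha hb hc A' B').hom =
      (tensorAct h h' ha hb hc A B).hom ≫ (ps.act g hc).map ((tensor h).map x y)
  tensorAct_one {a b c : G} (h : a * b = c) (ha : 1 * a = a * 1) (hb : 1 * b = b * 1)
    (hc : 1 * c = c * 1) (A : ps.fib a) (B : ps.fib b) :
    (tensorAct h h ha hb hc A B).hom ≫ (ps.actOne hc ((tensor h).obj A B)).hom =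
      (tensor h).map (ps.actOne ha A).hom (ps.actOne hb B).hom
  tensorAct_mul {a b c a' b' c' a'' b'' c'' f g e : G} (h : a * b = c) (h' : a' * b' = c')
    (h'' : a'' * b'' = c'') (fa : f * a = a' * f) (fb : f * b = b' * f) (fc : f * c = c' * f)
    (ga : g * a' = a'' * g) (gb : g * b' = b'' * g) (gc : g * c' = c'' * g)
    (ea : e * a = a'' * e) (eb : e * b = b'' * e) (ec : e * c = c'' * e) (hm : g * f = e)
    (A : ps.fib a) (B : ps.fib b) :
    (tensorAct h' h'' ga gb gc ((ps.act f fa).obj A) ((ps.act f fb).obj B)).hom ≫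
        (ps.act g gc).map (tensorAct h h' fa fb fc A B).hom ≫
          (ps.actMul fc gc ec hm ((tensor h).obj A B)).hom =
      (tensor h'').map (ps.actMul fa ga ea hm A).hom (ps.actMul fb gb eb hm B).hom ≫
        (tensorAct h h'' ea eb ec A B).hom
  /-- The unit is pseudonatural. -/
  unitAct {g : G} (h : g * 1 = 1 * g) : unit ≅ (ps.act g h).obj unit
  unitAct_one (h : (1 : G) * 1 = 1 * 1) : (unitAct h).hom ≫ (ps.actOne h unit).hom = 𝟙 unit
  unitAct_mul {f g e : G} (hf : f * 1 = 1 * f) (hg : g * 1 = 1 * g) (he : e * 1 = 1 * e)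
    (hm : g * f = e) :
    (unitAct hg).hom ≫ (ps.act g hg).map (unitAct hf).hom ≫ (ps.actMul hf hg he hm unit).hom =
      (unitAct he).hom
  /-- The associativity constraint `(A □ B) □ C ≅ A □ (B □ C)`. -/
  assoc {a b c p q s : G} (hp : a * b = p) (hpc : p * c = s) (hq : b * c = q) (haq : a * q = s)
    (A : ps.fib a) (B : ps.fib b) (C : ps.fib c) :
    (tensor hpc).obj ((tensor hp).obj A B) C ≅ (tensor haq).obj A ((tensor hq).obj B C)
  assoc_naturality {a b c p q s : G} (hp : a * b = p) (hpc : p * c = s) (hq : b * c = q)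
    (haq : a * q = s) {A A' : ps.fib a} {B B' : ps.fib b} {C C' : ps.fib c} (x : A ⟶ A')
    (y : B ⟶ B') (z : C ⟶ C') :
    (tensor hpc).map ((tensor hp).map x y) z ≫ (assoc hp hpc hq haq A' B' C').hom =
      (assoc hp hpc hq haq A B C).hom ≫ (tensor haq).map x ((tensor hq).map y z)
  /-- The associativity constraint is a modification. -/
  assoc_act {a b c p q s a' b' c' p' q' s' g : G} (hp : a * b = p) (hpc : p * c = s)
    (hq : b * c = q) (haq : a * q = s) (hp' : a' * b' = p') (hpc' : p' * c' = s')
    (hq' : b' * c' = q') (haq' : a' * q' = s') (ga : g * a = a' * g) (gb : g * b = b' * g)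
    (gc : g * c = c' * g) (gp : g * p = p' * g) (gq : g * q = q' * g) (gs : g * s = s' * g)
    (A : ps.fib a) (B : ps.fib b) (C : ps.fib c) :
    (tensor hpc').map (tensorAct hp hp' ga gb gp A B).hom (𝟙 ((ps.act g gc).obj C)) ≫
        (tensorAct hpc hpc' gp gc gs ((tensor hp).obj A B) C).hom ≫
          (ps.act g gs).map (assoc hp hpc hq haq A B C).hom =
      (assoc hp' hpc' hq' haq' _ _ _).hom ≫
        (tensor haq').map (𝟙 ((ps.act g ga).obj A)) (tensorAct hq hq' gb gc gq B C).hom ≫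
          (tensorAct haq haq' ga gq gs A ((tensor hq).obj B C)).hom
  /-- The left unit constraint `I □ A ≅ A`. -/
  leftUnit {a : G} (h : 1 * a = a) (A : ps.fib a) : (tensor h).obj unit A ≅ A
  leftUnit_naturality {a : G} (h : 1 * a = a) {A A' : ps.fib a} (x : A ⟶ A') :
    (tensor h).map (𝟙 unit) x ≫ (leftUnit h A').hom = (leftUnit h A).hom ≫ x
  leftUnit_act {a a' g : G} (h : 1 * a = a) (h' : 1 * a' = a') (g1 : g * 1 = 1 * g)
    (ga : g * a = a' * g) (A : ps.fib a) :
    (tensor h').map (unitAct g1).hom (𝟙 ((ps.act g ga).obj A)) ≫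
        (tensorAct h h' g1 ga ga unit A).hom ≫ (ps.act g ga).map (leftUnit h A).hom =
      (leftUnit h' ((ps.act g ga).obj A)).hom
  /-- The right unit constraint `A □ I ≅ A`. -/
  rightUnit {a : G} (h : a * 1 = a) (A : ps.fib a) : (tensor h).obj A unit ≅ A
  rightUnit_naturality {a : G} (h : a * 1 = a) {A A' : ps.fib a} (x : A ⟶ A') :
    (tensor h).map x (𝟙 unit) ≫ (rightUnit h A').hom = (rightUnit h A).hom ≫ x
  rightUnit_act {a a' g : G} (h : a * 1 = a) (h' : a' * 1 = a') (g1 : g * 1 = 1 * g)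
    (ga : g * a = a' * g) (A : ps.fib a) :
    (tensor h').map (𝟙 ((ps.act g ga).obj A)) (unitAct g1).hom ≫
        (tensorAct h h' ga g1 ga A unit).hom ≫ (ps.act g ga).map (rightUnit h A).hom =
      (rightUnit h' ((ps.act g ga).obj A)).hom
  pentagon {a b c d p q r s t z : G} (hp : a * b = p) (hq : b * c = q) (hr : c * d = r)
    (hpc : p * c = s) (haq : a * q = s) (hqd : q * d = t) (hbr : b * r = t) (hsd : s * d = z)
    (hpr : p * r = z) (hat : a * t = z) (A : ps.fib a) (B : ps.fib b) (C : ps.fib c)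
    (D : ps.fib d) :
    (tensor hsd).map (assoc hp hpc hq haq A B C).hom (𝟙 D) ≫
        (assoc haq hsd hqd hat A ((tensor hq).obj B C) D).hom ≫
          (tensor hat).map (𝟙 A) (assoc hq hqd hr hbr B C D).hom =
      (assoc hpc hsd hr hpr ((tensor hp).obj A B) C D).hom ≫
        (assoc hp hpr hbr hat A B ((tensor hr).obj C D)).hom
  triangle {a b c : G} (ha : a * 1 = a) (hb : 1 * b = b) (h : a * b = c) (A : ps.fib a)
    (B : ps.fib b) :
    (assoc ha h hb h A unit B).hom ≫ (tensor h).map (𝟙 A) (leftUnit hb B).hom =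
      (tensor h).map (rightUnit ha A).hom (𝟙 B)

/-- A braided monoidale in `Ps(G^aut, 𝒱-Cat)`, for the braiding of the convolution tensor product
that takes the summand `S a ⊗ T b` to `T b' ⊗ S a`, `b' = a * b * a⁻¹`, by `(A, B) ↦ (a B, A)`. -/
structure BraidedMonoidale (k : Type w) [CommRing k] (G : Type u) [Group G] extends
    Monoidale.{w, v, u} k G where
  /-- The braiding `A □ B ≅ a B □ A`. -/
  braid {a b b' c : G} (h : a * b = c) (hb : a * b = b' * a) (h' : b' * a = c) (A : ps.fib a)
    (B : ps.fib b) : (tensor h).obj A B ≅ (tensor h').obj ((ps.act a hb).obj B) A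
  braid_naturality {a b b' c : G} (h : a * b = c) (hb : a * b = b' * a) (h' : b' * a = c)
    {A A' : ps.fib a} {B B' : ps.fib b} (x : A ⟶ A') (y : B ⟶ B') :
    (tensor h).map x y ≫ (braid h hb h' A' B').hom =
      (braid h hb h' A B).hom ≫ (tensor h').map ((ps.act a hb).map y) x
  /-- The braiding is a modification; here `m = g * a = a₁ * g`. -/
  braid_act {a b b' c a₁ b₁ b₁' c₁ g m : G} (h : a * b = c) (hb : a * b = b' * a)
    (h' : b' * a = c) (h₁ : a₁ * b₁ = c₁) (hb₁ : a₁ * b₁ = b₁' * a₁) (h₁' : b₁' * a₁ = c₁)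
    (ga : g * a = a₁ * g) (gb : g * b = b₁ * g) (gb' : g * b' = b₁' * g) (gc : g * c = c₁ * g)
    (m₁ : g * a = m) (m₂ : a₁ * g = m) (mb : m * b = b₁' * m) (A : ps.fib a) (B : ps.fib b) :
    (tensorAct h h₁ ga gb gc A B).hom ≫ (ps.act g gc).map (braid h hb h' A B).hom =
      (braid h₁ hb₁ h₁' ((ps.act g ga).obj A) ((ps.act g gb).obj B)).hom ≫
        (tensor h₁').map ((ps.actMul gb hb₁ mb m₂ B).hom ≫ (ps.actMul hb gb' mb m₁ B).inv)
            (𝟙 ((ps.act g ga).obj A)) ≫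
          (tensorAct h' h₁' gb' ga gc ((ps.act a hb).obj B) A).hom
  /-- The two ways from `(A □ B) □ C` to `a B □ (a C □ A)` agree. -/
  hexagon_right {a b c b' c' p q q' r s : G} (hp : a * b = p) (hpc : p * c = s) (hq : b * c = q)
    (haq : a * q = s) (hb : a * b = b' * a) (hc : a * c = c' * a) (hq' : b' * c' = q')
    (haq' : a * q = q' * a) (hqa : q' * a = s) (hba : b' * a = p) (hr : a * c = r)
    (hca : c' * a = r) (hbr : b' * r = s) (A : ps.fib a) (B : ps.fib b) (C : ps.fib c) :
    (assoc hp hpc hq haq A B C).hom ≫ (braid haq haq' hqa A ((tensor hq).obj B C)).hom ≫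
        (tensor hqa).map (tensorAct hq hq' hb hc haq' B C).inv (𝟙 A) ≫
          (assoc hq' hqa hca hbr ((ps.act a hb).obj B) ((ps.act a hc).obj C) A).hom =
      (tensor hpc).map (braid hp hb hba A B).hom (𝟙 C) ≫
        (assoc hba hpc hr hbr ((ps.act a hb).obj B) A C).hom ≫
          (tensor hbr).map (𝟙 ((ps.act a hb).obj B)) (braid hr hc hca A C).hom
  /-- The two ways from `A □ (B □ C)` to `(a (b C) □ A) □ B` agree. -/
  hexagon_left {a b c c' c'' p q r s : G} (hp : a * b = p) (hpc : p * c = s) (hq : b * c = q)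
    (haq : a * q = s) (hc : b * c = c' * b) (hc' : a * c' = c'' * a) (hpc' : p * c = c'' * p)
    (hcp : c'' * p = s) (hcb : c' * b = q) (hr : a * c' = r) (hca : c'' * a = r) (hrb : r * b = s)
    (A : ps.fib a) (B : ps.fib b) (C : ps.fib c) :
    (assoc hp hpc hq haq A B C).inv ≫ (braid hpc hpc' hcp ((tensor hp).obj A B) C).hom ≫
        (tensor hcp).map (ps.actMul hc hc' hpc' hp C).inv (𝟙 ((tensor hp).obj A B)) ≫
          (assoc hca hrb hp hcp ((ps.act a hc').obj ((ps.act b hc).obj C)) A B).inv =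
      (tensor haq).map (𝟙 A) (braid hq hc hcb B C).hom ≫
        (assoc hr hrb hcb haq A ((ps.act b hc).obj C) B).inv ≫
          (tensor hrb).map (braid hr hc' hca A ((ps.act b hc).obj C)).hom (𝟙 B)

namespace PsGAut

variable {k : Type w} [CommRing k] {G : Type u} [Group G] {F F' F'' : PsGAut.{w, v, u} k G}

@[simp]
theorem comp_id_obj (a : G) (A : fib F a) : (comp (𝟙 F) a).obj A = A := rfl

@[simp]
theorem comp_id_map (a : G) {A B : fib F a} (f : A ⟶ B) : (comp (𝟙 F) a).map f = f := rfl

@[simp]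
theorem comp_comp_obj (T : F ⟶ F') (T' : F' ⟶ F'') (a : G) (A : fib F a) :
    (comp (T ≫ T') a).obj A = (comp T' a).obj ((comp T a).obj A) := rfl

@[simp]
theorem comp_comp_map (T : F ⟶ F') (T' : F' ⟶ F'') (a : G) {A B : fib F a} (f : A ⟶ B) :
    (comp (T ≫ T') a).map f = (comp T' a).map ((comp T a).map f) := rfl

@[simp]
theorem compAct_id {a b : G} (g : G) (h : g * a = b * g) (A : fib F a) :
    (compAct (𝟙 F) g h A).hom = 𝟙 ((act F g h).obj A) := by
  simp [compAct]
  rfl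

@[simp]
theorem compAct_id_inv {a b : G} (g : G) (h : g * a = b * g) (A : fib F a) :
    (compAct (𝟙 F) g h A).inv = 𝟙 ((act F g h).obj A) := by
  simp [compAct]
  rfl

theorem compAct_naturality (T : F ⟶ F') {a b : G} (g : G) (h : g * a = b * g) {A B : fib F a}
    (f : A ⟶ B) : (comp T b).map ((act F g h).map f) ≫ (compAct T g h B).hom =
      (compAct T g h A).hom ≫ (act F' g h).map ((comp T a).map f) :=
  (T.naturality (GAut.arr g h)).hom.toNatTrans.naturality f

theorem modApp_act {T T' : F ⟶ F'} (θ : T ⟶ T') {a b : G} (g : G) (h : g * a = b * g)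
    (A : fib F a) : modApp θ ((act F g h).obj A) ≫ (compAct T' g h A).hom =
      (compAct T g h A).hom ≫ (act F' g h).map (modApp θ A) :=
  congrArg (fun α => LinCat.Hom₂.toNatTrans α |>.app A) (θ.as.naturality (GAut.arr g h))

theorem compAct_comp (T : F ⟶ F') (T' : F' ⟶ F'') {a b : G} (g : G) (h : g * a = b * g)
    (A : fib F a) : (compAct (T ≫ T') g h A).hom =
      (comp T' b).map (compAct T g h A).hom ≫ (compAct T' g h ((comp T a).obj A)).hom := by
  have key : ((T ≫ T').naturality (GAut.arr g h)).hom =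
      (α_ (F.map (GAut.arr g h)) (T.app ⟨⟨b⟩⟩) (T'.app ⟨⟨b⟩⟩)).inv ≫
        (T.naturality (GAut.arr g h)).hom ▷ T'.app ⟨⟨b⟩⟩ ≫
          (α_ (T.app ⟨⟨a⟩⟩) (F'.map (GAut.arr g h)) (T'.app ⟨⟨b⟩⟩)).hom ≫
            T.app ⟨⟨a⟩⟩ ◁ (T'.naturality (GAut.arr g h)).hom ≫
              (α_ (T.app ⟨⟨a⟩⟩) (T'.app ⟨⟨a⟩⟩) (F''.map (GAut.arr g h))).inv := rfl
  change ((T ≫ T').naturality (GAut.arr g h)).hom.toNatTrans.app A = _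
  rw [key]
  simp [compAct, comp]
  rfl

theorem compAct_comp_inv (T : F ⟶ F') (T' : F' ⟶ F'') {a b : G} (g : G) (h : g * a = b * g)
    (A : fib F a) : (compAct (T ≫ T') g h A).inv =
      (compAct T' g h ((comp T a).obj A)).inv ≫ (comp T' b).map (compAct T g h A).inv :=
  congrArg Iso.inv (show compAct (T ≫ T') g h A =
    (comp T' b).mapIso (compAct T g h A) ≪≫ compAct T' g h ((comp T a).obj A) from
      Iso.ext (compAct_comp T T' g h A))

theorem modApp_naturality {T T' : F ⟶ F'} (θ : T ⟶ T') {a : G} {A B : fib F a} (f : A ⟶ B) :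
    (comp T a).map f ≫ modApp θ B = modApp θ A ≫ (comp T' a).map f :=
  (θ.as.app ⟨⟨a⟩⟩).toNatTrans.naturality f

@[simp]
theorem modApp_id (T : F ⟶ F') {a : G} (A : fib F a) :
    modApp (𝟙 T) A = 𝟙 ((comp T a).obj A) := rfl

@[simp]
theorem modApp_comp {T T' T'' : F ⟶ F'} (θ : T ⟶ T') (θ' : T' ⟶ T'') {a : G} (A : fib F a) :
    modApp (θ ≫ θ') A = modApp θ A ≫ modApp θ' A := rfl

@[simp]
theorem modApp_whiskerLeft (T : F ⟶ F') {S S' : F' ⟶ F''} (θ : S ⟶ S') {a : G} (A : fib F a) :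
    modApp (T ◁ θ) A = modApp θ ((comp T a).obj A) := rfl

@[simp]
theorem modApp_whiskerRight {T T' : F ⟶ F'} (θ : T ⟶ T') (S : F' ⟶ F'') {a : G} (A : fib F a) :
    modApp (θ ▷ S) A = (comp S a).map (modApp θ A) := rfl

end PsGAut

namespace LinCat.BilinFunctor

variable {k : Type w} [CommRing k] {A B C : LinCat.{w, v, u} k} (T : BilinFunctor A B C)

theorem map_comp_assoc {X X' X'' : A} {Y Y' Y'' : B} (f : X ⟶ X') (f' : X' ⟶ X'') (g : Y ⟶ Y')
    (g' : Y' ⟶ Y'') {Z : C} (z : T.obj X'' Y'' ⟶ Z) :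
    T.map (f ≫ f') (g ≫ g') ≫ z = T.map f g ≫ T.map f' g' ≫ z := by
  rw [T.map_comp, Category.assoc]

theorem map_comp_id {X X' X'' : A} (f : X ⟶ X') (f' : X' ⟶ X'') (Y : B) :
    T.map (f ≫ f') (𝟙 Y) = T.map f (𝟙 Y) ≫ T.map f' (𝟙 Y) := by
  rw [← T.map_comp, Category.comp_id]

theorem map_id_comp (X : A) {Y Y' Y'' : B} (f : Y ⟶ Y') (f' : Y' ⟶ Y'') :
    T.map (𝟙 X) (f ≫ f') = T.map (𝟙 X) f ≫ T.map (𝟙 X) f' := by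
  rw [← T.map_comp, Category.comp_id]

end LinCat.BilinFunctor

namespace BraidedMonoidale

open PsGAut

variable {k : Type w} [CommRing k] {G : Type u} [Group G]

/-- A braided strong monoidal morphism between braided monoidales. -/
structure Hom (M N : BraidedMonoidale.{w, v, u} k G) where
  trans : M.ps ⟶ N.ps
  /-- The constraint `T A □ T B ≅ T (A □ B)`. -/
  tensorIso {a b c : G} (h : a * b = c) (A : M.ps.fib a) (B : M.ps.fib b) :
    (N.tensor h).obj ((comp trans a).obj A) ((comp trans b).obj B) ≅
      (comp trans c).obj ((M.tensor h).obj A B)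
  tensorIso_naturality {a b c : G} (h : a * b = c) {A A' : M.ps.fib a} {B B' : M.ps.fib b}
    (x : A ⟶ A') (y : B ⟶ B') :
    (N.tensor h).map ((comp trans a).map x) ((comp trans b).map y) ≫ (tensorIso h A' B').hom =
      (tensorIso h A B).hom ≫ (comp trans c).map ((M.tensor h).map x y)
  /-- The constraint `I ≅ T I`. -/
  unitIso : N.unit ≅ (comp trans 1).obj M.unit
  /-- The constraint `tensorIso` is a modification. -/
  tensorIso_act {a b c a' b' c' g : G} (h : a * b = c) (h' : a' * b' = c') (ha : g * a = a' * g)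
    (hb : g * b = b' * g) (hc : g * c = c' * g) (A : M.ps.fib a) (B : M.ps.fib b) :
    (N.tensor h').map (compAct trans g ha A).hom (compAct trans g hb B).hom ≫
        (N.tensorAct h h' ha hb hc ((comp trans a).obj A) ((comp trans b).obj B)).hom ≫
          (N.ps.act g hc).map (tensorIso h A B).hom =
      (tensorIso h' ((M.ps.act g ha).obj A) ((M.ps.act g hb).obj B)).hom ≫
        (comp trans c').map (M.tensorAct h h' ha hb hc A B).hom ≫
          (compAct trans g hc ((M.tensor h).obj A B)).hom
  /-- The constraint `unitIso` is a modification. -/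
  unitIso_act {g : G} (h : g * 1 = 1 * g) :
    (N.unitAct h).hom ≫ (N.ps.act g h).map unitIso.hom =
      unitIso.hom ≫ (comp trans 1).map (M.unitAct h).hom ≫ (compAct trans g h M.unit).hom
  assoc {a b c p q s : G} (hp : a * b = p) (hpc : p * c = s) (hq : b * c = q) (haq : a * q = s)
    (A : M.ps.fib a) (B : M.ps.fib b) (C : M.ps.fib c) :
    (N.tensor hpc).map (tensorIso hp A B).hom (𝟙 ((comp trans c).obj C)) ≫
        (tensorIso hpc ((M.tensor hp).obj A B) C).hom ≫
          (comp trans s).map (M.assoc hp hpc hq haq A B C).hom =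
      (N.assoc hp hpc hq haq _ _ _).hom ≫
        (N.tensor haq).map (𝟙 ((comp trans a).obj A)) (tensorIso hq B C).hom ≫
          (tensorIso haq A ((M.tensor hq).obj B C)).hom
  leftUnit {a : G} (h : 1 * a = a) (A : M.ps.fib a) :
    (N.tensor h).map unitIso.hom (𝟙 ((comp trans a).obj A)) ≫ (tensorIso h M.unit A).hom ≫
        (comp trans a).map (M.leftUnit h A).hom =
      (N.leftUnit h ((comp trans a).obj A)).hom
  rightUnit {a : G} (h : a * 1 = a) (A : M.ps.fib a) :
    (N.tensor h).map (𝟙 ((comp trans a).obj A)) unitIso.hom ≫ (tensorIso h A M.unit).hom ≫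
        (comp trans a).map (M.rightUnit h A).hom =
      (N.rightUnit h ((comp trans a).obj A)).hom
  braid {a b b' c : G} (h : a * b = c) (hb : a * b = b' * a) (h' : b' * a = c) (A : M.ps.fib a)
    (B : M.ps.fib b) :
    (tensorIso h A B).hom ≫ (comp trans c).map (M.braid h hb h' A B).hom =
      (N.braid h hb h' ((comp trans a).obj A) ((comp trans b).obj B)).hom ≫
        (N.tensor h').map (compAct trans a hb B).inv (𝟙 ((comp trans a).obj A)) ≫
          (tensorIso h' ((M.ps.act a hb).obj B) A).hom

/-- A monoidal modification between braided strong monoidal morphisms. -/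
@[ext]
structure Hom₂ {M N : BraidedMonoidale.{w, v, u} k G} (T T' : Hom M N) where
  mod : T.trans ⟶ T'.trans
  tensor {a b c : G} (h : a * b = c) (A : M.ps.fib a) (B : M.ps.fib b) :
    (T.tensorIso h A B).hom ≫ modApp mod ((M.tensor h).obj A B) =
      (N.tensor h).map (modApp mod A) (modApp mod B) ≫ (T'.tensorIso h A B).hom
  unit : T.unitIso.hom ≫ modApp mod M.unit = T'.unitIso.hom

/-- The identity 1-cell. -/
def Hom.id (M : BraidedMonoidale.{w, v, u} k G) : Hom M M where
  trans := 𝟙 M.ps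
  tensorIso h A B := Iso.refl ((M.tensor h).obj A B)
  tensorIso_naturality h _ _ _ _ x y := by simp
  unitIso := Iso.refl M.unit
  tensorIso_act h h' ha hb hc A B := by simp
  unitIso_act h := by simp
  assoc hp hpc hq haq A B C := by simp
  leftUnit h A := by simp
  rightUnit h A := by simp
  braid h hb h' A B := by simp

/-- Composition of 1-cells. -/
def Hom.comp {M N P : BraidedMonoidale.{w, v, u} k G} (T : Hom M N) (S : Hom N P) : Hom M P where
  trans := T.trans ≫ S.trans
  tensorIso {a b c} h A B :=
    S.tensorIso h ((PsGAut.comp T.trans a).obj A) ((PsGAut.comp T.trans b).obj B) ≪≫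
      (PsGAut.comp S.trans c).mapIso (T.tensorIso h A B)
  tensorIso_naturality {a b c} h A A' B B' x y := by
    have h₁ := S.tensorIso_naturality h ((PsGAut.comp T.trans a).map x)
      ((PsGAut.comp T.trans b).map y)
    have h₂ := T.tensorIso_naturality h x y
    have key : (P.tensor h).map ((PsGAut.comp S.trans a).map ((PsGAut.comp T.trans a).map x))
        ((PsGAut.comp S.trans b).map ((PsGAut.comp T.trans b).map y)) ≫
        (S.tensorIso h ((PsGAut.comp T.trans a).obj A') ((PsGAut.comp T.trans b).obj B')).hom ≫
          (PsGAut.comp S.trans c).map (T.tensorIso h A' B').hom =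
        ((S.tensorIso h ((PsGAut.comp T.trans a).obj A) ((PsGAut.comp T.trans b).obj B)).hom ≫
          (PsGAut.comp S.trans c).map (T.tensorIso h A B).hom) ≫
          (PsGAut.comp S.trans c).map ((PsGAut.comp T.trans c).map ((M.tensor h).map x y)) := by
      rw [Category.assoc, reassoc_of% h₁, ← Functor.map_comp, ← Functor.map_comp, h₂]
    exact key
  unitIso := S.unitIso ≪≫ (PsGAut.comp S.trans 1).mapIso T.unitIso
  tensorIso_act {a b c a' b' c' g} h h' ha hb hc A B := by
    have h₁ := S.tensorIso_act h h' ha hb hc ((PsGAut.comp T.trans a).obj A)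
      ((PsGAut.comp T.trans b).obj B)
    have h₂ := T.tensorIso_act h h' ha hb hc A B
    have h₃ := compAct_naturality S.trans g hc (T.tensorIso h A B).hom
    have h₄ := S.tensorIso_naturality h' (compAct T.trans g ha A).hom (compAct T.trans g hb B).hom
    rw [compAct_comp, compAct_comp, compAct_comp]
    have key : (P.tensor h').map
        ((PsGAut.comp S.trans a').map (compAct T.trans g ha A).hom ≫
          (compAct S.trans g ha ((PsGAut.comp T.trans a).obj A)).hom)
        ((PsGAut.comp S.trans b').map (compAct T.trans g hb B).hom ≫
          (compAct S.trans g hb ((PsGAut.comp T.trans b).obj B)).hom) ≫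
        (P.tensorAct h h' ha hb hc
          ((PsGAut.comp S.trans a).obj ((PsGAut.comp T.trans a).obj A))
          ((PsGAut.comp S.trans b).obj ((PsGAut.comp T.trans b).obj B))).hom ≫
          (P.ps.act g hc).map
            ((S.tensorIso h ((PsGAut.comp T.trans a).obj A) ((PsGAut.comp T.trans b).obj B)).hom ≫
              (PsGAut.comp S.trans c).map (T.tensorIso h A B).hom) =
        ((S.tensorIso h' ((PsGAut.comp T.trans a').obj ((M.ps.act g ha).obj A))
            ((PsGAut.comp T.trans b').obj ((M.ps.act g hb).obj B))).hom ≫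
          (PsGAut.comp S.trans c').map
            (T.tensorIso h' ((M.ps.act g ha).obj A) ((M.ps.act g hb).obj B)).hom) ≫
          (PsGAut.comp S.trans c').map ((PsGAut.comp T.trans c').map
              (M.tensorAct h h' ha hb hc A B).hom) ≫
            (PsGAut.comp S.trans c').map (compAct T.trans g hc ((M.tensor h).obj A B)).hom ≫
              (compAct S.trans g hc ((PsGAut.comp T.trans c).obj ((M.tensor h).obj A B))).hom := by
      rw [LinCat.BilinFunctor.map_comp, Functor.map_comp, Category.assoc, reassoc_of% h₁, ← h₃,
        reassoc_of% h₄, Category.assoc]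
      simp only [← Functor.map_comp_assoc, h₂]
    exact key
  unitIso_act {g} h := by
    have h₁ := S.unitIso_act h
    have h₂ := T.unitIso_act h
    have h₃ := compAct_naturality S.trans g h T.unitIso.hom
    rw [compAct_comp]
    have key : (P.unitAct h).hom ≫
        (P.ps.act g h).map (S.unitIso.hom ≫ (PsGAut.comp S.trans 1).map T.unitIso.hom) =
        (S.unitIso.hom ≫ (PsGAut.comp S.trans 1).map T.unitIso.hom) ≫
          (PsGAut.comp S.trans 1).map ((PsGAut.comp T.trans 1).map (M.unitAct h).hom) ≫
            (PsGAut.comp S.trans 1).map (compAct T.trans g h M.unit).hom ≫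
              (compAct S.trans g h ((PsGAut.comp T.trans 1).obj M.unit)).hom := by
      rw [Functor.map_comp, reassoc_of% h₁, ← h₃, Category.assoc]
      simp only [← Functor.map_comp_assoc, h₂]
    exact key
  assoc {a b c p q s} hp hpc hq haq A B C := by
    have h₁ := S.assoc hp hpc hq haq ((PsGAut.comp T.trans a).obj A)
      ((PsGAut.comp T.trans b).obj B) ((PsGAut.comp T.trans c).obj C)
    have h₂ := T.assoc hp hpc hq haq A B C
    have h₃ := S.tensorIso_naturality hpc (T.tensorIso hp A B).hom
      (𝟙 ((PsGAut.comp T.trans c).obj C))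
    have h₄ := S.tensorIso_naturality haq (𝟙 ((PsGAut.comp T.trans a).obj A))
      (T.tensorIso hq B C).hom
    rw [CategoryTheory.Functor.map_id] at h₃ h₄
    have key : (P.tensor hpc).map
        ((S.tensorIso hp ((PsGAut.comp T.trans a).obj A) ((PsGAut.comp T.trans b).obj B)).hom ≫
          (PsGAut.comp S.trans p).map (T.tensorIso hp A B).hom)
        (𝟙 ((PsGAut.comp S.trans c).obj ((PsGAut.comp T.trans c).obj C))) ≫
        ((S.tensorIso hpc ((PsGAut.comp T.trans p).obj ((M.tensor hp).obj A B))
            ((PsGAut.comp T.trans c).obj C)).hom ≫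
          (PsGAut.comp S.trans s).map (T.tensorIso hpc ((M.tensor hp).obj A B) C).hom) ≫
          (PsGAut.comp S.trans s).map ((PsGAut.comp T.trans s).map
            (M.assoc hp hpc hq haq A B C).hom) =
        (P.assoc hp hpc hq haq _ _ _).hom ≫
          (P.tensor haq).map (𝟙 ((PsGAut.comp S.trans a).obj ((PsGAut.comp T.trans a).obj A)))
            ((S.tensorIso hq ((PsGAut.comp T.trans b).obj B)
                ((PsGAut.comp T.trans c).obj C)).hom ≫
              (PsGAut.comp S.trans q).map (T.tensorIso hq B C).hom) ≫
            (S.tensorIso haq ((PsGAut.comp T.trans a).obj A)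
                ((PsGAut.comp T.trans q).obj ((M.tensor hq).obj B C))).hom ≫
              (PsGAut.comp S.trans s).map (T.tensorIso haq A ((M.tensor hq).obj B C)).hom := by
      rw [LinCat.BilinFunctor.map_comp_id, LinCat.BilinFunctor.map_id_comp]
      simp only [Category.assoc]
      rw [reassoc_of% h₃, reassoc_of% h₄, ← reassoc_of% h₁]
      simp only [← Functor.map_comp, h₂]
    exact key
  leftUnit {a} h A := by
    have h₁ := S.leftUnit h ((PsGAut.comp T.trans a).obj A)
    have h₂ := T.leftUnit h A
    have h₃ := S.tensorIso_naturality h T.unitIso.hom (𝟙 ((PsGAut.comp T.trans a).obj A))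
    rw [CategoryTheory.Functor.map_id] at h₃
    have key : (P.tensor h).map (S.unitIso.hom ≫ (PsGAut.comp S.trans 1).map T.unitIso.hom)
        (𝟙 ((PsGAut.comp S.trans a).obj ((PsGAut.comp T.trans a).obj A))) ≫
        ((S.tensorIso h ((PsGAut.comp T.trans 1).obj M.unit)
            ((PsGAut.comp T.trans a).obj A)).hom ≫
          (PsGAut.comp S.trans a).map (T.tensorIso h M.unit A).hom) ≫
          (PsGAut.comp S.trans a).map ((PsGAut.comp T.trans a).map (M.leftUnit h A).hom) =
        (P.leftUnit h ((PsGAut.comp S.trans a).obj ((PsGAut.comp T.trans a).obj A))).hom := by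
      rw [LinCat.BilinFunctor.map_comp_id]
      simp only [Category.assoc]
      rw [reassoc_of% h₃, ← h₁]
      simp only [← Functor.map_comp, h₂]
    exact key
  rightUnit {a} h A := by
    have h₁ := S.rightUnit h ((PsGAut.comp T.trans a).obj A)
    have h₂ := T.rightUnit h A
    have h₃ := S.tensorIso_naturality h (𝟙 ((PsGAut.comp T.trans a).obj A)) T.unitIso.hom
    rw [CategoryTheory.Functor.map_id] at h₃
    have key : (P.tensor h).map
        (𝟙 ((PsGAut.comp S.trans a).obj ((PsGAut.comp T.trans a).obj A)))
        (S.unitIso.hom ≫ (PsGAut.comp S.trans 1).map T.unitIso.hom) ≫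
        ((S.tensorIso h ((PsGAut.comp T.trans a).obj A)
            ((PsGAut.comp T.trans 1).obj M.unit)).hom ≫
          (PsGAut.comp S.trans a).map (T.tensorIso h A M.unit).hom) ≫
          (PsGAut.comp S.trans a).map ((PsGAut.comp T.trans a).map (M.rightUnit h A).hom) =
        (P.rightUnit h ((PsGAut.comp S.trans a).obj ((PsGAut.comp T.trans a).obj A))).hom := by
      rw [LinCat.BilinFunctor.map_id_comp]
      simp only [Category.assoc]
      rw [reassoc_of% h₃, ← h₁]
      simp only [← Functor.map_comp, h₂]
    exact key
  braid {a b b' c} h hb h' A B := by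
    have h₁ := S.braid h hb h' ((PsGAut.comp T.trans a).obj A) ((PsGAut.comp T.trans b).obj B)
    have h₂ := T.braid h hb h' A B
    have h₃ := S.tensorIso_naturality h' (compAct T.trans a hb B).inv
      (𝟙 ((PsGAut.comp T.trans a).obj A))
    rw [CategoryTheory.Functor.map_id] at h₃
    rw [compAct_comp_inv]
    have key : ((S.tensorIso h ((PsGAut.comp T.trans a).obj A)
            ((PsGAut.comp T.trans b).obj B)).hom ≫
          (PsGAut.comp S.trans c).map (T.tensorIso h A B).hom) ≫
          (PsGAut.comp S.trans c).map ((PsGAut.comp T.trans c).map (M.braid h hb h' A B).hom) =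
        (P.braid h hb h' ((PsGAut.comp S.trans a).obj ((PsGAut.comp T.trans a).obj A))
            ((PsGAut.comp S.trans b).obj ((PsGAut.comp T.trans b).obj B))).hom ≫
          (P.tensor h').map ((compAct S.trans a hb ((PsGAut.comp T.trans b).obj B)).inv ≫
              (PsGAut.comp S.trans b').map (compAct T.trans a hb B).inv)
            (𝟙 ((PsGAut.comp S.trans a).obj ((PsGAut.comp T.trans a).obj A))) ≫
            (S.tensorIso h' ((PsGAut.comp T.trans b').obj ((M.ps.act a hb).obj B))
                ((PsGAut.comp T.trans a).obj A)).hom ≫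
              (PsGAut.comp S.trans c).map (T.tensorIso h' ((M.ps.act a hb).obj B) A).hom := by
      rw [LinCat.BilinFunctor.map_comp_id]
      simp only [Category.assoc]
      rw [reassoc_of% h₃, ← Functor.map_comp, h₂, Functor.map_comp, reassoc_of% h₁]
      simp only [Functor.map_comp]
    exact key

instance : CategoryStruct (BraidedMonoidale.{w, v, u} k G) where
  Hom M N := Hom M N
  id M := Hom.id M
  comp T S := Hom.comp T S

/-- The identity 2-cell. -/
def Hom₂.id {M N : BraidedMonoidale.{w, v, u} k G} (T : Hom M N) : Hom₂ T T where
  mod := 𝟙 T.trans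
  tensor h A B := by simp
  unit := by simp

/-- Vertical composition of 2-cells. -/
def Hom₂.vcomp {M N : BraidedMonoidale.{w, v, u} k G} {T T' T'' : Hom M N} (θ : Hom₂ T T')
    (θ' : Hom₂ T' T'') : Hom₂ T T'' where
  mod := θ.mod ≫ θ'.mod
  tensor h A B := by
    simp only [modApp_comp, LinCat.BilinFunctor.map_comp, Category.assoc]
    rw [reassoc_of% θ.tensor h A B, θ'.tensor h A B]
  unit := by
    simp only [modApp_comp]
    rw [reassoc_of% θ.unit, θ'.unit]

instance homCategory (M N : BraidedMonoidale.{w, v, u} k G) : Category (M ⟶ N) where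
  Hom T T' := Hom₂ T T'
  id T := Hom₂.id T
  comp θ θ' := Hom₂.vcomp θ θ'
  id_comp θ := Hom₂.ext (Category.id_comp θ.mod)
  comp_id θ := Hom₂.ext (Category.comp_id θ.mod)
  assoc θ θ' θ'' := Hom₂.ext (Category.assoc θ.mod θ'.mod θ''.mod)

/-- Left whiskering. -/
def Hom₂.whiskerLeft {M N P : BraidedMonoidale.{w, v, u} k G} (T : Hom M N) {S S' : Hom N P}
    (θ : Hom₂ S S') : Hom₂ (T.comp S) (T.comp S') where
  mod := T.trans ◁ θ.mod
  tensor {a b c} h A B := by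
    have h₁ := θ.tensor h ((PsGAut.comp T.trans a).obj A) ((PsGAut.comp T.trans b).obj B)
    have h₂ := modApp_naturality θ.mod (T.tensorIso h A B).hom
    have key : ((S.tensorIso h ((PsGAut.comp T.trans a).obj A)
          ((PsGAut.comp T.trans b).obj B)).hom ≫
          (PsGAut.comp S.trans c).map (T.tensorIso h A B).hom) ≫
            modApp θ.mod ((PsGAut.comp T.trans c).obj ((M.tensor h).obj A B)) =
        (P.tensor h).map (modApp θ.mod ((PsGAut.comp T.trans a).obj A))
            (modApp θ.mod ((PsGAut.comp T.trans b).obj B)) ≫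
          (S'.tensorIso h ((PsGAut.comp T.trans a).obj A) ((PsGAut.comp T.trans b).obj B)).hom ≫
            (PsGAut.comp S'.trans c).map (T.tensorIso h A B).hom := by
      rw [Category.assoc, h₂, reassoc_of% h₁]
    exact key
  unit := by
    have h₁ := θ.unit
    have h₂ := modApp_naturality θ.mod T.unitIso.hom
    have key : (S.unitIso.hom ≫ (PsGAut.comp S.trans 1).map T.unitIso.hom) ≫
        modApp θ.mod ((PsGAut.comp T.trans 1).obj M.unit) =
        S'.unitIso.hom ≫ (PsGAut.comp S'.trans 1).map T.unitIso.hom := by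
      rw [Category.assoc, h₂, reassoc_of% h₁]
    exact key

/-- Right whiskering. -/
def Hom₂.whiskerRight {M N P : BraidedMonoidale.{w, v, u} k G} {T T' : Hom M N} (θ : Hom₂ T T')
    (S : Hom N P) : Hom₂ (T.comp S) (T'.comp S) where
  mod := θ.mod ▷ S.trans
  tensor {a b c} h A B := by
    have h₁ := θ.tensor h A B
    have h₂ := S.tensorIso_naturality h (modApp θ.mod A) (modApp θ.mod B)
    have key : ((S.tensorIso h ((PsGAut.comp T.trans a).obj A)
          ((PsGAut.comp T.trans b).obj B)).hom ≫
          (PsGAut.comp S.trans c).map (T.tensorIso h A B).hom) ≫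
            (PsGAut.comp S.trans c).map (modApp θ.mod ((M.tensor h).obj A B)) =
        (P.tensor h).map ((PsGAut.comp S.trans a).map (modApp θ.mod A))
            ((PsGAut.comp S.trans b).map (modApp θ.mod B)) ≫
          (S.tensorIso h ((PsGAut.comp T'.trans a).obj A)
            ((PsGAut.comp T'.trans b).obj B)).hom ≫
            (PsGAut.comp S.trans c).map (T'.tensorIso h A B).hom := by
      rw [Category.assoc, ← Functor.map_comp, h₁, reassoc_of% h₂, Functor.map_comp]
    exact key
  unit := by
    have h₁ := θ.unit
    have key : (S.unitIso.hom ≫ (PsGAut.comp S.trans 1).map T.unitIso.hom) ≫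
        (PsGAut.comp S.trans 1).map (modApp θ.mod M.unit) =
        S.unitIso.hom ≫ (PsGAut.comp S.trans 1).map T'.unitIso.hom := by
      rw [Category.assoc, ← Functor.map_comp, h₁]
    exact key

/-- An invertible modification compatible with the constraints is an invertible 2-cell. -/
def isoMk {M N : BraidedMonoidale.{w, v, u} k G} {T T' : M ⟶ N}
    (θ : Hom.trans T ≅ Hom.trans T')
    (tensor : ∀ {a b c : G} (h : a * b = c) (A : M.ps.fib a) (B : M.ps.fib b),
      (Hom.tensorIso T h A B).hom ≫ modApp θ.hom ((M.tensor h).obj A B) =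
        (N.tensor h).map (modApp θ.hom A) (modApp θ.hom B) ≫ (Hom.tensorIso T' h A B).hom)
    (unit : (Hom.unitIso T).hom ≫ modApp θ.hom M.unit = (Hom.unitIso T').hom) : T ≅ T' where
  hom := Hom₂.mk θ.hom tensor unit
  inv := Hom₂.mk θ.inv
    (fun {a b c} h A B => by
      have e : ∀ {x : G} (X : M.ps.fib x), modApp θ.inv X ≫ modApp θ.hom X = 𝟙 _ := fun X => by
        rw [← modApp_comp, θ.inv_hom_id, modApp_id]
      have e' : ∀ {x : G} (X : M.ps.fib x), modApp θ.hom X ≫ modApp θ.inv X = 𝟙 _ := fun X => by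
        rw [← modApp_comp, θ.hom_inv_id, modApp_id]
      have h₁ := (N.tensor h).map (modApp θ.inv A) (modApp θ.inv B) ≫= tensor h A B
      rw [← (N.tensor h).map_comp_assoc, e, e, LinCat.BilinFunctor.map_id, Category.id_comp] at h₁
      rw [← h₁, Category.assoc, Category.assoc, e', Category.comp_id])
    (by
      rw [← unit, Category.assoc, ← modApp_comp, θ.hom_inv_id, modApp_id]
      exact Category.comp_id _)
  hom_inv_id := Hom₂.ext θ.hom_inv_id
  inv_hom_id := Hom₂.ext θ.inv_hom_id

/-- Two 2-cells agree if their underlying modifications do. -/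
theorem hom₂_ext {M N : BraidedMonoidale.{w, v, u} k G} {T T' : M ⟶ N} {θ θ' : T ⟶ T'}
    (h : Hom₂.mod θ = Hom₂.mod θ') : θ = θ' :=
  Hom₂.ext h

namespace Hom₂

theorem assoc_tensor {M N P Q : BraidedMonoidale.{w, v, u} k G} (T : Hom M N) (S : Hom N P)
    (R : Hom P Q) {a b c : G} (h : a * b = c) (A : M.ps.fib a) (B : M.ps.fib b) :
    (((T.comp S).comp R).tensorIso h A B).hom ≫
        modApp (α_ T.trans S.trans R.trans).hom ((M.tensor h).obj A B) =
      (Q.tensor h).map (modApp (α_ T.trans S.trans R.trans).hom A)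
          (modApp (α_ T.trans S.trans R.trans).hom B) ≫
        ((T.comp (S.comp R)).tensorIso h A B).hom := by
  have key : ((R.tensorIso h ((PsGAut.comp S.trans a).obj ((PsGAut.comp T.trans a).obj A))
        ((PsGAut.comp S.trans b).obj ((PsGAut.comp T.trans b).obj B))).hom ≫
        (PsGAut.comp R.trans c).map
          ((S.tensorIso h ((PsGAut.comp T.trans a).obj A) ((PsGAut.comp T.trans b).obj B)).hom ≫
            (PsGAut.comp S.trans c).map (T.tensorIso h A B).hom)) ≫ 𝟙 _ =
      (Q.tensor h).map (𝟙 _) (𝟙 _) ≫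
        ((R.tensorIso h ((PsGAut.comp S.trans a).obj ((PsGAut.comp T.trans a).obj A))
          ((PsGAut.comp S.trans b).obj ((PsGAut.comp T.trans b).obj B))).hom ≫
          (PsGAut.comp R.trans c).map
            (S.tensorIso h ((PsGAut.comp T.trans a).obj A)
              ((PsGAut.comp T.trans b).obj B)).hom) ≫
          (PsGAut.comp R.trans c).map ((PsGAut.comp S.trans c).map (T.tensorIso h A B).hom) := by
    simp
  exact key

theorem assoc_unit {M N P Q : BraidedMonoidale.{w, v, u} k G} (T : Hom M N) (S : Hom N P)
    (R : Hom P Q) :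
    ((T.comp S).comp R).unitIso.hom ≫ modApp (α_ T.trans S.trans R.trans).hom M.unit =
      (T.comp (S.comp R)).unitIso.hom := by
  have key : (R.unitIso.hom ≫ (PsGAut.comp R.trans 1).map
        (S.unitIso.hom ≫ (PsGAut.comp S.trans 1).map T.unitIso.hom)) ≫ 𝟙 _ =
      (R.unitIso.hom ≫ (PsGAut.comp R.trans 1).map S.unitIso.hom) ≫
        (PsGAut.comp R.trans 1).map ((PsGAut.comp S.trans 1).map T.unitIso.hom) := by
    simp
  exact key

theorem leftUnitor_tensor {M N : BraidedMonoidale.{w, v, u} k G} (T : Hom M N) {a b c : G}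
    (h : a * b = c) (A : M.ps.fib a) (B : M.ps.fib b) :
    (((Hom.id M).comp T).tensorIso h A B).hom ≫
        modApp (λ_ T.trans).hom ((M.tensor h).obj A B) =
      (N.tensor h).map (modApp (λ_ T.trans).hom A) (modApp (λ_ T.trans).hom B) ≫
        (T.tensorIso h A B).hom := by
  have key : ((T.tensorIso h A B).hom ≫
        (PsGAut.comp T.trans c).map (𝟙 ((M.tensor h).obj A B))) ≫ 𝟙 _ =
      (N.tensor h).map (𝟙 _) (𝟙 _) ≫ (T.tensorIso h A B).hom := by
    simp
  exact key

theorem leftUnitor_unit {M N : BraidedMonoidale.{w, v, u} k G} (T : Hom M N) :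
    ((Hom.id M).comp T).unitIso.hom ≫ modApp (λ_ T.trans).hom M.unit = T.unitIso.hom := by
  have key : (T.unitIso.hom ≫ (PsGAut.comp T.trans 1).map (𝟙 M.unit)) ≫ 𝟙 _ =
      T.unitIso.hom := by
    simp
  exact key

theorem rightUnitor_tensor {M N : BraidedMonoidale.{w, v, u} k G} (T : Hom M N) {a b c : G}
    (h : a * b = c) (A : M.ps.fib a) (B : M.ps.fib b) :
    ((T.comp (Hom.id N)).tensorIso h A B).hom ≫
        modApp (ρ_ T.trans).hom ((M.tensor h).obj A B) =
      (N.tensor h).map (modApp (ρ_ T.trans).hom A) (modApp (ρ_ T.trans).hom B) ≫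
        (T.tensorIso h A B).hom := by
  have key : (𝟙 _ ≫ (T.tensorIso h A B).hom) ≫ 𝟙 _ =
      (N.tensor h).map (𝟙 _) (𝟙 _) ≫ (T.tensorIso h A B).hom := by
    simp
  exact key

theorem rightUnitor_unit {M N : BraidedMonoidale.{w, v, u} k G} (T : Hom M N) :
    (T.comp (Hom.id N)).unitIso.hom ≫ modApp (ρ_ T.trans).hom M.unit = T.unitIso.hom := by
  have key : (𝟙 _ ≫ T.unitIso.hom) ≫ 𝟙 _ = T.unitIso.hom := by
    simp
  exact key

end Hom₂

/-- The bicategory of braided monoidales in `Ps(G^aut, 𝒱-Cat)`, with braided strong monoidal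
morphisms and monoidal modifications. -/
instance : Bicategory (BraidedMonoidale.{w, v, u} k G) where
  homCategory M N := homCategory M N
  whiskerLeft T _ _ θ := Hom₂.whiskerLeft T θ
  whiskerRight θ S := Hom₂.whiskerRight θ S
  associator T S R := isoMk (T := (T ≫ S) ≫ R) (T' := T ≫ S ≫ R)
    (α_ (Hom.trans T) (Hom.trans S) (Hom.trans R))
    (Hom₂.assoc_tensor T S R) (Hom₂.assoc_unit T S R)
  leftUnitor T := isoMk (T := 𝟙 _ ≫ T) (T' := T) (λ_ (Hom.trans T))
    (Hom₂.leftUnitor_tensor T) (Hom₂.leftUnitor_unit T)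
  rightUnitor T := isoMk (T := T ≫ 𝟙 _) (T' := T) (ρ_ (Hom.trans T))
    (Hom₂.rightUnitor_tensor T) (Hom₂.rightUnitor_unit T)
  whiskerLeft_id T S := hom₂_ext (Bicategory.whiskerLeft_id (Hom.trans T) (Hom.trans S))
  whiskerLeft_comp T _ _ _ θ θ' :=
    hom₂_ext (Bicategory.whiskerLeft_comp (Hom.trans T) (Hom₂.mod θ) (Hom₂.mod θ'))
  id_whiskerLeft θ := hom₂_ext (Bicategory.id_whiskerLeft (Hom₂.mod θ))
  comp_whiskerLeft T S _ _ θ :=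
    hom₂_ext (Bicategory.comp_whiskerLeft (Hom.trans T) (Hom.trans S) (Hom₂.mod θ))
  id_whiskerRight T S := hom₂_ext (Bicategory.id_whiskerRight (Hom.trans T) (Hom.trans S))
  comp_whiskerRight θ θ' S :=
    hom₂_ext (Bicategory.comp_whiskerRight (Hom₂.mod θ) (Hom₂.mod θ') (Hom.trans S))
  whiskerRight_id θ := hom₂_ext (Bicategory.whiskerRight_id (Hom₂.mod θ))
  whiskerRight_comp θ S R :=
    hom₂_ext (Bicategory.whiskerRight_comp (Hom₂.mod θ) (Hom.trans S) (Hom.trans R))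
  whisker_assoc T _ _ θ R :=
    hom₂_ext (Bicategory.whisker_assoc (Hom.trans T) (Hom₂.mod θ) (Hom.trans R))
  whisker_exchange θ η := hom₂_ext (Bicategory.whisker_exchange (Hom₂.mod θ) (Hom₂.mod η))
  pentagon T S R Q := hom₂_ext (Bicategory.pentagon (Hom.trans T) (Hom.trans S) (Hom.trans R)
    (Hom.trans Q))
  triangle T S := hom₂_ext (Bicategory.triangle (Hom.trans T) (Hom.trans S))

end BraidedMonoidale

/-- `X` is a direct sum of the family `Y`. -/
def IsDirectSum {C : Type u} [Category.{v} C] [Preadditive C] {ι : Type*} (X : C) (Y : ι → C) :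
    Prop :=
  ∃ b : Limits.Bicone Y, Nonempty b.IsBilimit ∧ Nonempty (b.pt ≅ X)

section

open MonoidalCategory
open Functor.LaxMonoidal (μ comp_μ comp_ε μ_natural_assoc μ_natural_right_assoc)

/-- A small `G`-graded category over `k`. -/
structure GGradedCat (k : Type w) [CommRing k] (G : Type u) [Group G] where
  carrier : Type u
  [category : Category.{v} carrier]
  [preadditive : Preadditive carrier]
  [linear : Linear k carrier]
  [monoidal : MonoidalCategory carrier]
  [monoidalPreadditive : MonoidalPreadditive carrier]
  [monoidalLinear : MonoidalLinear k carrier]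
  [hasFiniteBiproducts : Limits.HasFiniteBiproducts carrier]
  /-- `deg a X` means that `X` lies in the full subcategory of objects homogeneous over `a`. -/
  deg : G → ObjectProperty carrier
  deg_disjoint {a b : G} {X : carrier} (ha : deg a X) (hb : deg b X) : a = b
  deg_hasFiniteBiproducts (a : G) : Limits.HasFiniteBiproducts (deg a).FullSubcategory
  exists_splitting (X : carrier) :
    ∃ (s : Finset G) (Y : s → carrier), (∀ a : s, deg a (Y a)) ∧ IsDirectSum X Y
  deg_tensor {a b c : G} (h : a * b = c) {X Y : carrier} (hX : deg a X) (hY : deg b Y) :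
    deg c (X ⊗ Y)
  hom_eq_zero {a b : G} (h : a ≠ b) {X Y : carrier} (hX : deg a X) (hY : deg b Y) (f : X ⟶ Y) :
    f = 0
  deg_unit : deg 1 (𝟙_ carrier)

attribute [instance] GGradedCat.category GGradedCat.preadditive GGradedCat.linear
  GGradedCat.monoidal GGradedCat.monoidalPreadditive GGradedCat.monoidalLinear
  GGradedCat.hasFiniteBiproducts GGradedCat.deg_hasFiniteBiproducts

/-- A small `G`-crossed category over `k`: the functors `φ a`, with the isomorphisms
`φ a (φ b X) ≅ φ (b * a) X` and `X ≅ φ 1 X`, form a strong monoidal functor from the discrete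
monoidal category on `G` (with the tensor product of `a` and `b` being `b * a`) to the monoidal
`k`-linear auto-equivalences. -/
structure GCrossedCat (k : Type w) [CommRing k] (G : Type u) [Group G] extends
    GGradedCat.{w, v, u} k G where
  φ (a : G) : carrier ⥤ carrier
  φ_additive (a : G) : (φ a).Additive
  φ_linear (a : G) : (φ a).Linear k
  φ_monoidal (a : G) : (φ a).Monoidal
  φ_isEquivalence (a : G) : (φ a).IsEquivalence
  /-- `φ a` takes objects of degree `b` to objects of degree `c = a⁻¹ * b * a`. -/
  deg_φ {a b c : G} (h : a * c = b * a) {X : carrier} (hX : deg b X) : deg c ((φ a).obj X)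
  φComp {a b c : G} (h : b * a = c) : φ b ⋙ φ a ≅ φ c
  φComp_isMonoidal {a b c : G} (h : b * a = c) : NatTrans.IsMonoidal (φComp h).hom
  φUnit : 𝟭 carrier ≅ φ 1
  φUnit_isMonoidal : NatTrans.IsMonoidal φUnit.hom
  φ_assoc {a b c p q s : G} (hp : b * a = p) (hs : c * p = s) (hq : c * b = q) (hs' : q * a = s)
    (X : carrier) : (φComp hp).hom.app ((φ c).obj X) ≫ (φComp hs).hom.app X =
      (φ a).map ((φComp hq).hom.app X) ≫ (φComp hs').hom.app X
  φ_unit_left {a : G} (h : a * 1 = a) (X : carrier) :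
    φUnit.hom.app ((φ a).obj X) ≫ (φComp h).hom.app X = 𝟙 ((φ a).obj X)
  φ_unit_right {a : G} (h : 1 * a = a) (X : carrier) :
    (φ a).map (φUnit.hom.app X) ≫ (φComp h).hom.app X = 𝟙 ((φ a).obj X)

attribute [instance] GCrossedCat.φ_additive GCrossedCat.φ_linear GCrossedCat.φ_monoidal
  GCrossedCat.φ_isEquivalence GCrossedCat.φComp_isMonoidal GCrossedCat.φUnit_isMonoidal

/-- A small `G`-braided category over `k`. -/
structure GBraidedCat (k : Type w) [CommRing k] (G : Type u) [Group G] extends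
    GCrossedCat.{w, v, u} k G where
  /-- The `G`-braiding `X ⊗ Y ≅ Y ⊗ φ b X` for `Y` homogeneous over `b`. -/
  braid {b : G} (X Y : carrier) (hY : deg b Y) : X ⊗ Y ≅ Y ⊗ (φ b).obj X
  braid_naturality {b : G} {X X' Y Y' : carrier} (hY : deg b Y) (hY' : deg b Y') (x : X ⟶ X')
    (y : Y ⟶ Y') :
    (x ⊗ₘ y) ≫ (braid X' Y' hY').hom = (braid X Y hY).hom ≫ (y ⊗ₘ (φ b).map x)
  braid_tensor_right {b c d : G} (h : b * c = d) (X : carrier) {Y Z : carrier} (hY : deg b Y)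
    (hZ : deg c Z) :
    (braid X (Y ⊗ Z) (deg_tensor h hY hZ)).hom =
      (α_ X Y Z).inv ≫ (braid X Y hY).hom ▷ Z ≫ (α_ Y ((φ b).obj X) Z).hom ≫
        Y ◁ (braid ((φ b).obj X) Z hZ).hom ≫ (α_ Y Z ((φ c).obj ((φ b).obj X))).inv ≫
          (Y ⊗ Z) ◁ (φComp h).hom.app X
  braid_tensor_left {c : G} (X Y : carrier) {Z : carrier} (hZ : deg c Z) :
    (braid (X ⊗ Y) Z hZ).hom =
      (α_ X Y Z).hom ≫ X ◁ (braid Y Z hZ).hom ≫ (α_ X Z ((φ c).obj Y)).inv ≫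
        (braid X Z hZ).hom ▷ (φ c).obj Y ≫ (α_ Z ((φ c).obj X) ((φ c).obj Y)).hom ≫
          Z ◁ μ (φ c) X Y
  /-- The functors `φ a` preserve the `G`-braiding. -/
  braid_φ {a b c d : G} (hc : a * c = b * a) (hd : b * a = d) (X : carrier) {Y : carrier}
    (hY : deg b Y) :
    μ (φ a) X Y ≫ (φ a).map (braid X Y hY).hom =
      (braid ((φ a).obj X) ((φ a).obj Y) (deg_φ hc hY)).hom ≫
        (φ a).obj Y ◁ ((φComp (hc.trans hd)).hom.app X ≫ (φComp hd).inv.app X) ≫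
          μ (φ a) Y ((φ b).obj X)

namespace GBraidedCat

variable {k : Type w} [CommRing k] {G : Type u} [Group G]

/-- A `k`-linear strong monoidal functor that preserves degrees, commutes with the crossings up to
coherent isomorphism and preserves the `G`-braidings. -/
structure Hom (C D : GBraidedCat.{w, v, u} k G) where
  functor : C.carrier ⥤ D.carrier
  [additive : functor.Additive]
  [linear : functor.Linear k]
  [monoidal : functor.Monoidal]
  deg_obj {a : G} {X : C.carrier} (hX : C.deg a X) : D.deg a (functor.obj X)
  /-- The isomorphism `F (φ a X) ≅ φ a (F X)`. -/
  crossIso (a : G) (X : C.carrier) : functor.obj ((C.φ a).obj X) ≅ (D.φ a).obj (functor.obj X)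
  crossIso_naturality (a : G) {X Y : C.carrier} (f : X ⟶ Y) :
    functor.map ((C.φ a).map f) ≫ (crossIso a Y).hom =
      (crossIso a X).hom ≫ (D.φ a).map (functor.map f)
  crossIso_tensor (a : G) (X Y : C.carrier) :
    μ functor ((C.φ a).obj X) ((C.φ a).obj Y) ≫ functor.map (μ (C.φ a) X Y) ≫
        (crossIso a (X ⊗ Y)).hom =
      ((crossIso a X).hom ⊗ₘ (crossIso a Y).hom) ≫
        μ (D.φ a) (functor.obj X) (functor.obj Y) ≫ (D.φ a).map (μ functor X Y)
  crossIso_unit (a : G) :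
    Functor.LaxMonoidal.ε functor ≫ functor.map (Functor.LaxMonoidal.ε (C.φ a)) ≫ (crossIso a (𝟙_ C.carrier)).hom =
      Functor.LaxMonoidal.ε (D.φ a) ≫ (D.φ a).map (Functor.LaxMonoidal.ε functor)
  crossIso_comp {a b c : G} (h : b * a = c) (X : C.carrier) :
    functor.map ((C.φComp h).hom.app X) ≫ (crossIso c X).hom =
      (crossIso a ((C.φ b).obj X)).hom ≫ (D.φ a).map (crossIso b X).hom ≫
        (D.φComp h).hom.app (functor.obj X)
  crossIso_one (X : C.carrier) :
    functor.map (C.φUnit.hom.app X) ≫ (crossIso 1 X).hom = D.φUnit.hom.app (functor.obj X)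
  braid {b : G} (X : C.carrier) {Y : C.carrier} (hY : C.deg b Y) :
    μ functor X Y ≫ functor.map (C.braid X Y hY).hom =
      (D.braid (functor.obj X) (functor.obj Y) (deg_obj hY)).hom ≫
        functor.obj Y ◁ (crossIso b X).inv ≫ μ functor Y ((C.φ b).obj X)

attribute [instance] Hom.additive Hom.linear Hom.monoidal

/-- A monoidal natural transformation compatible with the crossings. -/
@[ext]
structure Hom₂ {C D : GBraidedCat.{w, v, u} k G} (S T : Hom C D) where
  nat : S.functor ⟶ T.functor
  isMonoidal : NatTrans.IsMonoidal nat
  cross (a : G) (X : C.carrier) :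
    nat.app ((C.φ a).obj X) ≫ (T.crossIso a X).hom =
      (S.crossIso a X).hom ≫ (D.φ a).map (nat.app X)

attribute [instance] Hom₂.isMonoidal

/-- The identity 1-cell. -/
def Hom.id (C : GBraidedCat.{w, v, u} k G) : Hom C C where
  functor := 𝟭 C.carrier
  deg_obj hX := hX
  crossIso a X := Iso.refl ((C.φ a).obj X)
  crossIso_naturality a _ _ f := by simp
  crossIso_tensor a X Y := by simp
  crossIso_unit a := by simp
  crossIso_comp h X := by simp
  crossIso_one X := by simp
  braid X _ hY := by simp

/-- Composition of 1-cells. -/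
def Hom.comp {C D E : GBraidedCat.{w, v, u} k G} (S : Hom C D) (T : Hom D E) : Hom C E where
  functor := S.functor ⋙ T.functor
  deg_obj hX := T.deg_obj (S.deg_obj hX)
  crossIso a X := T.functor.mapIso (S.crossIso a X) ≪≫ T.crossIso a (S.functor.obj X)
  crossIso_naturality a X Y f := by
    have h₁ := S.crossIso_naturality a f
    have h₂ := T.crossIso_naturality a (S.functor.map f)
    simp only [Functor.comp_map, Iso.trans_hom, Functor.mapIso_hom, Category.assoc, ← h₂]
    simp only [← Functor.map_comp_assoc, h₁]
  crossIso_tensor a X Y := by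
    have h₁ := S.crossIso_tensor a X Y
    have h₂ := T.crossIso_tensor a (S.functor.obj X) (S.functor.obj Y)
    have h₃ := T.crossIso_naturality a (μ S.functor X Y)
    simp only [comp_μ, Functor.comp_map, Functor.comp_obj, Iso.trans_hom, Functor.mapIso_hom,
      Category.assoc, Functor.map_comp]
    rw [← tensorHom_comp_tensorHom_assoc, ← reassoc_of% h₂, ← h₃, μ_natural_assoc]
    simp only [← Functor.map_comp_assoc, h₁]
  crossIso_unit a := by
    have h₁ := S.crossIso_unit a
    have h₂ := T.crossIso_unit a
    have h₃ := T.crossIso_naturality a (Functor.LaxMonoidal.ε S.functor)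
    simp only [comp_ε, Functor.comp_map, Functor.comp_obj, Iso.trans_hom, Functor.mapIso_hom,
      Category.assoc, Functor.map_comp]
    rw [← reassoc_of% h₂, ← h₃]
    simp only [← Functor.map_comp_assoc, h₁]
  crossIso_comp {a b c} h X := by
    have h₁ := S.crossIso_comp h X
    have h₂ := T.crossIso_comp h (S.functor.obj X)
    have h₃ := T.crossIso_naturality a (S.crossIso b X).hom
    simp only [Functor.comp_map, Functor.comp_obj, Iso.trans_hom, Functor.mapIso_hom,
      Category.assoc, Functor.map_comp]
    rw [← reassoc_of% h₃, ← h₂]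
    simp only [← Functor.map_comp_assoc, h₁]
  crossIso_one X := by
    have h₁ := S.crossIso_one X
    have h₂ := T.crossIso_one (S.functor.obj X)
    simp only [Functor.comp_map, Functor.comp_obj, Iso.trans_hom, Functor.mapIso_hom]
    rw [← Functor.map_comp_assoc, h₁, h₂]
  braid {b} X Y hY := by
    have h₁ := S.braid X hY
    have h₂ := T.braid (S.functor.obj X) (S.deg_obj hY)
    simp only [comp_μ, Functor.comp_map, Functor.comp_obj, Iso.trans_inv, Functor.mapIso_inv,
      Category.assoc, MonoidalCategory.whiskerLeft_comp]
    rw [← Functor.map_comp, h₁, μ_natural_right_assoc, Functor.map_comp, reassoc_of% h₂,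
      Functor.map_comp]

instance : CategoryStruct (GBraidedCat.{w, v, u} k G) where
  Hom C D := Hom C D
  id C := Hom.id C
  comp S T := Hom.comp S T

instance homCategory (C D : GBraidedCat.{w, v, u} k G) : Category (C ⟶ D) where
  Hom S T := Hom₂ S T
  id S := Hom₂.mk (𝟙 (Hom.functor S)) inferInstance (by simp)
  comp η θ := Hom₂.mk (Hom₂.nat η ≫ Hom₂.nat θ) inferInstance (fun a X => by
    have h₁ := Hom₂.cross η a X
    have h₂ := Hom₂.cross θ a X
    simp only [NatTrans.comp_app, Category.assoc, Functor.map_comp, h₂, reassoc_of% h₁])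
  id_comp η := Hom₂.ext (Category.id_comp (Hom₂.nat η))
  comp_id η := Hom₂.ext (Category.comp_id (Hom₂.nat η))
  assoc η θ ι := Hom₂.ext (Category.assoc (Hom₂.nat η) (Hom₂.nat θ) (Hom₂.nat ι))

/-- Two 2-cells agree if their underlying natural transformations do. -/
theorem hom₂_ext {C D : GBraidedCat.{w, v, u} k G} {S T : C ⟶ D} {η θ : S ⟶ T}
    (h : Hom₂.nat η = Hom₂.nat θ) : η = θ :=
  Hom₂.ext h

/-- A monoidal natural isomorphism compatible with the crossings is an invertible 2-cell. -/
def isoMk {C D : GBraidedCat.{w, v, u} k G} {S T : C ⟶ D} (η : Hom.functor S ≅ Hom.functor T)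
    (isMonoidal : NatTrans.IsMonoidal η.hom)
    (cross : ∀ (a : G) (X : C.carrier),
      η.hom.app ((C.φ a).obj X) ≫ (Hom.crossIso T a X).hom =
        (Hom.crossIso S a X).hom ≫ (D.φ a).map (η.hom.app X)) : S ≅ T where
  hom := Hom₂.mk η.hom inferInstance cross
  inv := Hom₂.mk η.inv inferInstance (fun a X => by
    rw [← cancel_epi (η.hom.app ((C.φ a).obj X)), Iso.hom_inv_id_app_assoc, reassoc_of% cross,
      ← Functor.map_comp, Iso.hom_inv_id_app, CategoryTheory.Functor.map_id, Category.comp_id])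
  hom_inv_id := Hom₂.ext η.hom_inv_id
  inv_hom_id := Hom₂.ext η.inv_hom_id

namespace Hom₂

variable {C D E E' : GBraidedCat.{w, v, u} k G}

theorem whiskerLeft_cross (S : Hom C D) {T T' : Hom D E} (η : Hom₂ T T') (a : G) (X : C.carrier) :
    (Functor.whiskerLeft S.functor η.nat).app ((C.φ a).obj X) ≫ ((S.comp T').crossIso a X).hom =
      ((S.comp T).crossIso a X).hom ≫
        (E.φ a).map ((Functor.whiskerLeft S.functor η.nat).app X) := by
  have key : η.nat.app (S.functor.obj ((C.φ a).obj X)) ≫ T'.functor.map (S.crossIso a X).hom ≫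
      (T'.crossIso a (S.functor.obj X)).hom =
      (T.functor.map (S.crossIso a X).hom ≫ (T.crossIso a (S.functor.obj X)).hom) ≫
        (E.φ a).map (η.nat.app (S.functor.obj X)) := by
    rw [Category.assoc, ← η.cross, NatTrans.naturality_assoc]
  exact key

theorem whiskerRight_cross {S S' : Hom C D} (η : Hom₂ S S') (T : Hom D E) (a : G)
    (X : C.carrier) :
    (Functor.whiskerRight η.nat T.functor).app ((C.φ a).obj X) ≫
        ((S'.comp T).crossIso a X).hom =
      ((S.comp T).crossIso a X).hom ≫
        (E.φ a).map ((Functor.whiskerRight η.nat T.functor).app X) := by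
  have key : T.functor.map (η.nat.app ((C.φ a).obj X)) ≫ T.functor.map (S'.crossIso a X).hom ≫
      (T.crossIso a (S'.functor.obj X)).hom =
      (T.functor.map (S.crossIso a X).hom ≫ (T.crossIso a (S.functor.obj X)).hom) ≫
        (E.φ a).map (T.functor.map (η.nat.app X)) := by
    rw [Category.assoc, ← T.crossIso_naturality, ← Functor.map_comp_assoc, η.cross,
      Functor.map_comp_assoc]
  exact key

theorem associator_cross (S : Hom C D) (T : Hom D E) (R : Hom E E') (a : G) (X : C.carrier) :
    (Functor.associator S.functor T.functor R.functor).hom.app ((C.φ a).obj X) ≫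
        ((S.comp (T.comp R)).crossIso a X).hom =
      (((S.comp T).comp R).crossIso a X).hom ≫
        (E'.φ a).map ((Functor.associator S.functor T.functor R.functor).hom.app X) := by
  have key : 𝟙 _ ≫ R.functor.map (T.functor.map (S.crossIso a X).hom) ≫
      R.functor.map (T.crossIso a (S.functor.obj X)).hom ≫
        (R.crossIso a (T.functor.obj (S.functor.obj X))).hom =
      (R.functor.map (T.functor.map (S.crossIso a X).hom ≫
        (T.crossIso a (S.functor.obj X)).hom) ≫
          (R.crossIso a (T.functor.obj (S.functor.obj X))).hom) ≫ (E'.φ a).map (𝟙 _) := by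
    simp
  exact key

theorem leftUnitor_cross (S : Hom C D) (a : G) (X : C.carrier) :
    (Functor.leftUnitor S.functor).hom.app ((C.φ a).obj X) ≫ (S.crossIso a X).hom =
      (((Hom.id C).comp S).crossIso a X).hom ≫
        (D.φ a).map ((Functor.leftUnitor S.functor).hom.app X) := by
  have key : 𝟙 _ ≫ (S.crossIso a X).hom =
      (S.functor.map (𝟙 _) ≫ (S.crossIso a X).hom) ≫ (D.φ a).map (𝟙 _) := by
    simp
  exact key

theorem rightUnitor_cross (S : Hom C D) (a : G) (X : C.carrier) :
    (Functor.rightUnitor S.functor).hom.app ((C.φ a).obj X) ≫ (S.crossIso a X).hom =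
      ((S.comp (Hom.id D)).crossIso a X).hom ≫
        (D.φ a).map ((Functor.rightUnitor S.functor).hom.app X) := by
  have key : 𝟙 _ ≫ (S.crossIso a X).hom =
      ((S.crossIso a X).hom ≫ 𝟙 _) ≫ (D.φ a).map (𝟙 _) := by
    simp
  exact key

end Hom₂

/-- The bicategory of small `G`-braided categories over `k`. -/
instance : Bicategory (GBraidedCat.{w, v, u} k G) where
  homCategory C D := homCategory C D
  whiskerLeft S _ _ η := Hom₂.mk (Functor.whiskerLeft (Hom.functor S) (Hom₂.nat η))
    (show NatTrans.IsMonoidal (Functor.whiskerLeft (Hom.functor S) (Hom₂.nat η)) from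
      inferInstance) (Hom₂.whiskerLeft_cross S η)
  whiskerRight η T := Hom₂.mk (Functor.whiskerRight (Hom₂.nat η) (Hom.functor T))
    (show NatTrans.IsMonoidal (Functor.whiskerRight (Hom₂.nat η) (Hom.functor T)) from
      inferInstance) (Hom₂.whiskerRight_cross η T)
  associator S T R := isoMk (S := (S ≫ T) ≫ R) (T := S ≫ T ≫ R)
    (Functor.associator (Hom.functor S) (Hom.functor T) (Hom.functor R))
    (show NatTrans.IsMonoidal
      (Functor.associator (Hom.functor S) (Hom.functor T) (Hom.functor R)).hom from
        inferInstance) (Hom₂.associator_cross S T R)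
  leftUnitor S := isoMk (S := 𝟙 _ ≫ S) (T := S) (Functor.leftUnitor (Hom.functor S))
    (show NatTrans.IsMonoidal (Functor.leftUnitor (Hom.functor S)).hom from inferInstance)
    (Hom₂.leftUnitor_cross S)
  rightUnitor S := isoMk (S := S ≫ 𝟙 _) (T := S) (Functor.rightUnitor (Hom.functor S))
    (show NatTrans.IsMonoidal (Functor.rightUnitor (Hom.functor S)).hom from inferInstance)
    (Hom₂.rightUnitor_cross S)
  whiskerLeft_id _ _ := hom₂_ext (Functor.whiskerLeft_id _)
  whiskerLeft_comp _ _ _ _ _ _ := hom₂_ext (Functor.whiskerLeft_comp _ _ _)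
  id_whiskerLeft _ := hom₂_ext (by ext; exact ((Category.id_comp _).trans (Category.comp_id _)).symm)
  comp_whiskerLeft _ _ _ _ _ :=
    hom₂_ext (by ext; exact ((Category.id_comp _).trans (Category.comp_id _)).symm)
  id_whiskerRight _ _ := hom₂_ext (Functor.whiskerRight_id _)
  comp_whiskerRight _ _ _ := hom₂_ext (Functor.whiskerRight_comp _ _ _)
  whiskerRight_id _ :=
    hom₂_ext (by ext; exact ((Category.id_comp _).trans (Category.comp_id _)).symm)
  whiskerRight_comp _ _ _ :=
    hom₂_ext (by ext; exact ((Category.id_comp _).trans (Category.comp_id _)).symm)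
  whisker_assoc _ _ _ _ _ :=
    hom₂_ext (by ext; exact ((Category.id_comp _).trans (Category.comp_id _)).symm)
  whisker_exchange η θ := hom₂_ext (by ext; exact ((Hom₂.nat θ).naturality _).symm)
  pentagon S T R Q := hom₂_ext (Functor.pentagon (Hom.functor S) (Hom.functor T) (Hom.functor R)
    (Hom.functor Q))
  triangle S T := hom₂_ext (Functor.triangle (Hom.functor S) (Hom.functor T))

end GBraidedCat

end

/-! From a $G$-braided category $\mathcal C$ to a braided monoidale: the value at $a$ is $\mathcal
C_a$. Since $\phi$ reverses products and takes $\mathcal C_b$ to $\mathcal C_{a^{-1}ba}$, an element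
$g$ has to act by $\phi_{g^{-1}}$. Tensor product, unit and their constraints are restricted from
$\mathcal C$. Only the braiding has to be converted. For $A\in\mathcal C_a$, the $G$-braiding of
$\phi_{a^{-1}}B$ with $A$, followed by the cancellation $\phi_a\phi_{a^{-1}}B\cong B$, is an
isomorphism $\phi_{a^{-1}}B\otimes A\cong A\otimes B$ (`invBraid`), and its inverse is the braiding
$A\,\square\,B\cong aB\,\square\,A$. Under this dictionary axiom (ii) becomes the right hexagon,
axiom (i) the left hexagon and axiom (iii) the modification axiom (`hexagon_right_aux`,
`hexagon_left_aux`, `invBraid_φ`). Conversely $X\cong\phi_{b^{-1}}\phi_bX$ recovers the $G$-braiding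
from an inverse one (`GCrossedCat.InvBraiding`).

Equivalence on hom-categories: every object of $\mathcal C$ is a finite direct sum of homogeneous
objects, and morphisms between different degrees vanish. So an additive functor, or a transformation
between additive functors, given on homogeneous objects extends to all of $\mathcal C$, and
equations need only be tested after precomposition with morphisms from homogeneous objects
(`exists_extAt`, `HomogNat.ext`, `hom_ext_homog`). A 1-cell between the associated monoidales is
thus extended to a functor, its constraints are transported along the comparison isomorphisms `κ`,
and the result is a 1-cell of $G$-braided categories (`FibHom.homogHom`, `HomogHom.toHom`). Full
faithfulness is the same argument for 2-cells.

From a braided monoidale $M$ to a $G$-braided category: the coproduct of the linear categories $Ma$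
(`LinCat.Total`) is monoidal, with crossings and an inverse braiding. Its finite direct sum
completion, with finite families as objects and matrices as morphisms (`Fam`), is the required
category `compl`. The structure isomorphisms of the completion are monomial matrices, so each of its
axioms reduces entry by entry to one in the coproduct, and that one is an axiom of $M$. The
single-member families give a 1-cell `emb` that is fully faithful in each degree, and each
homogeneous family is the direct sum of its members. If every $Ma$ has finite direct sums, the
components of `emb` are equivalences; a 1-cell with this property is an equivalence, since its
constraints can be transported to fibrewise inverses (`Hom.equivalence`). In the other direction, an
equivalence of braided monoidales is an equivalence at each $a$, and $\mathcal C_a$ has finite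
direct sums.

One technical device recurs. Degrees such as $a(bc)$ and $(ab)c$ are equal, but not by definition.
Constraints are therefore indexed by free names for products and conjugates together with equations,
and are compared with the canonical choices by isomorphisms (`tensorDeg`, `crossIncl`) that become
identities once the names are substituted. -/

theorem comp_id_interleaved {C : Type*} [Category* C] {X Y Z W : C} (x : X ⟶ Y) (y : Y ⟶ Z)
    (z : Z ⟶ W) : x ≫ 𝟙 _ ≫ y ≫ 𝟙 _ ≫ z ≫ 𝟙 _ = x ≫ y ≫ z := by
  simp

theorem LinCat.eqToHom_app {k : Type w} [CommRing k] {C D : LinCat.{w, v, u} k} {F F' : C ⟶ D}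
    (h : F = F') (A : C) : (eqToHom h).toNatTrans.app A = eqToHom (by rw [h]) := by
  subst h
  rfl

/-- Like `comp_id_interleaved`, this discards the identity components that associators of linear
functors contribute to evaluated coherence laws. -/
theorem comp_id_interleaved' {C : Type*} [Category* C] {X Y Z W V : C} (x : X ⟶ Y) (y : Y ⟶ Z)
    (z : Z ⟶ W) (z' : W ⟶ V) : x ≫ y ≫ 𝟙 _ ≫ z ≫ z' = x ≫ y ≫ z ≫ z' := by
  simp

/-! ### Coherence laws of pseudofunctors on `GAut G`, evaluated at objects -/

namespace PsGAut

variable {k : Type w} [CommRing k] {G : Type u} [Group G]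

instance act_additive (F : PsGAut.{w, v, u} k G) {a b : G} (g : G) (h : g * a = b * g) :
    (act F g h).Additive :=
  (F.map (GAut.arr g h)).additive

instance act_linear (F : PsGAut.{w, v, u} k G) {a b : G} (g : G) (h : g * a = b * g) :
    (act F g h).Linear k :=
  (F.map (GAut.arr g h)).linear

instance comp_additive {F F' : PsGAut.{w, v, u} k G} (T : F ⟶ F') (a : G) :
    (comp T a).Additive :=
  (T.app ⟨⟨a⟩⟩).additive

instance comp_linear {F F' : PsGAut.{w, v, u} k G} (T : F ⟶ F') (a : G) :
    (comp T a).Linear k :=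
  (T.app ⟨⟨a⟩⟩).linear

section

variable (F : PsGAut.{w, v, u} k G)

theorem actOne_hom_eq {a : G} (h : (1 : G) * a = a * 1) (A : fib F a) :
    (actOne F h A).hom = (F.mapId ⟨⟨a⟩⟩).hom.toNatTrans.app A :=
  congrArg (fun α => (LinCat.Hom₂.toNatTrans (Iso.hom α)).app A) (F.mapId'_eq_mapId _)

/-- The inverse appears because `actMul` points from the iterated action to the action of the
product, against `mapComp`. -/
theorem actMul_inv_eq {a b c f g : G} (hf : f * a = b * f) (hg : g * b = c * g)
    (he : g * f * a = c * (g * f)) (A : fib F a) : (actMul F hf hg he rfl A).inv =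
      (F.mapComp (GAut.arr f hf) (GAut.arr g hg)).hom.toNatTrans.app A :=
  congrArg (fun α => (LinCat.Hom₂.toNatTrans (Iso.hom α)).app A)
    (F.mapComp'_eq_mapComp (GAut.arr f hf) (GAut.arr g hg))

theorem actOne_naturality {a : G} (h : (1 : G) * a = a * 1) {A B : fib F a} (f : A ⟶ B) :
    (act F 1 h).map f ≫ (actOne F h B).hom = (actOne F h A).hom ≫ f :=
  (LinCat.natIso (F.mapId' (GAut.arr 1 h) rfl)).hom.naturality f

theorem actMul_naturality {a b c f g e : G} (hf : f * a = b * f) (hg : g * b = c * g)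
    (he : e * a = c * e) (hm : g * f = e) {A B : fib F a} (x : A ⟶ B) :
    (act F g hg).map ((act F f hf).map x) ≫ (actMul F hf hg he hm B).hom =
      (actMul F hf hg he hm A).hom ≫ (act F e he).map x :=
  (LinCat.natIso (F.mapComp' (GAut.arr f hf) (GAut.arr g hg) (GAut.arr e he)
    (by subst hm; rfl))).symm.hom.naturality x

/-- This is the associativity coherence of `mapComp'` at the object `A`. Every composite has its own
name and equation, so that later uses need no transport along `mul_assoc`. -/
theorem actMul_assoc {a b c d e f g p q s : G} (he : e * a = b * e) (hf : f * b = c * f)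
    (hg : g * c = d * g) (hp : p * a = c * p) (hq : q * b = d * q) (hs : s * a = d * s)
    (h₁ : f * e = p) (h₂ : g * f = q) (h₃ : g * p = s) (h₄ : q * e = s) (A : fib F a) :
    (actMul F hf hg hq h₂ ((act F e he).obj A)).hom ≫ (actMul F he hq hs h₄ A).hom =
      (act F g hg).map (actMul F he hf hp h₁ A).hom ≫ (actMul F hp hg hs h₃ A).hom := by
  have key := F.mapComp'_inv_whiskerRight_mapComp'₀₂₃_inv (GAut.arr e he) (GAut.arr f hf)
    (GAut.arr g hg) (GAut.arr p hp) (GAut.arr q hq) (GAut.arr s hs) (by subst h₁; rfl)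
    (by subst h₂; rfl) (by subst h₃; rfl)
  have := congrArg (fun α => LinCat.Hom₂.toNatTrans α |>.app A) key
  simp only [LinCat.comp_app, LinCat.whiskerRight_app, LinCat.whiskerLeft_app,
    LinCat.associator_hom_app, Category.id_comp] at this
  exact this.symm

theorem actMul_one_left {a b g : G} (h1 : (1 : G) * b = b * 1) (hg : g * a = b * g)
    (hm : 1 * g = g) (A : fib F a) :
    (actMul F hg h1 hg hm A).hom = (actOne F h1 ((act F g hg).obj A)).hom := by
  have key := F.mapComp'_comp_id_inv (GAut.arr g hg)
  have := congrArg (fun α => LinCat.Hom₂.toNatTrans α |>.app A) key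
  simp only [LinCat.comp_app, LinCat.whiskerLeft_app,
    LinCat.rightUnitor_hom_app] at this
  erw [Category.comp_id] at this
  exact this.trans (actOne_hom_eq F h1 _).symm

theorem actMul_one_right {a b g : G} (h1 : (1 : G) * a = a * 1) (hg : g * a = b * g)
    (hm : g * 1 = g) (A : fib F a) :
    (actMul F h1 hg hg hm A).hom = (act F g hg).map (actOne F h1 A).hom := by
  have key := F.mapComp'_id_comp_inv (GAut.arr g hg)
  have := congrArg (fun α => LinCat.Hom₂.toNatTrans α |>.app A) key
  simp only [LinCat.comp_app, LinCat.whiskerRight_app,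
    LinCat.leftUnitor_hom_app] at this
  erw [Category.comp_id] at this
  exact this.trans (congrArg (act F g hg).map (actOne_hom_eq F h1 A).symm)

end

variable {F F' F'' : PsGAut.{w, v, u} k G}

theorem compAct_one (T : F ⟶ F') {a : G} (h : (1 : G) * a = a * 1) (A : fib F a) :
    (compAct T 1 h A).hom ≫ (actOne F' h ((comp T a).obj A)).hom =
      (comp T a).map (actOne F h A).hom := by
  have := congrArg (fun α => LinCat.Hom₂.toNatTrans α |>.app A) (T.naturality_id ⟨⟨a⟩⟩)
  simp only [LinCat.comp_app, LinCat.whiskerRight_app, LinCat.whiskerLeft_app,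
    LinCat.leftUnitor_hom_app, LinCat.rightUnitor_inv_app] at this
  erw [Category.comp_id, Category.comp_id] at this
  rw [actOne_hom_eq, actOne_hom_eq]
  exact this

/-- This is `naturality_comp` at `A`, where associators are identities. The bicategorical law
contains `mapComp`, that is, inverses of `actMul`, so both sides have to be rearranged. -/
theorem compAct_mul (T : F ⟶ F') {a b c f g e : G} (hf : f * a = b * f) (hg : g * b = c * g)
    (he : e * a = c * e) (hm : g * f = e) (A : fib F a) :
    (compAct T g hg ((act F f hf).obj A)).hom ≫ (act F' g hg).map (compAct T f hf A).hom ≫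
        (actMul F' hf hg he hm ((comp T a).obj A)).hom =
      (comp T c).map (actMul F hf hg he hm A).hom ≫ (compAct T e he A).hom := by
  subst hm
  have := congrArg (fun α => LinCat.Hom₂.toNatTrans α |>.app A)
    (T.naturality_comp (GAut.arr f hf) (GAut.arr g hg))
  simp only [LinCat.comp_app, LinCat.whiskerRight_app, LinCat.whiskerLeft_app,
    LinCat.associator_hom_app, LinCat.associator_inv_app] at this
  erw [Category.comp_id, Category.id_comp, Category.id_comp] at this
  have key : (compAct T (g * f) he A).hom ≫
      (actMul F' hf hg he rfl ((comp T a).obj A)).inv =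
      (comp T c).map (actMul F hf hg he rfl A).inv ≫
        (compAct T g hg ((act F f hf).obj A)).hom ≫ (act F' g hg).map (compAct T f hf A).hom := by
    rw [actMul_inv_eq, actMul_inv_eq]
    exact this
  rw [← Category.assoc, ← Iso.eq_comp_inv, Category.assoc, key, ← Functor.map_comp_assoc,
    Iso.hom_inv_id, CategoryTheory.Functor.map_id, Category.id_comp]

/-- A modification from its components. -/
def mkMod {T T' : F ⟶ F'} (α : ∀ a, comp T a ⟶ comp T' a)
    (act : ∀ {a b : G} (g : G) (h : g * a = b * g) (A : fib F a),
      (α b).app ((act F g h).obj A) ≫ (compAct T' g h A).hom =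
        (compAct T g h A).hom ≫ (PsGAut.act F' g h).map ((α a).app A)) : T ⟶ T' :=
  Pseudofunctor.StrongTrans.Hom.of
    { app := fun a => LinCat.Hom₂.mk (α a.as.el)
      naturality := fun f => LinCat.hom₂_ext fun A => act f.as.1 f.as.2 A }

theorem mod_ext {T T' : F ⟶ F'} {θ θ' : T ⟶ T'}
    (h : ∀ {a : G} (A : fib F a), modApp θ A = modApp θ' A) : θ = θ' :=
  Pseudofunctor.StrongTrans.Hom.ext
    (Pseudofunctor.StrongTrans.Modification.ext
      (funext fun _ => LinCat.hom₂_ext fun A => h A))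

/-- An invertible modification from its components. -/
def mkModIso {T T' : F ⟶ F'} (α : ∀ a, comp T a ≅ comp T' a)
    (act : ∀ {a b : G} (g : G) (h : g * a = b * g) (A : fib F a),
      (α b).hom.app ((act F g h).obj A) ≫ (compAct T' g h A).hom =
        (compAct T g h A).hom ≫ (PsGAut.act F' g h).map ((α a).hom.app A)) : T ≅ T' where
  hom := mkMod (fun a => (α a).hom) act
  inv := mkMod (fun a => (α a).inv) fun {a b} g h A => by
    rw [← cancel_epi ((α b).hom.app ((PsGAut.act F g h).obj A)), Iso.hom_inv_id_app_assoc,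
      reassoc_of% act g h A, ← Functor.map_comp, Iso.hom_inv_id_app,
      CategoryTheory.Functor.map_id, Category.comp_id]
  hom_inv_id := mod_ext fun {a} A => (α a).hom_inv_id_app A
  inv_hom_id := mod_ext fun {a} A => (α a).inv_hom_id_app A

/-- A pseudonatural transformation from its components. -/
def mkTrans (T : ∀ a, fib F a ⥤ fib F' a) [∀ a, (T a).Additive] [∀ a, (T a).Linear k]
    (act : ∀ {a b : G} (g : G) (h : g * a = b * g),
      act F g h ⋙ T b ≅ T a ⋙ act F' g h)
    (one : ∀ {a : G} (h : (1 : G) * a = a * 1) (A : fib F a),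
      (act 1 h).hom.app A ≫ (actOne F' h ((T a).obj A)).hom = (T a).map (actOne F h A).hom)
    (mul : ∀ {a b c f g e : G} (hf : f * a = b * f) (hg : g * b = c * g) (he : e * a = c * e)
      (hm : g * f = e) (A : fib F a),
      (act g hg).hom.app ((PsGAut.act F f hf).obj A) ≫
          (PsGAut.act F' g hg).map ((act f hf).hom.app A) ≫
            (actMul F' hf hg he hm ((T a).obj A)).hom =
        (T c).map (actMul F hf hg he hm A).hom ≫ (act e he).hom.app A) : F ⟶ F' where
  app a := LinCat.Hom.mk (T a.as.el)
  naturality f := LinCat.isoMk (act f.as.1 f.as.2)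
  naturality_naturality {a b f g} η := by
    -- The source is locally discrete, so its only 2-cells are identities.
    obtain rfl : f = g := LocallyDiscrete.eq_of_hom η
    obtain rfl : η = 𝟙 f := Subsingleton.elim _ _
    simp
  naturality_id a := LinCat.hom₂_ext fun A => by
    have h := one (a := a.as.el) (by simp) A
    rw [actOne_hom_eq, actOne_hom_eq] at h
    refine h.trans ?_
    change _ = (T _).map _ ≫ 𝟙 _ ≫ 𝟙 _
    rw [Category.comp_id, Category.comp_id]
  naturality_comp {a b c} f g := LinCat.hom₂_ext fun A => by
    have h := mul f.as.2 g.as.2 (f ≫ g).as.2 rfl A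
    -- The hypothesis is turned from `actMul` to its inverse on both sides, the direction in which a
    -- pseudonatural transformation states the law.
    rw [← Category.assoc, ← Iso.eq_comp_inv, Category.assoc] at h
    have h' := congrArg (fun z => (T _).map (actMul F f.as.2 g.as.2 (f ≫ g).as.2 rfl A).inv ≫ z) h
    simp only [← Functor.map_comp_assoc, Iso.inv_hom_id, CategoryTheory.Functor.map_id,
      Category.id_comp] at h'
    have h₂ := h'.symm
    erw [actMul_inv_eq, actMul_inv_eq] at h₂
    exact h₂.trans (comp_id_interleaved _ _ _).symm

section

variable (T : ∀ a, fib F a ⥤ fib F' a) [∀ a, (T a).Additive] [∀ a, (T a).Linear k]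
  (act : ∀ {a b : G} (g : G) (h : g * a = b * g), act F g h ⋙ T b ≅ T a ⋙ act F' g h) (one)
  (mul)

end

/-- A pseudofunctor from its components. -/
def mkPs (N : G → LinCat.{w, v, u} k)
    (act : ∀ {a b : G} (g : G) (_ : g * a = b * g), N a ⥤ N b)
    [∀ {a b : G} (g : G) (h : g * a = b * g), (act g h).Additive]
    [∀ {a b : G} (g : G) (h : g * a = b * g), (act g h).Linear k]
    (one : ∀ {a : G} (h : (1 : G) * a = a * 1), act 1 h ≅ 𝟭 (N a))
    (mul : ∀ {a b c f g e : G} (hf : f * a = b * f) (hg : g * b = c * g) (he : e * a = c * e)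
      (_ : g * f = e), act f hf ⋙ act g hg ≅ act e he)
    (assoc : ∀ {a b c d e f g p q s : G} (he : e * a = b * e) (hf : f * b = c * f)
      (hg : g * c = d * g) (hp : p * a = c * p) (hq : q * b = d * q) (hs : s * a = d * s)
      (h₁ : f * e = p) (h₂ : g * f = q) (h₃ : g * p = s) (h₄ : q * e = s) (A : N a),
      (mul hf hg hq h₂).hom.app ((act e he).obj A) ≫ (mul he hq hs h₄).hom.app A =
        (act g hg).map ((mul he hf hp h₁).hom.app A) ≫ (mul hp hg hs h₃).hom.app A)
    (one_left : ∀ {a b g : G} (h1 : (1 : G) * b = b * 1) (hg : g * a = b * g) (hm : 1 * g = g)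
      (A : N a), (mul hg h1 hg hm).hom.app A = (one h1).hom.app ((act g hg).obj A))
    (one_right : ∀ {a b g : G} (h1 : (1 : G) * a = a * 1) (hg : g * a = b * g) (hm : g * 1 = g)
      (A : N a), (mul h1 hg hg hm).hom.app A = (act g hg).map ((one h1).hom.app A)) :
    PsGAut.{w, v, u} k G :=
  LocallyDiscrete.mkPseudofunctor (fun a => N a.el)
    (fun f => LinCat.Hom.mk (act f.1 f.2))
    (fun a => LinCat.isoMk (F := LinCat.Hom.mk (act 1 _)) (G := 𝟙 (N a.el)) (one (by simp)))
    (fun f g => (LinCat.isoMk (F := LinCat.Hom.mk (act f.1 f.2) ≫ LinCat.Hom.mk (act g.1 g.2))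
      (G := LinCat.Hom.mk (act (f ≫ g).1 (f ≫ g).2)) (mul f.2 g.2 (f ≫ g).2 rfl)).symm)
    (fun {a b c d} f g h => LinCat.hom₂_ext fun A => by
      have h₁ := assoc f.2 g.2 h.2 (f ≫ g).2 (g ≫ h).2 ((f ≫ g) ≫ h).2 rfl rfl rfl
        (congrArg Subtype.val (Category.assoc f g h)).symm A
      -- The two bracketings of a triple composite are equal but not by definition. Replacing one by
      -- the other costs exactly the `eqToHom` that the associator of the source is mapped to.
      have h₂ : ∀ {e e' : a ⟶ d} (hm : h.1 * g.1 * f.1 = e.1) (he : e = e'),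
          (mul f.2 (g ≫ h).2 e'.2 (by subst he; exact hm)).hom.app A =
          (mul f.2 (g ≫ h).2 e.2 hm).hom.app A ≫ eqToHom (by rw [he]) := by
        intro e e' hm he
        subst he
        exact (Category.comp_id _).symm
      have h₃ := h₂ (e := (f ≫ g) ≫ h) (e' := f ≫ g ≫ h)
        (congrArg Subtype.val (Category.assoc f g h)).symm (Category.assoc f g h)
      refine Eq.trans ?_ (LinCat.eqToHom_app _ A).symm
      refine (comp_id_interleaved' _ _ _ _).trans ?_
      have h₄ : (mul f.2 (g ≫ h).2 (f ≫ g ≫ h).2 rfl).hom.app A =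
        (mul g.2 h.2 (g ≫ h).2 rfl).inv.app ((act f.1 f.2).obj A) ≫
        (act h.1 h.2).map ((mul f.2 g.2 (f ≫ g).2 rfl).hom.app A) ≫
          (mul (f ≫ g).2 h.2 ((f ≫ g) ≫ h).2 rfl).hom.app A ≫
            eqToHom (by rw [Category.assoc f g h]) := by
        rw [reassoc_of% h₁.symm, Iso.inv_hom_id_app_assoc]
        exact h₃
      have h₅ : (mul (f ≫ g).2 h.2 ((f ≫ g) ≫ h).2 rfl).inv.app A ≫
          (act h.1 h.2).map ((mul f.2 g.2 (f ≫ g).2 rfl).inv.app A) ≫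
            (mul g.2 h.2 (g ≫ h).2 rfl).hom.app ((act f.1 f.2).obj A) ≫
              (mul f.2 (g ≫ h).2 (f ≫ g ≫ h).2 rfl).hom.app A =
          eqToHom (by rw [Category.assoc f g h]) := by
        rw [h₄, Iso.hom_inv_id_app_assoc, ← Functor.map_comp_assoc, Iso.inv_hom_id_app,
          CategoryTheory.Functor.map_id]
        erw [Category.id_comp]
        rw [Iso.inv_hom_id_app_assoc]
      exact h₅)
    (fun {a b} f => LinCat.hom₂_ext fun A => by
      -- The composite `𝟙 a ≫ f` is generalised to any `e` equal to `f`, so that it can be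
      -- substituted and `one_right` applies.
      have h₁ : ∀ {e : a ⟶ b} (hm : f.1 * 1 = e.1) (he : e = f),
          (mul (𝟙 a : a ⟶ a).2 f.2 e.2 hm).inv.app A ≫
            (act f.1 f.2).map ((one (by simp)).hom.app A) ≫ 𝟙 _ = eqToHom (by rw [he]; rfl) := by
        intro e hm he
        subst he
        erw [← one_right _ e.2 hm A, Category.comp_id, Iso.inv_hom_id_app]
        rfl
      refine Eq.trans ?_ (LinCat.eqToHom_app _ A).symm
      exact h₁ (e := 𝟙 a ≫ f) rfl (Category.id_comp f))
    (fun {a b} f => LinCat.hom₂_ext fun A => by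
      have h₁ : ∀ {e : a ⟶ b} (hm : 1 * f.1 = e.1) (he : e = f),
          (mul f.2 (𝟙 b : b ⟶ b).2 e.2 hm).inv.app A ≫
            (one (by simp)).hom.app ((act f.1 f.2).obj A) ≫ 𝟙 _ = eqToHom (by rw [he]; rfl) := by
        intro e hm he
        subst he
        erw [← one_left _ e.2 hm A, Category.comp_id, Iso.inv_hom_id_app]
        rfl
      refine Eq.trans ?_ (LinCat.eqToHom_app _ A).symm
      exact h₁ (e := f ≫ 𝟙 b) rfl (Category.comp_id f))

section

variable (N : G → LinCat.{w, v, u} k)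
  (act : ∀ {a b : G} (g : G) (_ : g * a = b * g), N a ⥤ N b)
  [∀ {a b : G} (g : G) (h : g * a = b * g), (act g h).Additive]
  [∀ {a b : G} (g : G) (h : g * a = b * g), (act g h).Linear k]
  (one : ∀ {a : G} (h : (1 : G) * a = a * 1), act 1 h ≅ 𝟭 (N a))
  (mul : ∀ {a b c f g e : G} (hf : f * a = b * f) (hg : g * b = c * g) (he : e * a = c * e)
    (_ : g * f = e), act f hf ⋙ act g hg ≅ act e he)
  (assoc) (one_left) (one_right)

theorem actOne_mkPs {a : G} (h : (1 : G) * a = a * 1) (A : N a) :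
    actOne (mkPs N act one mul assoc one_left one_right) h A = (one h).app A :=
  Iso.ext (actOne_hom_eq _ _ _)

theorem actMul_mkPs {a b c f g e : G} (hf : f * a = b * f) (hg : g * b = c * g)
    (he : e * a = c * e) (hm : g * f = e) (A : N a) :
    actMul (mkPs N act one mul assoc one_left one_right) hf hg he hm A =
      (mul hf hg he hm).app A := by
  subst hm
  exact Iso.ext_inv (actMul_inv_eq _ _ _ _ _)

end

end PsGAut

section

open MonoidalCategory
open Functor.LaxMonoidal (μ)

/-! ### Calculus of the crossing isomorphisms -/

namespace GCrossedCat

variable {k : Type w} [CommRing k] {G : Type u} [Group G] (C : GCrossedCat.{w, v, u} k G)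

/-- The isomorphism `φ a (φ b X) ≅ φ c X` for `c = b * a`. -/
def compIso {a b c : G} (h : b * a = c) (X : C.carrier) :
    (C.φ a).obj ((C.φ b).obj X) ≅ (C.φ c).obj X :=
  (C.φComp h).app X

/-- The isomorphism `X ≅ φ 1 X`. -/
def unitIso (X : C.carrier) : X ≅ (C.φ 1).obj X :=
  C.φUnit.app X

/-- The isomorphism `φ e X ≅ X` for `e = 1`. -/
def oneIso {e : G} (h : e = 1) (X : C.carrier) : (C.φ e).obj X ≅ X :=
  eqToIso (by rw [h]) ≪≫ (C.unitIso X).symm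

/-- The isomorphism `φ a (φ g X) ≅ X` for `g` inverse to `a`. -/
def cancelIso {a g : G} (h : g * a = 1) (X : C.carrier) : (C.φ a).obj ((C.φ g).obj X) ≅ X :=
  C.compIso h X ≪≫ (C.unitIso X).symm

/-- The index `e` in `oneIso` is needed because the identity acts by `φ 1⁻¹`, which is `φ 1` only
through `inv_one`. After substituting `e` this equation reduces statements on `oneIso` to `unitIso`.
-/
theorem oneIso_one (X : C.carrier) : C.oneIso rfl X = (C.unitIso X).symm := by
  ext; simp [oneIso]

theorem compIso_naturality {a b c : G} (h : b * a = c) {X Y : C.carrier} (f : X ⟶ Y) :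
    (C.φ a).map ((C.φ b).map f) ≫ (C.compIso h Y).hom = (C.compIso h X).hom ≫ (C.φ c).map f :=
  (C.φComp h).hom.naturality f

theorem unitIso_naturality {X Y : C.carrier} (f : X ⟶ Y) :
    f ≫ (C.unitIso Y).hom = (C.unitIso X).hom ≫ (C.φ 1).map f :=
  C.φUnit.hom.naturality f

theorem oneIso_naturality {e : G} (h : e = 1) {X Y : C.carrier} (f : X ⟶ Y) :
    (C.φ e).map f ≫ (C.oneIso h Y).hom = (C.oneIso h X).hom ≫ f := by
  subst h
  rw [oneIso_one, oneIso_one]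
  exact C.φUnit.inv.naturality f

theorem cancelIso_naturality {a g : G} (h : g * a = 1) {X Y : C.carrier} (f : X ⟶ Y) :
    (C.φ a).map ((C.φ g).map f) ≫ (C.cancelIso h Y).hom = (C.cancelIso h X).hom ≫ f := by
  rw [← cancel_mono (C.unitIso Y).hom]
  simp [cancelIso, compIso_naturality, unitIso_naturality]

theorem compIso_assoc {a b c p q s : G} (hp : b * a = p) (hs : c * p = s) (hq : c * b = q)
    (hs' : q * a = s) (X : C.carrier) :
    (C.compIso hp ((C.φ c).obj X)).hom ≫ (C.compIso hs X).hom =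
      (C.φ a).map (C.compIso hq X).hom ≫ (C.compIso hs' X).hom :=
  C.φ_assoc hp hs hq hs' X

theorem unitIso_compIso {a : G} (h : a * 1 = a) (X : C.carrier) :
    (C.unitIso ((C.φ a).obj X)).hom ≫ (C.compIso h X).hom = 𝟙 _ :=
  C.φ_unit_left h X

theorem map_unitIso_compIso {a : G} (h : 1 * a = a) (X : C.carrier) :
    (C.φ a).map (C.unitIso X).hom ≫ (C.compIso h X).hom = 𝟙 _ :=
  C.φ_unit_right h X

theorem compIso_tensor {a b c : G} (h : b * a = c) (X Y : C.carrier) :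
    μ (C.φ a) _ _ ≫ (C.φ a).map (μ (C.φ b) X Y) ≫ (C.compIso h (X ⊗ Y)).hom =
      ((C.compIso h X).hom ⊗ₘ (C.compIso h Y).hom) ≫ μ (C.φ c) X Y := by
  have := NatTrans.IsMonoidal.tensor (τ := (C.φComp h).hom) X Y
  rw [Functor.LaxMonoidal.comp_μ, Category.assoc] at this
  exact this

theorem compIso_unit {a b c : G} (h : b * a = c) :
    Functor.LaxMonoidal.ε (C.φ a) ≫ (C.φ a).map (Functor.LaxMonoidal.ε (C.φ b)) ≫
      (C.compIso h (𝟙_ _)).hom = Functor.LaxMonoidal.ε (C.φ c) := by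
  have := NatTrans.IsMonoidal.unit (τ := (C.φComp h).hom)
  rw [Functor.LaxMonoidal.comp_ε, Category.assoc] at this
  exact this

theorem unitIso_tensor (X Y : C.carrier) :
    (C.unitIso (X ⊗ Y)).hom = ((C.unitIso X).hom ⊗ₘ (C.unitIso Y).hom) ≫ μ (C.φ 1) X Y := by
  have := NatTrans.IsMonoidal.tensor (τ := C.φUnit.hom) X Y
  simp only [Functor.LaxMonoidal.id_μ, Category.id_comp] at this
  exact this

theorem unitIso_unit : (C.unitIso (𝟙_ _)).hom = Functor.LaxMonoidal.ε (C.φ 1) := by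
  have := NatTrans.IsMonoidal.unit (τ := C.φUnit.hom)
  simp only [Functor.LaxMonoidal.id_ε, Category.id_comp] at this
  exact this

theorem oneIso_tensor {e : G} (h : e = 1) (X Y : C.carrier) :
    μ (C.φ e) X Y ≫ (C.oneIso h (X ⊗ Y)).hom =
      (C.oneIso h X).hom ⊗ₘ (C.oneIso h Y).hom := by
  subst h
  rw [oneIso_one, Iso.symm_hom, ← cancel_mono (C.unitIso (X ⊗ Y)).hom, Category.assoc,
    Iso.inv_hom_id, unitIso_tensor, tensorHom_comp_tensorHom_assoc, oneIso_one, oneIso_one,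
    Iso.symm_hom, Iso.symm_hom, Iso.inv_hom_id,
    Iso.inv_hom_id, id_tensorHom_id, Category.id_comp, Category.comp_id]

theorem oneIso_unit {e : G} (h : e = 1) :
    Functor.LaxMonoidal.ε (C.φ e) ≫ (C.oneIso h (𝟙_ _)).hom = 𝟙 _ := by
  subst h
  rw [oneIso_one, ← unitIso_unit, Iso.symm_hom, Iso.hom_inv_id]

/-- Both sides become the identity after precomposition with the invertible `unitIso`, by the unit
axiom of the crossing. -/
theorem compIso_one_left {a e : G} (he : e = 1) (h : a * e = a) (X : C.carrier) :
    (C.compIso h X).hom = (C.oneIso he ((C.φ a).obj X)).hom := by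
  subst he
  rw [oneIso_one, ← cancel_epi (C.unitIso ((C.φ a).obj X)).hom, unitIso_compIso, Iso.symm_hom,
    Iso.hom_inv_id]

theorem compIso_one_right {a e : G} (he : e = 1) (h : e * a = a) (X : C.carrier) :
    (C.compIso h X).hom = (C.φ a).map (C.oneIso he X).hom := by
  subst he
  rw [oneIso_one, ← cancel_epi ((C.φ a).map (C.unitIso X).hom), map_unitIso_compIso,
    Iso.symm_hom, ← Functor.map_comp, Iso.hom_inv_id, CategoryTheory.Functor.map_id]

/-- Since `unitIso` is invertible, an identity between cancellations can be checked after composing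
with it, where only `compIso` and its associativity remain. -/
theorem cancelIso_unitIso {a g : G} (h : g * a = 1) (X : C.carrier) :
    (C.cancelIso h X).hom ≫ (C.unitIso X).hom = (C.compIso h X).hom := by
  simp [cancelIso]

theorem cancelIso_tensor {a g : G} (h : g * a = 1) (X Y : C.carrier) :
    μ (C.φ a) _ _ ≫ (C.φ a).map (μ (C.φ g) X Y) ≫ (C.cancelIso h (X ⊗ Y)).hom =
      ((C.cancelIso h X).hom ⊗ₘ (C.cancelIso h Y).hom) := by
  rw [← cancel_mono (C.unitIso (X ⊗ Y)).hom, Category.assoc, Category.assoc,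
    cancelIso_unitIso, unitIso_tensor, compIso_tensor, tensorHom_comp_tensorHom_assoc,
    cancelIso_unitIso, cancelIso_unitIso]

theorem map_cancelIso {a b g : G} (h : g * a = 1) (X : C.carrier) :
    (C.φ b).map (C.cancelIso h X).hom =
      (C.φ b).map (C.compIso h X).hom ≫ (C.compIso (one_mul b) X).hom := by
  rw [← cancelIso_unitIso, Functor.map_comp, Category.assoc, map_unitIso_compIso,
    Category.comp_id]

/-- Two ways of collapsing $\phi_b\phi_a\phi_x\phi_yX$ to $X$: pair the outer two and the inner two,
or cancel from the inside out. They agree by two uses of associativity. The tensor axiom of the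
braiding in its homogeneous variable needs this. -/
theorem cancelIso_comp {a b p x y z : G} (hp : a * b = p) (hz : y * x = z) (ha : x * a = 1)
    (hb : y * b = 1) (hzp : z * p = 1) (X : C.carrier) :
    (C.compIso hp ((C.φ x).obj ((C.φ y).obj X))).hom ≫
        (C.φ p).map (C.compIso hz X).hom ≫ (C.cancelIso hzp X).hom =
      (C.φ b).map (C.cancelIso ha ((C.φ y).obj X)).hom ≫ (C.cancelIso hb X).hom := by
  have hxp : x * p = b := by rw [← hp, ← mul_assoc, ha, one_mul]
  rw [← cancel_mono (C.unitIso X).hom]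
  simp only [Category.assoc]
  rw [cancelIso_unitIso, cancelIso_unitIso, map_cancelIso, ← C.compIso_assoc hxp hb hz hzp,
    ← Category.assoc]
  congr 1
  exact C.compIso_assoc hp hxp ha (one_mul b) _

/-- Cancelling $\phi_{a'}\phi_{x'}$ on $\phi_hX$ is the same as moving $\phi_h$ outward past both
and cancelling $\phi_a\phi_x$ beneath it; here `m` and `y` are the common values of the two
products. It converts between the compatibility of crossings with a braiding and with its inverse
form. -/
theorem cancelIso_conj {a a' h x x' m y : G} (hm : a * h = m) (hm' : h * a' = m)
    (hy : x * h = y) (hy' : h * x' = y) (ha : x * a = 1) (ha' : x' * a' = 1) (X : C.carrier) :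
    (C.φ a').map ((C.compIso hy' X).hom ≫ (C.compIso hy X).inv) ≫
      (C.compIso hm' ((C.φ x).obj X)).hom ≫ (C.compIso hm ((C.φ x).obj X)).inv ≫
        (C.φ h).map (C.cancelIso ha X).hom =
      (C.cancelIso ha' ((C.φ h).obj X)).hom := by
  have e₁ : y * a' = h := by rw [← hy', mul_assoc, ha', mul_one]
  have e₂ : x * m = h := by rw [← hm, ← mul_assoc, ha, one_mul]
  have k₁ := C.compIso_assoc hm e₂ ha (one_mul h) X
  have k₂ := C.compIso_assoc hm' e₂ hy e₁ X
  have k₃ := C.compIso_assoc ha' (mul_one h) hy' e₁ X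
  have k₄ : (C.φ h).map (C.cancelIso ha X).hom =
      (C.compIso hm ((C.φ x).obj X)).hom ≫ (C.compIso e₂ X).hom := by
    rw [map_cancelIso, k₁]
  have k₅ : (C.cancelIso ha' ((C.φ h).obj X)).hom =
      (C.φ a').map (C.compIso hy' X).hom ≫ (C.compIso e₁ X).hom := by
    rw [← k₃, ← cancelIso_unitIso, Category.assoc, unitIso_compIso, Category.comp_id]
  rw [k₄, k₅, Iso.inv_hom_id_assoc, k₂, ← Functor.map_comp_assoc,
    Category.assoc, Iso.inv_hom_id, Category.comp_id]

end GCrossedCat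

/-! ### The inverse form of a $G$-braiding -/

namespace GBraidedCat

variable {k : Type w} [CommRing k] {G : Type u} [Group G] (C : GBraidedCat.{w, v, u} k G)

/-- The braiding `φ g Y ⊗ X ≅ X ⊗ Y` for `X` homogeneous over `a` and `g` inverse to `a`. -/
def invBraid {a g : G} (hg : g * a = 1) (X Y : C.carrier) (hX : C.deg a X) :
    (C.φ g).obj Y ⊗ X ≅ X ⊗ Y :=
  C.braid ((C.φ g).obj Y) X hX ≪≫ MonoidalCategory.whiskerLeftIso X (C.cancelIso hg Y)

theorem braid_tensor_right_compIso {b c d : G} (h : b * c = d) (X : C.carrier) {Y Z : C.carrier}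
    (hY : C.deg b Y) (hZ : C.deg c Z) (hYZ : C.deg d (Y ⊗ Z)) :
    (C.braid X (Y ⊗ Z) hYZ).hom =
      (α_ X Y Z).inv ≫ (C.braid X Y hY).hom ▷ Z ≫ (α_ Y ((C.φ b).obj X) Z).hom ≫
        Y ◁ (C.braid ((C.φ b).obj X) Z hZ).hom ≫ (α_ Y Z ((C.φ c).obj ((C.φ b).obj X))).inv ≫
          (Y ⊗ Z) ◁ (C.compIso h X).hom :=
  C.braid_tensor_right h X hY hZ

theorem invBraid_naturality {a g : G} (hg : g * a = 1) {X X' Y Y' : C.carrier} (hX : C.deg a X)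
    (hX' : C.deg a X') (x : X ⟶ X') (y : Y ⟶ Y') :
    ((C.φ g).map y ⊗ₘ x) ≫ (C.invBraid hg X' Y' hX').hom =
      (C.invBraid hg X Y hX).hom ≫ (x ⊗ₘ y) := by
  have h := C.braid_naturality hX hX' ((C.φ g).map y) x
  simp only [invBraid, Iso.trans_hom, MonoidalCategory.whiskerLeftIso_hom, reassoc_of% h, Category.assoc]
  rw [← id_tensorHom, ← id_tensorHom, tensorHom_comp_tensorHom, tensorHom_comp_tensorHom,
    C.cancelIso_naturality, Category.comp_id, Category.id_comp]

/-- Axiom (iii) for $\phi_xB$ and $A$, after which `cancelIso_conj` identifies the two cancellations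
of crossings that occur. -/
theorem invBraid_φ {a a' h x x' y : G} (hc : h * a' = a * h)
    (hy : x * h = y) (hy' : h * x' = y) (ha : x * a = 1) (ha' : x' * a' = 1) {A : C.carrier}
    (B : C.carrier) (hA : C.deg a A) (hA' : C.deg a' ((C.φ h).obj A)) :
    ((C.compIso hy' B).hom ≫ (C.compIso hy B).inv) ▷ (C.φ h).obj A ≫
        μ (C.φ h) ((C.φ x).obj B) A ≫ (C.φ h).map (C.invBraid ha A B hA).hom =
      (C.invBraid ha' ((C.φ h).obj A) ((C.φ h).obj B) hA').hom ≫ μ (C.φ h) A B := by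
  have h₁ := C.braid_φ hc rfl ((C.φ x).obj B) hA
  have h₂ := C.cancelIso_conj (rfl : a * h = a * h) hc hy hy' ha ha' B
  have h₃ := C.braid_naturality hA' hA' ((C.compIso hy' B).hom ≫ (C.compIso hy B).inv)
    (𝟙 ((C.φ h).obj A))
  simp only [invBraid, Iso.trans_hom, MonoidalCategory.whiskerLeftIso_hom, Category.assoc, Functor.map_comp]
  rw [reassoc_of% h₁, ← Functor.LaxMonoidal.μ_natural_right, ← tensorHom_id,
    ← MonoidalCategory.whiskerLeft_comp_assoc, reassoc_of% h₃, id_tensorHom,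
    ← MonoidalCategory.whiskerLeft_comp_assoc]
  congr 3
  rw [← h₂, Category.assoc]
  rfl

/-- Axiom (ii) for the product of $\phi_xB$ and $\phi_xD$. The monoidality of the cancellation
splits the cancellation of the product into those of its factors, and the rest is interchange. -/
theorem hexagon_right_aux {a x : G} (hx : x * a = 1) (A B D : C.carrier) (hA : C.deg a A) :
    (α_ ((C.φ x).obj B) ((C.φ x).obj D) A).inv ≫ μ (C.φ x) B D ▷ A ≫ (C.invBraid hx A (B ⊗ D) hA).hom ≫ (α_ A B D).inv =
      (C.φ x).obj B ◁ (C.invBraid hx A D hA).hom ≫ (α_ ((C.φ x).obj B) A D).inv ≫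
        (C.invBraid hx A B hA).hom ▷ D := by
  have h₁ := C.braid_tensor_left ((C.φ x).obj B) ((C.φ x).obj D) hA
  have h₂ := C.braid_naturality hA hA (μ (C.φ x) B D) (𝟙 A)
  have h₃ := C.cancelIso_tensor hx B D
  simp only [invBraid, Iso.trans_hom, MonoidalCategory.whiskerLeftIso_hom, Category.assoc]
  rw [← tensorHom_id, reassoc_of% h₂, reassoc_of% h₁, id_tensorHom, Iso.inv_hom_id_assoc,
    ← MonoidalCategory.whiskerLeft_comp_assoc, ← MonoidalCategory.whiskerLeft_comp_assoc,
    Category.assoc, h₃]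
  simp only [MonoidalCategory.whiskerLeft_comp, MonoidalCategory.comp_whiskerRight, Category.assoc,
    MonoidalCategory.tensorHom_def, MonoidalCategory.whisker_assoc]
  rw [MonoidalCategory.associator_inv_naturality_right_assoc, MonoidalCategory.whisker_exchange_assoc,
    MonoidalCategory.associator_naturality_right_assoc, ← MonoidalCategory.whiskerLeft_comp_assoc A (_ ◁ _),
    MonoidalCategory.whisker_exchange, MonoidalCategory.whiskerLeft_comp_assoc]

/-- Axiom (i) for $\phi_x\phi_yD$. By `cancelIso_comp` the cancellation of the product becomes two
successive cancellations, and naturality of the braiding moves the first one before the braiding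
with $B$. -/
theorem hexagon_left_aux {a b p x y z : G} (hp : a * b = p) (hz : y * x = z) (ha : x * a = 1)
    (hb : y * b = 1) (hzp : z * p = 1) (A B D : C.carrier) (hA : C.deg a A) (hB : C.deg b B)
    (hAB : C.deg p (A ⊗ B)) :
    (α_ ((C.φ x).obj ((C.φ y).obj D)) A B).hom ≫ (C.compIso hz D).hom ▷ (A ⊗ B) ≫
        (C.invBraid hzp (A ⊗ B) D hAB).hom ≫ (α_ A B D).hom =
      (C.invBraid ha A ((C.φ y).obj D) hA).hom ▷ B ≫ (α_ A ((C.φ y).obj D) B).hom ≫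
        A ◁ (C.invBraid hb B D hB).hom := by
  have h₁ := C.braid_tensor_right_compIso hp ((C.φ x).obj ((C.φ y).obj D)) hA hB hAB
  have h₂ := C.braid_naturality hAB hAB (C.compIso hz D).hom (𝟙 (A ⊗ B))
  have h₃ := C.cancelIso_comp hp hz ha hb hzp D
  have h₄ := C.braid_naturality hB hB (C.cancelIso ha ((C.φ y).obj D)).hom (𝟙 B)
  simp only [invBraid, Iso.trans_hom, MonoidalCategory.whiskerLeftIso_hom, Category.assoc]
  rw [← tensorHom_id, reassoc_of% h₂, reassoc_of% h₁, id_tensorHom, Iso.hom_inv_id_assoc,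
    ← MonoidalCategory.whiskerLeft_comp_assoc, ← MonoidalCategory.whiskerLeft_comp_assoc]
  rw [Category.assoc, h₃]
  rw [tensorHom_id, id_tensorHom] at h₄
  simp only [MonoidalCategory.whiskerLeft_comp, MonoidalCategory.comp_whiskerRight, Category.assoc,
    MonoidalCategory.whisker_assoc, Iso.inv_hom_id_assoc]
  rw [← MonoidalCategory.whiskerLeft_comp_assoc A (_ ▷ B), h₄]
  simp

end GBraidedCat

/-! ### The braided monoidale of a $G$-braided category -/

namespace GBraidedCat

variable {k : Type w} [CommRing k] {G : Type u} [Group G] (C : GBraidedCat.{w, v, u} k G)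

/-- The action of `g : a ⟶ b` on homogeneous objects: the restriction of `φ g⁻¹`. -/
def actFunctor {a b : G} (g : G) (h : g * a = b * g) :
    (C.deg a).FullSubcategory ⥤ (C.deg b).FullSubcategory :=
  (C.deg b).lift ((C.deg a).ι ⋙ C.φ g⁻¹) fun X => C.deg_φ
    (show g⁻¹ * b = a * g⁻¹ by rw [inv_mul_eq_iff_eq_mul, ← mul_assoc, h, mul_inv_cancel_right]) X.2

instance {a b : G} (g : G) (h : g * a = b * g) : (C.actFunctor g h).Additive where
  map_add {_ _ f f'} := ObjectProperty.hom_ext _ ((C.φ g⁻¹).map_add (f := f.hom) (g := f'.hom))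

instance {a b : G} (g : G) (h : g * a = b * g) : (C.actFunctor g h).Linear k where
  map_smul f r := ObjectProperty.hom_ext _ ((C.φ g⁻¹).map_smul r f.hom)

/-- The pseudofunctor underlying the braided monoidale of a `G`-braided category. -/
def toPs : PsGAut.{w, v, u} k G :=
  PsGAut.mkPs (fun a => LinCat.of k (C.deg a).FullSubcategory)
    (fun g h => C.actFunctor g h)
    (fun {a} h => NatIso.ofComponents
      (fun X => (C.deg a).isoMk (X := (C.actFunctor 1 h).obj X) (Y := X) (C.oneIso inv_one X.1))
      fun f => ObjectProperty.hom_ext _ (C.oneIso_naturality inv_one f.hom))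
    (fun {a b c f g e} hf hg he hm => NatIso.ofComponents
      (fun X => (C.deg c).isoMk (X := (C.actFunctor g hg).obj ((C.actFunctor f hf).obj X))
        (Y := (C.actFunctor e he).obj X)
        (C.compIso (show f⁻¹ * g⁻¹ = e⁻¹ by rw [← hm, mul_inv_rev]) X.1))
      fun x => ObjectProperty.hom_ext _ (C.compIso_naturality _ x.hom))
    (fun _ _ _ _ _ _ _ _ _ _ _ => ObjectProperty.hom_ext _ (C.compIso_assoc _ _ _ _ _))
    (fun _ _ _ A => ObjectProperty.hom_ext _ (C.compIso_one_left inv_one _ _))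
    (fun _ _ _ A => ObjectProperty.hom_ext _ (C.compIso_one_right inv_one _ _))

theorem toPs_actOne {a : G} (h : (1 : G) * a = a * 1) (A : C.toPs.fib a) :
    C.toPs.actOne h A = (C.deg a).isoMk (C.oneIso inv_one A.1) := by
  exact PsGAut.actOne_mkPs (fun a => LinCat.of k (C.deg a).FullSubcategory)
    (fun g h => C.actFunctor g h) _ _ _ _ _ h A

theorem toPs_actMul {a b c f g e : G} (hf : f * a = b * f) (hg : g * b = c * g)
    (he : e * a = c * e) (hm : g * f = e) (A : C.toPs.fib a) :
    C.toPs.actMul hf hg he hm A = (C.deg c).isoMk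
      (C.compIso (show f⁻¹ * g⁻¹ = e⁻¹ by rw [← hm, mul_inv_rev]) A.1) := by
  exact PsGAut.actMul_mkPs (fun a => LinCat.of k (C.deg a).FullSubcategory)
    (fun g h => C.actFunctor g h) _ _ _ _ _ hf hg he hm A

/-- The tensor product of homogeneous objects. -/
@[simps]
def tensorFib {a b c : G} (h : a * b = c) :
    LinCat.BilinFunctor (C.toPs.fib a) (C.toPs.fib b) (C.toPs.fib c) where
  obj X Y := ⟨X.1 ⊗ Y.1, C.deg_tensor h X.2 Y.2⟩
  map f g := (C.deg c).homMk (f.hom ⊗ₘ g.hom)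
  map_id _ _ := ObjectProperty.hom_ext _ (id_tensorHom_id _ _)
  map_comp _ _ _ _ := ObjectProperty.hom_ext _ (tensorHom_comp_tensorHom _ _ _ _).symm
  map_add_left _ _ _ := ObjectProperty.hom_ext _ (MonoidalPreadditive.add_tensor _ _ _)
  map_add_right _ _ _ := ObjectProperty.hom_ext _ (MonoidalPreadditive.tensor_add _ _ _)
  map_smul_left r f g := ObjectProperty.hom_ext _ (by
    change (r • f.hom) ⊗ₘ g.hom = r • (f.hom ⊗ₘ g.hom)
    simp [MonoidalCategory.tensorHom_def])
  map_smul_right r f g := ObjectProperty.hom_ext _ (by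
    change f.hom ⊗ₘ (r • g.hom) = r • (f.hom ⊗ₘ g.hom)
    simp [MonoidalCategory.tensorHom_def])

/-- The unit object, as a homogeneous object. -/
def unitFib : C.toPs.fib 1 := ⟨𝟙_ C.carrier, C.deg_unit⟩

/-- The monoidale of a `G`-braided category. -/
def toMonoidale : Monoidale.{w, v, u} k G where
  ps := C.toPs
  tensor h := C.tensorFib h
  unit := C.unitFib
  tensorAct {a b c a' b' c' g} h h' ha hb hc A B :=
    (C.deg c').isoMk (Functor.Monoidal.μIso (C.φ g⁻¹) A.1 B.1)
  tensorAct_naturality _ _ _ _ _ _ _ _ _ x y :=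
    ObjectProperty.hom_ext _ (Functor.LaxMonoidal.μ_natural _ x.hom y.hom)
  tensorAct_one {a b c} h ha hb hc A B := by
    rw [toPs_actOne, toPs_actOne, toPs_actOne]
    exact ObjectProperty.hom_ext _ (C.oneIso_tensor inv_one A.1 B.1)
  tensorAct_mul {a b c a' b' c' a'' b'' c'' f g e} h h' h'' fa fb fc ga gb gc ea eb ec hm A B := by
    rw [toPs_actMul, toPs_actMul, toPs_actMul]
    exact ObjectProperty.hom_ext _ (C.compIso_tensor _ A.1 B.1)
  unitAct {g} h := (C.deg 1).isoMk (Functor.Monoidal.εIso (C.φ g⁻¹))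
  unitAct_one h := by
    rw [toPs_actOne]
    exact ObjectProperty.hom_ext _ (C.oneIso_unit inv_one)
  unitAct_mul {f g e} hf hg he hm := by
    rw [toPs_actMul]
    exact ObjectProperty.hom_ext _ (C.compIso_unit _)
  assoc {a b c p q s} hp hpc hq haq A B D := (C.deg s).isoMk (α_ A.1 B.1 D.1)
  assoc_naturality _ _ _ _ _ _ _ _ _ _ x y z :=
    ObjectProperty.hom_ext _ (associator_naturality x.hom y.hom z.hom)
  assoc_act {a b c p q s a' b' c' p' q' s' g} hp hpc hq haq hp' hpc' hq' haq' ga gb gc gp gq gs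
      A B D := ObjectProperty.hom_ext _ (by
    change (μ (C.φ g⁻¹) A.1 B.1 ⊗ₘ 𝟙 _) ≫ μ (C.φ g⁻¹) (A.1 ⊗ B.1) D.1 ≫
        (C.φ g⁻¹).map (α_ A.1 B.1 D.1).hom =
      (MonoidalCategoryStruct.associator _ _ _).hom ≫ (𝟙 _ ⊗ₘ μ (C.φ g⁻¹) B.1 D.1) ≫ μ (C.φ g⁻¹) A.1 (B.1 ⊗ D.1)
    rw [tensorHom_id, id_tensorHom]
    exact Functor.LaxMonoidal.associativity _ _ _ _)
  leftUnit {a} h A := (C.deg a).isoMk (λ_ A.1)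
  leftUnit_naturality h _ _ x := ObjectProperty.hom_ext _ (by
    change (𝟙 _ ⊗ₘ x.hom) ≫ (MonoidalCategoryStruct.leftUnitor _).hom = (MonoidalCategoryStruct.leftUnitor _).hom ≫ x.hom
    rw [id_tensorHom]
    exact leftUnitor_naturality _)
  leftUnit_act {a a' g} h h' g1 ga A := ObjectProperty.hom_ext _ (by
    change (Functor.LaxMonoidal.ε (C.φ g⁻¹) ⊗ₘ 𝟙 _) ≫ μ (C.φ g⁻¹) (𝟙_ _) A.1 ≫
      (C.φ g⁻¹).map (λ_ A.1).hom = (MonoidalCategoryStruct.leftUnitor _).hom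
    rw [tensorHom_id]
    exact (Functor.LaxMonoidal.left_unitality _ _).symm)
  rightUnit {a} h A := (C.deg a).isoMk (ρ_ A.1)
  rightUnit_naturality h _ _ x := ObjectProperty.hom_ext _ (by
    change (x.hom ⊗ₘ 𝟙 _) ≫ (MonoidalCategoryStruct.rightUnitor _).hom = (MonoidalCategoryStruct.rightUnitor _).hom ≫ x.hom
    rw [tensorHom_id]
    exact rightUnitor_naturality _)
  rightUnit_act {a a' g} h h' g1 ga A := ObjectProperty.hom_ext _ (by
    change (𝟙 _ ⊗ₘ Functor.LaxMonoidal.ε (C.φ g⁻¹)) ≫ μ (C.φ g⁻¹) A.1 (𝟙_ _) ≫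
      (C.φ g⁻¹).map (ρ_ A.1).hom = (MonoidalCategoryStruct.rightUnitor _).hom
    rw [id_tensorHom]
    exact (Functor.LaxMonoidal.right_unitality _ _).symm)
  pentagon {a b c d p q r s t z} hp hq hr hpc haq hqd hbr hsd hpr hat A B D E :=
      ObjectProperty.hom_ext _ (by
    change ((α_ A.1 B.1 D.1).hom ⊗ₘ 𝟙 E.1) ≫ (α_ A.1 (B.1 ⊗ D.1) E.1).hom ≫
      (𝟙 A.1 ⊗ₘ (α_ B.1 D.1 E.1).hom) =
        (α_ (A.1 ⊗ B.1) D.1 E.1).hom ≫ (α_ A.1 B.1 (D.1 ⊗ E.1)).hom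
    rw [tensorHom_id, id_tensorHom]
    exact MonoidalCategory.pentagon _ _ _ _)
  triangle {a b c} ha hb h A B := ObjectProperty.hom_ext _ (by
    change (α_ A.1 (𝟙_ _) B.1).hom ≫ (𝟙 A.1 ⊗ₘ (λ_ B.1).hom) = (ρ_ A.1).hom ⊗ₘ 𝟙 B.1
    rw [tensorHom_id, id_tensorHom]
    exact MonoidalCategory.triangle _ _)

theorem toMonoidale_actMul {a b c f g e : G} (hf : f * a = b * f) (hg : g * b = c * g)
    (he : e * a = c * e) (hm : g * f = e) (A : C.toMonoidale.ps.fib a) :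
    C.toMonoidale.ps.actMul hf hg he hm A = (C.deg c).isoMk
      (C.compIso (show f⁻¹ * g⁻¹ = e⁻¹ by rw [← hm, mul_inv_rev]) A.1) :=
  C.toPs_actMul hf hg he hm A

/-- The braiding of the monoidale is the inverse of `invBraid`, and this passes naturality across
the inversion. -/
theorem cancel_iso_eq {X : Type*} [Category* X] {A B A' B' : X} (i : A ≅ B) (j : A' ≅ B')
    {f : A ⟶ A'} {g : B ⟶ B'} (h : i.inv ≫ f = g ≫ j.inv) : f ≫ j.hom = i.hom ≫ g := by
  rw [← Iso.eq_comp_inv, Category.assoc, ← h, Iso.hom_inv_id_assoc]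

/-- The braided monoidale of a `G`-braided category. -/
def toBraidedMonoidale : BraidedMonoidale.{w, v, u} k G where
  __ := C.toMonoidale
  -- Here $aB$ is $\phi_{a^{-1}}B$, so $A\,\square\,B\cong aB\,\square\,A$ runs against `invBraid`.
  braid {a b b' c} h hb h' A B := (C.deg c).isoMk (C.invBraid (inv_mul_cancel a) A.1 B.1 A.2).symm
  braid_naturality {a b b' c} h hb h' {A A' B B'} x y := ObjectProperty.hom_ext _ (by
    have := C.invBraid_naturality (inv_mul_cancel a) A.2 A'.2 x.hom y.hom
    exact cancel_iso_eq (C.invBraid (inv_mul_cancel a) A.1 B.1 A.2).symm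
      (C.invBraid (inv_mul_cancel a) A'.1 B'.1 A'.2).symm this.symm)
  braid_act {a b b' c a₁ b₁ b₁' c₁ g m} h hb h' h₁ hb₁ h₁' ga gb gb' gc m₁ m₂ mb A B := by
    rw [toMonoidale_actMul, toMonoidale_actMul]
    refine ObjectProperty.hom_ext _ ?_
    have hg : g⁻¹ * a₁ = a * g⁻¹ := by
      rw [inv_mul_eq_iff_eq_mul, ← mul_assoc, ga, mul_inv_cancel_right]
    have key := C.invBraid_φ hg (show a⁻¹ * g⁻¹ = m⁻¹ by rw [← m₁, mul_inv_rev])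
      (show g⁻¹ * a₁⁻¹ = m⁻¹ by rw [← m₂, mul_inv_rev]) (inv_mul_cancel a) (inv_mul_cancel a₁)
      B.1 A.2 (C.deg_φ hg A.2)
    -- The equation `key` solved for the inverses; its factor at `m` is the change between the
    -- factorisations `g * a` and `a₁ * g` of `m`.
    have key₂ : μ (C.φ g⁻¹) A.1 B.1 ≫ (C.φ g⁻¹).map (C.invBraid (inv_mul_cancel a) A.1 B.1 A.2).inv =
        (C.invBraid (inv_mul_cancel a₁) ((C.φ g⁻¹).obj A.1) ((C.φ g⁻¹).obj B.1)
          (C.deg_φ hg A.2)).inv ≫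
        (((C.compIso (show g⁻¹ * a₁⁻¹ = m⁻¹ by rw [← m₂, mul_inv_rev]) B.1).hom ≫
          (C.compIso (show a⁻¹ * g⁻¹ = m⁻¹ by rw [← m₁, mul_inv_rev]) B.1).inv) ⊗ₘ
            𝟙 ((C.φ g⁻¹).obj A.1)) ≫ μ (C.φ g⁻¹) ((C.φ a⁻¹).obj B.1) A.1 := by
      rw [Iso.eq_inv_comp, tensorHom_id, ← cancel_mono ((C.φ g⁻¹).map
        (C.invBraid (inv_mul_cancel a) A.1 B.1 A.2).hom)]
      simp only [Category.assoc, key, ← Functor.map_comp, Iso.inv_hom_id,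
        CategoryTheory.Functor.map_id, Category.comp_id]
    exact key₂
  hexagon_right {a b c b' c' p q q' r s} hp hpc hq haq hb hc hq' haq' hqa hba hr hca hbr A B D :=
      ObjectProperty.hom_ext _ (by
    have key := C.hexagon_right_aux (inv_mul_cancel a) A.1 B.1 D.1 A.2
    change (α_ A.1 B.1 D.1).hom ≫ (C.invBraid (inv_mul_cancel a) A.1 (B.1 ⊗ D.1) A.2).inv ≫
      ((Functor.Monoidal.μIso (C.φ a⁻¹) B.1 D.1).inv ⊗ₘ 𝟙 A.1) ≫
        (MonoidalCategoryStruct.associator _ _ _).hom =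
      ((C.invBraid (inv_mul_cancel a) A.1 B.1 A.2).inv ⊗ₘ 𝟙 D.1) ≫
        (MonoidalCategoryStruct.associator _ _ _).hom ≫
          (𝟙 _ ⊗ₘ (C.invBraid (inv_mul_cancel a) A.1 D.1 A.2).inv)
    -- Both sides of `key` are composites of isomorphisms. Reading the equation backwards, as one of
    -- inverses, gives the hexagon.
    have e := congrArg Iso.inv (show (MonoidalCategoryStruct.associator _ _ _).symm ≪≫
        MonoidalCategory.whiskerRightIso (Functor.Monoidal.μIso (C.φ a⁻¹) B.1 D.1) A.1 ≪≫
          C.invBraid (inv_mul_cancel a) A.1 (B.1 ⊗ D.1) A.2 ≪≫ (α_ A.1 B.1 D.1).symm =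
        MonoidalCategory.whiskerLeftIso _ (C.invBraid (inv_mul_cancel a) A.1 D.1 A.2) ≪≫
          (MonoidalCategoryStruct.associator _ _ _).symm ≪≫
            MonoidalCategory.whiskerRightIso (C.invBraid (inv_mul_cancel a) A.1 B.1 A.2) D.1 from
      Iso.ext key)
    simp only [Iso.trans_inv, Iso.symm_inv, MonoidalCategory.whiskerRightIso_inv,
      MonoidalCategory.whiskerLeftIso_inv, Category.assoc] at e
    rw [tensorHom_id, tensorHom_id, id_tensorHom]
    exact e)
  hexagon_left {a b c c' c'' p q r s} hp hpc hq haq hc hc' hpc' hcp hcb hr hca hrb A B D := by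
    rw [toMonoidale_actMul]
    refine ObjectProperty.hom_ext _ ?_
    have key := C.hexagon_left_aux hp (show b⁻¹ * a⁻¹ = p⁻¹ by rw [← hp, mul_inv_rev])
      (inv_mul_cancel a) (inv_mul_cancel b) (inv_mul_cancel p) A.1 B.1 D.1 A.2 B.2
      (C.deg_tensor hp A.2 B.2)
    have e := congrArg Iso.inv (show MonoidalCategoryStruct.associator _ _ _ ≪≫
        MonoidalCategory.whiskerRightIso
          (C.compIso (show b⁻¹ * a⁻¹ = p⁻¹ by rw [← hp, mul_inv_rev]) D.1) (A.1 ⊗ B.1) ≪≫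
          C.invBraid (inv_mul_cancel p) (A.1 ⊗ B.1) D.1 (C.deg_tensor hp A.2 B.2) ≪≫
            α_ A.1 B.1 D.1 =
        MonoidalCategory.whiskerRightIso
            (C.invBraid (inv_mul_cancel a) A.1 ((C.φ b⁻¹).obj D.1) A.2) B.1 ≪≫
          MonoidalCategoryStruct.associator _ _ _ ≪≫
            MonoidalCategory.whiskerLeftIso A.1 (C.invBraid (inv_mul_cancel b) B.1 D.1 B.2) from
      Iso.ext key)
    simp only [Iso.trans_inv, MonoidalCategory.whiskerRightIso_inv,
      MonoidalCategory.whiskerLeftIso_inv, Category.assoc] at e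
    rw [← tensorHom_id, ← tensorHom_id, ← id_tensorHom] at e
    exact e

end GBraidedCat

/-! ### The pseudofunctor on 1-cells and 2-cells -/

namespace GBraidedCat

variable {k : Type w} [CommRing k] {G : Type u} [Group G] {C D E : GBraidedCat.{w, v, u} k G}

namespace Hom

theorem crossIso_oneIso (S : Hom C D) {e : G} (h : e = 1) (X : C.carrier) :
    (S.crossIso e X).hom ≫ (D.oneIso h (S.functor.obj X)).hom =
      S.functor.map (C.oneIso h X).hom := by
  subst h
  have h₁ : S.functor.map (C.unitIso X).hom ≫ (S.crossIso 1 X).hom =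
    (D.unitIso (S.functor.obj X)).hom := S.crossIso_one X
  rw [GCrossedCat.oneIso_one, GCrossedCat.oneIso_one, Iso.symm_hom, Iso.symm_hom, Iso.comp_inv_eq,
    ← h₁, ← Functor.map_comp_assoc, Iso.inv_hom_id, CategoryTheory.Functor.map_id,
    Category.id_comp]

theorem crossIso_compIso (S : Hom C D) {a b c : G} (h : b * a = c) (X : C.carrier) :
    (S.crossIso a ((C.φ b).obj X)).hom ≫ (D.φ a).map (S.crossIso b X).hom ≫
        (D.compIso h (S.functor.obj X)).hom =
      S.functor.map (C.compIso h X).hom ≫ (S.crossIso c X).hom :=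
  (S.crossIso_comp h X).symm

/-- The cancellation is built from `compIso` and `unitIso`, and a 1-cell respects both; the
statement is checked after `unitIso`. -/
theorem crossIso_cancelIso (S : Hom C D) {a x : G} (h : x * a = 1) (X : C.carrier) :
    (S.crossIso a ((C.φ x).obj X)).hom ≫ (D.φ a).map (S.crossIso x X).hom ≫
        (D.cancelIso h (S.functor.obj X)).hom = S.functor.map (C.cancelIso h X).hom := by
  have h₁ : S.functor.map (C.unitIso X).hom ≫ (S.crossIso 1 X).hom =
    (D.unitIso (S.functor.obj X)).hom := S.crossIso_one X
  rw [← cancel_mono (D.unitIso (S.functor.obj X)).hom]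
  simp only [Category.assoc]
  rw [GCrossedCat.cancelIso_unitIso, crossIso_compIso, ← h₁, ← Functor.map_comp_assoc,
    GCrossedCat.cancelIso_unitIso]

/-- The compatibility of a 1-cell with the $G$-braiding, taken at $\phi_xB$. Naturality of the
braiding in the target and `crossIso_cancelIso` then put it in terms of the inverse form. -/
theorem μ_invBraid (S : Hom C D) {a x : G} (h : x * a = 1) (A B : C.carrier) (hA : C.deg a A) :
    (S.crossIso x B).hom ▷ S.functor.obj A ≫
        (D.invBraid h (S.functor.obj A) (S.functor.obj B) (S.deg_obj hA)).hom ≫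
          μ S.functor A B =
      μ S.functor ((C.φ x).obj B) A ≫ S.functor.map (C.invBraid h A B hA).hom := by
  have h₁ := S.braid ((C.φ x).obj B) hA
  have h₂ := D.braid_naturality (S.deg_obj hA) (S.deg_obj hA) (S.crossIso x B).hom
    (𝟙 (S.functor.obj A))
  have h₃ : (S.crossIso a ((C.φ x).obj B)).inv ≫ S.functor.map (C.cancelIso h B).hom =
      (D.φ a).map (S.crossIso x B).hom ≫ (D.cancelIso h (S.functor.obj B)).hom := by
    rw [← S.crossIso_cancelIso, Iso.inv_hom_id_assoc]
  rw [tensorHom_id, id_tensorHom] at h₂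
  simp only [invBraid, Iso.trans_hom, MonoidalCategory.whiskerLeftIso_hom, Category.assoc,
    Functor.map_comp]
  rw [reassoc_of% h₁, reassoc_of% h₂, ← Functor.LaxMonoidal.μ_natural_right,
    ← MonoidalCategory.whiskerLeft_comp_assoc, ← MonoidalCategory.whiskerLeft_comp_assoc, h₃]

/-- The restriction of a functor to homogeneous objects. -/
def fibFunctor (S : Hom C D) (a : G) :
    C.toPs.fib a ⥤ D.toPs.fib a :=
  (D.deg a).lift ((C.deg a).ι ⋙ S.functor) fun X => S.deg_obj X.2

instance (S : Hom C D) (a : G) : (S.fibFunctor a).Additive where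
  map_add {_ _ f f'} := ObjectProperty.hom_ext _ (S.functor.map_add (f := f.hom) (g := f'.hom))

instance (S : Hom C D) (a : G) : (S.fibFunctor a).Linear k where
  map_smul f r := ObjectProperty.hom_ext _ (S.functor.map_smul r f.hom)

/-- The pseudonatural transformation underlying a 1-cell. -/
def toTrans (S : Hom C D) : C.toBraidedMonoidale.ps ⟶ D.toBraidedMonoidale.ps :=
  PsGAut.mkTrans (F := C.toPs) (F' := D.toPs) (fun a => S.fibFunctor a)
    (fun {a b} g h => NatIso.ofComponents
      (fun X => (D.deg b).isoMk (X := (S.fibFunctor b).obj ((C.actFunctor g h).obj X))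
        (Y := (D.actFunctor g h).obj ((S.fibFunctor a).obj X)) (S.crossIso g⁻¹ X.1))
      fun f => ObjectProperty.hom_ext _ (S.crossIso_naturality g⁻¹ f.hom))
    (fun h A => by
      rw [toPs_actOne, toPs_actOne]
      exact ObjectProperty.hom_ext _ (S.crossIso_oneIso inv_one A.1))
    (fun hf hg he hm A => by
      rw [toPs_actMul, toPs_actMul]
      exact ObjectProperty.hom_ext _ (S.crossIso_compIso _ A.1))

/-- The morphism of braided monoidales of a 1-cell of `G`-braided categories. -/
def toBraidedMonoidale (S : Hom C D) :
    BraidedMonoidale.Hom C.toBraidedMonoidale D.toBraidedMonoidale where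
  trans := S.toTrans
  tensorIso {a b c} h A B := (D.deg c).isoMk (Functor.Monoidal.μIso S.functor A.1 B.1)
  tensorIso_naturality _ _ _ _ _ x y :=
    ObjectProperty.hom_ext _ (Functor.LaxMonoidal.μ_natural S.functor x.hom y.hom)
  unitIso := (D.deg 1).isoMk (Functor.Monoidal.εIso S.functor)
  tensorIso_act {a b c a' b' c' g} h h' ha hb hc A B :=
    ObjectProperty.hom_ext _ (S.crossIso_tensor g⁻¹ A.1 B.1).symm
  unitIso_act {g} h := ObjectProperty.hom_ext _ (S.crossIso_unit g⁻¹).symm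
  assoc {a b c p q s} hp hpc hq haq A B E := ObjectProperty.hom_ext _ (by
    change (μ S.functor A.1 B.1 ⊗ₘ 𝟙 _) ≫ μ S.functor (A.1 ⊗ B.1) E.1 ≫
        S.functor.map (α_ A.1 B.1 E.1).hom =
      (MonoidalCategoryStruct.associator _ _ _).hom ≫ (𝟙 _ ⊗ₘ μ S.functor B.1 E.1) ≫
        μ S.functor A.1 (B.1 ⊗ E.1)
    rw [tensorHom_id, id_tensorHom]
    exact Functor.LaxMonoidal.associativity _ _ _ _)
  leftUnit {a} h A := ObjectProperty.hom_ext _ (by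
    change (Functor.LaxMonoidal.ε S.functor ⊗ₘ 𝟙 _) ≫ μ S.functor (𝟙_ _) A.1 ≫
      S.functor.map (λ_ A.1).hom = (MonoidalCategoryStruct.leftUnitor _).hom
    rw [tensorHom_id]
    exact (Functor.LaxMonoidal.left_unitality _ _).symm)
  rightUnit {a} h A := ObjectProperty.hom_ext _ (by
    change (𝟙 _ ⊗ₘ Functor.LaxMonoidal.ε S.functor) ≫ μ S.functor A.1 (𝟙_ _) ≫
      S.functor.map (ρ_ A.1).hom = (MonoidalCategoryStruct.rightUnitor _).hom
    rw [id_tensorHom]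
    exact (Functor.LaxMonoidal.right_unitality _ _).symm)
  braid {a b b' c} h hb h' A B := ObjectProperty.hom_ext _ (by
    have key := S.μ_invBraid (inv_mul_cancel a) A.1 B.1 A.2
    have e : μ S.functor A.1 B.1 ≫ S.functor.map (C.invBraid (inv_mul_cancel a) A.1 B.1 A.2).inv =
        (D.invBraid (inv_mul_cancel a) (S.functor.obj A.1) (S.functor.obj B.1)
          (S.deg_obj A.2)).inv ≫ ((S.crossIso a⁻¹ B.1).inv ⊗ₘ 𝟙 _) ≫
            μ S.functor ((C.φ a⁻¹).obj B.1) A.1 := by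
      rw [Iso.eq_inv_comp, tensorHom_id, ← cancel_mono (S.functor.map
          (C.invBraid (inv_mul_cancel a) A.1 B.1 A.2).hom),
        ← cancel_epi ((S.crossIso a⁻¹ B.1).hom ▷ S.functor.obj A.1)]
      simp only [Category.assoc, ← Functor.map_comp, Iso.inv_hom_id,
        CategoryTheory.Functor.map_id, Category.comp_id, key,
        MonoidalCategory.hom_inv_whiskerRight_assoc]
    exact e)

end Hom

/-- The 2-cell of braided monoidales of a 2-cell of `G`-braided categories. -/
def Hom₂.toBraidedMonoidale {S T : Hom C D} (η : Hom₂ S T) :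
    BraidedMonoidale.Hom₂ S.toBraidedMonoidale T.toBraidedMonoidale where
  mod := PsGAut.mkMod
    (fun a => { app X := (D.deg a).homMk (X := (S.fibFunctor a).obj X)
                  (Y := (T.fibFunctor a).obj X) (η.nat.app X.1)
                naturality _ _ f := ObjectProperty.hom_ext _ (η.nat.naturality f.hom) })
    (fun {a b} g h A => ObjectProperty.hom_ext _ (η.cross g⁻¹ A.1))
  tensor {a b c} h A B := ObjectProperty.hom_ext _ (NatTrans.IsMonoidal.tensor A.1 B.1)
  unit := ObjectProperty.hom_ext _ NatTrans.IsMonoidal.unit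

/-- The constraint of the pseudofunctor for identities. -/
def mapIdIso (C : GBraidedCat.{w, v, u} k G) :
    (show C.toBraidedMonoidale ⟶ C.toBraidedMonoidale from (Hom.id C).toBraidedMonoidale) ≅
      𝟙 C.toBraidedMonoidale :=
  BraidedMonoidale.isoMk
    -- The restricted functors agree by definition, so the components are identities and only the
    -- constraints are left to compare.
    (PsGAut.mkModIso (fun a => Iso.refl (𝟭 (C.toPs.fib a))) (fun g h A => by
      refine (Category.id_comp _).trans ((PsGAut.compAct_id g h A).trans ?_)
      exact ((congrArg (_ ≫ ·) (CategoryTheory.Functor.map_id _ _)).trans (Category.comp_id _)).symm))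
    (fun {a b c} h A B => ObjectProperty.hom_ext _ (by
      change μ (𝟭 C.carrier) A.1 B.1 ≫ 𝟙 _ = (𝟙 A.1 ⊗ₘ 𝟙 B.1) ≫ 𝟙 _
      simp))
    (Category.comp_id _)

/-- The constraint of the pseudofunctor for composites. -/
def mapCompIso (S : Hom C D) (T : Hom D E) :
    (show C.toBraidedMonoidale ⟶ E.toBraidedMonoidale from (S.comp T).toBraidedMonoidale) ≅
      (show C.toBraidedMonoidale ⟶ D.toBraidedMonoidale from S.toBraidedMonoidale) ≫
        (show D.toBraidedMonoidale ⟶ E.toBraidedMonoidale from T.toBraidedMonoidale) :=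
  BraidedMonoidale.isoMk
    (PsGAut.mkModIso (fun a => Iso.refl (S.fibFunctor a ⋙ T.fibFunctor a)) (fun g h A => by
      refine (Category.id_comp _).trans ((PsGAut.compAct_comp S.toTrans T.toTrans g h A).trans ?_)
      exact ((congrArg (_ ≫ ·) (CategoryTheory.Functor.map_id _ _)).trans (Category.comp_id _)).symm))
    (fun {a b c} h A B => ObjectProperty.hom_ext _ (by
      change μ (S.functor ⋙ T.functor) A.1 B.1 ≫ 𝟙 _ = (𝟙 _ ⊗ₘ 𝟙 _) ≫ μ T.functor _ _ ≫ T.functor.map (μ S.functor _ _)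
      simp))
    (ObjectProperty.hom_ext _ (by
      change Functor.LaxMonoidal.ε (S.functor ⋙ T.functor) ≫ 𝟙 _ = Functor.LaxMonoidal.ε T.functor ≫ T.functor.map (Functor.LaxMonoidal.ε S.functor)
      simp))

/-- A 2-cell is determined by morphisms in the ambient category `D`. This makes the pseudofunctor
laws equations between composites that differ by identities. -/
theorem hom_ext_braidedMonoidale {M : BraidedMonoidale.{w, v, u} k G}
    {S T : M ⟶ D.toBraidedMonoidale} {θ θ' : S ⟶ T}
    (h : ∀ {a : G} (A : M.ps.fib a),
      (PsGAut.modApp (BraidedMonoidale.Hom₂.mod θ) A).hom =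
        (PsGAut.modApp (BraidedMonoidale.Hom₂.mod θ') A).hom) : θ = θ' :=
  BraidedMonoidale.hom₂_ext (PsGAut.mod_ext fun A => ObjectProperty.hom_ext _ (h A))

variable (k G) in
/-- The pseudofunctor from `G`-braided categories to braided monoidales. -/
def toBraidedMonoidaleFunctor :
    Pseudofunctor (GBraidedCat.{w, v, u} k G) (BraidedMonoidale.{w, v, u} k G) where
  obj C := C.toBraidedMonoidale
  map S := Hom.toBraidedMonoidale S
  map₂ η := Hom₂.toBraidedMonoidale η
  map₂_id S := hom_ext_braidedMonoidale fun A => rfl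
  map₂_comp η θ := hom_ext_braidedMonoidale fun A => rfl
  mapId C := mapIdIso C
  mapComp S T := mapCompIso S T
  map₂_whisker_left S _ _ η := hom_ext_braidedMonoidale fun A =>
    ((Category.id_comp _).trans (Category.comp_id _)).symm
  map₂_whisker_right η S := hom_ext_braidedMonoidale fun A =>
    ((Category.id_comp _).trans (Category.comp_id _)).symm
  map₂_associator {_ _ _ B} S T R := hom_ext_braidedMonoidale fun A => by
    change 𝟙 ((Hom.functor R).obj ((Hom.functor T).obj ((Hom.functor S).obj A.1))) =
      𝟙 _ ≫ (Hom.functor R).map (𝟙 ((Hom.functor T).obj ((Hom.functor S).obj A.1))) ≫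
        𝟙 _ ≫ 𝟙 _ ≫ 𝟙 _
    simp
  map₂_left_unitor S := hom_ext_braidedMonoidale fun A => by
    change 𝟙 ((Hom.functor S).obj A.1) = 𝟙 _ ≫ (Hom.functor S).map (𝟙 A.1) ≫ 𝟙 _
    simp
  map₂_right_unitor S := hom_ext_braidedMonoidale fun A => by
    change 𝟙 ((Hom.functor S).obj A.1) = 𝟙 _ ≫ 𝟙 ((Hom.functor S).obj A.1) ≫ 𝟙 _
    simp

end GBraidedCat

/-! ### The coproduct of a family of linear categories -/

namespace LinCat

variable {k : Type w} [CommRing k] {G : Type u}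

/-- The coproduct of a family of `k`-linear categories: all morphisms between objects of different
members of the family are zero. -/
structure Total (N : G → LinCat.{w, v, u} k) where
  deg : G
  obj : N deg

namespace Total

variable {N : G → LinCat.{w, v, u} k}

/-- Transport of an object along an equality of indices. -/
def transport {a b : G} (h : a = b) (A : N a) : N b := h ▸ A

/-- Transport of a morphism along an equality of indices. -/
def transportMap {a b : G} (h : a = b) {A B : N a} (f : A ⟶ B) :
    transport h A ⟶ transport h B := by
  subst h
  exact f

/-- A morphism is a function of a proof that the degrees agree. For different degrees there is
exactly one, so the zero hom-modules need no case distinction and the module structure is pointwise.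
Composites through an object of another degree are zero. -/
noncomputable instance : CategoryStruct (Total N) where
  Hom x y := (h : PLift (x.deg = y.deg)) → (transport h.down x.obj ⟶ y.obj)
  id x := fun _ => 𝟙 x.obj
  comp {x y z} f g := fun h => open Classical in
    if e : x.deg = y.deg then
      eqToHom (by obtain ⟨a, A⟩ := x; obtain ⟨b, B⟩ := y; obtain ⟨c, C⟩ := z; cases e; rfl) ≫
        transportMap (e.symm.trans h.down) (f ⟨e⟩) ≫ g ⟨e.symm.trans h.down⟩
    else 0

instance (x y : Total N) : AddCommGroup (x ⟶ y) := Pi.addCommGroup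

instance (x y : Total N) : Module k (x ⟶ y) := Pi.module _ _ _

/-- A morphism of a member of the family, as a morphism of the coproduct. -/
def inclMap {a : G} {A B : N a} (f : A ⟶ B) : (⟨a, A⟩ : Total N) ⟶ ⟨a, B⟩ := fun _ => f

theorem exists_inclMap {a : G} {A B : N a} (f : (⟨a, A⟩ : Total N) ⟶ ⟨a, B⟩) :
    ∃ f' : A ⟶ B, f = inclMap f' := ⟨f ⟨rfl⟩, rfl⟩

theorem eq_zero {x y : Total N} (h : x.deg ≠ y.deg) (f : x ⟶ y) : f = 0 :=
  funext fun e => (h e.down).elim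

theorem inclMap_injective {a : G} {A B : N a} :
    Function.Injective (inclMap : (A ⟶ B) → ((⟨a, A⟩ : Total N) ⟶ ⟨a, B⟩)) :=
  fun _ _ h => congrFun h ⟨rfl⟩

theorem inclMap_id {a : G} (A : N a) : inclMap (𝟙 A) = 𝟙 (⟨a, A⟩ : Total N) := rfl

theorem inclMap_comp {a : G} {A B C : N a} (f : A ⟶ B) (g : B ⟶ C) :
    inclMap (f ≫ g) = inclMap f ≫ inclMap g := by
  funext h
  exact ((dif_pos rfl).trans (Category.id_comp _)).symm

theorem inclMap_add {a : G} {A B : N a} (f g : A ⟶ B) :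
    inclMap (f + g) = inclMap f + inclMap g := rfl

theorem inclMap_smul {a : G} {A B : N a} (r : k) (f : A ⟶ B) :
    inclMap (r • f) = r • inclMap f := rfl

theorem inclMap_zero {a : G} (A B : N a) : inclMap (0 : A ⟶ B) = 0 := rfl

/-- Case distinction on the indices of the source and of the target of a morphism. -/
theorem hom_cases {motive : ∀ {x y : Total N}, (x ⟶ y) → Prop}
    (incl : ∀ {a : G} {A B : N a} (f : A ⟶ B), motive (inclMap f))
    (zero : ∀ {x y : Total N}, motive (0 : x ⟶ y)) {x y : Total N} (f : x ⟶ y) : motive f := by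
  by_cases h : x.deg = y.deg
  · obtain ⟨a, A⟩ := x
    obtain ⟨b, B⟩ := y
    cases h
    exact incl (f ⟨rfl⟩)
  · rw [eq_zero h f]
    exact zero

/-- Used to establish the category and preadditive axioms, so it is proved directly from the
definition of composition. If the middle object has another degree, composition is zero by
definition; if the outer degrees differ, every morphism is zero. -/
theorem zero_comp' {x y z : Total N} (g : y ⟶ z) : (0 : x ⟶ y) ≫ g = 0 := by
  obtain ⟨a, A⟩ := x
  obtain ⟨b, B⟩ := y
  obtain ⟨c, C⟩ := z
  by_cases h : a = b
  · subst h
    by_cases h' : a = c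
    · subst h'
      obtain ⟨g, rfl⟩ := exists_inclMap g
      rw [← inclMap_zero, ← inclMap_comp, Limits.zero_comp, inclMap_zero]
    · exact (eq_zero (by exact h') _).trans (eq_zero (by exact h') _).symm
  · exact funext fun _ => dif_neg h

theorem comp_zero' {x y z : Total N} (f : x ⟶ y) : f ≫ (0 : y ⟶ z) = 0 := by
  obtain ⟨a, A⟩ := x
  obtain ⟨b, B⟩ := y
  obtain ⟨c, C⟩ := z
  by_cases h : a = b
  · subst h
    by_cases h' : a = c
    · subst h'
      obtain ⟨f, rfl⟩ := exists_inclMap f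
      rw [← inclMap_zero, ← inclMap_comp, Limits.comp_zero, inclMap_zero]
    · exact (eq_zero (by exact h') _).trans (eq_zero (by exact h') _).symm
  · exact funext fun _ => dif_neg h

/-- Case distinction on the index of the target of a morphism out of a fixed object. -/
theorem hom_cases_left {a : G} {A : N a} {motive : ∀ {y : Total N}, ((⟨a, A⟩ : Total N) ⟶ y) → Prop}
    (incl : ∀ {B : N a} (f : A ⟶ B), motive (inclMap f))
    (zero : ∀ {y : Total N}, motive (0 : ⟨a, A⟩ ⟶ y)) {y : Total N} (f : ⟨a, A⟩ ⟶ y) :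
    motive f := by
  by_cases h : a = y.deg
  · obtain ⟨b, B⟩ := y
    cases h
    exact incl (f ⟨rfl⟩)
  · rw [eq_zero (by exact h) f]
    exact zero

noncomputable instance : Category (Total N) where
  id_comp {x y} f := by
    induction f using hom_cases with
    | incl f => rw [← inclMap_id, ← inclMap_comp, Category.id_comp]
    | zero => exact comp_zero' _
  comp_id {x y} f := by
    induction f using hom_cases with
    | incl f => rw [← inclMap_id, ← inclMap_comp, Category.comp_id]
    | zero => exact zero_comp' _
  assoc {x y z t} f g h := by
    induction f using hom_cases with
    | zero => simp only [zero_comp']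
    | incl f =>
      induction g using hom_cases_left with
      | zero => simp only [zero_comp', comp_zero']
      | incl g =>
        induction h using hom_cases_left with
        | zero => simp only [comp_zero']
        | incl h => simp only [← inclMap_comp, Category.assoc]

noncomputable instance : Preadditive (Total N) where
  add_comp x y z f f' g := by
    obtain ⟨a, A⟩ := x
    obtain ⟨b, B⟩ := y
    by_cases e : a = b
    · subst e
      induction g using hom_cases_left with
      | zero => simp only [comp_zero', add_zero]
      | incl g =>
        obtain ⟨f, rfl⟩ := exists_inclMap f
        obtain ⟨f', rfl⟩ := exists_inclMap f'
        simp only [← inclMap_comp, ← inclMap_add, Preadditive.add_comp]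
    · rw [eq_zero (by exact e) f, eq_zero (by exact e) f', zero_comp', add_zero, zero_comp', add_zero]
  comp_add x y z f g g' := by
    induction f using hom_cases with
    | zero => simp only [zero_comp', add_zero]
    | @incl a A B f =>
      obtain ⟨c, C⟩ := z
      by_cases e : a = c
      · subst e
        obtain ⟨g, rfl⟩ := exists_inclMap g
        obtain ⟨g', rfl⟩ := exists_inclMap g'
        simp only [← inclMap_comp, ← inclMap_add, Preadditive.comp_add]
      · rw [eq_zero (by exact e) g, eq_zero (by exact e) g', comp_zero', add_zero, comp_zero', add_zero]

noncomputable instance : Linear k (Total N) where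
  smul_comp x y z r f g := by
    induction f using hom_cases with
    | zero => simp only [smul_zero, zero_comp']
    | incl f =>
      induction g using hom_cases_left with
      | zero => simp only [smul_zero, comp_zero']
      | incl g => simp only [← inclMap_comp, ← inclMap_smul, Linear.smul_comp]
  comp_smul x y z f r g := by
    induction f using hom_cases with
    | zero => simp only [smul_zero, zero_comp']
    | incl f =>
      induction g using hom_cases_left with
      | zero => simp only [smul_zero, comp_zero']
      | incl g => simp only [← inclMap_comp, ← inclMap_smul, Linear.comp_smul]

/-- The inclusion of a member of the family. -/
@[simps]
noncomputable def incl (N : G → LinCat.{w, v, u} k) (a : G) : N a ⥤ Total N where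
  obj A := ⟨a, A⟩
  map f := inclMap f
  map_id A := inclMap_id A
  map_comp f g := inclMap_comp f g

instance (a : G) : (incl N a).Additive where
instance (a : G) : (incl N a).Linear k where
instance (a : G) : (incl N a).Full where
  map_surjective f := ⟨f ⟨rfl⟩, rfl⟩
instance (a : G) : (incl N a).Faithful where
  map_injective h := inclMap_injective h

section desc

variable {D : Type*} [Category* D] [Preadditive D]

/-- The action on morphisms of the functor given by functors out of the members of a family. -/
noncomputable def descMap (P : ∀ a, N a ⥤ D) {x y : Total N} (f : x ⟶ y) :
    (P x.deg).obj x.obj ⟶ (P y.deg).obj y.obj := open Classical in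
  if e : x.deg = y.deg then
    eqToHom (by obtain ⟨a, A⟩ := x; obtain ⟨b, B⟩ := y; cases e; rfl) ≫ (P y.deg).map (f ⟨e⟩)
  else 0

theorem descMap_inclMap (P : ∀ a, N a ⥤ D) {a : G} {A B : N a} (f : A ⟶ B) :
    descMap P (inclMap f) = (P a).map f :=
  (dif_pos rfl).trans (Category.id_comp _)

theorem descMap_zero (P : ∀ a, N a ⥤ D) [∀ a, (P a).Additive] (x y : Total N) :
    descMap P (0 : x ⟶ y) = 0 := by
  obtain ⟨a, A⟩ := x
  obtain ⟨b, B⟩ := y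
  by_cases e : a = b
  · subst e
    rw [← inclMap_zero, descMap_inclMap, Functor.map_zero]
  · exact dif_neg e

/-- The functor given by functors out of the members of a family. -/
@[simps]
noncomputable def desc (P : ∀ a, N a ⥤ D) [∀ a, (P a).Additive] : Total N ⥤ D where
  obj x := (P x.deg).obj x.obj
  map f := descMap P f
  map_id x := (descMap_inclMap P (𝟙 x.obj)).trans ((P x.deg).map_id _)
  map_comp f g := by
    induction f using hom_cases with
    | zero => simp only [descMap_zero, Limits.zero_comp]
    | incl f =>
      induction g using hom_cases_left with
      | zero => simp only [descMap_zero, Limits.comp_zero]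
      | incl g => simp only [← inclMap_comp, descMap_inclMap, Functor.map_comp]

instance (P : ∀ a, N a ⥤ D) [∀ a, (P a).Additive] : (desc P).Additive where
  map_add {x y f g} := by
    change descMap P (f + g) = descMap P f + descMap P g
    obtain ⟨a, A⟩ := x
    obtain ⟨b, B⟩ := y
    by_cases e : a = b
    · subst e
      obtain ⟨f, rfl⟩ := exists_inclMap f
      obtain ⟨g, rfl⟩ := exists_inclMap g
      simp only [← inclMap_add, descMap_inclMap, Functor.map_add]
    · rw [eq_zero (by exact e) f, eq_zero (by exact e) g]
      simp only [descMap_zero, add_zero]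

instance [Linear k D] (P : ∀ a, N a ⥤ D) [∀ a, (P a).Additive] [∀ a, (P a).Linear k] :
    (desc P).Linear k where
  map_smul f r := by
    change descMap P (r • f) = r • descMap P f
    induction f using hom_cases with
    | zero => simp only [smul_zero, descMap_zero]
    | incl f => simp only [← inclMap_smul, descMap_inclMap, Functor.map_smul]

end desc

end Total
end LinCat

namespace LinCat.BilinFunctor

variable {k : Type w} [CommRing k] {A B C : LinCat.{w, v, u} k} (T : BilinFunctor A B C)

theorem map_zero_left {X X' : A} {Y Y' : B} (g : Y ⟶ Y') : T.map (0 : X ⟶ X') g = 0 := by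
  have := T.map_smul_left (0 : k) (0 : X ⟶ X') g
  rwa [zero_smul, zero_smul] at this

theorem map_zero_right {X X' : A} {Y Y' : B} (f : X ⟶ X') : T.map f (0 : Y ⟶ Y') = 0 := by
  have := T.map_smul_right (0 : k) f (0 : Y ⟶ Y')
  rwa [zero_smul, zero_smul] at this

/-- The action on isomorphisms. -/
@[simps]
def mapIso {X X' : A} {Y Y' : B} (f : X ≅ X') (g : Y ≅ Y') : T.obj X Y ≅ T.obj X' Y' where
  hom := T.map f.hom g.hom
  inv := T.map f.inv g.inv
  hom_inv_id := by rw [← T.map_comp, f.hom_inv_id, g.hom_inv_id, T.map_id]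
  inv_hom_id := by rw [← T.map_comp, f.inv_hom_id, g.inv_hom_id, T.map_id]

end LinCat.BilinFunctor

namespace LinCat.Total

variable {k : Type w} [CommRing k] {G : Type u} {N : G → LinCat.{w, v, u} k}

/-- An isomorphism of a member of the family, as an isomorphism of the coproduct. -/
@[simps]
noncomputable def inclIso {a : G} {A B : N a} (f : A ≅ B) : (⟨a, A⟩ : Total N) ≅ ⟨a, B⟩ where
  hom := inclMap f.hom
  inv := inclMap f.inv
  hom_inv_id := by rw [← inclMap_comp, f.hom_inv_id, inclMap_id]
  inv_hom_id := by rw [← inclMap_comp, f.inv_hom_id, inclMap_id]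

end LinCat.Total

/-! ### The monoidal structure on the coproduct of the values of a monoidale -/

namespace Monoidale

open LinCat.Total

variable {k : Type w} [CommRing k] {G : Type u} [Group G] (M : Monoidale.{w, v, u} k G)

/-- The `k`-linear category of all objects of all degrees. -/
abbrev Tot := LinCat.Total (fun a => M.ps.fib a)

variable {M}

/-- The tensor product of morphisms of any degree. -/
noncomputable def totTensorHom {x x' y y' : M.Tot} (f : x ⟶ x') (g : y ⟶ y') :
    (⟨x.deg * y.deg, (M.tensor rfl).obj x.obj y.obj⟩ : M.Tot) ⟶
      ⟨x'.deg * y'.deg, (M.tensor rfl).obj x'.obj y'.obj⟩ := open Classical in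
  if e : x.deg = x'.deg then
    if e' : y.deg = y'.deg then
      eqToHom (by
        obtain ⟨a, A⟩ := x; obtain ⟨b, B⟩ := y; obtain ⟨a', A'⟩ := x'; obtain ⟨b', B'⟩ := y'
        cases e; cases e'; rfl) ≫ inclMap ((M.tensor rfl).map (f ⟨e⟩) (g ⟨e'⟩))
    else 0
  else 0

/-- Change of the degree of a tensor product along an equation. -/
noncomputable def tensorDeg {a b c : G} (h : a * b = c) (A : M.ps.fib a) (B : M.ps.fib b) :
    (⟨a * b, (M.tensor rfl).obj A B⟩ : M.Tot) ≅ ⟨c, (M.tensor h).obj A B⟩ :=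
  eqToIso (by subst h; rfl)

theorem tensorDeg_rfl {a b : G} (A : M.ps.fib a) (B : M.ps.fib b) :
    tensorDeg rfl A B = Iso.refl (⟨a * b, (M.tensor rfl).obj A B⟩ : M.Tot) := rfl

theorem totTensorHom_inclMap {a b : G} {A A' : M.ps.fib a} {B B' : M.ps.fib b} (f : A ⟶ A')
    (g : B ⟶ B') : totTensorHom (M := M) (inclMap f) (inclMap g) =
      inclMap ((M.tensor rfl).map f g) :=
  (dif_pos rfl).trans ((dif_pos rfl).trans (Category.id_comp _))

theorem totTensorHom_zero_left {x x' y y' : M.Tot} (g : y ⟶ y') :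
    totTensorHom (0 : x ⟶ x') g = 0 := by
  obtain ⟨a, A⟩ := x
  obtain ⟨a', A'⟩ := x'
  by_cases e : a = a'
  · subst e
    induction g using hom_cases with
    | incl g =>
      rw [← inclMap_zero, totTensorHom_inclMap, LinCat.BilinFunctor.map_zero_left, inclMap_zero]
    | @zero y y' =>
      obtain ⟨b, B⟩ := y
      obtain ⟨b', B'⟩ := y'
      by_cases e : b = b'
      · subst e
        rw [← inclMap_zero, ← inclMap_zero, totTensorHom_inclMap,
          LinCat.BilinFunctor.map_zero_left, inclMap_zero]
      · exact (dif_pos rfl).trans (dif_neg e)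
  · exact dif_neg e

theorem totTensorHom_zero_right {x x' y y' : M.Tot} (f : x ⟶ x') :
    totTensorHom f (0 : y ⟶ y') = 0 := by
  induction f using hom_cases with
  | zero => exact totTensorHom_zero_left _
  | incl f =>
    obtain ⟨b, B⟩ := y
    obtain ⟨b', B'⟩ := y'
    by_cases e : b = b'
    · subst e
      rw [← inclMap_zero, totTensorHom_inclMap, LinCat.BilinFunctor.map_zero_right, inclMap_zero]
    · exact (dif_pos rfl).trans (dif_neg e)

noncomputable instance : MonoidalCategoryStruct M.Tot where
  tensorObj x y := ⟨x.deg * y.deg, (M.tensor rfl).obj x.obj y.obj⟩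
  tensorHom f g := totTensorHom f g
  whiskerLeft x _ _ g := totTensorHom (𝟙 x) g
  whiskerRight f y := totTensorHom f (𝟙 y)
  tensorUnit := ⟨1, M.unit⟩
  associator x y z := inclIso (M.assoc rfl rfl rfl (mul_assoc _ _ _).symm x.obj y.obj z.obj) ≪≫
    (tensorDeg (mul_assoc _ _ _).symm x.obj ((M.tensor rfl).obj y.obj z.obj)).symm
  leftUnitor x := tensorDeg (one_mul _) M.unit x.obj ≪≫ inclIso (M.leftUnit _ x.obj)
  rightUnitor x := tensorDeg (mul_one _) x.obj M.unit ≪≫ inclIso (M.rightUnit _ x.obj)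

theorem inclMap_tensorHom_inclMap {a b : G} {A A' : M.ps.fib a} {B B' : M.ps.fib b} (f : A ⟶ A')
    (g : B ⟶ B') : (inclMap f : (⟨a, A⟩ : M.Tot) ⟶ _) ⊗ₘ (inclMap g : (⟨b, B⟩ : M.Tot) ⟶ _) =
      inclMap ((M.tensor rfl).map f g) :=
  totTensorHom_inclMap f g

theorem zero_tensorHom {x x' y y' : M.Tot} (g : y ⟶ y') : (0 : x ⟶ x') ⊗ₘ g = 0 :=
  totTensorHom_zero_left g

theorem tensorHom_zero {x x' y y' : M.Tot} (f : x ⟶ x') : f ⊗ₘ (0 : y ⟶ y') = 0 :=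
  totTensorHom_zero_right f

theorem id_tensorHom_id' (x y : M.Tot) : 𝟙 x ⊗ₘ 𝟙 y = 𝟙 (x ⊗ y) :=
  (inclMap_tensorHom_inclMap (𝟙 x.obj) (𝟙 y.obj)).trans (by rw [LinCat.BilinFunctor.map_id]; rfl)

theorem tensorHom_comp_tensorHom' {x x' x'' y y' y'' : M.Tot} (f : x ⟶ x') (g : y ⟶ y')
    (f' : x' ⟶ x'') (g' : y' ⟶ y'') : (f ⊗ₘ g) ≫ (f' ⊗ₘ g') = (f ≫ f') ⊗ₘ (g ≫ g') := by
  induction f using hom_cases with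
  | zero => simp only [zero_tensorHom, Limits.zero_comp]
  | incl f =>
    induction g using hom_cases with
    | zero => simp only [tensorHom_zero, Limits.zero_comp]
    | incl g =>
      induction f' using hom_cases_left with
      | zero => simp only [zero_tensorHom, Limits.comp_zero]
      | incl f' =>
        induction g' using hom_cases_left with
        | zero => simp only [tensorHom_zero, Limits.comp_zero]
        | incl g' =>
          rw [← inclMap_comp, ← inclMap_comp, inclMap_tensorHom_inclMap,
            inclMap_tensorHom_inclMap, inclMap_tensorHom_inclMap, LinCat.BilinFunctor.map_comp]
          exact (inclMap_comp _ _).symm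

/-- Substituting the name of the product turns `tensorDeg` into an identity; the equation is then
the rule for tensoring morphisms within fibres. -/
theorem tensorDeg_naturality {a b c : G} (h : a * b = c) {A A' : M.ps.fib a} {B B' : M.ps.fib b}
    (f : A ⟶ A') (g : B ⟶ B') :
    ((inclMap f : (⟨a, A⟩ : M.Tot) ⟶ _) ⊗ₘ (inclMap g : (⟨b, B⟩ : M.Tot) ⟶ _)) ≫
        (tensorDeg h A' B').hom =
      (tensorDeg h A B).hom ≫ inclMap ((M.tensor h).map f g) := by
  subst h
  rw [inclMap_tensorHom_inclMap]
  exact (Category.comp_id _).trans (Category.id_comp _).symm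

/-- The associator of the coproduct is expressed by the constraint of `M` at arbitrary names for the
degrees. After substitution only `haq` survives as a genuine equation, because one of the two
bracketings of the triple product must be renamed. -/
theorem tensorDeg_assoc {a b c p q s : G} (hp : a * b = p) (hpc : p * c = s) (hq : b * c = q)
    (haq : a * q = s) (A : M.ps.fib a) (B : M.ps.fib b) (C : M.ps.fib c) :
    ((tensorDeg hp A B).hom ⊗ₘ 𝟙 (⟨c, C⟩ : M.Tot)) ≫
        (tensorDeg hpc ((M.tensor hp).obj A B) C).hom ≫
          inclMap (M.assoc hp hpc hq haq A B C).hom =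
      (α_ (⟨a, A⟩ : M.Tot) ⟨b, B⟩ ⟨c, C⟩).hom ≫
        (𝟙 (⟨a, A⟩ : M.Tot) ⊗ₘ (tensorDeg hq B C).hom) ≫
          (tensorDeg haq A ((M.tensor hq).obj B C)).hom := by
  subst hp hq hpc
  have h : (α_ (⟨a, A⟩ : M.Tot) ⟨b, B⟩ ⟨c, C⟩).hom = inclMap (M.assoc rfl rfl rfl haq A B C).hom ≫
    (tensorDeg haq A ((M.tensor rfl).obj B C)).inv := rfl
  rw [h]
  simp only [tensorDeg_rfl, Iso.refl_hom]
  erw [id_tensorHom_id', id_tensorHom_id', Category.id_comp, Category.id_comp, Category.id_comp, Category.assoc,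
    Iso.inv_hom_id, Category.comp_id]

theorem tensorDeg_assoc_left {a b c p : G} (hp : a * b = p) (haq : a * (b * c) = p * c)
    (A : M.ps.fib a) (B : M.ps.fib b) (C : M.ps.fib c) :
    ((tensorDeg hp A B).hom ⊗ₘ 𝟙 (⟨c, C⟩ : M.Tot)) ≫
          inclMap (M.assoc hp rfl rfl haq A B C).hom =
      (α_ (⟨a, A⟩ : M.Tot) ⟨b, B⟩ ⟨c, C⟩).hom ≫
          (tensorDeg haq A ((M.tensor rfl).obj B C)).hom := by
  have h := tensorDeg_assoc hp rfl rfl haq A B C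
  simp only [tensorDeg_rfl, Iso.refl_hom] at h
  erw [id_tensorHom_id', Category.id_comp, Category.id_comp] at h
  exact h

theorem tensorDeg_assoc_right {a b c q s : G} (hpc : a * b * c = s) (hq : b * c = q)
    (haq : a * q = s) (A : M.ps.fib a) (B : M.ps.fib b) (C : M.ps.fib c) :
    (tensorDeg hpc ((M.tensor rfl).obj A B) C).hom ≫
          inclMap (M.assoc rfl hpc hq haq A B C).hom =
      (α_ (⟨a, A⟩ : M.Tot) ⟨b, B⟩ ⟨c, C⟩).hom ≫
        (𝟙 (⟨a, A⟩ : M.Tot) ⊗ₘ (tensorDeg hq B C).hom) ≫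
          (tensorDeg haq A ((M.tensor hq).obj B C)).hom := by
  have h := tensorDeg_assoc rfl hpc hq haq A B C
  simp only [tensorDeg_rfl, Iso.refl_hom] at h
  erw [id_tensorHom_id', Category.id_comp] at h
  exact h

theorem tensorDeg_leftUnit {a : G} (h : 1 * a = a) (A : M.ps.fib a) :
    (tensorDeg h M.unit A).hom ≫ inclMap (M.leftUnit h A).hom = (λ_ (⟨a, A⟩ : M.Tot)).hom := rfl

theorem tensorDeg_rightUnit {a : G} (h : a * 1 = a) (A : M.ps.fib a) :
    (tensorDeg h A M.unit).hom ≫ inclMap (M.rightUnit h A).hom = (ρ_ (⟨a, A⟩ : M.Tot)).hom := rfl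

theorem tensorDeg_inv_naturality {a b c : G} (h : a * b = c) {A A' : M.ps.fib a}
    {B B' : M.ps.fib b} (f : A ⟶ A') (g : B ⟶ B') :
    inclMap ((M.tensor h).map f g) ≫ (tensorDeg h A' B').inv = (tensorDeg h A B).inv ≫
      ((inclMap f : (⟨a, A⟩ : M.Tot) ⟶ _) ⊗ₘ (inclMap g : (⟨b, B⟩ : M.Tot) ⟶ _)) := by
  rw [Iso.comp_inv_eq, Category.assoc, tensorDeg_naturality, Iso.inv_hom_id_assoc]

theorem tot_associator_hom {a b c : G} (A : M.ps.fib a) (B : M.ps.fib b) (C : M.ps.fib c) :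
    (α_ (⟨a, A⟩ : M.Tot) ⟨b, B⟩ ⟨c, C⟩).hom =
      inclMap (M.assoc rfl rfl rfl (mul_assoc a b c).symm A B C).hom ≫
        (tensorDeg (mul_assoc a b c).symm A ((M.tensor rfl).obj B C)).inv := rfl

theorem inclMap_tensorHom_id {a b : G} {A A' : M.ps.fib a} (f : A ⟶ A') (B : M.ps.fib b) :
    (inclMap f : (⟨a, A⟩ : M.Tot) ⟶ _) ⊗ₘ 𝟙 (⟨b, B⟩ : M.Tot) =
      inclMap ((M.tensor rfl).map f (𝟙 B)) :=
  inclMap_tensorHom_inclMap f (𝟙 B)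

theorem id_tensorHom_inclMap {a b : G} (A : M.ps.fib a) {B B' : M.ps.fib b} (f : B ⟶ B') :
    𝟙 (⟨a, A⟩ : M.Tot) ⊗ₘ (inclMap f : (⟨b, B⟩ : M.Tot) ⟶ _) =
      inclMap ((M.tensor rfl).map (𝟙 A) f) :=
  inclMap_tensorHom_inclMap (𝟙 A) f

/-- The pentagon of `M` is used with all four-fold products named by their left bracketing, so that
it is an equation in one fibre. The isomorphisms `tensorDeg` carry each associator of the coproduct
to the constraint occurring there. -/
theorem tot_pentagon (x y z w : M.Tot) :
    ((α_ x y z).hom ⊗ₘ 𝟙 w) ≫ (α_ x (y ⊗ z) w).hom ≫ (𝟙 x ⊗ₘ (α_ y z w).hom) =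
      (α_ (x ⊗ y) z w).hom ≫ (α_ x y (z ⊗ w)).hom := by
  obtain ⟨a, A⟩ := x
  obtain ⟨b, B⟩ := y
  obtain ⟨c, C⟩ := z
  obtain ⟨d, D⟩ := w
  have haq : a * (b * c) = a * b * c := (mul_assoc _ _ _).symm
  have hbr : b * (c * d) = b * c * d := (mul_assoc _ _ _).symm
  have hpr : a * b * (c * d) = a * b * c * d := (mul_assoc _ _ _).symm
  have hat : a * (b * c * d) = a * b * c * d := by simp only [mul_assoc]
  have h₁ := tensorDeg_assoc_left haq hat A ((M.tensor rfl).obj B C) D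
  have h₂ := tensorDeg_assoc_right hpr hbr hat A B ((M.tensor rfl).obj C D)
  have h₃ := congrArg (inclMap (N := fun a => M.ps.fib a))
    (M.pentagon rfl rfl rfl rfl haq rfl hbr rfl hpr hat A B C D)
  rw [inclMap_comp, inclMap_comp, inclMap_comp] at h₃
  have h₄ := tensorDeg_naturality hat (𝟙 A) (M.assoc rfl rfl rfl hbr B C D).hom
  have e₁ : ((α_ (⟨a, A⟩ : M.Tot) ⟨b, B⟩ ⟨c, C⟩).hom ⊗ₘ 𝟙 (⟨d, D⟩ : M.Tot)) ≫
      ((tensorDeg haq A ((M.tensor rfl).obj B C)).hom ⊗ₘ 𝟙 _) =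
        inclMap ((M.tensor rfl).map (M.assoc rfl rfl rfl haq A B C).hom (𝟙 D)) := by
    rw [tensorHom_comp_tensorHom', ← inclMap_tensorHom_id]
    congr 1
    · erw [tot_associator_hom, Category.assoc, Iso.inv_hom_id, Category.comp_id]
    · exact Category.comp_id _
  have e₂ : (𝟙 (⟨a, A⟩ : M.Tot) ⊗ₘ (α_ (⟨b, B⟩ : M.Tot) ⟨c, C⟩ ⟨d, D⟩).hom) ≫
      (𝟙 _ ⊗ₘ (tensorDeg hbr B ((M.tensor rfl).obj C D)).hom) =
        (inclMap (𝟙 A) ⊗ₘ inclMap (M.assoc rfl rfl rfl hbr B C D).hom) := by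
    rw [tensorHom_comp_tensorHom']
    congr 1
    · exact Category.comp_id _
    · erw [tot_associator_hom, Category.assoc, Iso.inv_hom_id, Category.comp_id]
  have e₃ : (α_ (⟨a * b, (M.tensor rfl).obj A B⟩ : M.Tot) ⟨c, C⟩ ⟨d, D⟩).hom ≫
      (tensorDeg hpr ((M.tensor rfl).obj A B) ((M.tensor rfl).obj C D)).hom =
        inclMap (M.assoc rfl rfl rfl hpr ((M.tensor rfl).obj A B) C D).hom := by
    erw [tot_associator_hom, Category.assoc, Iso.inv_hom_id, Category.comp_id]
  have e₄ : ((α_ (⟨a, A⟩ : M.Tot) ⟨b, B⟩ ⟨c, C⟩).hom ⊗ₘ 𝟙 (⟨d, D⟩ : M.Tot)) ≫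
      (α_ (⟨a, A⟩ : M.Tot) ⟨b * c, (M.tensor rfl).obj B C⟩ ⟨d, D⟩).hom ≫
        (tensorDeg hat A ((M.tensor rfl).obj ((M.tensor rfl).obj B C) D)).hom =
      inclMap ((M.tensor rfl).map (M.assoc rfl rfl rfl haq A B C).hom (𝟙 D)) ≫
        inclMap (M.assoc haq rfl rfl hat A ((M.tensor rfl).obj B C) D).hom := by
    rw [← h₁, ← e₁, Category.assoc]
  -- The monoidal category axioms are still being proved, so invertibility of this tensor product is
  -- checked by hand from functoriality.
  have hm : Mono ((𝟙 (⟨a, A⟩ : M.Tot)) ⊗ₘ (tensorDeg hbr B ((M.tensor rfl).obj C D)).hom) := by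
    have : IsIso ((𝟙 (⟨a, A⟩ : M.Tot)) ⊗ₘ (tensorDeg hbr B ((M.tensor rfl).obj C D)).hom) :=
      ⟨(𝟙 (⟨a, A⟩ : M.Tot)) ⊗ₘ (tensorDeg hbr B ((M.tensor rfl).obj C D)).inv, by
        rw [tensorHom_comp_tensorHom', Iso.hom_inv_id, Category.id_comp]
        exact id_tensorHom_id' _ _, by
        rw [tensorHom_comp_tensorHom', Iso.inv_hom_id, Category.id_comp]
        exact id_tensorHom_id' _ _⟩
    infer_instance
  refine hm.right_cancellation _ _ ?_
  rw [← cancel_mono (tensorDeg hat A ((M.tensor hbr).obj B ((M.tensor rfl).obj C D))).hom]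
  simp only [Category.assoc]
  erw [reassoc_of% e₂, h₄, ← h₂, reassoc_of% e₃, reassoc_of% e₄, h₃]

/-- With `a` naming `a * 1` and `b` naming `1 * b`, the triangle of `M` lies in the single fibre at
`a * b`, and `tensorDeg_assoc` compares it with the associator of the coproduct. -/
theorem tot_triangle (x y : M.Tot) :
    (α_ x (𝟙_ M.Tot) y).hom ≫ (𝟙 x ⊗ₘ (λ_ y).hom) = (ρ_ x).hom ⊗ₘ 𝟙 y := by
  obtain ⟨a, A⟩ := x
  obtain ⟨b, B⟩ := y
  have h₁ := tensorDeg_assoc (mul_one a) rfl (one_mul b) rfl A M.unit B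
  have h₃ := M.triangle (mul_one a) (one_mul b) rfl A B
  rw [← tensorDeg_leftUnit (one_mul b), ← tensorDeg_rightUnit (mul_one a)]
  have e₁ : ∀ {x y z w : M.Tot} (f : x ⟶ y) (g : y ⟶ z), (f ≫ g) ⊗ₘ 𝟙 w = (f ⊗ₘ 𝟙 w) ≫ (g ⊗ₘ 𝟙 w) :=
    fun f g => by rw [tensorHom_comp_tensorHom', Category.comp_id]
  have e₂ : ∀ {x y z w : M.Tot} (f : x ⟶ y) (g : y ⟶ z), 𝟙 w ⊗ₘ (f ≫ g) = (𝟙 w ⊗ₘ f) ≫ (𝟙 w ⊗ₘ g) :=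
    fun f g => by rw [tensorHom_comp_tensorHom', Category.comp_id]
  rw [e₁, e₂, inclMap_tensorHom_id, id_tensorHom_inclMap, ← h₃, inclMap_comp]
  rw [tensorDeg_rfl, tensorDeg_rfl] at h₁
  erw [Category.id_comp, Category.comp_id] at h₁
  erw [reassoc_of% h₁]
  rfl

/-- Each naturality law is trivial when one of the morphisms is zero. What remains are morphisms
inside fibres, for which it is naturality of the constraints of `M`. -/
noncomputable instance : MonoidalCategory M.Tot := MonoidalCategory.ofTensorHom
  (id_tensorHom_id := id_tensorHom_id')
  (tensorHom_comp_tensorHom := tensorHom_comp_tensorHom')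
  (id_tensorHom := fun _ _ _ _ => rfl)
  (tensorHom_id := fun _ _ => rfl)
  (associator_naturality := fun {x y z x' y' z'} f g h => by
    induction f using hom_cases with
    | zero => simp only [zero_tensorHom, Limits.zero_comp, Limits.comp_zero]
    | incl f =>
      induction g using hom_cases with
      | zero => simp only [zero_tensorHom, tensorHom_zero, Limits.zero_comp, Limits.comp_zero]
      | incl g =>
        induction h using hom_cases with
        | zero => simp only [tensorHom_zero, Limits.zero_comp, Limits.comp_zero]
        | incl h =>
          rw [inclMap_tensorHom_inclMap, inclMap_tensorHom_inclMap, tot_associator_hom,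
            tot_associator_hom]
          have e := M.assoc_naturality rfl rfl rfl (mul_assoc _ _ _).symm f g h
          refine (Category.assoc _ _ _).symm.trans ?_
          refine (congrArg (· ≫ _) ((inclMap_comp _ _).symm.trans ((congrArg inclMap e).trans
            (inclMap_comp _ _)))).trans ?_
          rw [Category.assoc]
          erw [tensorDeg_inv_naturality, Category.assoc]
          exact congrArg (fun z => _ ≫ _ ≫ (inclMap f ⊗ₘ z)) (inclMap_tensorHom_inclMap g h).symm)
  (leftUnitor_naturality := fun {x x'} f => by
    induction f using hom_cases with
    | zero => simp only [tensorHom_zero, Limits.zero_comp, Limits.comp_zero]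
    | incl f =>
      rw [← tensorDeg_leftUnit (one_mul _), ← tensorDeg_leftUnit (one_mul _), Category.assoc, ← inclMap_comp, ← M.leftUnit_naturality,
        inclMap_comp]
      erw [← reassoc_of% (tensorDeg_naturality (one_mul _) (𝟙 M.unit) f)]
      rfl)
  (rightUnitor_naturality := fun {x x'} f => by
    induction f using hom_cases with
    | zero => simp only [zero_tensorHom, Limits.zero_comp, Limits.comp_zero]
    | incl f =>
      rw [← tensorDeg_rightUnit (mul_one _), ← tensorDeg_rightUnit (mul_one _), Category.assoc, ← inclMap_comp, ← M.rightUnit_naturality,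
        inclMap_comp]
      erw [← reassoc_of% (tensorDeg_naturality (mul_one _) f (𝟙 M.unit))]
      rfl)
  (pentagon := tot_pentagon)
  (triangle := tot_triangle)

theorem tensorHom_add_aux {x y z w : M.Tot} (f : x ⟶ y) (g g' : z ⟶ w) :
    f ⊗ₘ (g + g') = f ⊗ₘ g + f ⊗ₘ g' := by
  induction f using hom_cases with
  | zero => simp only [zero_tensorHom, add_zero]
  | incl f =>
    obtain ⟨b, B⟩ := z
    obtain ⟨c, C⟩ := w
    by_cases e : b = c
    · subst e
      obtain ⟨g, rfl⟩ := exists_inclMap g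
      obtain ⟨g', rfl⟩ := exists_inclMap g'
      refine (inclMap_tensorHom_inclMap f (g + g')).trans ?_
      rw [inclMap_tensorHom_inclMap, inclMap_tensorHom_inclMap, LinCat.BilinFunctor.map_add_right]
      rfl
    · rw [eq_zero (by exact e) g, eq_zero (by exact e) g', tensorHom_zero, add_zero,
        tensorHom_zero, add_zero]

theorem add_tensorHom_aux {x y z w : M.Tot} (f f' : x ⟶ y) (g : z ⟶ w) :
    (f + f') ⊗ₘ g = f ⊗ₘ g + f' ⊗ₘ g := by
  induction g using hom_cases with
  | zero => simp only [tensorHom_zero, add_zero]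
  | incl g =>
    obtain ⟨b, B⟩ := x
    obtain ⟨c, C⟩ := y
    by_cases e : b = c
    · subst e
      obtain ⟨f, rfl⟩ := exists_inclMap f
      obtain ⟨f', rfl⟩ := exists_inclMap f'
      refine (inclMap_tensorHom_inclMap (f + f') g).trans ?_
      rw [inclMap_tensorHom_inclMap, inclMap_tensorHom_inclMap, LinCat.BilinFunctor.map_add_left]
      rfl
    · rw [eq_zero (by exact e) f, eq_zero (by exact e) f', zero_tensorHom, add_zero,
        zero_tensorHom, add_zero]

theorem tensorHom_smul_aux {x y z w : M.Tot} (r : k) (f : x ⟶ y) (g : z ⟶ w) :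
    f ⊗ₘ (r • g) = r • (f ⊗ₘ g) := by
  induction f using hom_cases with
  | zero => simp only [zero_tensorHom, smul_zero]
  | incl f =>
    induction g using hom_cases with
    | zero => simp only [tensorHom_zero, smul_zero]
    | incl g =>
      refine (inclMap_tensorHom_inclMap f (r • g)).trans ?_
      rw [inclMap_tensorHom_inclMap, LinCat.BilinFunctor.map_smul_right]
      rfl

theorem smul_tensorHom_aux {x y z w : M.Tot} (r : k) (f : x ⟶ y) (g : z ⟶ w) :
    (r • f) ⊗ₘ g = r • (f ⊗ₘ g) := by
  induction f using hom_cases with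
  | zero => simp only [zero_tensorHom, smul_zero]
  | incl f =>
    induction g using hom_cases with
    | zero => simp only [tensorHom_zero, smul_zero]
    | incl g =>
      refine (inclMap_tensorHom_inclMap (r • f) g).trans ?_
      rw [inclMap_tensorHom_inclMap, LinCat.BilinFunctor.map_smul_left]
      rfl

instance : MonoidalPreadditive M.Tot where
  whiskerLeft_zero := tensorHom_zero _
  zero_whiskerRight := zero_tensorHom _
  whiskerLeft_add f g := tensorHom_add_aux _ f g
  add_whiskerRight f g := add_tensorHom_aux f g _

instance : MonoidalLinear k M.Tot where
  whiskerLeft_smul _ _ _ r f := tensorHom_smul_aux r _ f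
  smul_whiskerRight r _ _ f _ := smul_tensorHom_aux r f _

/-- The tensor product of objects of the coproduct is given by that of the monoidale. -/
noncomputable def tensorIncl {a b c : G} (h : a * b = c) (A : M.ps.fib a) (B : M.ps.fib b) :
    (⟨a, A⟩ : M.Tot) ⊗ ⟨b, B⟩ ≅ ⟨c, (M.tensor h).obj A B⟩ :=
  tensorDeg h A B

theorem tensorIncl_naturality {a b c : G} (h : a * b = c) {A A' : M.ps.fib a} {B B' : M.ps.fib b}
    (f : A ⟶ A') (g : B ⟶ B') :
    ((inclMap f : (⟨a, A⟩ : M.Tot) ⟶ _) ⊗ₘ (inclMap g : (⟨b, B⟩ : M.Tot) ⟶ _)) ≫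
        (tensorIncl h A' B').hom =
      (tensorIncl h A B).hom ≫ inclMap ((M.tensor h).map f g) :=
  tensorDeg_naturality h f g

theorem tensorIncl_naturality_left {a b c : G} (h : a * b = c) {A A' : M.ps.fib a} {B : M.ps.fib b}
    (f : A ⟶ A') :
    (inclMap f : (⟨a, A⟩ : M.Tot) ⟶ _) ▷ (⟨b, B⟩ : M.Tot) ≫ (tensorIncl h A' B).hom =
      (tensorIncl h A B).hom ≫ inclMap ((M.tensor h).map f (𝟙 B)) :=
  tensorDeg_naturality h f (𝟙 B)

theorem tensorIncl_naturality_right {a b c : G} (h : a * b = c) {A : M.ps.fib a} {B B' : M.ps.fib b}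
    (g : B ⟶ B') :
    (⟨a, A⟩ : M.Tot) ◁ (inclMap g : (⟨b, B⟩ : M.Tot) ⟶ _) ≫ (tensorIncl h A B').hom =
      (tensorIncl h A B).hom ≫ inclMap ((M.tensor h).map (𝟙 A) g) :=
  tensorDeg_naturality h (𝟙 A) g

theorem tensorIncl_assoc {a b c p q s : G} (hp : a * b = p) (hpc : p * c = s) (hq : b * c = q)
    (haq : a * q = s) (A : M.ps.fib a) (B : M.ps.fib b) (C : M.ps.fib c) :
    (tensorIncl hp A B).hom ▷ (⟨c, C⟩ : M.Tot) ≫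
        (tensorIncl hpc ((M.tensor hp).obj A B) C).hom ≫
          inclMap (M.assoc hp hpc hq haq A B C).hom =
      (α_ (⟨a, A⟩ : M.Tot) ⟨b, B⟩ ⟨c, C⟩).hom ≫
        (⟨a, A⟩ : M.Tot) ◁ (tensorIncl hq B C).hom ≫
          (tensorIncl haq A ((M.tensor hq).obj B C)).hom :=
  tensorDeg_assoc hp hpc hq haq A B C

theorem tensorIncl_leftUnit {a : G} (h : 1 * a = a) (A : M.ps.fib a) :
    (tensorIncl h M.unit A).hom ≫ inclMap (M.leftUnit h A).hom = (λ_ (⟨a, A⟩ : M.Tot)).hom := rfl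

theorem tensorIncl_rightUnit {a : G} (h : a * 1 = a) (A : M.ps.fib a) :
    (tensorIncl h A M.unit).hom ≫ inclMap (M.rightUnit h A).hom = (ρ_ (⟨a, A⟩ : M.Tot)).hom := rfl

end Monoidale

/-! ### Crossings on the coproduct -/

namespace Monoidale

open LinCat.Total PsGAut

variable {k : Type w} [CommRing k] {G : Type u} [Group G] {M : Monoidale.{w, v, u} k G}

variable (M) in
/-- The functor of crossing by `x`: it is the action of `x⁻¹`. -/
noncomputable def cross (x : G) : M.Tot ⥤ M.Tot :=
  desc fun a => M.ps.act (b := x⁻¹ * a * x) x⁻¹ (mul_inv_cancel_right _ _).symm ⋙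
    incl (fun a => M.ps.fib a) (x⁻¹ * a * x)

noncomputable instance (x : G) : (M.cross x).Additive :=
  inferInstanceAs (desc _).Additive

noncomputable instance (x : G) : (M.cross x).Linear k :=
  inferInstanceAs ((desc _).Linear k)

theorem cross_map_inclMap (x : G) {a : G} {A B : M.ps.fib a} (f : A ⟶ B) :
    (M.cross x).map (inclMap f) = inclMap ((M.ps.act (b := x⁻¹ * a * x) x⁻¹
      (mul_inv_cancel_right _ _).symm).map f) :=
  descMap_inclMap (fun a => M.ps.act (b := x⁻¹ * a * x) x⁻¹ (mul_inv_cancel_right _ _).symm ⋙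
    incl (fun a => M.ps.fib a) (x⁻¹ * a * x)) f

/-- The target degree of an action is determined by its source and the acting element. Hence the
names of conjugates can always be substituted away. -/
theorem eq_of_cross {x g a b : G} (hx : x⁻¹ = g) (h : g * a = b * g) : x⁻¹ * a * x = b := by
  subst hx
  rw [h, inv_mul_cancel_right]

/-- Crossing by `x` is given by the action of `x⁻¹`. -/
noncomputable def crossIncl {x g a b : G} (hx : x⁻¹ = g) (h : g * a = b * g) (A : M.ps.fib a) :
    (M.cross x).obj ⟨a, A⟩ ≅ ⟨b, (M.ps.act g h).obj A⟩ :=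
  eqToIso (by obtain rfl := eq_of_cross hx h; subst hx; rfl)

theorem crossIncl_rfl {x a : G} (h) (A : M.ps.fib a) :
    crossIncl (x := x) (b := x⁻¹ * a * x) rfl h A = Iso.refl _ := rfl

theorem crossIncl_naturality {x g a b : G} (hx : x⁻¹ = g) (h : g * a = b * g) {A A' : M.ps.fib a}
    (f : A ⟶ A') : (M.cross x).map (inclMap f) ≫ (crossIncl hx h A').hom =
      (crossIncl hx h A).hom ≫ inclMap ((M.ps.act g h).map f) := by
  obtain rfl := eq_of_cross hx h
  subst hx
  refine (Category.comp_id _).trans (Eq.trans ?_ (Category.id_comp _).symm)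
  exact cross_map_inclMap _ f

/-- The composition constraint of crossings. -/
noncomputable def crossCompApp {x y z : G} (h : y * x = z) (A : M.Tot) :
    (M.cross x).obj ((M.cross y).obj A) ≅ (M.cross z).obj A :=
  crossIncl (a := y⁻¹ * A.deg * y) (b := z⁻¹ * A.deg * z) rfl (by subst h; group) _ ≪≫
    inclIso (M.ps.actMul (e := z⁻¹) _ _ _ (by rw [← h, mul_inv_rev]) A.obj)

/-- The composition constraint is `actMul` for any names of the degrees: once these are substituted,
all the comparisons `crossIncl` are identities. Later proofs use this equation, and its analogues
for the other constraints, instead of the definition with its particular choice of degrees. -/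
theorem crossCompApp_crossIncl {x y z f g e a b c : G} (h : y * x = z) (hy : y⁻¹ = f)
    (hx : x⁻¹ = g) (hz : z⁻¹ = e) (hf : f * a = b * f) (hg : g * b = c * g) (he : e * a = c * e)
    (hm : g * f = e) (A : M.ps.fib a) :
    (M.cross x).map (crossIncl hy hf A).hom ≫ (crossIncl hx hg ((M.ps.act f hf).obj A)).hom ≫
        inclMap (M.ps.actMul hf hg he hm A).hom =
      (crossCompApp h ⟨a, A⟩).hom ≫ (crossIncl hz he A).hom := by
  obtain rfl := eq_of_cross hy hf
  obtain rfl := eq_of_cross hz he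
  subst hy hx hz
  simp only [crossIncl_rfl, Iso.refl_hom]
  erw [CategoryTheory.Functor.map_id, Category.id_comp, Category.comp_id]
  rfl

theorem crossCompApp_naturality {x y z : G} (h : y * x = z) {A B : M.Tot} (f : A ⟶ B) :
    (M.cross x).map ((M.cross y).map f) ≫ (crossCompApp h B).hom =
      (crossCompApp h A).hom ≫ (M.cross z).map f := by
  induction f using hom_cases with
  | zero => simp only [Functor.map_zero, Limits.zero_comp, Limits.comp_zero]
  | @incl a A B f =>
    have hf : y⁻¹ * a = (y⁻¹ * a * y) * y⁻¹ := by group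
    have hg : x⁻¹ * (y⁻¹ * a * y) = (z⁻¹ * a * z) * x⁻¹ := by subst h; group
    have he : z⁻¹ * a = (z⁻¹ * a * z) * z⁻¹ := by group
    have hm : x⁻¹ * y⁻¹ = z⁻¹ := by rw [← h, mul_inv_rev]
    have h₁ := crossCompApp_crossIncl h rfl rfl rfl hf hg he hm A
    have h₂ := crossCompApp_crossIncl h rfl rfl rfl hf hg he hm B
    rw [← cancel_mono (crossIncl rfl he B).hom, Category.assoc, Category.assoc, ← h₂,
      crossIncl_naturality, ← reassoc_of% h₁, ← inclMap_comp, ← actMul_naturality, inclMap_comp,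
      ← reassoc_of% crossIncl_naturality rfl hg, ← Functor.map_comp_assoc,
      ← Functor.map_comp_assoc, crossIncl_naturality]

variable (M) in
/-- The composition constraint of crossings. -/
noncomputable def crossComp {x y z : G} (h : y * x = z) : M.cross y ⋙ M.cross x ≅ M.cross z :=
  NatIso.ofComponents (fun A => crossCompApp h A) fun f => crossCompApp_naturality h f

/-- The unit constraint of crossings. -/
noncomputable def crossUnitApp (A : M.Tot) : A ≅ (M.cross 1).obj A :=
  (crossIncl (a := A.deg) (b := A.deg) inv_one (by simp) A.obj ≪≫
    inclIso (M.ps.actOne (by simp) A.obj)).symm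

theorem crossUnitApp_crossIncl {a : G} (h : (1 : G) * a = a * 1) (A : M.ps.fib a) :
    (crossUnitApp (⟨a, A⟩ : M.Tot)).hom ≫ (crossIncl inv_one h A).hom ≫
      inclMap (M.ps.actOne h A).hom = 𝟙 _ :=
  (crossUnitApp (⟨a, A⟩ : M.Tot)).hom_inv_id

theorem crossUnitApp_naturality {A B : M.Tot} (f : A ⟶ B) :
    f ≫ (crossUnitApp B).hom = (crossUnitApp A).hom ≫ (M.cross 1).map f := by
  induction f using hom_cases with
  | zero => simp only [Functor.map_zero, Limits.zero_comp, Limits.comp_zero]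
  | @incl a A B f =>
    rw [← Iso.inv_comp_eq, ← Category.assoc, ← Iso.eq_comp_inv]
    have h : (1 : G) * a = a * 1 := by simp
    change ((crossIncl inv_one h A).hom ≫ inclMap (M.ps.actOne h A).hom) ≫ inclMap f =
      (M.cross 1).map (inclMap f) ≫ (crossIncl inv_one h B).hom ≫ inclMap (M.ps.actOne h B).hom
    rw [reassoc_of% crossIncl_naturality, Category.assoc, ← inclMap_comp, ← inclMap_comp,
      actOne_naturality]

variable (M) in
/-- The unit constraint of crossings. -/
noncomputable def crossUnit : 𝟭 M.Tot ≅ M.cross 1 :=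
  NatIso.ofComponents (fun A => crossUnitApp A) fun f => crossUnitApp_naturality f

/-- The tensor constraint of a crossing. -/
noncomputable def crossTensor (x : G) (A B : M.Tot) :
    (M.cross x).obj A ⊗ (M.cross x).obj B ≅ (M.cross x).obj (A ⊗ B) :=
  tensorIncl (c := x⁻¹ * (A.deg * B.deg) * x) (by group) _ _ ≪≫
    inclIso (M.tensorAct rfl _ _ _ _ A.obj B.obj)

/-- The tensor constraint of a crossing is `tensorAct` for any names of the degrees. It transfers
the axioms on `tensorAct` to the crossings. -/
theorem crossTensor_crossIncl {x a b c a' b' c' g : G} (hx : x⁻¹ = g) (h : a * b = c)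
    (h' : a' * b' = c') (ha : g * a = a' * g) (hb : g * b = b' * g) (hc : g * c = c' * g)
    (A : M.ps.fib a) (B : M.ps.fib b) :
    ((crossIncl hx ha A).hom ⊗ₘ (crossIncl hx hb B).hom) ≫ (tensorIncl h' _ _).hom ≫
        inclMap (M.tensorAct h h' ha hb hc A B).hom =
      (crossTensor x ⟨a, A⟩ ⟨b, B⟩).hom ≫ (M.cross x).map (tensorIncl h A B).hom ≫
        (crossIncl hx hc ((M.tensor h).obj A B)).hom := by
  obtain rfl := eq_of_cross hx ha
  obtain rfl := eq_of_cross hx hb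
  obtain rfl := eq_of_cross hx hc
  subst hx h
  have h₁ : (tensorIncl rfl A B).hom = 𝟙 ((⟨a, A⟩ : M.Tot) ⊗ ⟨b, B⟩) := rfl
  rw [h₁, CategoryTheory.Functor.map_id, crossIncl_rfl, crossIncl_rfl, crossIncl_rfl]
  simp only [Iso.refl_hom]
  erw [id_tensorHom_id, Category.id_comp, Category.id_comp, Category.comp_id]
  rfl

/-- The unit constraint of a crossing. -/
noncomputable def crossOne (x : G) : 𝟙_ M.Tot ≅ (M.cross x).obj (𝟙_ M.Tot) :=
  inclIso (M.unitAct (by simp)) ≪≫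
    (crossIncl (x := x) (a := 1) (b := 1) rfl (by simp) M.unit).symm

theorem crossOne_crossIncl {x g : G} (hx : x⁻¹ = g) (h : g * 1 = 1 * g) :
    (crossOne (M := M) x).hom ≫ (crossIncl hx h M.unit).hom = inclMap (M.unitAct h).hom := by
  subst hx
  change (inclMap _ ≫ (crossIncl rfl h M.unit).inv) ≫ _ = _
  rw [Category.assoc, Iso.inv_hom_id]
  exact Category.comp_id _

end Monoidale

/-! ### Coherence of the crossings -/

namespace Monoidale

open LinCat.Total PsGAut

variable {k : Type w} [CommRing k] {G : Type u} [Group G] {M : Monoidale.{w, v, u} k G}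

theorem comp_comp_tensorHom {T : Type*} [Category* T] [MonoidalCategory T] {a b c d e f : T}
    (p : a ⟶ b) (q : b ⟶ c) (r : c ⟶ d) (s : e ⟶ f) :
    (p ≫ q ≫ r) ⊗ₘ s = (p ⊗ₘ s) ≫ q ▷ f ≫ r ▷ f := by
  rw [← tensorHom_id, ← tensorHom_id, tensorHom_comp_tensorHom, tensorHom_comp_tensorHom,
    Category.comp_id, Category.comp_id]

theorem tensorHom_comp_comp {T : Type*} [Category* T] [MonoidalCategory T] {a b c d e f : T}
    (p : a ⟶ b) (q : b ⟶ c) (r : c ⟶ d) (s : e ⟶ f) :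
    s ⊗ₘ (p ≫ q ≫ r) = (s ⊗ₘ p) ≫ f ◁ q ≫ f ◁ r := by
  rw [← id_tensorHom, ← id_tensorHom, tensorHom_comp_tensorHom, tensorHom_comp_tensorHom,
    Category.comp_id, Category.comp_id]

theorem whiskerRight_comp_comp_tensorHom {T : Type*} [Category* T] [MonoidalCategory T]
    {a b c d e f z : T} (p : a ⟶ b) (q : b ⟶ c) (r : c ⟶ d) (s : e ⟶ f) (h : d ⊗ f ⟶ z) :
    p ▷ e ≫ q ▷ e ≫ (r ⊗ₘ s) ≫ h = ((p ≫ q ≫ r) ⊗ₘ s) ≫ h := by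
  rw [← tensorHom_id, ← tensorHom_id, tensorHom_comp_tensorHom_assoc,
    tensorHom_comp_tensorHom_assoc, Category.id_comp, Category.id_comp]
  simp only [Category.assoc]

theorem whiskerLeft_comp_comp_tensorHom {T : Type*} [Category* T] [MonoidalCategory T]
    {a b c d e f z : T} (p : a ⟶ b) (q : b ⟶ c) (r : c ⟶ d) (s : e ⟶ f) (h : f ⊗ d ⟶ z) :
    e ◁ p ≫ e ◁ q ≫ (s ⊗ₘ r) ≫ h = (s ⊗ₘ (p ≫ q ≫ r)) ≫ h := by
  rw [← id_tensorHom, ← id_tensorHom, tensorHom_comp_tensorHom_assoc,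
    tensorHom_comp_tensorHom_assoc, Category.id_comp, Category.id_comp]
  simp only [Category.assoc]

theorem conj_eq (x a : G) : x⁻¹ * a = x⁻¹ * a * x * x⁻¹ := (mul_inv_cancel_right _ _).symm

/-- Zero morphisms are trivial. Within fibres, after the comparison with canonical degrees, this is
`tensorAct_naturality`. -/
theorem crossTensor_naturality (x : G) {A A' B B' : M.Tot} (f : A ⟶ A') (g : B ⟶ B') :
    ((M.cross x).map f ⊗ₘ (M.cross x).map g) ≫ (crossTensor x A' B').hom =
      (crossTensor x A B).hom ≫ (M.cross x).map (f ⊗ₘ g) := by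
  induction f using hom_cases with
  | zero => simp only [Functor.map_zero, zero_tensorHom, Limits.zero_comp, Limits.comp_zero]
  | @incl a A A' f =>
    induction g using hom_cases with
    | zero => simp only [Functor.map_zero, tensorHom_zero, Limits.zero_comp, Limits.comp_zero]
    | @incl b B B' g =>
      have h' : x⁻¹ * a * x * (x⁻¹ * b * x) = x⁻¹ * (a * b) * x := by group
      have e₁ := crossTensor_crossIncl rfl rfl h' (conj_eq x a) (conj_eq x b) (conj_eq x (a * b)) A B
      have e₂ := crossTensor_crossIncl rfl rfl h' (conj_eq x a) (conj_eq x b) (conj_eq x (a * b)) A' B'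
      rw [← cancel_mono ((M.cross x).map (tensorIncl rfl A' B').hom ≫
        (crossIncl rfl (conj_eq x (a * b)) _).hom), Category.assoc, Category.assoc, ← e₂,
        tensorHom_comp_tensorHom_assoc, crossIncl_naturality, crossIncl_naturality,
        ← tensorHom_comp_tensorHom_assoc, reassoc_of% tensorIncl_naturality,
        ← inclMap_comp, M.tensorAct_naturality, inclMap_comp, reassoc_of% e₁,
        ← crossIncl_naturality, ← Functor.map_comp_assoc, ← Functor.map_comp_assoc,
        tensorIncl_naturality]

theorem crossTensor_naturality_left (x : G) {A A' : M.Tot} (f : A ⟶ A') (B : M.Tot) :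
    (M.cross x).map f ▷ (M.cross x).obj B ≫ (crossTensor x A' B).hom =
      (crossTensor x A B).hom ≫ (M.cross x).map (f ▷ B) := by
  have := crossTensor_naturality x f (𝟙 B)
  rwa [CategoryTheory.Functor.map_id, tensorHom_id, tensorHom_id] at this

theorem crossTensor_naturality_right (x : G) (A : M.Tot) {B B' : M.Tot} (f : B ⟶ B') :
    (M.cross x).obj A ◁ (M.cross x).map f ≫ (crossTensor x A B').hom =
      (crossTensor x A B).hom ≫ (M.cross x).map (A ◁ f) := by
  have := crossTensor_naturality x (𝟙 A) f
  rwa [CategoryTheory.Functor.map_id, id_tensorHom, id_tensorHom] at this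

/-- This is `assoc_act`, the modification axiom of the associativity constraint. The comparisons
`eAB` to `eABC'` and `hα`, `hα'` translate every constraint of the coproduct into one of `M`. -/
theorem crossTensor_assoc (x : G) (A B C : M.Tot) :
    (crossTensor x A B).hom ▷ (M.cross x).obj C ≫ (crossTensor x (A ⊗ B) C).hom ≫
        (M.cross x).map (α_ A B C).hom =
      (α_ ((M.cross x).obj A) ((M.cross x).obj B) ((M.cross x).obj C)).hom ≫
        (M.cross x).obj A ◁ (crossTensor x B C).hom ≫ (crossTensor x A (B ⊗ C)).hom := by
  obtain ⟨a, A⟩ := A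
  obtain ⟨b, B⟩ := B
  obtain ⟨c, C⟩ := C
  have haq : a * (b * c) = a * b * c := (mul_assoc _ _ _).symm
  have hp' : x⁻¹ * a * x * (x⁻¹ * b * x) = x⁻¹ * (a * b) * x := by group
  have hq' : x⁻¹ * b * x * (x⁻¹ * c * x) = x⁻¹ * (b * c) * x := by group
  have hpc' : x⁻¹ * (a * b) * x * (x⁻¹ * c * x) = x⁻¹ * (a * b * c) * x := by group
  have haq' : x⁻¹ * a * x * (x⁻¹ * (b * c) * x) = x⁻¹ * (a * b * c) * x := by group
  have eAB := crossTensor_crossIncl rfl rfl hp' (conj_eq x a) (conj_eq x b) (conj_eq x _) A B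
  have eBC := crossTensor_crossIncl rfl rfl hq' (conj_eq x b) (conj_eq x c) (conj_eq x _) B C
  have eABC := crossTensor_crossIncl rfl rfl hpc' (conj_eq x _) (conj_eq x c) (conj_eq x _)
    ((M.tensor rfl).obj A B) C
  have eABC' := crossTensor_crossIncl rfl haq haq' (conj_eq x _) (conj_eq x _) (conj_eq x _)
    A ((M.tensor rfl).obj B C)
  have hα := tensorIncl_assoc rfl rfl rfl haq A B C
  have hα' := tensorIncl_assoc hp' hpc' hq' haq' ((M.ps.act x⁻¹ (conj_eq x a)).obj A)
    ((M.ps.act x⁻¹ (conj_eq x b)).obj B) ((M.ps.act x⁻¹ (conj_eq x c)).obj C)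
  have hM := M.assoc_act rfl rfl rfl haq hp' hpc' hq' haq' (conj_eq x a) (conj_eq x b)
    (conj_eq x c) (conj_eq x _) (conj_eq x _) (conj_eq x _) A B C
  have hM' := congrArg (inclMap (N := fun a => M.ps.fib a)) hM
  rw [inclMap_comp, inclMap_comp, inclMap_comp, inclMap_comp] at hM'
  -- The composite cancelled here is the isomorphism from the crossed triple product to an object of
  -- a single fibre; with it appended, the translations can be used.
  rw [← cancel_mono ((M.cross x).map ((⟨a, A⟩ : M.Tot) ◁ (tensorIncl rfl B C).hom) ≫
    (M.cross x).map (tensorIncl haq A ((M.tensor rfl).obj B C)).hom ≫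
      (crossIncl rfl (conj_eq x _) _).hom)]
  simp only [Category.assoc]
  rw [← Functor.map_comp_assoc, ← Functor.map_comp_assoc, Category.assoc, ← hα,
    Functor.map_comp, Functor.map_comp, Category.assoc, Category.assoc, crossIncl_naturality,
    ← reassoc_of% crossTensor_naturality_left, ← reassoc_of% eABC,
    whiskerRight_comp_comp_tensorHom, ← eAB, comp_comp_tensorHom,
    ← reassoc_of% crossTensor_naturality_right, ← eABC', whiskerLeft_comp_comp_tensorHom,
    ← eBC, tensorHom_comp_comp]
  simp only [Category.assoc]
  rw [reassoc_of% tensorIncl_naturality_left, reassoc_of% tensorIncl_naturality_right, hM',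
    reassoc_of% hα', associator_naturality_assoc]

/-- This is `leftUnit_act`, read in the fibre over the conjugate of `a`. -/
theorem crossTensor_leftUnit (x : G) (A : M.Tot) :
    (λ_ ((M.cross x).obj A)).hom = (crossOne x).hom ▷ (M.cross x).obj A ≫
      (crossTensor x (𝟙_ M.Tot) A).hom ≫ (M.cross x).map (λ_ A).hom := by
  obtain ⟨a, A⟩ := A
  have h1 : x⁻¹ * 1 = 1 * x⁻¹ := by simp
  have e₁ := crossTensor_crossIncl (M := M) rfl (one_mul a) (one_mul (x⁻¹ * a * x)) h1
    (conj_eq x a) (conj_eq x a) M.unit A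
  have e₂ := crossOne_crossIncl (M := M) (x := x) rfl h1
  have hM := congrArg (inclMap (N := fun a => M.ps.fib a)) (M.leftUnit_act (one_mul a)
    (one_mul _) h1 (conj_eq x a) A)
  rw [inclMap_comp, inclMap_comp] at hM
  rw [← cancel_mono (crossIncl rfl (conj_eq x a) A).hom, ← MonoidalCategory.leftUnitor_naturality,
    ← tensorIncl_leftUnit (one_mul _), ← tensorIncl_leftUnit (one_mul _), ← hM]
  simp only [Category.assoc, Functor.map_comp]
  rw [crossIncl_naturality]
  erw [← reassoc_of% e₁]
  rw [← reassoc_of% tensorIncl_naturality_left, ← e₂, ← tensorHom_def'_assoc, ← tensorHom_id, tensorHom_comp_tensorHom_assoc, Category.id_comp]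

theorem crossTensor_rightUnit (x : G) (A : M.Tot) :
    (ρ_ ((M.cross x).obj A)).hom = (M.cross x).obj A ◁ (crossOne x).hom ≫
      (crossTensor x A (𝟙_ M.Tot)).hom ≫ (M.cross x).map (ρ_ A).hom := by
  obtain ⟨a, A⟩ := A
  have h1 : x⁻¹ * 1 = 1 * x⁻¹ := by simp
  have e₁ := crossTensor_crossIncl (M := M) rfl (mul_one a) (mul_one (x⁻¹ * a * x))
    (conj_eq x a) h1 (conj_eq x a) A M.unit
  have e₂ := crossOne_crossIncl (M := M) (x := x) rfl h1
  have hM := congrArg (inclMap (N := fun a => M.ps.fib a)) (M.rightUnit_act (mul_one a)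
    (mul_one _) h1 (conj_eq x a) A)
  rw [inclMap_comp, inclMap_comp] at hM
  rw [← cancel_mono (crossIncl rfl (conj_eq x a) A).hom, ← MonoidalCategory.rightUnitor_naturality,
    ← tensorIncl_rightUnit (mul_one _), ← tensorIncl_rightUnit (mul_one _), ← hM]
  simp only [Category.assoc, Functor.map_comp]
  rw [crossIncl_naturality]
  erw [← reassoc_of% e₁]
  rw [← reassoc_of% tensorIncl_naturality_right, ← e₂, ← MonoidalCategory.tensorHom_def_assoc, ← id_tensorHom, tensorHom_comp_tensorHom_assoc, Category.id_comp]

noncomputable instance (x : G) : (M.cross x).Monoidal :=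
  Functor.CoreMonoidal.toMonoidal
    { εIso := crossOne x
      μIso := crossTensor x
      μIso_hom_natural_left f B := by
        have := crossTensor_naturality x f (𝟙 B)
        rw [CategoryTheory.Functor.map_id] at this
        simpa only [tensorHom_id] using this
      μIso_hom_natural_right A f := by
        have := crossTensor_naturality x (𝟙 A) f
        rw [CategoryTheory.Functor.map_id] at this
        simpa only [id_tensorHom] using this
      associativity := crossTensor_assoc x
      left_unitality := crossTensor_leftUnit x
      right_unitality := crossTensor_rightUnit x }

/-- This is `tensorAct_mul` for the elements `y⁻¹` and `x⁻¹`, whose product is `z⁻¹`; it makes the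
composition constraint monoidal. -/
theorem crossComp_tensor {x y z : G} (h : y * x = z) (A B : M.Tot) :
    (crossTensor x ((M.cross y).obj A) ((M.cross y).obj B)).hom ≫
        (M.cross x).map (crossTensor y A B).hom ≫ (crossCompApp h (A ⊗ B)).hom =
      ((crossCompApp h A).hom ⊗ₘ (crossCompApp h B).hom) ≫ (crossTensor z A B).hom := by
  obtain ⟨a, A⟩ := A
  obtain ⟨b, B⟩ := B
  have hm : x⁻¹ * y⁻¹ = z⁻¹ := by rw [← h, mul_inv_rev]
  have ga : x⁻¹ * (y⁻¹ * a * y) = (z⁻¹ * a * z) * x⁻¹ := by subst h; group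
  have gb : x⁻¹ * (y⁻¹ * b * y) = (z⁻¹ * b * z) * x⁻¹ := by subst h; group
  have gc : x⁻¹ * (y⁻¹ * (a * b) * y) = (z⁻¹ * (a * b) * z) * x⁻¹ := by subst h; group
  have h₁ : y⁻¹ * a * y * (y⁻¹ * b * y) = y⁻¹ * (a * b) * y := by group
  have h₂ : z⁻¹ * a * z * (z⁻¹ * b * z) = z⁻¹ * (a * b) * z := by group
  have eA := crossCompApp_crossIncl h rfl rfl rfl (conj_eq y a) ga (conj_eq z a) hm A
  have eB := crossCompApp_crossIncl h rfl rfl rfl (conj_eq y b) gb (conj_eq z b) hm B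
  have eC := crossCompApp_crossIncl h rfl rfl rfl (conj_eq y _) gc (conj_eq z _) hm
    ((M.tensor rfl).obj A B)
  have e₁ := crossTensor_crossIncl rfl rfl h₁ (conj_eq y a) (conj_eq y b) (conj_eq y _) A B
  have e₂ := crossTensor_crossIncl rfl h₁ h₂ ga gb gc ((M.ps.act y⁻¹ (conj_eq y a)).obj A)
    ((M.ps.act y⁻¹ (conj_eq y b)).obj B)
  have e₃ := crossTensor_crossIncl rfl rfl h₂ (conj_eq z a) (conj_eq z b) (conj_eq z _) A B
  have hM := congrArg (inclMap (N := fun a => M.ps.fib a)) (M.tensorAct_mul rfl h₁ h₂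
    (conj_eq y a) (conj_eq y b) (conj_eq y _) ga gb gc (conj_eq z a) (conj_eq z b) (conj_eq z _)
    hm A B)
  rw [inclMap_comp, inclMap_comp, inclMap_comp] at hM
  have n := crossCompApp_naturality h (tensorIncl rfl A B).hom
  have nt := crossTensor_naturality x (crossIncl rfl (conj_eq y a) A).hom
    (crossIncl rfl (conj_eq y b) B).hom
  have e₁' := congrArg (M.cross x).map e₁
  simp only [Functor.map_comp] at e₁'
  rw [← cancel_mono ((M.cross z).map (tensorIncl rfl A B).hom ≫
    (crossIncl rfl (conj_eq z _) ((M.tensor rfl).obj A B)).hom)]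
  simp only [Category.assoc]
  rw [← e₃, ← reassoc_of% n, ← eC, ← reassoc_of% e₁', ← reassoc_of% nt,
    reassoc_of% crossIncl_naturality, ← reassoc_of% e₂, hM, tensorHom_comp_tensorHom_assoc,
    tensorHom_comp_tensorHom_assoc, ← eA, ← eB, ← reassoc_of% tensorIncl_naturality,
    tensorHom_comp_tensorHom_assoc]
  simp only [Category.assoc]

theorem crossComp_one {x y z : G} (h : y * x = z) :
    (crossOne x).hom ≫ (M.cross x).map (crossOne y).hom ≫ (crossCompApp h (𝟙_ M.Tot)).hom =
      (crossOne z).hom := by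
  have hm : x⁻¹ * y⁻¹ = z⁻¹ := by rw [← h, mul_inv_rev]
  have hf : y⁻¹ * 1 = 1 * y⁻¹ := by simp
  have hg : x⁻¹ * 1 = 1 * x⁻¹ := by simp
  have he : z⁻¹ * 1 = 1 * z⁻¹ := by simp
  have e := crossCompApp_crossIncl h rfl rfl rfl hf hg he hm M.unit
  have e₁ := crossOne_crossIncl (M := M) (x := x) rfl hg
  have e₂ := crossOne_crossIncl (M := M) (x := y) rfl hf
  have e₃ := crossOne_crossIncl (M := M) (x := z) rfl he
  have hM := congrArg (inclMap (N := fun a => M.ps.fib a)) (M.unitAct_mul hf hg he hm)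
  rw [inclMap_comp, inclMap_comp] at hM
  have e₂' := congrArg (M.cross x).map e₂
  rw [Functor.map_comp] at e₂'
  rw [← cancel_mono (crossIncl rfl he M.unit).hom, e₃, ← hM, ← e₁]
  simp only [Category.assoc]
  erw [← e, reassoc_of% e₂', reassoc_of% crossIncl_naturality]

/-- This is `tensorAct_one`. The comparison involves `inv_one`, since crossing by `1` is the action
of `1⁻¹`. -/
theorem crossUnit_tensor (A B : M.Tot) :
    ((crossUnitApp A).hom ⊗ₘ (crossUnitApp B).hom) ≫ (crossTensor 1 A B).hom =
      (crossUnitApp (A ⊗ B)).hom := by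
  obtain ⟨a, A⟩ := A
  obtain ⟨b, B⟩ := B
  have h : ∀ a : G, 1 * a = a * 1 := fun a => by simp
  have eA := crossUnitApp_crossIncl (h a) A
  have eB := crossUnitApp_crossIncl (h b) B
  have eC := crossUnitApp_crossIncl (h (a * b)) ((M.tensor rfl).obj A B)
  have e₁ := crossTensor_crossIncl inv_one rfl rfl (h a) (h b) (h (a * b)) A B
  have hM := congrArg (inclMap (N := fun a => M.ps.fib a)) (M.tensorAct_one rfl (h a) (h b) (h _)
    A B)
  rw [inclMap_comp] at hM
  have n := crossUnitApp_naturality (tensorIncl rfl A B).hom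
  have hmono : Mono (inclMap (N := fun a => M.ps.fib a)
      (M.ps.actOne (h (a * b)) ((M.tensor rfl).obj A B)).hom) :=
    inferInstanceAs (Mono (inclIso (N := fun a => M.ps.fib a)
      (M.ps.actOne (h (a * b)) ((M.tensor rfl).obj A B))).hom)
  rw [← cancel_mono ((M.cross 1).map (tensorIncl rfl A B).hom ≫
    (crossIncl inv_one (h _) ((M.tensor rfl).obj A B)).hom ≫
      inclMap (M.ps.actOne (h (a * b)) ((M.tensor rfl).obj A B)).hom)]
  simp only [Category.assoc]
  rw [← reassoc_of% n, eC, ← reassoc_of% e₁, hM, Category.comp_id,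
    ← tensorIncl_naturality, tensorHom_comp_tensorHom_assoc, tensorHom_comp_tensorHom_assoc]
  simp only [Category.assoc]
  rw [eA, eB, id_tensorHom_id, Category.id_comp]

theorem crossUnit_one : (crossUnitApp (𝟙_ M.Tot)).hom = (crossOne 1).hom := by
  have h : (1 : G) * 1 = 1 * 1 := rfl
  have e₁ := crossUnitApp_crossIncl h M.unit
  have e₂ := crossOne_crossIncl (M := M) inv_one h
  have hM := congrArg (inclMap (N := fun a => M.ps.fib a)) (M.unitAct_one h)
  rw [inclMap_comp, ← e₂] at hM
  rw [← cancel_mono ((crossIncl inv_one h M.unit).hom ≫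
    (inclIso (M.ps.actOne h M.unit)).hom)]
  exact e₁.trans (hM.symm.trans (Category.assoc _ _ _))

/-- This is `actMul_assoc` for the inverses of `c`, `b`, `a`; `p`, `q` and `s` name the products in
the reversed order. -/
theorem crossComp_assoc {a b c p q s : G} (hp : b * a = p) (hs : c * p = s) (hq : c * b = q)
    (hs' : q * a = s) (X : M.Tot) :
    (crossCompApp hp ((M.cross c).obj X)).hom ≫ (crossCompApp hs X).hom =
      (M.cross a).map (crossCompApp hq X).hom ≫ (crossCompApp hs' X).hom := by
  obtain ⟨d, X⟩ := X
  have hc : c⁻¹ * d = c⁻¹ * d * c * c⁻¹ := conj_eq _ _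
  have hb : b⁻¹ * (c⁻¹ * d * c) = (q⁻¹ * d * q) * b⁻¹ := by subst hq; group
  have ha : a⁻¹ * (q⁻¹ * d * q) = (s⁻¹ * d * s) * a⁻¹ := by subst hs'; group
  have hpp : p⁻¹ * (c⁻¹ * d * c) = (s⁻¹ * d * s) * p⁻¹ := by subst hs; group
  have e₁ := crossCompApp_crossIncl hp rfl rfl rfl hb ha hpp (by rw [← hp, mul_inv_rev])
    ((M.ps.act c⁻¹ hc).obj X)
  have e₂ := crossCompApp_crossIncl hs rfl rfl rfl hc hpp (conj_eq s d)
    (by rw [← hs, mul_inv_rev]) X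
  have e₃ := crossCompApp_crossIncl hq rfl rfl rfl hc hb (conj_eq q d)
    (by rw [← hq, mul_inv_rev]) X
  have e₄ := crossCompApp_crossIncl hs' rfl rfl rfl (conj_eq q d) ha (conj_eq s d)
    (by rw [← hs', mul_inv_rev]) X
  have hM := congrArg (inclMap (N := fun a => M.ps.fib a)) (M.ps.actMul_assoc hc hb ha
    (conj_eq q d) hpp (conj_eq s d) (by rw [← hq, mul_inv_rev]) (by rw [← hp, mul_inv_rev])
    (by rw [← hs', mul_inv_rev]) (by rw [← hs, mul_inv_rev]) X)
  rw [inclMap_comp, inclMap_comp] at hM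
  have n := crossCompApp_naturality hp (crossIncl rfl hc X).hom
  have e₃' := congrArg (M.cross a).map e₃
  simp only [Functor.map_comp] at e₃'
  rw [← cancel_mono (crossIncl rfl (conj_eq s d) X).hom, Category.assoc, Category.assoc, ← e₂,
    ← e₄, ← reassoc_of% n, reassoc_of% e₁.symm, hM, ← reassoc_of% e₃',
    reassoc_of% crossIncl_naturality]

/-- This is `actMul_one_left`: the composition constraint with the identity is `actOne`, which the
unit constraint inverts. -/
theorem crossUnit_crossComp {a : G} (h : a * 1 = a) (X : M.Tot) :
    (crossUnitApp ((M.cross a).obj X)).hom ≫ (crossCompApp h X).hom = 𝟙 _ := by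
  obtain ⟨p, X⟩ := X
  have e := crossCompApp_crossIncl h rfl inv_one rfl (conj_eq a p)
    (show (1 : G) * _ = _ * 1 by simp) (conj_eq a p) (one_mul _) X
  rw [actMul_one_left] at e
  rw [← cancel_mono (crossIncl rfl (conj_eq a p) X).hom, Category.assoc, ← e,
    ← reassoc_of% crossUnitApp_naturality, crossUnitApp_crossIncl, Category.comp_id,
    Category.id_comp]

theorem map_crossUnit_crossComp {a : G} (h : 1 * a = a) (X : M.Tot) :
    (M.cross a).map (crossUnitApp X).hom ≫ (crossCompApp h X).hom = 𝟙 _ := by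
  obtain ⟨p, X⟩ := X
  have h1 : (1 : G) * p = p * 1 := by simp
  have e := crossCompApp_crossIncl h inv_one rfl rfl h1 (conj_eq a p) (conj_eq a p) (mul_one _) X
  rw [actMul_one_right, ← crossIncl_naturality, ← Functor.map_comp_assoc] at e
  rw [← cancel_mono (crossIncl rfl (conj_eq a p) X).hom, Category.assoc, ← e,
    ← Functor.map_comp_assoc, crossUnitApp_crossIncl]
  simp

end Monoidale

/-! ### The inverse braiding on the coproduct -/

namespace BraidedMonoidale

open LinCat.Total PsGAut Monoidale

variable {k : Type w} [CommRing k] {G : Type u} [Group G] {M : BraidedMonoidale.{w, v, u} k G}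

theorem inv_eq_of_cross {x a : G} (h : x * a = 1) : x⁻¹ = a := inv_eq_of_mul_eq_one_right h

/-- The inverse braiding of objects of any degree. -/
noncomputable def totBraid {x : G} (A B : M.Tot) (h : x * A.deg = 1) :
    (M.cross x).obj B ⊗ A ≅ A ⊗ B :=
  MonoidalCategory.whiskerRightIso (crossIncl (a := B.deg) (b := x⁻¹ * B.deg * x) (g := A.deg)
      (inv_eq_of_cross h) (by rw [← inv_eq_of_cross h]; group) B.obj) A ≪≫
    tensorIncl (c := A.deg * B.deg) (by rw [← inv_eq_of_cross h]; group) _ A.obj ≪≫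
      inclIso (M.braid rfl _ _ A.obj B.obj).symm ≪≫ (tensorIncl rfl A.obj B.obj).symm

/-- Characterises `totBraid` by the braiding of `M` at any names of the degrees. The braiding sits
on the opposite side from `totBraid`, so the axioms of `M` can be used without inverting them. -/
theorem totBraid_crossIncl {x a b b' c : G} (hx : x * a = 1) (hx' : x⁻¹ = a) (h : a * b = c)
    (hb : a * b = b' * a) (h' : b' * a = c) (A : M.ps.fib a) (B : M.ps.fib b) :
    (crossIncl hx' hb B).hom ▷ (⟨a, A⟩ : M.Tot) ≫ (tensorIncl h' _ A).hom =
      (totBraid (⟨a, A⟩ : M.Tot) ⟨b, B⟩ hx).hom ≫ (tensorIncl h A B).hom ≫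
        inclMap (M.braid h hb h' A B).hom := by
  obtain rfl : a = x⁻¹ := hx'.symm
  obtain rfl := eq_of_cross hx' hb
  subst h
  have e : (totBraid (⟨x⁻¹, A⟩ : M.Tot) ⟨b, B⟩ hx).hom =
    (crossIncl hx' hb B).hom ▷ (⟨x⁻¹, A⟩ : M.Tot) ≫ (tensorIncl h' _ A).hom ≫
      inclMap (M.braid rfl hb h' A B).inv ≫ (tensorIncl rfl A B).inv := rfl
  rw [e]
  simp only [Category.assoc, Iso.inv_hom_id_assoc]
  rw [← inclMap_comp, Iso.inv_hom_id, inclMap_id]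
  erw [Category.comp_id]

theorem totBraid_naturality {x : G} {A A' B B' : M.Tot} (h : x * A.deg = 1) (h' : x * A'.deg = 1)
    (f : A ⟶ A') (g : B ⟶ B') : ((M.cross x).map g ⊗ₘ f) ≫ (totBraid A' B' h').hom =
      (totBraid A B h).hom ≫ (f ⊗ₘ g) := by
  induction f using hom_cases with
  | zero => rw [tensorHom_zero, zero_tensorHom, Limits.zero_comp, Limits.comp_zero]
  | @incl a A A' f =>
    induction g using hom_cases with
    | zero => rw [Functor.map_zero, tensorHom_zero, zero_tensorHom, Limits.zero_comp, Limits.comp_zero]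
    | @incl b B B' g =>
      have hx : x⁻¹ = a := inv_eq_of_cross h
      have hb : a * b = (x⁻¹ * b * x) * a := by rw [← hx]; group
      have hc : (x⁻¹ * b * x) * a = a * b := hb.symm
      have e₁ := totBraid_crossIncl h hx rfl hb hc A B
      have e₂ := totBraid_crossIncl h hx rfl hb hc A' B'
      have hM := congrArg (inclMap (N := fun a => M.ps.fib a)) (M.braid_naturality rfl hb hc f g)
      rw [inclMap_comp, inclMap_comp] at hM
      have hmono : Mono (inclMap (N := fun a => M.ps.fib a) (M.braid rfl hb hc A' B').hom) :=
        inferInstanceAs (Mono (inclIso (N := fun a => M.ps.fib a) (M.braid rfl hb hc A' B')).hom)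
      rw [← cancel_mono ((tensorIncl rfl A' B').hom ≫ inclMap (M.braid rfl hb hc A' B').hom)]
      simp only [Category.assoc]
      rw [← e₂, reassoc_of% tensorIncl_naturality, hM, ← reassoc_of% e₁, ← tensorHom_id,
        tensorHom_comp_tensorHom_assoc, crossIncl_naturality, Category.comp_id,
        ← tensorIncl_naturality, ← tensorHom_id, tensorHom_comp_tensorHom_assoc, Category.id_comp]

theorem tensorIncl_assoc_inv {a b c p q s : G} (hp : a * b = p) (hpc : p * c = s) (hq : b * c = q)
    (haq : a * q = s) (A : M.ps.fib a) (B : M.ps.fib b) (C : M.ps.fib c) :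
    (⟨a, A⟩ : M.Tot) ◁ (tensorIncl hq B C).hom ≫ (tensorIncl haq A ((M.tensor hq).obj B C)).hom ≫
        inclMap (M.assoc hp hpc hq haq A B C).inv =
      (α_ (⟨a, A⟩ : M.Tot) ⟨b, B⟩ ⟨c, C⟩).inv ≫ (tensorIncl hp A B).hom ▷ (⟨c, C⟩ : M.Tot) ≫
        (tensorIncl hpc ((M.tensor hp).obj A B) C).hom := by
  have h := tensorIncl_assoc hp hpc hq haq A B C
  rw [Iso.eq_inv_comp, ← reassoc_of% h, ← inclMap_comp, Iso.hom_inv_id, inclMap_id,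
    Category.comp_id]

/-- The right hexagon of `M`, carried into the coproduct. Both sides are compared after appending
the isomorphism `X`, which is one leg of that hexagon. -/
theorem totBraid_hexagon_right {x : G} (A B D : M.Tot) (hx : x * A.deg = 1) :
    (α_ ((M.cross x).obj B) ((M.cross x).obj D) A).inv ≫ (crossTensor x B D).hom ▷ A ≫
        (totBraid A (B ⊗ D) hx).hom ≫ (α_ A B D).inv =
      (M.cross x).obj B ◁ (totBraid A D hx).hom ≫ (α_ ((M.cross x).obj B) A D).inv ≫
        (totBraid A B hx).hom ▷ D := by
  obtain ⟨a, A⟩ := A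
  obtain ⟨b, B⟩ := B
  obtain ⟨d, D⟩ := D
  have hx' : x⁻¹ = a := inv_eq_of_cross hx
  have key : ∀ b : G, a * b = (x⁻¹ * b * x) * a := fun b => by rw [← hx']; group
  have haq : a * (b * d) = a * b * d := (mul_assoc _ _ _).symm
  have hq' : x⁻¹ * b * x * (x⁻¹ * d * x) = x⁻¹ * (b * d) * x := by group
  have hqa : x⁻¹ * (b * d) * x * a = a * b * d := by rw [← key, haq]
  have hbr : x⁻¹ * b * x * (a * d) = a * b * d := by rw [key b, mul_assoc _ a d]
  have eB := totBraid_crossIncl hx hx' rfl (key b) (key b).symm A B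
  have eD := totBraid_crossIncl hx hx' rfl (key d) (key d).symm A D
  have eBD := totBraid_crossIncl hx hx' haq (key (b * d)) hqa A ((M.tensor rfl).obj B D)
  have eM := crossTensor_crossIncl hx' rfl hq' (key b) (key d) (key _) B D
  have hM := congrArg (inclMap (N := fun a => M.ps.fib a)) (M.hexagon_right rfl rfl rfl haq (key b)
    (key d) hq' (key _) hqa (key b).symm rfl (key d).symm hbr A B D)
  simp only [inclMap_comp] at hM
  -- `X` is the leg through the braiding of `A` with the product. In `L` this form is used directly.
  -- In `R` it is first replaced, by `hM`, with the leg that braids `A` past `B` and `D` in turn. In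
  -- both cases the braidings of `M` cancel against `totBraid`.
  let X : ((⟨a, A⟩ ⊗ ⟨b, B⟩ : M.Tot) ⊗ ⟨d, D⟩) ≅ _ :=
    MonoidalCategory.whiskerRightIso (tensorIncl rfl A B) _ ≪≫ tensorIncl rfl _ D ≪≫
      inclIso (N := fun a => M.ps.fib a) (M.assoc rfl rfl rfl haq A B D) ≪≫
        inclIso (N := fun a => M.ps.fib a) (M.braid haq (key (b * d)) hqa A ((M.tensor rfl).obj B D)) ≪≫
        inclIso (N := fun a => M.ps.fib a) ((M.tensor hqa).mapIso (M.tensorAct rfl hq' (key b) (key d) (key _) B D).symm (Iso.refl A)) ≪≫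
        inclIso (N := fun a => M.ps.fib a) (M.assoc hq' hqa (key d).symm hbr ((M.ps.act a (key b)).obj B) ((M.ps.act a (key d)).obj D) A)
  have hX : X.hom = (tensorIncl rfl A B).hom ▷ _ ≫ (tensorIncl rfl _ D).hom ≫
      inclMap (M.assoc rfl rfl rfl haq A B D).hom ≫
      inclMap (M.braid haq (key (b * d)) hqa A ((M.tensor rfl).obj B D)).hom ≫
      inclMap ((M.tensor hqa).map (M.tensorAct rfl hq' (key b) (key d) (key _) B D).inv (𝟙 A)) ≫
      inclMap (M.assoc hq' hqa (key d).symm hbr ((M.ps.act a (key b)).obj B)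
        ((M.ps.act a (key d)).obj D) A).hom := rfl
  have nδ := totBraid_naturality (A := (⟨a, A⟩ : M.Tot)) hx hx (𝟙 _) (tensorIncl rfl B D).hom
  rw [tensorHom_id, id_tensorHom] at nδ
  have eM' : (crossTensor x (⟨b, B⟩ : M.Tot) ⟨d, D⟩).hom ≫ (M.cross x).map (tensorIncl rfl B D).hom ≫
      (crossIncl hx' (key _) _).hom ≫ inclMap (M.tensorAct rfl hq' (key b) (key d) (key _) B D).inv =
      ((crossIncl hx' (key b) B).hom ⊗ₘ (crossIncl hx' (key d) D).hom) ≫ (tensorIncl hq' _ _).hom := by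
    rw [← reassoc_of% eM, ← inclMap_comp, Iso.hom_inv_id, inclMap_id, Category.comp_id]
  have hα := tensorIncl_assoc rfl rfl rfl haq A B D
  have hα₁ := tensorIncl_assoc (key b).symm rfl rfl hbr ((M.ps.act a (key b)).obj B) A D
  have hα₂ := tensorIncl_assoc hq' hqa (key d).symm hbr ((M.ps.act a (key b)).obj B)
        ((M.ps.act a (key d)).obj D) A
  have L : (crossTensor x (⟨b, B⟩ : M.Tot) ⟨d, D⟩).hom ▷ (⟨a, A⟩ : M.Tot) ≫
        (totBraid (⟨a, A⟩ : M.Tot) (⟨b, B⟩ ⊗ ⟨d, D⟩) hx).hom ≫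
          (MonoidalCategoryStruct.associator (⟨a, A⟩ : M.Tot) ⟨b, B⟩ ⟨d, D⟩).inv ≫ X.hom =
      (MonoidalCategoryStruct.associator _ _ (⟨a, A⟩ : M.Tot)).hom ≫
        ((crossIncl hx' (key b) B).hom ⊗ₘ ((crossIncl hx' (key d) D).hom ▷ _)) ≫
        _ ◁ (tensorIncl (key d).symm _ A).hom ≫ (tensorIncl hbr _ _).hom := by
    rw [hX, reassoc_of% hα, Iso.inv_hom_id_assoc, ← reassoc_of% nδ, ← reassoc_of% eBD,
      ← reassoc_of% tensorIncl_naturality_left, ← MonoidalCategory.comp_whiskerRight_assoc, ← MonoidalCategory.comp_whiskerRight_assoc,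
      ← MonoidalCategory.comp_whiskerRight_assoc, Category.assoc, Category.assoc, eM',
      MonoidalCategory.comp_whiskerRight_assoc, hα₂, ← tensorHom_id, ← tensorHom_id, associator_naturality_assoc]
  have R : (M.cross x).obj (⟨b, B⟩ : M.Tot) ◁ (totBraid (⟨a, A⟩ : M.Tot) ⟨d, D⟩ hx).hom ≫
        (MonoidalCategoryStruct.associator _ _ _).inv ≫
        (totBraid (⟨a, A⟩ : M.Tot) ⟨b, B⟩ hx).hom ▷ _ ≫ X.hom =
      ((crossIncl hx' (key b) B).hom ⊗ₘ ((crossIncl hx' (key d) D).hom ▷ _)) ≫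
        _ ◁ (tensorIncl (key d).symm _ A).hom ≫ (tensorIncl hbr _ _).hom := by
    rw [hX, hM, ← reassoc_of% tensorIncl_naturality_left, ← MonoidalCategory.comp_whiskerRight_assoc,
      ← MonoidalCategory.comp_whiskerRight_assoc, Category.assoc, ← eB, MonoidalCategory.comp_whiskerRight_assoc, reassoc_of% hα₁,
      ← tensorIncl_naturality_right, MonoidalCategory.associator_naturality_left_assoc,
      Iso.inv_hom_id_assoc]
    refine Eq.trans (MonoidalCategory.whisker_exchange_assoc _ _ _) ?_
    dsimp only at eD ⊢
    rw [← MonoidalCategory.whiskerLeft_comp_assoc, ← MonoidalCategory.whiskerLeft_comp_assoc,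
      Category.assoc, ← eD, MonoidalCategory.whiskerLeft_comp_assoc, MonoidalCategory.tensorHom_def, Category.assoc]
  rw [← cancel_mono X.hom]
  simp only [Category.assoc]
  rw [L, R, Iso.inv_hom_id_assoc]

/-- The left hexagon of `M`, by the same method as for the right one; the composition constraint of
crossings corresponds to `actMul` in the hexagon. -/
theorem totBraid_hexagon_left {x y z : G} (hz : y * x = z) (A B D : M.Tot) (ha : x * A.deg = 1)
    (hb : y * B.deg = 1) (hzp : z * (A ⊗ B).deg = 1) :
    (α_ ((M.cross x).obj ((M.cross y).obj D)) A B).hom ≫ (crossCompApp hz D).hom ▷ (A ⊗ B) ≫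
        (totBraid (A ⊗ B) D hzp).hom ≫ (α_ A B D).hom =
      (totBraid A ((M.cross y).obj D) ha).hom ▷ B ≫ (α_ A ((M.cross y).obj D) B).hom ≫
        A ◁ (totBraid B D hb).hom := by
  obtain ⟨a, A⟩ := A
  obtain ⟨b, B⟩ := B
  obtain ⟨d, D⟩ := D
  have hx : x⁻¹ = a := inv_eq_of_cross ha
  have hy : y⁻¹ = b := inv_eq_of_cross hb
  have hzi : z⁻¹ = a * b := by rw [← hz, mul_inv_rev, hx, hy]
  have hzab : z * (a * b) = 1 := by rw [← hzi, mul_inv_cancel]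
  -- The conjugates of `d` get opaque names. Only their defining equations matter to the axioms of
  -- `M`.
  obtain ⟨c', hc⟩ : ∃ c', b * d = c' * b := ⟨b * d * b⁻¹, by group⟩
  obtain ⟨c'', hc'⟩ : ∃ c'', a * c' = c'' * a := ⟨a * c' * a⁻¹, by group⟩
  have haq : a * (b * d) = a * b * d := (mul_assoc _ _ _).symm
  have hpc' : a * b * d = c'' * (a * b) := by rw [mul_assoc, hc, ← mul_assoc, hc', mul_assoc]
  have hrb : a * c' * b = a * b * d := by rw [mul_assoc, ← hc, haq]
  have hM := congrArg (inclMap (N := fun a => M.ps.fib a)) (M.hexagon_left rfl rfl rfl haq hc hc' hpc'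
    hpc'.symm hc.symm rfl hc'.symm hrb A B D)
  simp only [inclMap_comp] at hM
  have eD := totBraid_crossIncl hb hy rfl hc hc.symm B D
  have eD' := totBraid_crossIncl ha hx rfl hc' hc'.symm A ((M.ps.act b hc).obj D)
  have eABD := totBraid_crossIncl hzab hzi rfl hpc' hpc'.symm ((M.tensor rfl).obj A B) D
  have cc := crossCompApp_crossIncl hz hy hx hzi hc hc' hpc' rfl D
  have cc' : (crossCompApp hz (⟨d, D⟩ : M.Tot)).hom ≫ (crossIncl hzi hpc' D).hom ≫
      inclMap (M.ps.actMul hc hc' hpc' rfl D).inv =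
      (M.cross x).map (crossIncl hy hc D).hom ≫ (crossIncl hx hc' _).hom := by
    rw [← reassoc_of% cc, ← inclMap_comp, Iso.hom_inv_id, inclMap_id, Category.comp_id]
  have hα := tensorIncl_assoc_inv rfl rfl rfl haq A B D
  have hα₁ := tensorIncl_assoc_inv rfl hrb hc.symm haq A ((M.ps.act b hc).obj D) B
  have hα₂ := tensorIncl_assoc_inv hc'.symm hrb rfl hpc'.symm
    ((M.ps.act a hc').obj ((M.ps.act b hc).obj D)) A B
  have nδ := totBraid_naturality hzp hzab (tensorIncl rfl A B).hom (𝟙 (⟨d, D⟩ : M.Tot))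
  rw [CategoryTheory.Functor.map_id, tensorHom_id, id_tensorHom] at nδ
  have nδ' := totBraid_naturality ha ha (𝟙 (⟨a, A⟩ : M.Tot)) (crossIncl hy hc D).hom
  rw [tensorHom_id, id_tensorHom] at nδ'
  -- Again one leg of the hexagon: `L` uses the braiding of the product of `A` and `B` with `D`, and
  -- `R` the two successive braidings supplied by `hM`.
  let X : (⟨a, A⟩ ⊗ (⟨b, B⟩ ⊗ ⟨d, D⟩) : M.Tot) ≅ _ :=
    MonoidalCategory.whiskerLeftIso _ (tensorIncl rfl B D) ≪≫ tensorIncl haq A _ ≪≫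
      inclIso (N := fun a => M.ps.fib a) (M.assoc rfl rfl rfl haq A B D).symm ≪≫
      inclIso (N := fun a => M.ps.fib a) (M.braid rfl hpc' hpc'.symm ((M.tensor rfl).obj A B) D) ≪≫
      inclIso (N := fun a => M.ps.fib a) ((M.tensor hpc'.symm).mapIso
        (M.ps.actMul hc hc' hpc' rfl D).symm (Iso.refl ((M.tensor rfl).obj A B))) ≪≫
      inclIso (N := fun a => M.ps.fib a) (M.assoc hc'.symm hrb rfl hpc'.symm
        ((M.ps.act a hc').obj ((M.ps.act b hc).obj D)) A B).symm
  have hX : X.hom = _ ◁ (tensorIncl rfl B D).hom ≫ (tensorIncl haq A _).hom ≫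
      inclMap (M.assoc rfl rfl rfl haq A B D).inv ≫
      inclMap (M.braid rfl hpc' hpc'.symm ((M.tensor rfl).obj A B) D).hom ≫
      inclMap ((M.tensor hpc'.symm).map (M.ps.actMul hc hc' hpc' rfl D).inv
        (𝟙 ((M.tensor rfl).obj A B))) ≫
      inclMap (M.assoc hc'.symm hrb rfl hpc'.symm
        ((M.ps.act a hc').obj ((M.ps.act b hc).obj D)) A B).inv := rfl
  have L : (crossCompApp hz (⟨d, D⟩ : M.Tot)).hom ▷ (⟨a, A⟩ ⊗ ⟨b, B⟩ : M.Tot) ≫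
        (totBraid (⟨a, A⟩ ⊗ ⟨b, B⟩ : M.Tot) ⟨d, D⟩ hzp).hom ≫
        (MonoidalCategoryStruct.associator (⟨a, A⟩ : M.Tot) ⟨b, B⟩ ⟨d, D⟩).hom ≫ X.hom =
      (MonoidalCategoryStruct.associator _ (⟨a, A⟩ : M.Tot) ⟨b, B⟩).inv ≫
      ((M.cross x).map (crossIncl hy hc D).hom ≫ (crossIncl hx hc' _).hom) ▷ _ ▷ _ ≫
      (tensorIncl hc'.symm _ A).hom ▷ _ ≫ (tensorIncl hrb _ B).hom := by
    rw [hX, reassoc_of% hα, Iso.hom_inv_id_assoc, ← reassoc_of% nδ, ← reassoc_of% eABD,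
      ← reassoc_of% tensorIncl_naturality_left]
    refine Eq.trans (congrArg _ (MonoidalCategory.whisker_exchange_assoc _ _ _)) ?_
    refine Eq.trans (congrArg _ (congrArg _ (MonoidalCategory.whisker_exchange_assoc _ _ _))) ?_
    rw [← MonoidalCategory.comp_whiskerRight_assoc, ← MonoidalCategory.comp_whiskerRight_assoc,
      Category.assoc, cc', hα₂, MonoidalCategory.associator_inv_naturality_left_assoc]
  have R : (totBraid (⟨a, A⟩ : M.Tot) ((M.cross y).obj (⟨d, D⟩ : M.Tot)) ha).hom ▷ (⟨b, B⟩ : M.Tot) ≫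
        (MonoidalCategoryStruct.associator _ _ _).hom ≫
        (⟨a, A⟩ : M.Tot) ◁ (totBraid (⟨b, B⟩ : M.Tot) ⟨d, D⟩ hb).hom ≫ X.hom =
      ((M.cross x).map (crossIncl hy hc D).hom ≫ (crossIncl hx hc' _).hom) ▷ _ ▷ _ ≫
      (tensorIncl hc'.symm _ A).hom ▷ _ ≫ (tensorIncl hrb _ B).hom := by
    rw [hX, hM, ← reassoc_of% tensorIncl_naturality_right, ← MonoidalCategory.whiskerLeft_comp_assoc,
      ← MonoidalCategory.whiskerLeft_comp_assoc, Category.assoc, ← eD,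
      MonoidalCategory.whiskerLeft_comp_assoc, reassoc_of% hα₁, ← tensorIncl_naturality_left]
    dsimp only
    rw [← MonoidalCategory.associator_naturality_middle_assoc, Iso.hom_inv_id_assoc,
      ← MonoidalCategory.comp_whiskerRight_assoc, ← nδ']
    simp only [← MonoidalCategory.comp_whiskerRight_assoc]
    rw [Category.assoc, ← eD', ← MonoidalCategory.comp_whiskerRight_assoc]
  rw [← cancel_mono X.hom]
  simp only [Category.assoc]
  rw [L, R, Iso.hom_inv_id_assoc]

/-- This is `braid_act` for the element `h⁻¹`. The hypotheses on `y` express that $h^{-1}a$ can be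
written in two ways, as $h^{-1}$ after $a$ or as $a_1$ after $h^{-1}$. -/
theorem totBraid_cross {h x x' y : G} (hy : x * h = y) (hy' : h * x' = y) (A B : M.Tot)
    (ha : x * A.deg = 1) (ha' : x' * ((M.cross h).obj A).deg = 1) :
    (crossCompApp hy' B).hom ▷ (M.cross h).obj A ≫ (crossCompApp hy B).inv ▷ (M.cross h).obj A ≫
        (crossTensor h ((M.cross x).obj B) A).hom ≫ (M.cross h).map (totBraid A B ha).hom =
      (totBraid ((M.cross h).obj A) ((M.cross h).obj B) ha').hom ≫ (crossTensor h A B).hom := by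
  obtain ⟨a, A⟩ := A
  obtain ⟨b, B⟩ := B
  have hx : x⁻¹ = a := inv_eq_of_cross ha
  obtain ⟨a₁, ga⟩ : ∃ a₁, h⁻¹ * a = a₁ * h⁻¹ := ⟨h⁻¹ * a * h, by group⟩
  obtain ⟨b₁, gb⟩ : ∃ b₁, h⁻¹ * b = b₁ * h⁻¹ := ⟨h⁻¹ * b * h, by group⟩
  obtain ⟨c₁, gc⟩ : ∃ c₁, h⁻¹ * (a * b) = c₁ * h⁻¹ := ⟨h⁻¹ * (a * b) * h, by group⟩
  obtain ⟨b', hb⟩ : ∃ b', a * b = b' * a := ⟨a * b * a⁻¹, by group⟩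
  obtain ⟨b₁', gb'⟩ : ∃ b₁', h⁻¹ * b' = b₁' * h⁻¹ := ⟨h⁻¹ * b' * h, by group⟩
  have hx' : x'⁻¹ = a₁ := by
    rw [inv_eq_of_cross ha']
    exact eq_of_cross rfl ga
  have ha₁ : x' * a₁ = 1 := by rw [← hx', mul_inv_cancel]
  have h₁ : a₁ * b₁ = c₁ := by
    rw [← mul_left_inj h⁻¹, ← gc, mul_assoc, ← gb, ← mul_assoc, ← ga, mul_assoc]
  have h₁' : b₁' * a₁ = c₁ := by
    rw [← mul_left_inj h⁻¹, ← gc, mul_assoc, ← ga, ← mul_assoc, ← gb', mul_assoc, hb]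
  have hb₁ : a₁ * b₁ = b₁' * a₁ := h₁.trans h₁'.symm
  have mb : h⁻¹ * a * b = b₁' * (h⁻¹ * a) := by rw [mul_assoc, hb, ← mul_assoc, gb', mul_assoc]
  have hyi : y⁻¹ = h⁻¹ * a := by rw [← hy, mul_inv_rev, hx]
  have hM := congrArg (inclMap (N := fun a => M.ps.fib a)) (M.braid_act rfl hb hb.symm h₁ hb₁ h₁' ga
    gb gb' gc rfl ga.symm mb A B)
  simp only [inclMap_comp] at hM
  have eB := totBraid_crossIncl ha hx rfl hb hb.symm A B
  have eB₁ := totBraid_crossIncl (A := (M.ps.act h⁻¹ ga).obj A) (B := (M.ps.act h⁻¹ gb).obj B)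
    ha₁ hx' h₁ hb₁ h₁'
  have e₁ := crossCompApp_crossIncl hy hx rfl hyi hb gb' mb rfl B
  have e₂ := crossCompApp_crossIncl hy' rfl hx' hyi gb hb₁ mb ga.symm B
  have t₁ := crossTensor_crossIncl rfl rfl h₁ ga gb gc A B
  have t₂ := crossTensor_crossIncl rfl hb.symm h₁' gb' ga gc ((M.ps.act a hb).obj B) A
  -- The change between the two factorisations of crossing by `y`, expressed by the two `actMul`
  -- constraints that occur in `braid_act`.
  have cc : (crossCompApp hy' (⟨b, B⟩ : M.Tot)).hom ≫ (crossCompApp hy (⟨b, B⟩ : M.Tot)).inv ≫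
      (M.cross h).map (crossIncl hx hb B).hom ≫ (crossIncl rfl gb' _).hom =
      (M.cross x').map (crossIncl rfl gb B).hom ≫ (crossIncl hx' hb₁ _).hom ≫
        inclMap ((M.ps.actMul gb hb₁ mb ga.symm B).hom ≫ (M.ps.actMul hb gb' mb rfl B).inv) := by
    rw [inclMap_comp, reassoc_of% e₂]
    congr 1
    rw [Iso.inv_comp_eq, ← reassoc_of% e₁, ← inclMap_comp, Iso.hom_inv_id, inclMap_id]
    erw [Category.comp_id]
  have nδ := totBraid_naturality ha' ha₁ (crossIncl rfl ga A).hom (crossIncl rfl gb B).hom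
  let X : (M.cross h).obj (⟨a, A⟩ ⊗ ⟨b, B⟩ : M.Tot) ≅ _ :=
    (M.cross h).mapIso (tensorIncl rfl A B) ≪≫ crossIncl rfl gc _ ≪≫
      inclIso (N := fun a => M.ps.fib a) ((M.ps.act h⁻¹ gc).mapIso (M.braid rfl hb hb.symm A B))
  have hX : X.hom = (M.cross h).map (tensorIncl rfl A B).hom ≫ (crossIncl rfl gc _).hom ≫
      inclMap ((M.ps.act h⁻¹ gc).map (M.braid rfl hb hb.symm A B).hom) := rfl
  rw [← cancel_mono X.hom]
  simp only [Category.assoc]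
  have L : (crossTensor h ((M.cross x).obj ⟨b, B⟩) (⟨a, A⟩ : M.Tot)).hom ≫
      (M.cross h).map (totBraid (⟨a, A⟩ : M.Tot) ⟨b, B⟩ ha).hom ≫ X.hom =
      (((M.cross h).map (crossIncl hx hb B).hom ≫ (crossIncl rfl gb' _).hom) ⊗ₘ
        (crossIncl rfl ga A).hom) ≫ (tensorIncl h₁' _ _).hom ≫
          inclMap (M.tensorAct hb.symm h₁' gb' ga gc ((M.ps.act a hb).obj B) A).hom := by
    rw [hX, ← crossIncl_naturality, ← Functor.map_comp_assoc, ← Functor.map_comp_assoc,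
      Category.assoc, ← eB, Functor.map_comp_assoc, ← reassoc_of% crossTensor_naturality_left,
      ← t₂, ← tensorHom_id, tensorHom_comp_tensorHom_assoc, Category.id_comp]
  have R : (totBraid ((M.cross h).obj (⟨a, A⟩ : M.Tot)) ((M.cross h).obj ⟨b, B⟩) ha').hom ≫
      (crossTensor h (⟨a, A⟩ : M.Tot) ⟨b, B⟩).hom ≫ X.hom =
      (((M.cross x').map (crossIncl rfl gb B).hom ≫ (crossIncl hx' hb₁ _).hom ≫
        inclMap ((M.ps.actMul gb hb₁ mb ga.symm B).hom ≫ (M.ps.actMul hb gb' mb rfl B).inv)) ⊗ₘ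
        (crossIncl rfl ga A).hom) ≫ (tensorIncl h₁' _ _).hom ≫
          inclMap (M.tensorAct hb.symm h₁' gb' ga gc ((M.ps.act a hb).obj B) A).hom := by
    rw [hX, ← reassoc_of% t₁, hM, ← reassoc_of% nδ, ← reassoc_of% eB₁,
      ← reassoc_of% tensorIncl_naturality_left, ← tensorHom_id, ← tensorHom_id,
      tensorHom_comp_tensorHom_assoc, tensorHom_comp_tensorHom_assoc, Category.comp_id, Category.assoc]
    erw [Category.comp_id]
  rw [L, R, ← cc, ← tensorHom_id, ← tensorHom_id, tensorHom_comp_tensorHom_assoc,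
    tensorHom_comp_tensorHom_assoc, Category.id_comp, Category.id_comp, Category.assoc]

end BraidedMonoidale

/-! ### The finite direct sum completion: families and matrices -/

/-- Codes for finite types, closed under products. -/
inductive Shape
  | fin (n : ℕ)
  | prod (s t : Shape)

namespace Shape

/-- The finite type with a given code. -/
def El : Shape → Type
  | fin n => Fin n
  | prod s t => El s × El t

/-- Using codes instead of arbitrary finite types keeps the type of families in the given universe.
Unlike numbers, they make the indices of a tensor product literally pairs, so associators come from
`Equiv.prodAssoc`. -/
instance fintype : ∀ s : Shape, Fintype s.El
  | fin n => inferInstanceAs (Fintype (Fin n))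
  | prod s t => @instFintypeProd s.El t.El (fintype s) (fintype t)

end Shape

/-- Finite families of objects of `T`, each with a label in `Λ` that morphisms ignore. -/
structure Fam (T Λ : Type u) where
  label : Λ
  shape : Shape
  obj : shape.El → T

namespace Fam

variable {T Λ : Type u}

/-- The index type of a family. -/
abbrev Idx (X : Fam T Λ) : Type := X.shape.El

section Additive

variable [Category.{v} T] [Preadditive T]

open Classical in
/-- Morphisms of families are matrices of morphisms. -/
noncomputable instance : CategoryStruct (Fam T Λ) where
  Hom X Y := ∀ (i : X.Idx) (j : Y.Idx), X.obj i ⟶ Y.obj j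
  id X := fun i j => if h : i = j then eqToHom (congrArg X.obj h) else 0
  comp {_ Y _} f g := fun i k => ∑ j : Y.Idx, f i j ≫ g j k

theorem id_self (X : Fam T Λ) (i : X.Idx) : (𝟙 X : X ⟶ X) i i = 𝟙 _ := dif_pos rfl

theorem id_of_ne (X : Fam T Λ) {i j : X.Idx} (h : i ≠ j) : (𝟙 X : X ⟶ X) i j = 0 := dif_neg h

theorem comp_apply {X Y Z : Fam T Λ} (f : X ⟶ Y) (g : Y ⟶ Z) (i : X.Idx) (k : Z.Idx) :
    (f ≫ g) i k = ∑ j, f i j ≫ g j k := rfl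

theorem hom_ext {X Y : Fam T Λ} {f g : X ⟶ Y} (h : ∀ i j, f i j = g i j) : f = g :=
  funext fun i => funext fun j => h i j

instance (X Y : Fam T Λ) : AddCommGroup (X ⟶ Y) :=
  inferInstanceAs (AddCommGroup (∀ (i : X.Idx) (j : Y.Idx), X.obj i ⟶ Y.obj j))

theorem add_apply {X Y : Fam T Λ} (f g : X ⟶ Y) (i : X.Idx) (j : Y.Idx) :
    (f + g) i j = f i j + g i j := rfl

theorem zero_apply {X Y : Fam T Λ} (i : X.Idx) (j : Y.Idx) : (0 : X ⟶ Y) i j = 0 := rfl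

theorem sum_apply {X Y : Fam T Λ} {J : Type*} (s : Finset J) (f : J → (X ⟶ Y)) (i : X.Idx)
    (j : Y.Idx) : (∑ a ∈ s, f a) i j = ∑ a ∈ s, f a i j := by
  classical
  induction s using Finset.induction_on with
  | empty => rfl
  | insert a s ha ih => rw [Finset.sum_insert ha, Finset.sum_insert ha, add_apply, ih]

open Classical in
/-- The morphism with entries `c i` in the places `(i, σ i)`. -/
noncomputable def mono {X Y : Fam T Λ} (σ : X.Idx → Y.Idx) (c : ∀ i, X.obj i ⟶ Y.obj (σ i)) :
    X ⟶ Y :=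
  fun i j => if h : σ i = j then c i ≫ eqToHom (congrArg Y.obj h) else 0

open Classical in
/-- The morphism with entries `d i` in the places `(σ i, i)`. -/
noncomputable def comono {X Y : Fam T Λ} (σ : X.Idx → Y.Idx) (d : ∀ i, Y.obj (σ i) ⟶ X.obj i) :
    Y ⟶ X :=
  fun j i => if h : σ i = j then eqToHom (congrArg Y.obj h.symm) ≫ d i else 0

section

variable {X Y Z W : Fam T Λ}

theorem mono_self (σ : X.Idx → Y.Idx) (c : ∀ i, X.obj i ⟶ Y.obj (σ i)) (i : X.Idx) :
    mono σ c i (σ i) = c i :=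
  (dif_pos rfl).trans (Category.comp_id _)

theorem mono_of_ne (σ : X.Idx → Y.Idx) (c : ∀ i, X.obj i ⟶ Y.obj (σ i)) {i : X.Idx} {j : Y.Idx}
    (h : σ i ≠ j) : mono σ c i j = 0 :=
  dif_neg h

theorem comono_self (σ : X.Idx → Y.Idx) (d : ∀ i, Y.obj (σ i) ⟶ X.obj i) (i : X.Idx) :
    comono σ d (σ i) i = d i :=
  (dif_pos rfl).trans (Category.id_comp _)

theorem comono_of_ne (σ : X.Idx → Y.Idx) (d : ∀ i, Y.obj (σ i) ⟶ X.obj i) {i : X.Idx}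
    {j : Y.Idx} (h : σ i ≠ j) : comono σ d j i = 0 :=
  dif_neg h

/-- Here `mono` stands for monomial matrices. Identities and structure isomorphisms are all of this
form, so composites and tensor products of them are computed index by index, without sums. -/
theorem id_eq_mono (X : Fam T Λ) : 𝟙 X = mono (fun i => i) fun i => 𝟙 (X.obj i) := by
  refine hom_ext fun i j => ?_
  by_cases h : i = j
  · subst h
    rw [id_self, mono_self (fun i : X.Idx => i)]
  · rw [id_of_ne _ h, mono_of_ne _ _ h]

theorem mono_comp_apply (σ : X.Idx → Y.Idx) (c : ∀ i, X.obj i ⟶ Y.obj (σ i)) (f : Y ⟶ Z)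
    (i : X.Idx) (k : Z.Idx) : (mono σ c ≫ f) i k = c i ≫ f (σ i) k := by
  rw [comp_apply, Finset.sum_eq_single (σ i), mono_self]
  · intro j _ hj
    rw [mono_of_ne _ _ hj.symm, Limits.zero_comp]
  · exact fun h => (h (Finset.mem_univ _)).elim

theorem comp_comono_apply (σ : X.Idx → Y.Idx) (d : ∀ i, Y.obj (σ i) ⟶ X.obj i) (f : Z ⟶ Y)
    (k : Z.Idx) (i : X.Idx) : (f ≫ comono σ d) k i = f k (σ i) ≫ d i := by
  rw [comp_apply, Finset.sum_eq_single (σ i), comono_self]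
  · intro j _ hj
    rw [comono_of_ne _ _ hj.symm, Limits.comp_zero]
  · exact fun h => (h (Finset.mem_univ _)).elim

theorem comp_mono_apply {σ : X.Idx → Y.Idx} (hσ : Function.Injective σ)
    (c : ∀ i, X.obj i ⟶ Y.obj (σ i)) (f : Z ⟶ X) (k : Z.Idx) (i : X.Idx) :
    (f ≫ mono σ c) k (σ i) = f k i ≫ c i := by
  rw [comp_apply, Finset.sum_eq_single i, mono_self]
  · intro j _ hj
    rw [mono_of_ne _ _ (fun h => hj (hσ h)), Limits.comp_zero]
  · exact fun h => (h (Finset.mem_univ _)).elim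

end

noncomputable instance : Category (Fam T Λ) where
  id_comp f := by
    refine hom_ext fun i k => ?_
    rw [id_eq_mono, mono_comp_apply, Category.id_comp]
  comp_id {X Y} f := by
    refine hom_ext fun i k => ?_
    rw [id_eq_mono]
    exact (comp_mono_apply (σ := fun i : Y.Idx => i) (fun _ _ h => h) _ f i k).trans
      (Category.comp_id _)
  assoc f g h := by
    refine hom_ext fun i l => ?_
    simp only [comp_apply, Preadditive.sum_comp, Preadditive.comp_sum, Category.assoc]
    exact Finset.sum_comm

noncomputable instance : Preadditive (Fam T Λ) where
  add_comp X Y Z f f' g := hom_ext fun i k => by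
    simp only [comp_apply, add_apply, Preadditive.add_comp, Finset.sum_add_distrib]
  comp_add X Y Z f g g' := hom_ext fun i k => by
    simp only [comp_apply, add_apply, Preadditive.comp_add, Finset.sum_add_distrib]

noncomputable instance {k : Type w} [CommRing k] [Linear k T] : Linear k (Fam T Λ) where
  homModule X Y := inferInstanceAs (Module k (∀ (i : X.Idx) (j : Y.Idx), X.obj i ⟶ Y.obj j))
  smul_comp X Y Z r f g := hom_ext fun i l => by
    change ∑ j, (r • f i j) ≫ g j l = r • ∑ j, f i j ≫ g j l
    rw [Finset.smul_sum]
    exact Finset.sum_congr rfl fun j _ => Linear.smul_comp _ _ _ r _ _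
  comp_smul X Y Z f r g := hom_ext fun i l => by
    change ∑ j, f i j ≫ (r • g j l) = r • ∑ j, f i j ≫ g j l
    rw [Finset.smul_sum]
    exact Finset.sum_congr rfl fun j _ => Linear.comp_smul _ _ _ _ r _

theorem smul_apply {k : Type w} [CommRing k] [Linear k T] {X Y : Fam T Λ} (r : k) (f : X ⟶ Y)
    (i : X.Idx) (j : Y.Idx) : (r • f) i j = r • f i j := rfl

section

variable {X Y Z W : Fam T Λ}

theorem mono_comp_mono (σ : X.Idx → Y.Idx) (c : ∀ i, X.obj i ⟶ Y.obj (σ i)) (τ : Y.Idx → Z.Idx)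
    (d : ∀ i, Y.obj i ⟶ Z.obj (τ i)) :
    mono σ c ≫ mono τ d = mono (fun i => τ (σ i)) fun i => c i ≫ d (σ i) := by
  refine hom_ext fun i k => ?_
  rw [mono_comp_apply]
  by_cases h : τ (σ i) = k
  · subst h
    rw [mono_self, mono_self (fun i => τ (σ i))]
  · rw [mono_of_ne _ _ h, mono_of_ne (fun i => τ (σ i)) _ h, Limits.comp_zero]

/-- Each entry of either composite is a sum with a single nonzero term, by bijectivity of `τ` on the
left and by monomiality on the right. Naturality for arbitrary matrices thus reduces to naturality
of their entries. -/
theorem comp_mono_eq {f : X ⟶ Y} {g : Z ⟶ W} {σ : X.Idx → Z.Idx}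
    {τ : Y.Idx → W.Idx} (hτ : Function.Bijective τ) {c : ∀ i, X.obj i ⟶ Z.obj (σ i)}
    {d : ∀ i, Y.obj i ⟶ W.obj (τ i)} (h : ∀ i j, f i j ≫ d j = c i ≫ g (σ i) (τ j)) :
    f ≫ mono τ d = mono σ c ≫ g := by
  refine hom_ext fun i k => ?_
  obtain ⟨j, rfl⟩ := hτ.2 k
  rw [comp_mono_apply hτ.1, mono_comp_apply, h]

theorem mono_comp_comono {σ : X.Idx → Y.Idx} (hσ : Function.Injective σ)
    {c : ∀ i, X.obj i ⟶ Y.obj (σ i)} {d : ∀ i, Y.obj (σ i) ⟶ X.obj i} (h : ∀ i, c i ≫ d i = 𝟙 _) :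
    mono σ c ≫ comono σ d = 𝟙 X := by
  refine hom_ext fun i j => ?_
  rw [comp_comono_apply]
  by_cases e : i = j
  · subst e
    rw [mono_self, h, id_self]
  · rw [mono_of_ne _ _ (fun h => e (hσ h)), id_of_ne _ e, Limits.zero_comp]

theorem comono_comp_mono {σ : X.Idx → Y.Idx} (hσ : Function.Bijective σ)
    {c : ∀ i, X.obj i ⟶ Y.obj (σ i)} {d : ∀ i, Y.obj (σ i) ⟶ X.obj i} (h : ∀ i, d i ≫ c i = 𝟙 _) :
    comono σ d ≫ mono σ c = 𝟙 Y := by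
  refine hom_ext fun i j => ?_
  obtain ⟨j, rfl⟩ := hσ.2 j
  obtain ⟨i, rfl⟩ := hσ.2 i
  rw [comp_mono_apply hσ.1]
  by_cases e : i = j
  · subst e
    rw [comono_self, h, id_self]
  · rw [comono_of_ne _ _ (fun h => e (hσ.1 h.symm)), id_of_ne _ (fun h => e (hσ.1 h)),
      Limits.zero_comp]

/-- A bijection of the indices and isomorphisms of the members give an isomorphism of families. -/
@[simps hom]
noncomputable def monoIso (σ : X.Idx ≃ Y.Idx) (c : ∀ i, X.obj i ≅ Y.obj (σ i)) : X ≅ Y where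
  hom := mono σ fun i => (c i).hom
  inv := comono σ fun i => (c i).inv
  hom_inv_id := mono_comp_comono σ.injective fun i => (c i).hom_inv_id
  inv_hom_id := comono_comp_mono σ.bijective fun i => (c i).inv_hom_id

end

/-- The family with a given label and with the objects of a given finite family. -/
noncomputable def ofFintype (l : Λ) {ι : Type} [Fintype ι] (A : ι → T) : Fam T Λ where
  label := l
  shape := .fin (Fintype.card ι)
  obj i := A ((Fintype.equivFin ι).symm i)

section

variable {J : Type*} [Fintype J] {Y : J → Fam T Λ} {X : Fam T Λ}

open Classical in
/-- A family is the biproduct of families that partition its members. -/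
noncomputable def bicone (σ : (Σ a, (Y a).Idx) ≃ X.Idx)
    (c : ∀ p : Σ a, (Y a).Idx, (Y p.1).obj p.2 ≅ X.obj (σ p)) : Limits.Bicone Y where
  pt := X
  π a := comono (fun i => σ ⟨a, i⟩) fun i => (c ⟨a, i⟩).inv
  ι a := mono (fun i => σ ⟨a, i⟩) fun i => (c ⟨a, i⟩).hom
  ι_π a b := by
    split_ifs with h
    · subst h
      exact mono_comp_comono (fun i j h => by simpa using h) fun i => (c ⟨a, i⟩).hom_inv_id
    · refine hom_ext fun i j => ?_
      rw [comp_comono_apply, mono_of_ne _ _ (fun e => h (congrArg Sigma.fst (σ.injective e))),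
        Limits.zero_comp, zero_apply]

/-- An index of `X` belongs to exactly one summand, so just one term contributes to each diagonal
entry and none to the others. -/
theorem sum_comono_comp_mono (σ : (Σ a, (Y a).Idx) ≃ X.Idx)
    (c : ∀ p : Σ a, (Y a).Idx, (Y p.1).obj p.2 ≅ X.obj (σ p)) :
    (∑ a, (comono (X := Y a) (fun i => σ ⟨a, i⟩) fun i => (c ⟨a, i⟩).inv) ≫
      mono (fun i => σ ⟨a, i⟩) fun i => (c ⟨a, i⟩).hom) = 𝟙 X := by
  have inj : ∀ a, Function.Injective fun i => σ ⟨a, i⟩ := fun a i j h => by simpa using h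
  refine hom_ext fun i j => ?_
  obtain ⟨⟨a, i⟩, rfl⟩ := σ.surjective i
  obtain ⟨⟨b, j⟩, rfl⟩ := σ.surjective j
  rw [sum_apply, Finset.sum_eq_single b]
  · refine (comp_mono_apply (inj b) _ _ _ j).trans ?_
    by_cases h : (⟨a, i⟩ : Σ a, (Y a).Idx) = ⟨b, j⟩
    · cases h
      rw [id_self]
      exact (congrArg (· ≫ _) (comono_self (fun i => σ ⟨a, i⟩) _ i)).trans
        (c ⟨a, i⟩).inv_hom_id
    · rw [id_of_ne _ (fun e => h (σ.injective e))]
      exact (congrArg (· ≫ _) (comono_of_ne (fun i => σ ⟨b, i⟩) _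
        (fun e => h (σ.injective e).symm))).trans Limits.zero_comp
  · intro a' _ ha'
    refine Finset.sum_eq_zero fun l _ => ?_
    exact (congrArg (_ ≫ ·) (mono_of_ne (fun i => σ ⟨a', i⟩) _
      (fun e => ha' (congrArg Sigma.fst (σ.injective e))))).trans Limits.comp_zero
  · exact fun h => (h (Finset.mem_univ _)).elim

theorem isDirectSum (σ : (Σ a, (Y a).Idx) ≃ X.Idx)
    (c : ∀ p : Σ a, (Y a).Idx, (Y p.1).obj p.2 ≅ X.obj (σ p)) : IsDirectSum X Y :=
  ⟨bicone σ c, ⟨Limits.isBilimitOfTotal _ (sum_comono_comp_mono σ c)⟩, ⟨Iso.refl X⟩⟩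

end

/-- The biproduct of a finite family, with a given label. -/
noncomputable def sumIso (l : Λ) {J : Type} [Fintype J] (Y : J → Fam T Λ) :
    (Σ a, (Y a).Idx) ≃ (ofFintype l fun p : Σ a, (Y a).Idx => (Y p.1).obj p.2).Idx :=
  Fintype.equivFin (Σ a, (Y a).Idx)

/-- The members of the biproduct are those of the summands. -/
noncomputable def sumObjIso (l : Λ) {J : Type} [Fintype J] (Y : J → Fam T Λ)
    (p : Σ a, (Y a).Idx) : (Y p.1).obj p.2 ≅
      (ofFintype l fun p : Σ a, (Y a).Idx => (Y p.1).obj p.2).obj (sumIso l Y p) :=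
  eqToIso (congrArg (fun p : Σ a, (Y a).Idx => (Y p.1).obj p.2)
    ((Fintype.equivFin (Σ a, (Y a).Idx)).symm_apply_apply p).symm)

instance [Inhabited Λ] : Limits.HasFiniteBiproducts (Fam T Λ) where
  out _ := ⟨fun Y => .mk ⟨bicone (sumIso default Y) (sumObjIso default Y),
    Limits.isBilimitOfTotal _ (sum_comono_comp_mono (sumIso default Y) (sumObjIso default Y))⟩⟩

/-- The label of the biproduct is prescribed because `P` may depend on it. Morphisms ignore labels,
so any choice gives a biproduct in the ambient category. -/
theorem hasFiniteBiproducts_fullSubcategory (P : ObjectProperty (Fam T Λ)) (l : Λ)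
    (h : ∀ (n : ℕ) (Y : Fin n → Fam T Λ), (∀ a, P (Y a)) →
      P (ofFintype l fun p : Σ a, (Y a).Idx => (Y p.1).obj p.2)) :
    Limits.HasFiniteBiproducts P.FullSubcategory where
  out n := by
    refine ⟨fun Y => ?_⟩
    let b := bicone (sumIso l fun a => (Y a).obj) (sumObjIso l fun a => (Y a).obj)
    let b' : Limits.Bicone Y :=
      { pt := ⟨b.pt, h n _ fun a => (Y a).property⟩
        π a := ObjectProperty.homMk (b.π a)
        ι a := ObjectProperty.homMk (b.ι a)
        ι_π a a' := by
          refine ObjectProperty.hom_ext _ ((b.ι_π a a').trans ?_)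
          split_ifs with e
          · subst e
            rfl
          · rfl }
    refine .mk ⟨b', Limits.isBilimitOfTotal _ ?_⟩
    refine ObjectProperty.hom_ext _ (Eq.trans ?_ (sum_comono_comp_mono (sumIso l fun a => (Y a).obj)
      (sumObjIso l fun a => (Y a).obj)))
    exact map_sum P.ι.mapAddHom (fun a => b'.π a ≫ b'.ι a) Finset.univ

end Additive

/-! ### The monoidal structure on families -/

section Monoidal

variable [Category.{v} T] [Preadditive T] [MonoidalCategory T] [MonoidalPreadditive T] [MulOneClass Λ]

/-- The family of tensor products of the members of two families. -/
def tensor (X Y : Fam T Λ) : Fam T Λ where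
  label := X.label * Y.label
  shape := .prod X.shape Y.shape
  obj p := X.obj p.1 ⊗ Y.obj p.2

/-- The Kronecker product of matrices. -/
def tensorMap {X X' Y Y' : Fam T Λ} (f : X ⟶ X') (g : Y ⟶ Y') : tensor X Y ⟶ tensor X' Y' :=
  fun p q => f p.1 q.1 ⊗ₘ g p.2 q.2

theorem mono_tensor {X X' Y Y' : Fam T Λ} (σ : X.Idx → X'.Idx) (c : ∀ i, X.obj i ⟶ X'.obj (σ i))
    (τ : Y.Idx → Y'.Idx) (d : ∀ i, Y.obj i ⟶ Y'.obj (τ i)) :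
    tensorMap (mono σ c) (mono τ d) =
      mono (X := tensor X Y) (Y := tensor X' Y') (fun p => (σ p.1, τ p.2))
        (fun p => c p.1 ⊗ₘ d p.2) := by
  refine hom_ext fun p q => ?_
  obtain ⟨i, j⟩ := p
  obtain ⟨i', j'⟩ := q
  change mono σ c i i' ⊗ₘ mono τ d j j' = _
  by_cases h : σ i = i'
  · subst h
    by_cases h' : τ j = j'
    · subst h'
      rw [mono_self, mono_self]
      exact (mono_self (X := tensor X Y) (Y := tensor X' Y') (fun p => (σ p.1, τ p.2))
        (fun p => c p.1 ⊗ₘ d p.2) (i, j)).symm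
    · rw [mono_of_ne _ _ h', MonoidalPreadditive.tensor_zero]
      exact (mono_of_ne (X := tensor X Y) (Y := tensor X' Y') (fun p => (σ p.1, τ p.2))
        (fun p => c p.1 ⊗ₘ d p.2) (i := (i, j)) (j := (σ i, j'))
        (fun e => h' (congrArg Prod.snd e))).symm
  · rw [mono_of_ne _ _ h, MonoidalPreadditive.zero_tensor]
    exact (mono_of_ne (X := tensor X Y) (Y := tensor X' Y') (fun p => (σ p.1, τ p.2))
      (fun p => c p.1 ⊗ₘ d p.2) (i := (i, j)) (j := (i', j'))
      (fun e => h (congrArg Prod.fst e))).symm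

/-- A sum over pairs is a double sum, over which the tensor product distributes. -/
theorem tensorMap_comp {X X' X'' Y Y' Y'' : Fam T Λ} (f : X ⟶ X') (g : Y ⟶ Y') (f' : X' ⟶ X'')
    (g' : Y' ⟶ Y'') : tensorMap f g ≫ tensorMap f' g' = tensorMap (f ≫ f') (g ≫ g') := by
  refine hom_ext fun p q => ?_
  change ∑ r : X'.Idx × Y'.Idx, (f p.1 r.1 ⊗ₘ g p.2 r.2) ≫ (f' r.1 q.1 ⊗ₘ g' r.2 q.2) =
    (∑ r, f p.1 r ≫ f' r q.1) ⊗ₘ ∑ r, g p.2 r ≫ g' r q.2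
  rw [Fintype.sum_prod_type, sum_tensor]
  refine Finset.sum_congr rfl fun r _ => ?_
  rw [tensor_sum]
  exact Finset.sum_congr rfl fun s _ => tensorHom_comp_tensorHom _ _ _ _

/-- The tensor unit. -/
def unit : Fam T Λ where
  label := 1
  shape := .fin 1
  obj _ := 𝟙_ T

/-- The associativity constraint. -/
noncomputable def assoc (X Y Z : Fam T Λ) : tensor (tensor X Y) Z ≅ tensor X (tensor Y Z) :=
  monoIso (X := tensor (tensor X Y) Z) (Y := tensor X (tensor Y Z)) (Equiv.prodAssoc X.Idx Y.Idx Z.Idx)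
    fun p => α_ (X.obj p.1.1) (Y.obj p.1.2) (Z.obj p.2)

/-- The left unit constraint. -/
noncomputable def leftUnit (X : Fam T Λ) : tensor unit X ≅ X :=
  monoIso (X := tensor unit X) (Y := X) (Equiv.uniqueProd X.Idx (Fin 1))
    fun p => λ_ (X.obj p.2)

/-- The right unit constraint. -/
noncomputable def rightUnit (X : Fam T Λ) : tensor X unit ≅ X :=
  monoIso (X := tensor X unit) (Y := X) (Equiv.prodUnique X.Idx (Fin 1))
    fun p => ρ_ (X.obj p.1)

/-- Pentagon and triangle compare monomial matrices with the same index map, so they hold by the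
corresponding axiom of `T` at each index. The naturality laws follow from `comp_mono_eq`. -/
noncomputable instance : MonoidalCategory (Fam T Λ) :=
  letI : MonoidalCategoryStruct (Fam T Λ) :=
    { tensorObj := tensor
      tensorHom := tensorMap
      whiskerLeft X _ _ f := tensorMap (𝟙 X) f
      whiskerRight f Y := tensorMap f (𝟙 Y)
      tensorUnit := unit
      associator := assoc
      leftUnitor := leftUnit
      rightUnitor := rightUnit }
  MonoidalCategory.ofTensorHom
    (id_tensorHom_id := fun X Y => by
      change tensorMap (𝟙 X) (𝟙 Y) = 𝟙 (tensor X Y)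
      rw [id_eq_mono, id_eq_mono, mono_tensor, id_eq_mono]
      simp only [id_tensorHom_id]
      rfl)
    (id_tensorHom := fun X _ _ f => rfl)
    (tensorHom_id := fun f Y => rfl)
    (tensorHom_comp_tensorHom := fun f g f' g' => tensorMap_comp f g f' g')
    (associator_naturality := fun {X₁ X₂ X₃ Y₁ Y₂ Y₃} f g h => by
      change tensorMap (tensorMap f g) h ≫ (assoc Y₁ Y₂ Y₃).hom =
        (assoc X₁ X₂ X₃).hom ≫ tensorMap f (tensorMap g h)
      exact comp_mono_eq (Equiv.bijective _) fun p q => associator_naturality _ _ _)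
    (leftUnitor_naturality := fun {X Y} f => by
      change tensorMap (𝟙 unit) f ≫ (leftUnit Y).hom = (leftUnit X).hom ≫ f
      refine comp_mono_eq (Equiv.bijective _) fun p q => ?_
      obtain ⟨a, i⟩ := p
      obtain ⟨b, j⟩ := q
      obtain rfl : a = b := Subsingleton.elim (α := Fin 1) _ _
      change ((𝟙 unit : (unit : Fam T Λ) ⟶ unit) a a ⊗ₘ f i j) ≫ _ = _
      rw [id_self]
      exact (congrArg (· ≫ _) (id_tensorHom _ _)).trans (leftUnitor_naturality _))
    (rightUnitor_naturality := fun {X Y} f => by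
      change tensorMap f (𝟙 unit) ≫ (rightUnit Y).hom = (rightUnit X).hom ≫ f
      refine comp_mono_eq (Equiv.bijective _) fun p q => ?_
      obtain ⟨i, a⟩ := p
      obtain ⟨j, b⟩ := q
      obtain rfl : a = b := Subsingleton.elim (α := Fin 1) _ _
      change (f i j ⊗ₘ (𝟙 unit : (unit : Fam T Λ) ⟶ unit) a a) ≫ _ = _
      rw [id_self]
      exact (congrArg (· ≫ _) (tensorHom_id _ _)).trans (rightUnitor_naturality _))
    (pentagon := fun W X Y Z => by
      change tensorMap (assoc W X Y).hom (𝟙 Z) ≫ (assoc W (tensor X Y) Z).hom ≫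
        tensorMap (𝟙 W) (assoc X Y Z).hom =
          (assoc (tensor W X) Y Z).hom ≫ (assoc W X (tensor Y Z)).hom
      rw [id_eq_mono, id_eq_mono]
      simp only [assoc]
      erw [mono_tensor, mono_tensor, mono_comp_mono, mono_comp_mono, mono_comp_mono]
      refine congrArg (mono _) (funext fun p => ?_)
      obtain ⟨⟨⟨a, b⟩, c⟩, d⟩ := p
      have := MonoidalCategory.pentagon (W.obj a) (X.obj b) (Y.obj c) (Z.obj d)
      rw [← tensorHom_id, ← id_tensorHom] at this
      exact this)
    (triangle := fun X Y => by
      change (assoc X unit Y).hom ≫ tensorMap (𝟙 X) (leftUnit Y).hom =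
        tensorMap (rightUnit X).hom (𝟙 Y)
      rw [id_eq_mono, id_eq_mono]
      simp only [assoc, leftUnit, rightUnit]
      erw [mono_tensor, mono_tensor, mono_comp_mono]
      refine congrArg (mono _) (funext fun p => ?_)
      obtain ⟨⟨a, b⟩, c⟩ := p
      have := MonoidalCategory.triangle (X.obj a) (Y.obj c)
      rw [← tensorHom_id, ← id_tensorHom] at this
      exact this)

instance : MonoidalPreadditive (Fam T Λ) where
  whiskerLeft_zero := hom_ext fun _ _ => MonoidalPreadditive.tensor_zero _
  zero_whiskerRight := hom_ext fun _ _ => MonoidalPreadditive.zero_tensor _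
  whiskerLeft_add f g := hom_ext fun _ _ => MonoidalPreadditive.tensor_add _ _ _
  add_whiskerRight f g := hom_ext fun _ _ => MonoidalPreadditive.add_tensor _ _ _

instance {k : Type w} [CommRing k] [Linear k T] [MonoidalLinear k T] :
    MonoidalLinear k (Fam T Λ) where
  whiskerLeft_smul X _ _ r f := hom_ext fun p q => by
    change (𝟙 X : X ⟶ X) p.1 q.1 ⊗ₘ (r • f p.2 q.2) = r • ((𝟙 X : X ⟶ X) p.1 q.1 ⊗ₘ f p.2 q.2)
    rw [MonoidalCategory.tensorHom_def, MonoidalCategory.tensorHom_def, MonoidalLinear.whiskerLeft_smul,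
      Linear.comp_smul]
  smul_whiskerRight r _ _ f Y := hom_ext fun p q => by
    change (r • f p.1 q.1) ⊗ₘ (𝟙 Y : Y ⟶ Y) p.2 q.2 = r • (f p.1 q.1 ⊗ₘ (𝟙 Y : Y ⟶ Y) p.2 q.2)
    rw [MonoidalCategory.tensorHom_def, MonoidalCategory.tensorHom_def,
      MonoidalLinear.smul_whiskerRight, Linear.smul_comp]

section

variable {X Y Z W : Fam T Λ}

theorem comp_eq_mono {f : X ⟶ Y} {g : Y ⟶ Z} {σ : X.Idx → Y.Idx} {c : ∀ i, X.obj i ⟶ Y.obj (σ i)}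
    {τ : Y.Idx → Z.Idx} {d : ∀ i, Y.obj i ⟶ Z.obj (τ i)} (hf : f = mono σ c) (hg : g = mono τ d) :
    f ≫ g = mono (fun i => τ (σ i)) fun i => c i ≫ d (σ i) := by
  rw [hf, hg, mono_comp_mono]

theorem whiskerRight_eq_mono {f : X ⟶ Y} {σ : X.Idx → Y.Idx} {c : ∀ i, X.obj i ⟶ Y.obj (σ i)}
    (hf : f = mono σ c) (Z : Fam T Λ) : f ▷ Z =
      mono (X := X ⊗ Z) (Y := Y ⊗ Z) (fun p => (σ p.1, p.2)) fun p => c p.1 ▷ Z.obj p.2 := by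
  change tensorMap f (𝟙 Z) = _
  rw [hf, id_eq_mono, mono_tensor]
  simp only [tensorHom_id]
  rfl

theorem whiskerLeft_eq_mono {f : X ⟶ Y} {σ : X.Idx → Y.Idx} {c : ∀ i, X.obj i ⟶ Y.obj (σ i)}
    (hf : f = mono σ c) (Z : Fam T Λ) : Z ◁ f =
      mono (X := Z ⊗ X) (Y := Z ⊗ Y) (fun p => (p.1, σ p.2)) fun p => Z.obj p.1 ◁ c p.2 := by
  change tensorMap (𝟙 Z) f = _
  rw [hf, id_eq_mono, mono_tensor]
  simp only [id_tensorHom]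
  rfl

theorem associator_eq_mono (X Y Z : Fam T Λ) : (α_ X Y Z).hom =
    mono (X := (X ⊗ Y) ⊗ Z) (Y := X ⊗ Y ⊗ Z) (fun p => (p.1.1, (p.1.2, p.2)))
      fun p => (α_ (X.obj p.1.1) (Y.obj p.1.2) (Z.obj p.2)).hom := rfl

/-- The inverse of a `monoIso` is a `comono` by construction. It has to be rewritten as a monomial
matrix before entrywise computation applies. -/
theorem associator_inv_eq_mono (X Y Z : Fam T Λ) : (α_ X Y Z).inv =
    mono (X := X ⊗ Y ⊗ Z) (Y := (X ⊗ Y) ⊗ Z) (fun p => ((p.1, p.2.1), p.2.2))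
      fun p => (α_ (X.obj p.1) (Y.obj p.2.1) (Z.obj p.2.2)).inv := by
  rw [← cancel_mono (α_ X Y Z).hom, Iso.inv_hom_id]
  refine (id_eq_mono _).trans (Eq.trans ?_ (comp_eq_mono rfl (associator_eq_mono X Y Z)).symm)
  exact congrArg (mono _) (funext fun p => (Iso.inv_hom_id _).symm)

end

end Monoidal

end Fam

/-! ### Functors and transformations induced on families -/

namespace Fam

variable {T Λ : Type u} [Category.{v} T] [Preadditive T]

/-- The functor induced by an additive functor on members and a map on labels. -/
noncomputable def map (F : T ⥤ T) [F.Additive] (l : Λ → Λ) : Fam T Λ ⥤ Fam T Λ where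
  obj X := ⟨l X.label, X.shape, fun i => F.obj (X.obj i)⟩
  map f := fun i j => F.map (f i j)
  map_id X := hom_ext fun (i j : X.Idx) => by
    change F.map ((𝟙 X : X ⟶ X) i j) = _
    by_cases h : i = j
    · subst h
      rw [id_self, CategoryTheory.Functor.map_id, id_self]
    · rw [id_of_ne _ h, F.map_zero]
      exact (id_of_ne (⟨l X.label, X.shape, fun i => F.obj (X.obj i)⟩ : Fam T Λ) h).symm
  map_comp {X Y Z} f g := hom_ext fun i k => by
    change F.map (∑ j : Y.Idx, f i j ≫ g j k) = ∑ j : Y.Idx, F.map (f i j) ≫ F.map (g j k)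
    rw [F.map_sum]
    exact Finset.sum_congr rfl fun j _ => F.map_comp _ _

section

variable (F : T ⥤ T) [F.Additive] (l : Λ → Λ)

instance : (map F l).Additive where
  map_add := hom_ext fun _ _ => F.map_add

instance {k : Type w} [CommRing k] [Linear k T] [F.Linear k] : (map F l).Linear k where
  map_smul _ _ := hom_ext fun _ _ => F.map_smul _ _

theorem map_mono {X Y : Fam T Λ} (σ : X.Idx → Y.Idx) (c : ∀ i, X.obj i ⟶ Y.obj (σ i)) :
    (map F l).map (mono σ c) =
      mono (X := (map F l).obj X) (Y := (map F l).obj Y) σ fun i => F.map (c i) := by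
  refine hom_ext fun (i : X.Idx) (j : Y.Idx) => ?_
  change F.map (mono σ c i j) = _
  by_cases h : σ i = j
  · subst h
    rw [mono_self]
    exact (mono_self (X := (map F l).obj X) (Y := (map F l).obj Y) σ (fun i => F.map (c i)) i).symm
  · rw [mono_of_ne _ _ h, F.map_zero]
    exact (mono_of_ne (X := (map F l).obj X) (Y := (map F l).obj Y) σ _ h).symm

variable [MonoidalCategory T] [MonoidalPreadditive T] [MulOneClass Λ] [F.Monoidal]

/-- The tensor constraint of the induced functor. -/
noncomputable def mapTensor (X Y : Fam T Λ) :
    (map F l).obj X ⊗ (map F l).obj Y ≅ (map F l).obj (X ⊗ Y) :=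
  monoIso (X := (map F l).obj X ⊗ (map F l).obj Y) (Y := (map F l).obj (X ⊗ Y))
    (Equiv.refl (X.Idx × Y.Idx)) fun p => Functor.Monoidal.μIso F (X.obj p.1) (Y.obj p.2)

/-- The unit constraint of the induced functor. -/
noncomputable def mapUnit : 𝟙_ (Fam T Λ) ≅ (map F l).obj (𝟙_ (Fam T Λ)) :=
  monoIso (X := 𝟙_ (Fam T Λ)) (Y := (map F l).obj (𝟙_ (Fam T Λ)))
    (Equiv.refl (Fin 1)) fun _ => Functor.Monoidal.εIso F

theorem mapTensor_naturality {X X' Y Y' : Fam T Λ} (f : X ⟶ X') (g : Y ⟶ Y') :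
    ((map F l).map f ⊗ₘ (map F l).map g) ≫ (mapTensor F l X' Y').hom =
      (mapTensor F l X Y).hom ≫ (map F l).map (f ⊗ₘ g) :=
  comp_mono_eq (Equiv.bijective _) fun _ _ => Functor.LaxMonoidal.μ_natural F _ _

noncomputable instance : (map F l).Monoidal :=
  Functor.CoreMonoidal.toMonoidal
    { εIso := mapUnit F l
      μIso := mapTensor F l
      μIso_hom_natural_left f X' := by
        have := mapTensor_naturality F l f (𝟙 X')
        rwa [CategoryTheory.Functor.map_id, tensorHom_id, tensorHom_id] at this
      μIso_hom_natural_right X' f := by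
        have := mapTensor_naturality F l (𝟙 X') f
        rwa [CategoryTheory.Functor.map_id, id_tensorHom, id_tensorHom] at this
      associativity X Y Z := by
        change tensorMap (mono _ _) (𝟙 ((map F l).obj Z)) ≫ mono _ _ ≫ (map F l).map (mono _ _) =
          mono _ _ ≫ tensorMap (𝟙 ((map F l).obj X)) (mono _ _) ≫ mono _ _
        rw [id_eq_mono, id_eq_mono]
        erw [map_mono, mono_tensor, mono_tensor, mono_comp_mono, mono_comp_mono, mono_comp_mono,
          mono_comp_mono]
        refine congrArg (mono _) (funext fun p => ?_)
        obtain ⟨⟨a, b⟩, c⟩ := p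
        have := Functor.LaxMonoidal.associativity F (X.obj a) (Y.obj b) (Z.obj c)
        rw [← tensorHom_id, ← id_tensorHom] at this
        exact this
      left_unitality X := by
        change mono _ _ = tensorMap (mono _ _) (𝟙 ((map F l).obj X)) ≫ mono _ _ ≫
          (map F l).map (mono _ _)
        rw [id_eq_mono]
        erw [map_mono, mono_tensor, mono_comp_mono, mono_comp_mono]
        refine congrArg (mono _) (funext fun p => ?_)
        have := Functor.LaxMonoidal.left_unitality F (X.obj p.2)
        rw [← tensorHom_id] at this
        exact this
      right_unitality X := by
        change mono _ _ = tensorMap (𝟙 ((map F l).obj X)) (mono _ _) ≫ mono _ _ ≫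
          (map F l).map (mono _ _)
        rw [id_eq_mono]
        erw [map_mono, mono_tensor, mono_comp_mono, mono_comp_mono]
        refine congrArg (mono _) (funext fun p => ?_)
        have := Functor.LaxMonoidal.right_unitality F (X.obj p.1)
        rw [← id_tensorHom] at this
        exact this }

end

/-- Isomorphic functors on members induce isomorphic functors. -/
noncomputable def mapComp {F F' F'' : T ⥤ T} [F.Additive] [F'.Additive] [F''.Additive]
    (l l' l'' : Λ → Λ) (θ : F ⋙ F' ≅ F'') : map F l ⋙ map F' l' ≅ map F'' l'' :=
  NatIso.ofComponents
    (fun X => monoIso (X := (map F l ⋙ map F' l').obj X) (Y := (map F'' l'').obj X)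
      (Equiv.refl X.Idx) fun i => θ.app (X.obj i))
    fun _ => comp_mono_eq (Equiv.bijective _) fun _ _ => θ.hom.naturality _

/-- A functor on members that is isomorphic to the identity induces such a functor. -/
noncomputable def mapId {F : T ⥤ T} [F.Additive] (l : Λ → Λ) (θ : 𝟭 T ≅ F) :
    𝟭 (Fam T Λ) ≅ map F l :=
  NatIso.ofComponents
    (fun X => monoIso (X := X) (Y := (map F l).obj X) (Equiv.refl X.Idx) fun i => θ.app (X.obj i))
    fun _ => comp_mono_eq (Equiv.bijective _) fun _ _ => θ.hom.naturality _

section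

variable {F F' F'' : T ⥤ T} [F.Additive] [F'.Additive] [F''.Additive] (l l' l'' : Λ → Λ)
  [MonoidalCategory T] [MonoidalPreadditive T] [MulOneClass Λ] [F.Monoidal] [F'.Monoidal]
  [F''.Monoidal]

/-- After composing the monomial matrices, each entry is an instance of monoidality of `θ`. -/
theorem mapComp_isMonoidal (θ : F ⋙ F' ≅ F'') [NatTrans.IsMonoidal θ.hom] :
    NatTrans.IsMonoidal (mapComp l l' l'' θ).hom where
  unit := by
    rw [Functor.LaxMonoidal.comp_ε]
    change (mono _ _ ≫ (map F' l').map (mono _ _)) ≫ mono _ _ = mono _ _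
    erw [map_mono, mono_comp_mono, mono_comp_mono]
    refine congrArg (mono _) (funext fun p => ?_)
    have := NatTrans.IsMonoidal.unit (τ := θ.hom)
    rw [Functor.LaxMonoidal.comp_ε] at this
    exact this
  tensor X Y := by
    rw [Functor.LaxMonoidal.comp_μ]
    change (mono _ _ ≫ (map F' l').map (mono _ _)) ≫ mono _ _ = tensorMap (mono _ _) (mono _ _) ≫ mono _ _
    erw [map_mono, mono_tensor, mono_comp_mono, mono_comp_mono, mono_comp_mono]
    refine congrArg (mono _) (funext fun p => ?_)
    have := NatTrans.IsMonoidal.tensor (τ := θ.hom) (X.obj p.1) (Y.obj p.2)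
    rw [Functor.LaxMonoidal.comp_μ] at this
    exact this

theorem mapId_isMonoidal (θ : 𝟭 T ≅ F) [NatTrans.IsMonoidal θ.hom] :
    NatTrans.IsMonoidal (mapId l θ).hom where
  unit := by
    rw [Functor.LaxMonoidal.id_ε, Category.id_comp]
    change mono _ _ = mono _ _
    refine congrArg (mono _) (funext fun p => ?_)
    have := NatTrans.IsMonoidal.unit (τ := θ.hom)
    rw [Functor.LaxMonoidal.id_ε, Category.id_comp] at this
    exact this
  tensor X Y := by
    rw [Functor.LaxMonoidal.id_μ, Category.id_comp]
    change mono _ _ = tensorMap (mono _ _) (mono _ _) ≫ mono _ _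
    erw [mono_tensor, mono_comp_mono]
    refine congrArg (mono _) (funext fun p => ?_)
    have := NatTrans.IsMonoidal.tensor (τ := θ.hom) (X.obj p.1) (Y.obj p.2)
    rw [Functor.LaxMonoidal.id_μ, Category.id_comp] at this
    exact this

end

end Fam

/-! ### The $G$-crossed completion of a braided monoidale -/

namespace Monoidale

variable {k : Type w} [CommRing k] {G : Type u} [Group G] (M : Monoidale.{w, v, u} k G)

instance crossComp_isMonoidal {x y z : G} (h : y * x = z) :
    NatTrans.IsMonoidal (M.crossComp h).hom where
  unit := by
    rw [Functor.LaxMonoidal.comp_ε, Category.assoc]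
    exact crossComp_one h
  tensor A B := by
    rw [Functor.LaxMonoidal.comp_μ, Category.assoc]
    exact crossComp_tensor h A B

instance crossUnit_isMonoidal : NatTrans.IsMonoidal M.crossUnit.hom where
  unit := by
    rw [Functor.LaxMonoidal.id_ε, Category.id_comp]
    exact crossUnit_one
  tensor A B := by
    rw [Functor.LaxMonoidal.id_μ, Category.id_comp]
    exact (crossUnit_tensor A B).symm

end Monoidale

namespace BraidedMonoidale

open Monoidale

variable {k : Type w} [CommRing k] {G : Type u} [Group G]

section

variable (M : BraidedMonoidale.{w, v, u} k G)

/-- The completion of a braided monoidale under finite direct sums. Homogeneous families are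
labelled by their degrees. -/
abbrev Compl : Type u := Fam M.Tot (WithZero G)

/-- The homogeneous families. -/
def complDeg (a : G) : ObjectProperty M.Compl :=
  -- The empty family satisfies the second condition for every `a`. The label is what makes the
  -- subcategories of different degrees disjoint.
  fun X => X.label = (a : WithZero G) ∧ ∀ i, (X.obj i).deg = a

theorem complDeg_ofFintype (a : G) (n : ℕ) (Y : Fin n → M.Compl) (h : ∀ i, M.complDeg a (Y i)) :
    M.complDeg a (Fam.ofFintype (a : WithZero G) fun p : Σ i, (Y i).Idx => (Y p.1).obj p.2) :=
  ⟨rfl, fun i => (h _).2 _⟩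

/-- The members are grouped by their degrees, each group getting its degree as label. The label of
`X` itself is irrelevant, since morphisms ignore it. -/
theorem exists_splitting (X : M.Compl) :
    ∃ (s : Finset G) (Y : s → M.Compl), (∀ a : s, M.complDeg a (Y a)) ∧ IsDirectSum X Y := by
  classical
  let s : Finset G := Finset.univ.image fun i => (X.obj i).deg
  let f (i : X.Idx) : s := ⟨(X.obj i).deg, Finset.mem_image_of_mem _ (Finset.mem_univ i)⟩
  refine ⟨s, fun a => Fam.ofFintype ((a : G) : WithZero G) fun i : {i // f i = a} => X.obj i,
    fun a => ⟨rfl, fun i => congrArg Subtype.val ((Fintype.equivFin {i // f i = a}).symm i).2⟩, ?_⟩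
  exact Fam.isDirectSum
    ((Equiv.sigmaCongrRight fun a => (Fintype.equivFin {i // f i = a}).symm).trans
      (Equiv.sigmaFiberEquiv f)) fun p => Iso.refl _

/-- The `G`-graded category associated with a braided monoidale. -/
noncomputable def toGGradedCat : GGradedCat.{w, v, u} k G where
  carrier := M.Compl
  hasFiniteBiproducts := 
    -- Any label would do: a biproduct of arbitrary families need not be homogeneous.
    letI : Inhabited (WithZero G) := ⟨1⟩
    inferInstanceAs (Limits.HasFiniteBiproducts (Fam _ (WithZero G)))
  deg := M.complDeg
  deg_disjoint ha hb := WithZero.coe_injective (ha.1.symm.trans hb.1)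
  deg_hasFiniteBiproducts a :=
    Fam.hasFiniteBiproducts_fullSubcategory _ (a : WithZero G) (M.complDeg_ofFintype a)
  exists_splitting := M.exists_splitting
  deg_tensor h _ _ hX hY := by
    subst h
    refine ⟨?_, fun p => ?_⟩
    · exact (congrArg₂ (· * ·) hX.1 hY.1).trans (WithZero.coe_mul _ _).symm
    · exact congrArg₂ (· * ·) (hX.2 p.1) (hY.2 p.2)
  hom_eq_zero h _ _ hX hY _ := Fam.hom_ext fun i j =>
    LinCat.Total.eq_zero (fun e => h ((hX.2 i).symm.trans (e.trans (hY.2 j)))) _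
  deg_unit := ⟨rfl, fun _ => rfl⟩

/-- The effect of a crossing on labels. -/
def conjLabel {G : Type u} [Group G] (x : G) : WithZero G → WithZero G :=
  Option.map fun a => x⁻¹ * a * x

/-- The crossings of the completion. -/
noncomputable def complCross (x : G) : M.Compl ⥤ M.Compl :=
  Fam.map (M.cross x) (conjLabel x)

noncomputable instance complCross_monoidal (x : G) : (M.complCross x).Monoidal :=
  inferInstanceAs (Fam.map (M.cross x) (conjLabel x)).Monoidal

/-- The composition constraint of the crossings of the completion. -/
noncomputable def complComp {x y z : G} (h : y * x = z) :
    M.complCross y ⋙ M.complCross x ≅ M.complCross z :=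
  Fam.mapComp _ _ _ (crossComp _ h)

/-- The unit constraint of the crossings of the completion. -/
noncomputable def complUnit : 𝟭 M.Compl ≅ M.complCross 1 :=
  Fam.mapId _ (crossUnit _)

/-- Crossing by `x⁻¹` is a quasi-inverse, by the composition and unit constraints. -/
theorem complCross_isEquivalence (x : G) : (M.complCross x).IsEquivalence :=
  (CategoryTheory.Equivalence.mk (M.complCross x) (M.complCross x⁻¹)
    (M.complUnit ≪≫ (M.complComp (mul_inv_cancel x)).symm)
    (M.complComp (inv_mul_cancel x) ≪≫ M.complUnit.symm)).isEquivalence_functor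

/-- The `G`-crossed category associated with a braided monoidale. -/
noncomputable def toGCrossedCat : GCrossedCat.{w, v, u} k G where
  toGGradedCat := M.toGGradedCat
  φ := M.complCross
  φ_additive x := inferInstanceAs (Fam.map _ _).Additive
  φ_linear x := inferInstanceAs ((Fam.map _ _).Linear k)
  φ_monoidal x := M.complCross_monoidal x
  φ_isEquivalence := M.complCross_isEquivalence
  deg_φ {a b c} h X hX := by
    obtain rfl : c = a⁻¹ * b * a := by rw [mul_assoc, ← h, inv_mul_cancel_left]
    exact ⟨congrArg (conjLabel a) hX.1, fun i => congrArg (fun b => a⁻¹ * b * a) (hX.2 i)⟩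
  φComp := M.complComp
  φComp_isMonoidal h := Fam.mapComp_isMonoidal _ _ _ (M.crossComp h)
  φUnit := M.complUnit
  φUnit_isMonoidal := Fam.mapId_isMonoidal _ M.crossUnit
  φ_assoc {a b c p q s} hp hs hq hs' X := by
    change Fam.mono _ _ ≫ Fam.mono _ _ = (Fam.map _ _).map (Fam.mono _ _) ≫ Fam.mono _ _
    erw [Fam.map_mono, Fam.mono_comp_mono, Fam.mono_comp_mono]
    exact congrArg (Fam.mono _) (funext fun i => crossComp_assoc hp hs hq hs' (X.obj i))
  φ_unit_left h X := by
    change Fam.mono _ _ ≫ Fam.mono _ _ = _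
    erw [Fam.id_eq_mono, Fam.mono_comp_mono]
    exact congrArg (Fam.mono _) (funext fun i => crossUnit_crossComp h (X.obj i))
  φ_unit_right h X := by
    change (Fam.map _ _).map (Fam.mono _ _) ≫ Fam.mono _ _ = _
    erw [Fam.id_eq_mono, Fam.map_mono, Fam.mono_comp_mono]
    exact congrArg (Fam.mono _) (funext fun i => map_crossUnit_crossComp h (X.obj i))

/-- The inverse braiding of the completion. -/
noncomputable def complBraid {a x : G} (hx : x * a = 1) (X Y : M.Compl) (hX : M.complDeg a X) :
    (M.complCross x).obj Y ⊗ X ≅ X ⊗ Y :=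
  Fam.monoIso (X := (M.complCross x).obj Y ⊗ X) (Y := X ⊗ Y) (Equiv.prodComm Y.Idx X.Idx)
    fun p => totBraid (X.obj p.2) (Y.obj p.1) ((congrArg (x * ·) (hX.2 p.2)).trans hx)

theorem complBraid_naturality {a x : G} (hx : x * a = 1) {X X' Y Y' : M.Compl}
    (hX : M.complDeg a X) (hX' : M.complDeg a X') (f : X ⟶ X') (g : Y ⟶ Y') :
    ((M.complCross x).map g ⊗ₘ f) ≫ (M.complBraid hx X' Y' hX').hom =
      (M.complBraid hx X Y hX).hom ≫ (f ⊗ₘ g) :=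
  Fam.comp_mono_eq (Equiv.bijective _) fun _ _ => totBraid_naturality _ _ _ _

/-- All factors are monomial with matching index maps, so this is `totBraid_hexagon_right` at each
triple of members. The other hexagon and the compatibility with crossings are proved in the same
way. -/
theorem complBraid_hexagon_right {a x : G} (hx : x * a = 1) (A B D : M.Compl)
    (hA : M.complDeg a A) :
    (α_ ((M.complCross x).obj B) ((M.complCross x).obj D) A).inv ≫
        μ (M.complCross x) B D ▷ A ≫ (M.complBraid hx A (B ⊗ D) hA).hom ≫ (α_ A B D).inv =
      (M.complCross x).obj B ◁ (M.complBraid hx A D hA).hom ≫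
        (α_ ((M.complCross x).obj B) A D).inv ≫ (M.complBraid hx A B hA).hom ▷ D := by
  refine (Fam.comp_eq_mono (Fam.associator_inv_eq_mono _ _ _) (Fam.comp_eq_mono
    (Fam.whiskerRight_eq_mono rfl _) (Fam.comp_eq_mono rfl
      (Fam.associator_inv_eq_mono _ _ _)))).trans (Eq.trans ?_ (Fam.comp_eq_mono
        (Fam.whiskerLeft_eq_mono rfl _) (Fam.comp_eq_mono (Fam.associator_inv_eq_mono _ _ _)
          (Fam.whiskerRight_eq_mono rfl _))).symm)
  exact congrArg (Fam.mono _) (funext fun p => totBraid_hexagon_right (A.obj p.2.2) (B.obj p.1)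
    (D.obj p.2.1) _)

theorem complBraid_hexagon_left {a b p x y z : G} (hz : y * x = z)
    (ha : x * a = 1) (hb : y * b = 1) (hzp : z * p = 1) (A B D : M.Compl) (hA : M.complDeg a A)
    (hB : M.complDeg b B) (hAB : M.complDeg p (A ⊗ B)) :
    (α_ ((M.complCross x).obj ((M.complCross y).obj D)) A B).hom ≫
        ((M.complComp hz).hom.app D) ▷ (A ⊗ B) ≫
        (M.complBraid hzp (A ⊗ B) D hAB).hom ≫ (α_ A B D).hom =
      (M.complBraid ha A ((M.complCross y).obj D) hA).hom ▷ B ≫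
        (α_ A ((M.complCross y).obj D) B).hom ≫ A ◁ (M.complBraid hb B D hB).hom := by
  refine (Fam.comp_eq_mono (Fam.associator_eq_mono _ _ _) (Fam.comp_eq_mono
    (Fam.whiskerRight_eq_mono rfl _) (Fam.comp_eq_mono rfl
      (Fam.associator_eq_mono _ _ _)))).trans (Eq.trans ?_ (Fam.comp_eq_mono
        (Fam.whiskerRight_eq_mono rfl _) (Fam.comp_eq_mono (Fam.associator_eq_mono _ _ _)
          (Fam.whiskerLeft_eq_mono rfl _))).symm)
  exact congrArg (Fam.mono _) (funext fun p => totBraid_hexagon_left hz (A.obj p.1.2) (B.obj p.2)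
    (D.obj p.1.1) _ _ _)

theorem complBraid_cross {a a' h x x' y : G} (hy : x * h = y) (hy' : h * x' = y)
    (ha : x * a = 1) (ha' : x' * a' = 1) {A : M.Compl} (B : M.Compl) (hA : M.complDeg a A)
    (hA' : M.complDeg a' ((M.complCross h).obj A)) :
    ((M.complComp hy').hom.app B ≫ (M.complComp hy).inv.app B) ▷ (M.complCross h).obj A ≫
        μ (M.complCross h) ((M.complCross x).obj B) A ≫
          (M.complCross h).map (M.complBraid ha A B hA).hom =
      (M.complBraid ha' ((M.complCross h).obj A) ((M.complCross h).obj B) hA').hom ≫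
        μ (M.complCross h) A B := by
  -- As a `monoIso`, the constraint has a `comono` for its inverse; the monomial form is needed
  -- below.
  have e : (M.complComp hy).inv.app B = Fam.mono
      (X := (M.complCross y).obj B) (Y := (M.complCross h).obj ((M.complCross x).obj B))
      (fun i => i) (fun i => (crossCompApp hy (B.obj i)).inv) := by
    rw [← cancel_mono ((M.complComp hy).hom.app B), Iso.inv_hom_id_app]
    refine (Fam.id_eq_mono _).trans (Eq.trans ?_ (Fam.comp_eq_mono rfl rfl).symm)
    exact congrArg (Fam.mono _) (funext fun p => (Iso.inv_hom_id _).symm)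
  refine (Fam.comp_eq_mono (Fam.whiskerRight_eq_mono (Fam.comp_eq_mono rfl e) _)
    (Fam.comp_eq_mono rfl (Fam.map_mono _ _ _ _))).trans
      (Eq.trans ?_ (Fam.comp_eq_mono rfl rfl).symm)
  refine congrArg (Fam.mono _) (funext fun p => ?_)
  have := totBraid_cross hy hy' (A.obj p.2) (B.obj p.1) ((congrArg (x * ·) (hA.2 p.2)).trans ha)
    ((congrArg (x' * ·) (hA'.2 p.2)).trans ha')
  rw [← MonoidalCategory.comp_whiskerRight_assoc] at this
  exact this

end

end BraidedMonoidale

/-! ### A $G$-braiding from an inverse $G$-braiding -/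

namespace GCrossedCat

variable {k : Type w} [CommRing k] {G : Type u} [Group G] (C : GCrossedCat.{w, v, u} k G)

/-- An inverse `G`-braiding, with isomorphisms `φ g Y ⊗ X ≅ X ⊗ Y` for `X` homogeneous over `g⁻¹`. -/
structure InvBraiding where
  iso {a g : G} (hg : g * a = 1) (X Y : C.carrier) (hX : C.deg a X) : (C.φ g).obj Y ⊗ X ≅ X ⊗ Y
  naturality {a g : G} (hg : g * a = 1) {X X' Y Y' : C.carrier} (hX : C.deg a X)
    (hX' : C.deg a X') (x : X ⟶ X') (y : Y ⟶ Y') :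
    ((C.φ g).map y ⊗ₘ x) ≫ (iso hg X' Y' hX').hom = (iso hg X Y hX).hom ≫ (x ⊗ₘ y)
  hexagon_right {a x : G} (hx : x * a = 1) (A B D : C.carrier) (hA : C.deg a A) :
    (α_ ((C.φ x).obj B) ((C.φ x).obj D) A).inv ≫ μ (C.φ x) B D ▷ A ≫
        (iso hx A (B ⊗ D) hA).hom ≫ (α_ A B D).inv =
      (C.φ x).obj B ◁ (iso hx A D hA).hom ≫ (α_ ((C.φ x).obj B) A D).inv ≫
        (iso hx A B hA).hom ▷ D
  hexagon_left {a b p x y z : G} (hz : y * x = z) (ha : x * a = 1) (hb : y * b = 1)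
    (hzp : z * p = 1) (A B D : C.carrier) (hA : C.deg a A) (hB : C.deg b B)
    (hAB : C.deg p (A ⊗ B)) :
    (α_ ((C.φ x).obj ((C.φ y).obj D)) A B).hom ≫ ((C.φComp hz).hom.app D) ▷ (A ⊗ B) ≫
        (iso hzp (A ⊗ B) D hAB).hom ≫ (α_ A B D).hom =
      (iso ha A ((C.φ y).obj D) hA).hom ▷ B ≫ (α_ A ((C.φ y).obj D) B).hom ≫
        A ◁ (iso hb B D hB).hom
  cross {a a' h x x' y : G} (hy : x * h = y) (hy' : h * x' = y) (ha : x * a = 1)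
    (ha' : x' * a' = 1) {A : C.carrier} (B : C.carrier) (hA : C.deg a A)
    (hA' : C.deg a' ((C.φ h).obj A)) :
    ((C.φComp hy').hom.app B ≫ (C.φComp hy).inv.app B) ▷ (C.φ h).obj A ≫
        μ (C.φ h) ((C.φ x).obj B) A ≫ (C.φ h).map (iso ha A B hA).hom =
      (iso ha' ((C.φ h).obj A) ((C.φ h).obj B) hA').hom ≫ μ (C.φ h) A B

namespace InvBraiding

variable {C} (δ : C.InvBraiding)

/-- The `G`-braiding determined by its inverse. -/
def braid {b : G} (X Y : C.carrier) (hY : C.deg b Y) : X ⊗ Y ≅ Y ⊗ (C.φ b).obj X :=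
  MonoidalCategory.whiskerRightIso (C.cancelIso (mul_inv_cancel b) X).symm Y ≪≫
    δ.iso (inv_mul_cancel b) Y ((C.φ b).obj X) hY

/-- The defining property of `braid`. The axioms below are proved by precomposing with the
invertible cancellation $\phi_{b^{-1}}\phi_bX\cong X$, after which only `δ` is left. -/
theorem cancelIso_braid {b : G} (X Y : C.carrier) (hY : C.deg b Y) :
    (C.cancelIso (mul_inv_cancel b) X).hom ▷ Y ≫ (δ.braid X Y hY).hom =
      (δ.iso (inv_mul_cancel b) Y ((C.φ b).obj X) hY).hom := by
  simp only [braid, Iso.trans_hom, MonoidalCategory.whiskerRightIso_hom, Iso.symm_hom]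
  rw [← MonoidalCategory.comp_whiskerRight_assoc, Iso.hom_inv_id, MonoidalCategory.id_whiskerRight,
    Category.id_comp]

theorem naturality_right {a g : G} (hg : g * a = 1) (X : C.carrier) {Y Y' : C.carrier}
    (hX : C.deg a X) (y : Y ⟶ Y') :
    (C.φ g).map y ▷ X ≫ (δ.iso hg X Y' hX).hom = (δ.iso hg X Y hX).hom ≫ X ◁ y := by
  have := δ.naturality hg hX hX (𝟙 X) y
  rwa [id_tensorHom, tensorHom_id] at this

theorem braid_naturality {b : G} {X X' Y Y' : C.carrier} (hY : C.deg b Y) (hY' : C.deg b Y')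
    (x : X ⟶ X') (y : Y ⟶ Y') : (x ⊗ₘ y) ≫ (δ.braid X' Y' hY').hom =
      (δ.braid X Y hY).hom ≫ (y ⊗ₘ (C.φ b).map x) := by
  rw [← cancel_epi ((C.cancelIso (mul_inv_cancel b) X).hom ▷ Y), reassoc_of% cancelIso_braid,
    ← δ.naturality _ hY hY', ← tensorHom_id, tensorHom_comp_tensorHom_assoc, ← C.cancelIso_naturality,
    ← cancelIso_braid δ X' Y' hY', ← tensorHom_id, tensorHom_comp_tensorHom_assoc, Category.id_comp,
    Category.comp_id]

/-- The right hexagon for $\phi_cX$ and $\phi_cY$. Monoidality of the cancellation lets the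
cancellations of $X$ and $Y$ be inserted separately. -/
theorem braid_tensor_left {c : G} (X Y : C.carrier) {Z : C.carrier} (hZ : C.deg c Z) :
    (δ.braid (X ⊗ Y) Z hZ).hom =
      (α_ X Y Z).hom ≫ X ◁ (δ.braid Y Z hZ).hom ≫ (α_ X Z ((C.φ c).obj Y)).inv ≫
        (δ.braid X Z hZ).hom ▷ (C.φ c).obj Y ≫ (α_ Z ((C.φ c).obj X) ((C.φ c).obj Y)).hom ≫
          Z ◁ μ (C.φ c) X Y := by
  have h₁ := δ.hexagon_right (inv_mul_cancel c) Z ((C.φ c).obj X) ((C.φ c).obj Y) hZ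
  have h₂ := C.cancelIso_tensor (mul_inv_cancel c) X Y
  have h₃ := δ.naturality_right (inv_mul_cancel c) Z hZ (μ (C.φ c) X Y)
  rw [Iso.inv_comp_eq, ← Category.assoc, ← Category.assoc, Iso.comp_inv_eq] at h₁
  simp only [Category.assoc] at h₁
  rw [← cancel_epi (((C.cancelIso (mul_inv_cancel c) X).hom ⊗ₘ
    (C.cancelIso (mul_inv_cancel c) Y).hom) ▷ Z)]
  -- In the middle expression the braidings are values of `δ` on crossed objects. One side reaches
  -- it by the hexagon, the other by `cancelIso_braid` in each factor.
  trans (MonoidalCategoryStruct.associator _ _ _).hom ≫ (C.φ c⁻¹).obj ((C.φ c).obj X) ◁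
      (δ.iso (inv_mul_cancel c) Z ((C.φ c).obj Y) hZ).hom ≫
        (MonoidalCategoryStruct.associator _ _ _).inv ≫ (δ.iso (inv_mul_cancel c) Z ((C.φ c).obj X) hZ).hom ▷ _ ≫
          (MonoidalCategoryStruct.associator _ _ _).hom ≫
          Z ◁ μ (C.φ c) X Y
  · rw [← h₂, MonoidalCategory.comp_whiskerRight, MonoidalCategory.comp_whiskerRight]
    simp only [Category.assoc]
    rw [cancelIso_braid, h₃, reassoc_of% h₁]
  · rw [← tensorHom_id ((C.cancelIso _ X).hom ⊗ₘ _) Z, associator_naturality_assoc,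
      ← cancelIso_braid, ← cancelIso_braid, tensorHom_id, MonoidalCategory.tensorHom_def', Category.assoc]
    simp only [MonoidalCategory.whiskerLeft_comp, MonoidalCategory.comp_whiskerRight,
      Category.assoc]
    rw [← MonoidalCategory.associator_inv_naturality_left_assoc,
      ← MonoidalCategory.whisker_exchange_assoc]

/-- The left hexagon for $\phi_c\phi_bX$. The cancellation for the product $d=bc$ is split into
those for $b$ and $c$ by `cancelIso_comp`. -/
theorem braid_tensor_right {b c d : G} (h : b * c = d) (X : C.carrier) {Y Z : C.carrier}
    (hY : C.deg b Y) (hZ : C.deg c Z) (hYZ : C.deg d (Y ⊗ Z)) :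
    (δ.braid X (Y ⊗ Z) hYZ).hom =
      (α_ X Y Z).inv ≫ (δ.braid X Y hY).hom ▷ Z ≫ (α_ Y ((C.φ b).obj X) Z).hom ≫
        Y ◁ (δ.braid ((C.φ b).obj X) Z hZ).hom ≫
          (α_ Y Z ((C.φ c).obj ((C.φ b).obj X))).inv ≫ (Y ⊗ Z) ◁ (C.compIso h X).hom := by
  have hz : c⁻¹ * b⁻¹ = d⁻¹ := by rw [← h, mul_inv_rev]
  have h₁ := δ.hexagon_left hz (inv_mul_cancel b) (inv_mul_cancel c) (inv_mul_cancel d) Y Z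
    ((C.φ c).obj ((C.φ b).obj X)) hY hZ hYZ
  have h₂ := C.cancelIso_comp hz h (mul_inv_cancel c) (mul_inv_cancel b) (mul_inv_cancel d) X
  have h₃ := δ.naturality_right (inv_mul_cancel b) Y hY
    (C.cancelIso (mul_inv_cancel c) ((C.φ b).obj X)).hom
  have h₄ := δ.naturality_right (inv_mul_cancel d) (Y ⊗ Z) hYZ (C.compIso h X).hom
  rw [← cancel_epi (((C.φ b⁻¹).map (C.cancelIso (mul_inv_cancel c) ((C.φ b).obj X)).hom ≫
    (C.cancelIso (mul_inv_cancel b) X).hom) ▷ (Y ⊗ Z))]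
  trans (C.compIso hz _).hom ▷ (Y ⊗ Z) ≫ (δ.iso (inv_mul_cancel d) (Y ⊗ Z) _ hYZ).hom ≫
    (Y ⊗ Z) ◁ (C.compIso h X).hom
  · rw [← h₂, MonoidalCategory.comp_whiskerRight, MonoidalCategory.comp_whiskerRight]
    simp only [Category.assoc]
    rw [cancelIso_braid, h₄]
  · rw [MonoidalCategory.associator_inv_naturality_left_assoc,
      ← MonoidalCategory.comp_whiskerRight_assoc, MonoidalCategory.comp_whiskerRight_assoc _ _ Y, cancelIso_braid, h₃, MonoidalCategory.comp_whiskerRight_assoc,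
      MonoidalCategory.associator_naturality_middle_assoc,
      ← MonoidalCategory.whiskerLeft_comp_assoc, cancelIso_braid, ← reassoc_of% h₁,
      Iso.inv_hom_id_assoc, Iso.hom_inv_id_assoc]
    rfl

/-- The field `cross`, with `cancelIso_conj` converting the cancellation under $\phi_a$ into the one
for the conjugate degree $c$. -/
theorem braid_φ {a b c d : G} (hc : a * c = b * a) (hd : b * a = d) (X : C.carrier)
    {Y : C.carrier} (hY : C.deg b Y) :
    μ (C.φ a) X Y ≫ (C.φ a).map (δ.braid X Y hY).hom =
      (δ.braid ((C.φ a).obj X) ((C.φ a).obj Y) (C.deg_φ hc hY)).hom ≫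
        (C.φ a).obj Y ◁ ((C.φComp (hc.trans hd)).hom.app X ≫ (C.φComp hd).inv.app X) ≫
          μ (C.φ a) Y ((C.φ b).obj X) := by
  have hy : b⁻¹ * a = b⁻¹ * a := rfl
  have hy' : a * c⁻¹ = b⁻¹ * a := by rw [mul_inv_eq_iff_eq_mul, mul_assoc, hc, inv_mul_cancel_left]
  let θ := (C.compIso (hc.trans hd) X).hom ≫ (C.compIso hd X).inv
  have h₁ : ((C.compIso hy' ((C.φ b).obj X)).hom ≫ (C.compIso hy ((C.φ b).obj X)).inv) ▷
      (C.φ a).obj Y ≫ _ = _ := δ.cross hy hy' (inv_mul_cancel b) (inv_mul_cancel c)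
        ((C.φ b).obj X) hY (C.deg_φ hc hY)
  have h₂ : (C.φ c⁻¹).map θ ≫ _ = _ :=
    C.cancelIso_conj hy hy' hd (hc.trans hd) (mul_inv_cancel b) (mul_inv_cancel c) X
  have h₃ := δ.naturality_right (inv_mul_cancel c) ((C.φ a).obj Y) (C.deg_φ hc hY) θ
  have h₄ := Functor.LaxMonoidal.μ_natural_left (C.φ a) (C.cancelIso (mul_inv_cancel b) X).hom Y
  change _ = _ ≫ _ ◁ θ ≫ _
  rw [← cancel_epi (((C.φ c⁻¹).map θ ≫ ((C.compIso hy' ((C.φ b).obj X)).hom ≫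
    (C.compIso hy ((C.φ b).obj X)).inv) ≫
      (C.φ a).map (C.cancelIso (mul_inv_cancel b) X).hom) ▷ (C.φ a).obj Y)]
  trans (C.φ c⁻¹).map θ ▷ (C.φ a).obj Y ≫
    (δ.iso (inv_mul_cancel c) _ _ (C.deg_φ hc hY)).hom ≫ μ (C.φ a) Y _
  · rw [MonoidalCategory.comp_whiskerRight_assoc, MonoidalCategory.comp_whiskerRight_assoc]
    rw [reassoc_of% h₄, ← Functor.map_comp, cancelIso_braid, h₁]
  · rw [reassoc_of% h₃, Category.assoc, h₂, ← reassoc_of% cancelIso_braid]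

end InvBraiding

end GCrossedCat

/-- A `G`-crossed category with an inverse `G`-braiding is a `G`-braided category. -/
def GBraidedCat.ofInvBraiding {k : Type w} [CommRing k] {G : Type u} [Group G]
    (C : GCrossedCat.{w, v, u} k G) (δ : C.InvBraiding) : GBraidedCat.{w, v, u} k G where
  toGCrossedCat := C
  braid := δ.braid
  braid_naturality := δ.braid_naturality
  braid_tensor_right h X _ _ hY hZ := δ.braid_tensor_right h X hY hZ _
  braid_tensor_left := δ.braid_tensor_left
  braid_φ := δ.braid_φ

/-! ### The $G$-braided completion and the embedding into it -/

namespace BraidedMonoidale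

variable {k : Type w} [CommRing k] {G : Type u} [Group G] (M : BraidedMonoidale.{w, v, u} k G)

/-- The inverse `G`-braiding of the completion. -/
noncomputable def complInvBraiding : M.toGCrossedCat.InvBraiding where
  iso := M.complBraid
  naturality := M.complBraid_naturality
  hexagon_right := M.complBraid_hexagon_right
  hexagon_left := M.complBraid_hexagon_left
  cross := M.complBraid_cross

/-- The `G`-braided category associated with a braided monoidale. -/
noncomputable def compl : GBraidedCat.{w, v, u} k G :=
  .ofInvBraiding M.toGCrossedCat M.complInvBraiding

end BraidedMonoidale

namespace Fam

variable {T Λ : Type u}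

/-- The family with a single member. -/
def single (l : Λ) (A : T) : Fam T Λ := ⟨l, .fin 1, fun _ => A⟩

variable [Category.{v} T] [Preadditive T]

theorem mono_single {X : Fam T Λ} {l : Λ} {B : T} (σ τ : X.Idx → (single l B).Idx)
    {c d : ∀ i, X.obj i ⟶ B} (h : ∀ i, c i = d i) :
    mono (Y := single l B) σ c = mono (Y := single l B) τ d := by
  obtain rfl : σ = τ := funext fun _ => Subsingleton.elim (α := Fin 1) _ _
  obtain rfl : c = d := funext h
  rfl

/-- The morphism of families with a single member given by a morphism. -/
noncomputable def singleMap (l l' : Λ) {A B : T} (f : A ⟶ B) : single l A ⟶ single l' B :=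
  mono (fun i => i) fun _ => f

theorem singleMap_apply (l l' : Λ) {A B : T} (f : A ⟶ B) (i : (single l A).Idx)
    (j : (single l' B).Idx) : singleMap l l' f i j = f := by
  obtain rfl : i = j := Subsingleton.elim (α := Fin 1) _ _
  exact mono_self _ _ _

/-- The embedding of `T` into families with a given label. -/
@[simps]
noncomputable def singleFunctor (T : Type u) [Category.{v} T] [Preadditive T] (l : Λ) :
    T ⥤ Fam T Λ where
  obj A := single l A
  map f := singleMap l l f
  map_id A := (id_eq_mono _).symm
  map_comp {A B C} f g := (mono_comp_mono (X := single l A) (Y := single l B) (Z := single l C)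
    (fun i => i) (fun _ => f) (fun i => i) fun _ => g).symm

instance (l : Λ) : (singleFunctor T l).Additive where
  map_add {A B f g} := hom_ext fun i j => by
    rw [add_apply]
    exact (singleMap_apply l l (f + g) i j).trans
      (congrArg₂ (· + ·) (singleMap_apply l l f i j) (singleMap_apply l l g i j)).symm

instance {k : Type w} [CommRing k] [Linear k T] (l : Λ) : (singleFunctor T l).Linear k where
  map_smul {A B} f r := hom_ext fun i j => by
    rw [smul_apply]
    exact (singleMap_apply l l (r • f) i j).trans
      (congrArg (r • ·) (singleMap_apply l l f i j)).symm

instance (l : Λ) : (singleFunctor T l).Faithful where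
  map_injective {A B f g} h := by
    have e := congrFun (congrFun h (0 : Fin 1)) (0 : Fin 1)
    exact (singleMap_apply l l f _ _).symm.trans (e.trans (singleMap_apply l l g _ _))

instance (l : Λ) : (singleFunctor T l).Full where
  map_surjective {A B} f := ⟨f (0 : Fin 1) (0 : Fin 1), hom_ext fun i j => by
    obtain rfl : i = (0 : Fin 1) := Subsingleton.elim (α := Fin 1) _ _
    obtain rfl : j = (0 : Fin 1) := Subsingleton.elim (α := Fin 1) _ _
    exact singleMap_apply l l _ _ _⟩

theorem tensorHom_eq_mono [MonoidalCategory T] [MonoidalPreadditive T] [MulOneClass Λ]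
    {X X' Y Y' : Fam T Λ} {f : X ⟶ X'} {g : Y ⟶ Y'} {σ : X.Idx → X'.Idx}
    {c : ∀ i, X.obj i ⟶ X'.obj (σ i)} {τ : Y.Idx → Y'.Idx} {d : ∀ i, Y.obj i ⟶ Y'.obj (τ i)}
    (hf : f = mono σ c) (hg : g = mono τ d) :
    f ⊗ₘ g = mono (X := X ⊗ Y) (Y := X' ⊗ Y') (fun p => (σ p.1, τ p.2))
      fun p => c p.1 ⊗ₘ d p.2 := by
  subst hf hg
  exact mono_tensor σ c τ d

theorem leftUnitor_eq_mono [MonoidalCategory T] [MonoidalPreadditive T] [MulOneClass Λ]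
    (X : Fam T Λ) : (λ_ X).hom =
      mono (X := 𝟙_ (Fam T Λ) ⊗ X) (Y := X) (fun p => p.2) fun p => (λ_ (X.obj p.2)).hom := rfl

theorem rightUnitor_eq_mono [MonoidalCategory T] [MonoidalPreadditive T] [MulOneClass Λ]
    (X : Fam T Λ) : (ρ_ X).hom =
      mono (X := X ⊗ 𝟙_ (Fam T Λ)) (Y := X) (fun p => p.1) fun p => (ρ_ (X.obj p.1)).hom := rfl

end Fam

/-- Passing from `δ` to a $G$-braiding and back returns `δ`. The point is the triangle identity `h₂`
between the cancellations of $\phi_a\phi_{a^{-1}}$ and $\phi_{a^{-1}}\phi_a$; the rest is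
naturality. It identifies the braiding of the monoidale of the completion. -/
theorem GCrossedCat.InvBraiding.invBraid_eq {k : Type w} [CommRing k] {G : Type u} [Group G]
    {C : GCrossedCat.{w, v, u} k G} (δ : C.InvBraiding) {a : G} (X Y : C.carrier)
    (hX : C.deg a X) :
    (GBraidedCat.ofInvBraiding C δ).invBraid (inv_mul_cancel a) X Y hX =
      δ.iso (inv_mul_cancel a) X Y hX := by
  ext
  have h₁ := δ.naturality_right (inv_mul_cancel a) X hX (C.cancelIso (inv_mul_cancel a) Y).hom
  have h₂ : (C.cancelIso (mul_inv_cancel a) ((C.φ a⁻¹).obj Y)).hom =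
      (C.φ a⁻¹).map (C.cancelIso (inv_mul_cancel a) Y).hom := by
    rw [C.map_cancelIso, ← C.compIso_assoc (mul_inv_cancel a) (mul_one a⁻¹),
      ← C.cancelIso_unitIso, Category.assoc, C.unitIso_compIso, Category.comp_id]
  change (δ.braid ((C.φ a⁻¹).obj Y) X hX).hom ≫ X ◁ (C.cancelIso (inv_mul_cancel a) Y).hom = _
  rw [← cancel_epi ((C.cancelIso (mul_inv_cancel a) ((C.φ a⁻¹).obj Y)).hom ▷ X),
    ← Category.assoc, δ.cancelIso_braid, ← h₁, h₂]

/-- The property is not assumed closed under isomorphism, so the biproduct is moved along `e` to the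
object `X`, which is known to satisfy it. -/
theorem ObjectProperty.isDirectSum_fullSubcategory {C : Type u} [Category.{v} C] [Preadditive C]
    (P : ObjectProperty C) {ι : Type*} [Fintype ι] {X : P.FullSubcategory}
    {Y : ι → P.FullSubcategory} (h : IsDirectSum X.obj fun i => (Y i).obj) : IsDirectSum X Y := by
  classical
  obtain ⟨b, ⟨hb⟩, ⟨e⟩⟩ := h
  let b' : Limits.Bicone Y :=
    { pt := X
      π i := P.homMk (e.inv ≫ b.π i)
      ι i := P.homMk (b.ι i ≫ e.hom)
      ι_π i j := by
        refine ObjectProperty.hom_ext _ (Eq.trans ?_ (b.ι_π i j) |>.trans ?_)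
        · change (b.ι i ≫ e.hom) ≫ e.inv ≫ b.π j = _
          rw [Category.assoc, Iso.hom_inv_id_assoc]
        · split_ifs with h
          · subst h
            rfl
          · rfl }
  refine ⟨b', ⟨Limits.isBilimitOfTotal _ (ObjectProperty.hom_ext _ ?_)⟩, ⟨Iso.refl _⟩⟩
  refine (map_sum P.ι.mapAddHom (fun a => b'.π a ≫ b'.ι a) Finset.univ).trans ?_
  change ∑ i, (e.inv ≫ b.π i) ≫ b.ι i ≫ e.hom = 𝟙 X.obj
  have : ∑ i, (e.inv ≫ b.π i) ≫ b.ι i ≫ e.hom = e.inv ≫ (∑ i, b.π i ≫ b.ι i) ≫ e.hom := by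
    simp only [Preadditive.sum_comp, Preadditive.comp_sum, Category.assoc]
  rw [this, Limits.IsBilimit.total hb, Category.id_comp, Iso.inv_hom_id]

namespace BraidedMonoidale

open Monoidale LinCat.Total

variable {k : Type w} [CommRing k] {G : Type u} [Group G] (M : BraidedMonoidale.{w, v, u} k G)

/-- The embedding of the fibre of a braided monoidale into the homogeneous objects of its
completion. -/
noncomputable def embFunctor (a : G) : M.ps.fib a ⥤ M.compl.toPs.fib a :=
  (M.complDeg a).lift (incl (fun a => M.ps.fib a) a ⋙ Fam.singleFunctor M.Tot (a : WithZero G))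
    fun _ => ⟨rfl, fun _ => rfl⟩

instance (a : G) : (M.embFunctor a).Additive where
  map_add {_ _ f g} := ObjectProperty.hom_ext _
    ((incl (fun a => M.ps.fib a) a ⋙ Fam.singleFunctor M.Tot (a : WithZero G)).map_add
      (f := f) (g := g))

instance (a : G) : (M.embFunctor a).Linear k where
  map_smul f r := ObjectProperty.hom_ext _
    ((incl (fun a => M.ps.fib a) a ⋙ Fam.singleFunctor M.Tot (a : WithZero G)).map_smul r f)

instance (a : G) : (M.embFunctor a).Full where
  map_surjective f :=
    let ⟨g, hg⟩ := (incl (fun a => M.ps.fib a) a ⋙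
      Fam.singleFunctor M.Tot (a : WithZero G)).map_surjective f.hom
    ⟨g, ObjectProperty.hom_ext _ hg⟩

instance (a : G) : (M.embFunctor a).Faithful where
  map_injective h := (incl (fun a => M.ps.fib a) a ⋙
    Fam.singleFunctor M.Tot (a : WithZero G)).map_injective (congrArg (fun z => (M.complDeg a).ι.map z) h)

/-- A homogeneous family is the direct sum of its members, each of which comes from the fibre over
`a`. It may carry only the label `a`, as do the single-member families. -/
theorem embFunctor_isDirectSum {a : G} (Y : M.compl.toPs.fib a) :
    ∃ (n : ℕ) (X : Fin n → M.ps.fib a), IsDirectSum Y fun i => (M.embFunctor a).obj (X i) := by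
  obtain ⟨⟨l, s, Y⟩, hl, hY⟩ := Y
  have hY' : ∀ i, ∃ A : M.ps.fib a, Y i = ⟨a, A⟩ := fun i => by
    have hi : (Y i).deg = a := hY i
    generalize Y i = y at hi
    obtain ⟨b, B⟩ := y
    subst hi
    exact ⟨B, rfl⟩
  choose A hA using hY'
  refine ⟨Fintype.card s.El, fun i => A ((Fintype.equivFin s.El).symm i), ?_⟩
  refine ObjectProperty.isDirectSum_fullSubcategory (M.complDeg a) ?_
  exact Fam.isDirectSum (X := ⟨l, s, Y⟩)
    ((Equiv.sigmaUnique (Fin (Fintype.card s.El)) fun _ => Fin 1).trans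
      (Fintype.equivFin s.El).symm) fun p => eqToIso (hA _).symm

/-- The action constraint of the embedding. -/
noncomputable def embAct {a b : G} (g : G) (h : g * a = b * g) (A : M.ps.fib a) :
    (Fam.single (b : WithZero G) (⟨b, (M.ps.act g h).obj A⟩ : M.Tot) : M.Compl) ≅
      (M.complCross g⁻¹).obj (Fam.single (a : WithZero G) (⟨a, A⟩ : M.Tot)) :=
  Fam.monoIso (X := Fam.single (b : WithZero G) (⟨b, (M.ps.act g h).obj A⟩ : M.Tot))
    (Y := (M.complCross g⁻¹).obj (Fam.single (a : WithZero G) (⟨a, A⟩ : M.Tot)))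
    (Equiv.refl (Fin 1)) fun _ => (crossIncl (inv_inv g) h A).symm

/-- The element `e` is `1⁻¹` in the application. Generalising it allows the unit constraint of the
completion to be exposed by substitution. -/
theorem embAct_one {a e : G} (he : e = 1) (he' : e⁻¹ = 1) (h : (1 : G) * a = a * 1) (A : M.ps.fib a) :
    Fam.mono (X := (Fam.single (a : WithZero G) (⟨a, (M.ps.act 1 h).obj A⟩ : M.Tot) : M.Compl))
      (Y := (M.complCross e).obj (Fam.single (a : WithZero G) (⟨a, A⟩ : M.Tot)))
      (fun i => i) (fun _ => (crossIncl he' h A).inv) ≫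
        (M.compl.oneIso he (Fam.single (a : WithZero G) (⟨a, A⟩ : M.Tot))).hom =
    Fam.singleMap _ _ (inclMap (M.ps.actOne h A).hom) := by
  subst he
  have e : (M.compl.oneIso rfl (Fam.single (a : WithZero G) (⟨a, A⟩ : M.Tot))).hom = (M.complUnit.app (Fam.single (a : WithZero G) (⟨a, A⟩ : M.Tot))).inv :=
    congrArg Iso.hom (GCrossedCat.oneIso_one _ _)
  refine (congrArg (_ ≫ ·) e).trans ?_
  refine (Iso.comp_inv_eq (M.complUnit.app
    (Fam.single (a : WithZero G) (⟨a, A⟩ : M.Tot) : M.Compl))).2 ?_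
  refine Eq.trans ?_ (Fam.comp_eq_mono rfl rfl).symm
  refine congrArg (Fam.mono _) (funext fun _ => ?_)
  change _ = _ ≫ (crossUnitApp (⟨a, A⟩ : M.Tot)).hom
  rw [← Iso.comp_inv_eq]
  exact Iso.inv_hom_id_assoc (crossIncl inv_one h A) _

/-- The pseudonatural transformation from a braided monoidale to its completion. -/
noncomputable def embTrans : M.ps ⟶ M.compl.toBraidedMonoidale.ps :=
  PsGAut.mkTrans (F := M.ps) (F' := M.compl.toPs) (fun a => M.embFunctor a)
    (fun {a b} g h => NatIso.ofComponents
      (fun A => (M.complDeg b).isoMk (X := (M.embFunctor b).obj ((M.ps.act g h).obj A))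
        (Y := (M.compl.actFunctor g h).obj ((M.embFunctor a).obj A)) (M.embAct g h A))
      fun {A A'} f => ObjectProperty.hom_ext _ (by
        refine (Fam.comp_eq_mono rfl rfl).trans (Eq.trans ?_ (Fam.comp_eq_mono rfl (Fam.map_mono _ _ _ _)).symm)
        refine congrArg (Fam.mono _) (funext fun _ => ?_)
        exact GBraidedCat.cancel_iso_eq (crossIncl (inv_inv g) h A).symm (crossIncl (inv_inv g) h A').symm (crossIncl_naturality (inv_inv g) h f).symm))
    (fun {a} h A => by
      rw [GBraidedCat.toPs_actOne]
      exact ObjectProperty.hom_ext _ (M.embAct_one inv_one (inv_inv 1) h A))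
    (fun {a b c f g e} hf hg he hm A => by
      rw [GBraidedCat.toPs_actMul]
      refine ObjectProperty.hom_ext _ ?_
      refine (Fam.comp_eq_mono rfl (Fam.comp_eq_mono (Fam.map_mono _ _ _ _) rfl)).trans (Eq.trans ?_ (Fam.comp_eq_mono rfl rfl).symm)
      refine congrArg (Fam.mono _) (funext fun _ => ?_)
      have key := crossCompApp_crossIncl (show f⁻¹ * g⁻¹ = e⁻¹ by rw [← hm, mul_inv_rev])
        (inv_inv f) (inv_inv g) (inv_inv e) hf hg he hm A
      change (crossIncl (inv_inv g) hg ((M.ps.act f hf).obj A)).inv ≫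
        (M.cross g⁻¹).map (crossIncl (inv_inv f) hf A).inv ≫ (crossCompApp (show f⁻¹ * g⁻¹ = e⁻¹ by rw [← hm, mul_inv_rev]) ⟨a, A⟩).hom =
          inclMap (M.ps.actMul hf hg he hm A).hom ≫ (crossIncl (inv_inv e) he A).inv
      rw [Iso.inv_comp_eq, ← Functor.mapIso_inv, Iso.inv_comp_eq, ← cancel_mono (crossIncl (inv_inv e) he A).hom]
      simp only [Category.assoc, Iso.inv_hom_id]
      exact key.symm.trans (by rw [Functor.mapIso_hom]; exact congrArg (fun z => _ ≫ _ ≫ z) (Category.comp_id _).symm))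

/-- The tensor constraint of the embedding. -/
noncomputable def embTensor {a b c : G} (h : a * b = c) (A : M.ps.fib a) (B : M.ps.fib b) :
    (Fam.single (a : WithZero G) (⟨a, A⟩ : M.Tot) ⊗ Fam.single (b : WithZero G) (⟨b, B⟩ : M.Tot)) ≅
      Fam.single (c : WithZero G) (⟨c, (M.tensor h).obj A B⟩ : M.Tot) :=
  Fam.monoIso (X := Fam.single (a : WithZero G) (⟨a, A⟩ : M.Tot) ⊗ Fam.single (b : WithZero G) (⟨b, B⟩ : M.Tot)) (Y := Fam.single (c : WithZero G) (⟨c, (M.tensor h).obj A B⟩ : M.Tot))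
    (Equiv.uniqueProd (Fin 1) (Fin 1)) fun _ => tensorIncl h A B

/-- The 1-cell from a braided monoidale to its completion. -/
noncomputable def emb : Hom M M.compl.toBraidedMonoidale where
  trans := M.embTrans
  tensorIso {a b c} h A B := (M.complDeg c).isoMk (M.embTensor h A B)
  tensorIso_naturality {a b c} h A A' B B' x y := ObjectProperty.hom_ext _ (by
    refine (Fam.comp_eq_mono (Fam.tensorHom_eq_mono rfl rfl) rfl).trans (Eq.trans ?_ (Fam.comp_eq_mono rfl rfl).symm)
    exact Fam.mono_single _ _ fun _ => tensorIncl_naturality h x y)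
  -- The single-member family on the unit of `M`, with label `1`, is by definition the unit of the
  -- completion.
  unitIso := Iso.refl _
  tensorIso_act {a b c a' b' c' g} h h' ha hb hc A B := ObjectProperty.hom_ext _ (by
    refine (Fam.comp_eq_mono (Fam.tensorHom_eq_mono rfl rfl) (Fam.comp_eq_mono rfl (Fam.map_mono _ _ _ _))).trans (Eq.trans ?_ (Fam.comp_eq_mono rfl (Fam.comp_eq_mono rfl rfl)).symm)
    refine Fam.mono_single (l := conjLabel g⁻¹ (c : WithZero G))
      (B := (M.cross g⁻¹).obj (⟨c, (M.tensor h).obj A B⟩ : M.Tot)) _ _ fun _ => ?_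
    have key := crossTensor_crossIncl (inv_inv g) h h' ha hb hc A B
    change ((crossIncl (inv_inv g) ha A).inv ⊗ₘ (crossIncl (inv_inv g) hb B).inv) ≫
      (crossTensor g⁻¹ ⟨a, A⟩ ⟨b, B⟩).hom ≫ (M.cross g⁻¹).map (tensorIncl h A B).hom =
      (tensorIncl h' _ _).hom ≫ inclMap (M.tensorAct h h' ha hb hc A B).hom ≫
        (crossIncl (inv_inv g) hc _).inv
    rw [← cancel_mono (crossIncl (inv_inv g) hc ((M.tensor h).obj A B)).hom]
    simp only [Category.assoc, Iso.inv_hom_id]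
    rw [← key, tensorHom_comp_tensorHom_assoc, Iso.inv_hom_id, Iso.inv_hom_id, id_tensorHom_id,
      Category.id_comp]
    exact congrArg (_ ≫ ·) (Category.comp_id _).symm)
  unitIso_act {g} h := by
    refine (congrArg (_ ≫ ·) (CategoryTheory.Functor.map_id _ _)).trans
      ((Category.comp_id _).trans (Eq.trans ?_ (Category.id_comp _).symm))
    refine ObjectProperty.hom_ext _ ?_
    refine Eq.trans ?_ (Fam.comp_eq_mono rfl rfl).symm
    refine congrArg (Fam.mono _) (funext fun _ => ?_)
    exact (Iso.eq_comp_inv (crossIncl (inv_inv g) h M.unit)).2 (crossOne_crossIncl (inv_inv g) h)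
  assoc {a b c p q s} hp hpc hq haq A B C := ObjectProperty.hom_ext _ (by
    refine (Fam.comp_eq_mono (Fam.tensorHom_eq_mono rfl (Fam.id_eq_mono _)) (Fam.comp_eq_mono rfl rfl)).trans
      (Eq.trans ?_ (Fam.comp_eq_mono (Fam.associator_eq_mono _ _ _) (Fam.comp_eq_mono (Fam.tensorHom_eq_mono (Fam.id_eq_mono _) rfl) rfl)).symm)
    refine Fam.mono_single _ _ fun _ => ?_
    have key := tensorIncl_assoc hp hpc hq haq A B C
    rw [← tensorHom_id, ← id_tensorHom] at key
    exact key)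
  leftUnit {a} h A := ObjectProperty.hom_ext _ (by
    refine (Fam.comp_eq_mono (Fam.tensorHom_eq_mono (Fam.id_eq_mono _) (Fam.id_eq_mono _))
      (Fam.comp_eq_mono rfl rfl)).trans (Eq.trans ?_ (Fam.leftUnitor_eq_mono _).symm)
    refine Fam.mono_single _ _ fun _ => ?_
    rw [id_tensorHom_id]
    exact (Category.id_comp _).trans (tensorIncl_leftUnit h A))
  rightUnit {a} h A := ObjectProperty.hom_ext _ (by
    refine (Fam.comp_eq_mono (Fam.tensorHom_eq_mono (Fam.id_eq_mono _) (Fam.id_eq_mono _))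
      (Fam.comp_eq_mono rfl rfl)).trans (Eq.trans ?_ (Fam.rightUnitor_eq_mono _).symm)
    refine Fam.mono_single _ _ fun _ => ?_
    rw [id_tensorHom_id]
    exact (Category.id_comp _).trans (tensorIncl_rightUnit h A))
  braid {a b b' c} h hb h' A B := ObjectProperty.hom_ext _ (by
    -- The braiding of the target is an inverse. Here the compatibility is cleared of inverses, so
    -- that it becomes `totBraid_crossIncl` on single members.
    have key : (M.embAct a hb B).hom ▷ (Fam.single (a : WithZero G) (⟨a, A⟩ : M.Tot) : M.Compl) ≫
        (M.complBraid (inv_mul_cancel a) (Fam.single (a : WithZero G) (⟨a, A⟩ : M.Tot))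
          (Fam.single (b : WithZero G) (⟨b, B⟩ : M.Tot)) ⟨rfl, fun _ => rfl⟩).hom ≫
          (M.embTensor h A B).hom ≫ Fam.singleMap (c : WithZero G) (c : WithZero G)
            (inclMap (M.braid h hb h' A B).hom) =
        (M.embTensor h' ((M.ps.act a hb).obj B) A).hom := by
      refine (Fam.comp_eq_mono (Fam.whiskerRight_eq_mono rfl _) (Fam.comp_eq_mono rfl (Fam.comp_eq_mono rfl rfl))).trans ?_
      refine Fam.mono_single _ _ fun _ => ?_
      change (crossIncl (inv_inv a) hb B).inv ▷ (⟨a, A⟩ : M.Tot) ≫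
        (totBraid (⟨a, A⟩ : M.Tot) ⟨b, B⟩ (inv_mul_cancel a)).hom ≫ (tensorIncl h A B).hom ≫
          inclMap (M.braid h hb h' A B).hom = (tensorIncl h' ((M.ps.act a hb).obj B) A).hom
      rw [← totBraid_crossIncl (inv_mul_cancel a) (inv_inv a) h hb h' A B]
      exact MonoidalCategory.inv_hom_whiskerRight_assoc (crossIncl (inv_inv a) hb B) _ _
    have e := M.complInvBraiding.invBraid_eq (Fam.single (a : WithZero G) (⟨a, A⟩ : M.Tot))
          (Fam.single (b : WithZero G) (⟨b, B⟩ : M.Tot)) ⟨rfl, fun _ => rfl⟩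
    refine Eq.trans ?_ (congrArg (fun z => Iso.inv z ≫ _) e.symm)
    refine (Iso.eq_inv_comp (M.complBraid (inv_mul_cancel a) (Fam.single (a : WithZero G) (⟨a, A⟩ : M.Tot))
          (Fam.single (b : WithZero G) (⟨b, B⟩ : M.Tot)) ⟨rfl, fun _ => rfl⟩)).2 ?_
    have e₂ : ∀ {Z : M.Compl} (z : _ ⟶ Z), ((M.embAct a hb B).inv ⊗ₘ
        𝟙 (Fam.single (a : WithZero G) (⟨a, A⟩ : M.Tot) : M.Compl)) ≫
          (M.embAct a hb B).hom ▷ (Fam.single (a : WithZero G) (⟨a, A⟩ : M.Tot) : M.Compl) ≫ z =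
        z := fun z => by rw [tensorHom_id, MonoidalCategory.inv_hom_whiskerRight_assoc]
    exact (e₂ _).symm.trans (congrArg (_ ≫ ·) key))

end BraidedMonoidale

/-! ### Extension of functors from a full subcategory to finite direct sums -/

section Extension

variable {A C D : Type*} [Category* A] [Category* C] [Category* D] [Preadditive A] [Preadditive C]
  [Preadditive D] (J : A ⥤ C) [J.Full] [J.Faithful] [J.Additive] (P : A ⥤ D) [P.Additive]

/-- The effect of `P` on morphisms of the full subcategory given by `J`. -/
noncomputable def extMap {X Y : A} (f : J.obj X ⟶ J.obj Y) : P.obj X ⟶ P.obj Y :=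
  P.map (J.preimage f)

variable {J P}

theorem extMap_id (X : A) : extMap J P (𝟙 (J.obj X)) = 𝟙 (P.obj X) := by
  simp [extMap]

theorem extMap_comp {X Y Z : A} (f : J.obj X ⟶ J.obj Y) (g : J.obj Y ⟶ J.obj Z) :
    extMap J P (f ≫ g) = extMap J P f ≫ extMap J P g := by
  simp [extMap]

theorem extMap_comp_assoc {X Y Z : A} (f : J.obj X ⟶ J.obj Y) (g : J.obj Y ⟶ J.obj Z) {W : D}
    (w : P.obj Z ⟶ W) : extMap J P (f ≫ g) ≫ w = extMap J P f ≫ extMap J P g ≫ w := by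
  rw [extMap_comp, Category.assoc]

theorem extMap_map {X Y : A} (f : X ⟶ Y) : extMap J P (J.map f) = P.map f := by
  simp [extMap]

theorem extMap_add {X Y : A} (f g : J.obj X ⟶ J.obj Y) :
    extMap J P (f + g) = extMap J P f + extMap J P g := by
  obtain ⟨f, rfl⟩ := J.map_surjective f
  obtain ⟨g, rfl⟩ := J.map_surjective g
  rw [← J.map_add, extMap_map, extMap_map, extMap_map, P.map_add]

theorem extMap_zero (X Y : A) : extMap J P (0 : J.obj X ⟶ J.obj Y) = 0 := by
  rw [← J.map_zero, extMap_map, P.map_zero]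

theorem extMap_sum {X Y : A} {ι : Type*} (s : Finset ι) (f : ι → (J.obj X ⟶ J.obj Y)) :
    extMap J P (∑ i ∈ s, f i) = ∑ i ∈ s, extMap J P (f i) := by
  classical
  induction s using Finset.induction_on with
  | empty => exact extMap_zero X Y
  | insert a s ha ih => rw [Finset.sum_insert ha, Finset.sum_insert ha, extMap_add, ih]

theorem extMap_smul {k : Type*} [CommRing k] [Linear k A] [Linear k C] [Linear k D] [J.Linear k]
    [P.Linear k] {X Y : A} (r : k) (f : J.obj X ⟶ J.obj Y) :
    extMap J P (r • f) = r • extMap J P f := by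
  obtain ⟨f, rfl⟩ := J.map_surjective f
  rw [← J.map_smul, extMap_map, extMap_map, P.map_smul]

variable (J P) in
/-- A presentation of `X` as a retract of a finite sum of objects of a full subcategory, with a
corresponding value `val` for an extension of a functor `P`. -/
structure ExtAt (X : C) where
  ι : Type u
  [fintype : Fintype ι]
  obj : ι → A
  inc (i : ι) : J.obj (obj i) ⟶ X
  pr (i : ι) : X ⟶ J.obj (obj i)
  total : ∑ i, pr i ≫ inc i = 𝟙 X
  val : D
  inc' (i : ι) : P.obj (obj i) ⟶ val
  pr' (i : ι) : val ⟶ P.obj (obj i)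
  total' : ∑ i, pr' i ≫ inc' i = 𝟙 val
  compat (i j : ι) : inc' i ≫ pr' j = extMap J P (inc i ≫ pr j)

attribute [instance] ExtAt.fintype

namespace ExtAt

/-- The identity of `X` is inserted between `f` and `g` as the sum given by `total`, and `P` is
additive. -/
theorem sum_extMap {X : C} (E : ExtAt.{u} J P X) {a b : A} (f : J.obj a ⟶ X) (g : X ⟶ J.obj b) :
    ∑ i, extMap J P (f ≫ E.pr i) ≫ extMap J P (E.inc i ≫ g) = extMap J P (f ≫ g) := by
  have : f ≫ g = ∑ i, (f ≫ E.pr i) ≫ E.inc i ≫ g := by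
    simp only [Category.assoc]
    rw [← Preadditive.comp_sum]
    simp only [← Category.assoc (E.pr _)]
    rw [← Preadditive.sum_comp, E.total, Category.id_comp]
  rw [this, extMap_sum]
  simp only [extMap_comp]

/-- The value of the extension on a morphism out of an object of the full subcategory. -/
noncomputable def ofJ {X : C} (E : ExtAt.{u} J P X) {a : A} (f : J.obj a ⟶ X) : P.obj a ⟶ E.val :=
  ∑ i, extMap J P (f ≫ E.pr i) ≫ E.inc' i

/-- The value of the extension on a morphism to an object of the full subcategory. -/
noncomputable def toJ {X : C} (E : ExtAt.{u} J P X) {a : A} (f : X ⟶ J.obj a) : E.val ⟶ P.obj a :=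
  ∑ i, E.pr' i ≫ extMap J P (E.inc i ≫ f)

/-- The value of the extension on morphisms. -/
noncomputable def map {X Y : C} (E : ExtAt.{u} J P X) (E' : ExtAt.{u} J P Y) (f : X ⟶ Y) :
    E.val ⟶ E'.val :=
  ∑ i, E.pr' i ≫ E'.ofJ (E.inc i ≫ f)

variable {X Y Z : C} (E : ExtAt.{u} J P X) (E' : ExtAt.{u} J P Y) (E'' : ExtAt.{u} J P Z)

theorem ofJ_pr' {a : A} (f : J.obj a ⟶ X) (i : E.ι) : E.ofJ f ≫ E.pr' i = extMap J P (f ≫ E.pr i) := by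
  rw [← sum_extMap E f (E.pr i), ofJ, Preadditive.sum_comp]
  simp only [Category.assoc, E.compat]

theorem ofJ_pr'_assoc {a : A} (f : J.obj a ⟶ X) (i : E.ι) {W : D} (w : P.obj (E.obj i) ⟶ W) :
    E.ofJ f ≫ E.pr' i ≫ w = extMap J P (f ≫ E.pr i) ≫ w := by
  rw [← Category.assoc, ofJ_pr']

theorem ofJ_toJ {a b : A} (f : J.obj a ⟶ X) (g : X ⟶ J.obj b) :
    E.ofJ f ≫ E.toJ g = extMap J P (f ≫ g) := by
  rw [toJ, Preadditive.comp_sum]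
  simp only [ofJ_pr'_assoc]
  exact sum_extMap E f g

theorem ofJ_toJ_assoc {a b : A} (f : J.obj a ⟶ X) (g : X ⟶ J.obj b) {W : D} (w : P.obj b ⟶ W) :
    E.ofJ f ≫ E.toJ g ≫ w = extMap J P (f ≫ g) ≫ w := by
  rw [← Category.assoc, ofJ_toJ]

/-- The matrix product through the presentation of `X` collapses by `total`. Functoriality of the
extension follows from this rule and `hom_ext`. -/
theorem ofJ_map {a : A} (f : J.obj a ⟶ X) (g : X ⟶ Y) :
    E.ofJ f ≫ E.map E' g = E'.ofJ (f ≫ g) := by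
  rw [map, Preadditive.comp_sum]
  simp only [ofJ_pr'_assoc]
  simp only [ofJ, Preadditive.comp_sum, ← extMap_comp_assoc]
  rw [Finset.sum_comm]
  refine Finset.sum_congr rfl fun j _ => ?_
  rw [← Preadditive.sum_comp, ← extMap_sum]
  congr 2
  simp only [Category.assoc]
  rw [← Preadditive.comp_sum]
  simp only [← Category.assoc (E.pr _)]
  rw [← Preadditive.sum_comp, E.total, Category.id_comp]

theorem ofJ_map_assoc {a : A} (f : J.obj a ⟶ X) (g : X ⟶ Y) {W : D} (w : E'.val ⟶ W) :
    E.ofJ f ≫ E.map E' g ≫ w = E'.ofJ (f ≫ g) ≫ w := by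
  rw [← Category.assoc, ofJ_map]

/-- By `compat` the sum contains `inc' i` followed by the total of the `pr'` and `inc'`, which is
the identity. -/
theorem ofJ_inc (i : E.ι) : E.ofJ (E.inc i) = E.inc' i := by
  rw [ofJ]
  simp only [← E.compat, Category.assoc]
  rw [← Preadditive.comp_sum, E.total', Category.comp_id]

/-- The morphisms `inc' i` jointly cover the value, by `total'`, and they are of the form `ofJ`. So
equality can be tested on morphisms from the full subcategory. -/
theorem hom_ext {W : D} {f g : E.val ⟶ W} (h : ∀ {a : A} (x : J.obj a ⟶ X), E.ofJ x ≫ f = E.ofJ x ≫ g) :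
    f = g := by
  rw [← Category.id_comp f, ← Category.id_comp g, ← E.total', Preadditive.sum_comp,
    Preadditive.sum_comp]
  refine Finset.sum_congr rfl fun i _ => ?_
  rw [Category.assoc, Category.assoc, ← ofJ_inc, h]

theorem ofJ_add {a : A} (f g : J.obj a ⟶ X) : E.ofJ (f + g) = E.ofJ f + E.ofJ g := by
  simp only [ofJ, Preadditive.add_comp, extMap_add, Finset.sum_add_distrib]

theorem ofJ_smul {k : Type*} [CommRing k] [Linear k A] [Linear k C] [Linear k D] [J.Linear k]
    [P.Linear k] {a : A} (r : k) (f : J.obj a ⟶ X) : E.ofJ (r • f) = r • E.ofJ f := by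
  simp only [ofJ, Linear.smul_comp, extMap_smul, Finset.smul_sum]

theorem map_ofJ {a b : A} (f : a ⟶ b) (g : J.obj b ⟶ X) : P.map f ≫ E.ofJ g = E.ofJ (J.map f ≫ g) := by
  simp only [ofJ, Preadditive.comp_sum, Category.assoc, extMap_comp, extMap_map]

/-- The extension of a functor along a full embedding. -/
@[simps]
noncomputable def functor (E : ∀ X, ExtAt.{u} J P X) : C ⥤ D where
  obj X := (E X).val
  map f := map (E _) (E _) f
  map_id X := (E X).hom_ext fun x => by rw [ofJ_map, Category.comp_id, Category.comp_id]
  map_comp f g := (E _).hom_ext fun x => by rw [ofJ_map, ofJ_map_assoc, ofJ_map, Category.assoc]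

theorem map_add (f g : X ⟶ Y) : E.map E' (f + g) = E.map E' f + E.map E' g :=
  E.hom_ext fun x => by simp only [Preadditive.comp_add, ofJ_map, ofJ_add]

theorem map_smul {k : Type*} [CommRing k] [Linear k A] [Linear k C] [Linear k D] [J.Linear k]
    [P.Linear k] (r : k) (f : X ⟶ Y) : E.map E' (r • f) = r • E.map E' f :=
  E.hom_ext fun x => by simp only [Linear.comp_smul, ofJ_map, ofJ_smul]

instance (E : ∀ X, ExtAt.{u} J P X) : (functor E).Additive where
  map_add := map_add _ _ _ _

theorem functor_linear {k : Type*} [CommRing k] [Linear k A] [Linear k C] [Linear k D] [J.Linear k]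
    [P.Linear k] (E : ∀ X, ExtAt.{u} J P X) : (functor E).Linear k where
  map_smul f r := map_smul _ _ r f

/-- The value of the extension at an object of the full subcategory. -/
@[simps]
noncomputable def isoAt {a : A} (E : ExtAt.{u} J P (J.obj a)) : P.obj a ≅ E.val where
  hom := E.ofJ (𝟙 _)
  inv := E.toJ (𝟙 _)
  hom_inv_id := by rw [ofJ_toJ, Category.comp_id, extMap_id]
  inv_hom_id := E.hom_ext fun x => by
    rw [ofJ_toJ_assoc, Category.comp_id, Category.comp_id]
    obtain ⟨x, rfl⟩ := J.map_surjective x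
    rw [extMap_map, map_ofJ, Category.comp_id]

theorem isoAt_naturality {a b : A} (E : ExtAt.{u} J P (J.obj a)) (E' : ExtAt.{u} J P (J.obj b))
    (f : a ⟶ b) : P.map f ≫ E'.isoAt.hom = E.isoAt.hom ≫ E.map E' (J.map f) := by
  rw [isoAt_hom, isoAt_hom, map_ofJ, ofJ_map, Category.comp_id, Category.id_comp]

/-- The extension agrees with the given functor on the full subcategory. -/
noncomputable def functorIso (E : ∀ X, ExtAt.{u} J P X) : P ≅ J ⋙ functor E :=
  NatIso.ofComponents (fun a => (E (J.obj a)).isoAt) fun f =>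
    isoAt_naturality (E _) (E _) f

end ExtAt

end Extension

/-! ### Functors and transformations determined on homogeneous objects -/

namespace GGradedCat

variable {k : Type w} [CommRing k] {G : Type u} [Group G] (C : GGradedCat.{w, v, u} k G)

/-- The homogeneous objects over `a`, as a linear category. -/
abbrev fib (a : G) : LinCat.{w, v, u} k := LinCat.of k (C.deg a).FullSubcategory

/-- The inclusion of all homogeneous objects. -/
noncomputable def totIncl : LinCat.Total C.fib ⥤ C.carrier :=
  LinCat.Total.desc (N := C.fib) (D := C.carrier) fun a => (C.deg a).ι

instance : C.totIncl.Additive := inferInstanceAs (LinCat.Total.desc _).Additive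

instance : C.totIncl.Linear k := 
  have : ∀ a, (C.deg a).ι.Linear k := inferInstance
  inferInstanceAs ((LinCat.Total.desc (N := C.fib) (D := C.carrier) fun a => (C.deg a).ι).Linear k)

theorem totIncl_map {a : G} {X Y : C.fib a} (f : X ⟶ Y) :
    C.totIncl.map (LinCat.Total.inclMap f : (⟨a, X⟩ : LinCat.Total C.fib) ⟶ ⟨a, Y⟩) = f.hom :=
  LinCat.Total.descMap_inclMap (N := C.fib) (fun a => (C.deg a).ι) f

/-- In equal degrees this is fullness of the subcategories. In different degrees it is the vanishing
of morphisms between them. -/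
instance : C.totIncl.Full where
  map_surjective {X Y} f := by
    obtain ⟨a, X⟩ := X
    obtain ⟨b, Y⟩ := Y
    by_cases h : a = b
    · subst h
      exact ⟨LinCat.Total.inclMap ((C.deg a).homMk f), C.totIncl_map _⟩
    · exact ⟨0, ((C.totIncl.map_zero _ _).trans (C.hom_eq_zero h X.2 Y.2 f).symm)⟩

instance : C.totIncl.Faithful where
  map_injective {X Y f g} e := by
    obtain ⟨a, X⟩ := X
    obtain ⟨b, Y⟩ := Y
    by_cases h : a = b
    · subst h
      obtain ⟨f, rfl⟩ := LinCat.Total.exists_inclMap f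
      obtain ⟨g, rfl⟩ := LinCat.Total.exists_inclMap g
      rw [totIncl_map, totIncl_map] at e
      exact congrArg LinCat.Total.inclMap (ObjectProperty.hom_ext _ e)
    · exact (LinCat.Total.eq_zero (by exact h) f).trans (LinCat.Total.eq_zero (by exact h) g).symm

/-- A presentation of an object as a retract of a finite sum of homogeneous objects. -/
structure Resolution (X : C.carrier) where
  ι : Type u
  [fintype : Fintype ι]
  deg : ι → G
  obj : ι → C.carrier
  hdeg (i : ι) : C.deg (deg i) (obj i)
  inc (i : ι) : obj i ⟶ X
  pr (i : ι) : X ⟶ obj i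
  total : ∑ i, pr i ≫ inc i = 𝟙 X

attribute [instance] Resolution.fintype

theorem nonempty_resolution (X : C.carrier) : Nonempty (C.Resolution X) := by
  obtain ⟨s, Y, hY, b, ⟨hb⟩, ⟨e⟩⟩ := C.exists_splitting X
  refine ⟨⟨s, fun a => a, Y, hY, fun a => b.ι a ≫ e.hom, fun a => e.inv ≫ b.π a, ?_⟩⟩
  have : ∑ i, (e.inv ≫ b.π i) ≫ b.ι i ≫ e.hom = e.inv ≫ (∑ i, b.π i ≫ b.ι i) ≫ e.hom := by
    simp only [Preadditive.sum_comp, Preadditive.comp_sum, Category.assoc]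
  rw [this, Limits.IsBilimit.total hb, Category.id_comp, Iso.inv_hom_id]

/-- A presentation of an object as a retract of a finite sum of homogeneous objects. -/
noncomputable def resolution (X : C.carrier) : C.Resolution X := (C.nonempty_resolution X).some

section Nat

variable {C} {E : Type*} [Category* E] [Preadditive E] {P Q R : C.carrier ⥤ E} [P.Additive] [Q.Additive] [R.Additive]

/-- Morphisms that agree on all homogeneous objects are equal. -/
theorem hom_ext_homog (P : C.carrier ⥤ E) [P.Additive] {X : C.carrier} {Z : E} {f g : P.obj X ⟶ Z}
    (h : ∀ {a : G} {A : C.carrier} (_ : C.deg a A) (x : A ⟶ X), P.map x ≫ f = P.map x ≫ g) :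
    f = g := by
  have e : 𝟙 (P.obj X) = ∑ i, P.map ((C.resolution X).pr i) ≫ P.map ((C.resolution X).inc i) := by
    simp only [← P.map_comp]
    rw [← P.map_sum, (C.resolution X).total, P.map_id]
  rw [← Category.id_comp f, ← Category.id_comp g, e, Preadditive.sum_comp, Preadditive.sum_comp]
  refine Finset.sum_congr rfl fun i _ => ?_
  rw [Category.assoc, Category.assoc, h ((C.resolution X).hdeg i)]

variable (P Q) in
/-- A natural transformation between the restrictions of functors to homogeneous objects. -/
structure HomogNat where
  app {a : G} {X : C.carrier} (hX : C.deg a X) : P.obj X ⟶ Q.obj X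
  naturality {a : G} {X Y : C.carrier} (hX : C.deg a X) (hY : C.deg a Y) (f : X ⟶ Y) :
    P.map f ≫ app hY = app hX ≫ Q.map f

namespace HomogNat

variable (α : HomogNat P Q)

/-- For different degrees both sides vanish, so naturality within each degree is enough. -/
theorem naturality' {a b : G} {X Y : C.carrier} (hX : C.deg a X) (hY : C.deg b Y) (f : X ⟶ Y) :
    P.map f ≫ α.app hY = α.app hX ≫ Q.map f := by
  by_cases h : a = b
  · subst h
    exact α.naturality hX hY f
  · rw [C.hom_eq_zero h hX hY f, P.map_zero, Q.map_zero, Limits.zero_comp, Limits.comp_zero]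

/-- The component of the extension of a natural transformation from homogeneous objects. -/
noncomputable def extApp (X : C.carrier) : P.obj X ⟶ Q.obj X :=
  ∑ i, P.map ((C.resolution X).pr i) ≫ α.app ((C.resolution X).hdeg i) ≫
    Q.map ((C.resolution X).inc i)

/-- Naturality moves each term of the sum to the other side of `α`, where the resolution adds up to
the identity. In particular the extension does not depend on the chosen resolution. -/
theorem map_extApp {a : G} {A X : C.carrier} (hA : C.deg a A) (x : A ⟶ X) :
    P.map x ≫ α.extApp X = α.app hA ≫ Q.map x := by
  rw [extApp, Preadditive.comp_sum]
  have : ∀ i, P.map x ≫ P.map ((C.resolution X).pr i) ≫ α.app ((C.resolution X).hdeg i) ≫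
      Q.map ((C.resolution X).inc i) =
        α.app hA ≫ Q.map (x ≫ (C.resolution X).pr i ≫ (C.resolution X).inc i) := fun i => by
    rw [← P.map_comp_assoc, ← Category.assoc, α.naturality' hA, Category.assoc, ← Q.map_comp,
      Category.assoc]
  rw [Finset.sum_congr rfl fun i _ => this i, ← Preadditive.comp_sum, ← Q.map_sum,
    ← Preadditive.comp_sum, (C.resolution X).total, Category.comp_id]

theorem extApp_eq {a : G} {X : C.carrier} (hX : C.deg a X) : α.extApp X = α.app hX := by
  have := α.map_extApp hX (𝟙 X)
  rwa [P.map_id, Q.map_id, Category.id_comp, Category.comp_id] at this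

/-- The extension of a natural transformation from homogeneous objects. -/
@[simps]
noncomputable def ext : P ⟶ Q where
  app := α.extApp
  naturality X Y f := hom_ext_homog P fun hA x => by
    rw [← P.map_comp_assoc, α.map_extApp hA, ← Category.assoc, α.map_extApp hA, Q.map_comp,
      Category.assoc]

end HomogNat

theorem nat_ext_homog {α β : P ⟶ Q}
    (h : ∀ {a : G} {X : C.carrier} (_ : C.deg a X), α.app X = β.app X) : α = β :=
  NatTrans.ext (funext fun X => hom_ext_homog P fun hA x => by
    rw [α.naturality, β.naturality, h hA])

/-- The extension of a natural isomorphism from homogeneous objects. -/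
noncomputable def HomogNat.extIso (app : ∀ {a : G} {X : C.carrier} (_ : C.deg a X), P.obj X ≅ Q.obj X)
    (naturality : ∀ {a : G} {X Y : C.carrier} (hX : C.deg a X) (hY : C.deg a Y) (f : X ⟶ Y),
      P.map f ≫ (app hY).hom = (app hX).hom ≫ Q.map f) : P ≅ Q where
  hom := HomogNat.ext ⟨fun hX => (app hX).hom, naturality⟩
  inv := HomogNat.ext ⟨fun hX => (app hX).inv, fun hX hY f => by
    rw [Iso.eq_inv_comp, ← reassoc_of% naturality hX hY f, Iso.hom_inv_id, Category.comp_id]⟩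
  hom_inv_id := nat_ext_homog fun hX => by
    simp only [NatTrans.comp_app, HomogNat.ext_app, HomogNat.extApp_eq _ hX, Iso.hom_inv_id,
      NatTrans.id_app]
  inv_hom_id := nat_ext_homog fun hX => by
    simp only [NatTrans.comp_app, HomogNat.ext_app, HomogNat.extApp_eq _ hX, Iso.inv_hom_id,
      NatTrans.id_app]

theorem HomogNat.extIso_hom_app (app naturality) {a : G} {X : C.carrier} (hX : C.deg a X) :
    (HomogNat.extIso (P := P) (Q := Q) app naturality).hom.app X = (app hX).hom :=
  HomogNat.extApp_eq _ hX

end Nat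

section Functor

variable {C} {D : GGradedCat.{w, v, u} k G} (T : ∀ a, C.fib a ⥤ D.fib a) [∀ a, (T a).Additive]
  [∀ a, (T a).Linear k]

/-- The functor on all homogeneous objects given by functors on homogeneous objects. -/
noncomputable def totFunctor : LinCat.Total C.fib ⥤ D.carrier :=
  LinCat.Total.desc (N := C.fib) (D := D.carrier) fun a => T a ⋙ (D.deg a).ι

instance : (totFunctor T).Additive := inferInstanceAs (LinCat.Total.desc _).Additive

instance : (totFunctor T).Linear k :=
  have : ∀ a, (T a ⋙ (D.deg a).ι).Linear k := inferInstance
  inferInstanceAs ((LinCat.Total.desc (N := C.fib) (D := D.carrier)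
    fun a => T a ⋙ (D.deg a).ι).Linear k)

theorem totFunctor_map {a : G} {X Y : C.fib a} (f : X ⟶ Y) :
    (totFunctor T).map (LinCat.Total.inclMap f : (⟨a, X⟩ : LinCat.Total C.fib) ⟶ ⟨a, Y⟩) =
      ((T a).map f).hom :=
  LinCat.Total.descMap_inclMap (N := C.fib) (fun a => T a ⋙ (D.deg a).ι) f

/-- The value must be literally of degree `a` when `X` is, because 1-cells preserve the
subcategories themselves and these need not be closed under isomorphism. This rules out choosing a
biproduct in all cases. -/
theorem exists_extAt (X : C.carrier) : ∃ E : ExtAt.{u} C.totIncl (totFunctor T) X,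
    ∀ a, C.deg a X → D.deg a E.val := by
  classical
  -- A homogeneous object is presented by itself, and its value is the given one. The biproduct of
  -- the values of the summands serves for the others.
  by_cases h : ∃ a, C.deg a X
  · obtain ⟨a, ha⟩ := h
    let A : LinCat.Total C.fib := ⟨a, ⟨X, ha⟩⟩
    refine ⟨{ ι := PUnit, obj := fun _ => A, inc := fun _ => 𝟙 X, pr := fun _ => 𝟙 X,
              total := (Fintype.sum_unique _).trans (Category.comp_id _), val := (totFunctor T).obj A, inc' := fun _ => 𝟙 _,
              pr' := fun _ => 𝟙 _, total' := by simp,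
              compat := fun _ _ => ?_ }, fun b hb => ?_⟩
    · exact (Category.comp_id _).trans ((extMap_id A).symm.trans
        (congrArg (extMap C.totIncl (totFunctor T) (X := A) (Y := A)) (Category.comp_id _).symm))
    -- Disjointness of the subcategories: no other degree has to be served by this value.
    · obtain rfl := C.deg_disjoint ha hb
      exact ((T a).obj ⟨X, ha⟩).2
  · obtain ⟨s, Y, hY, b, ⟨hb⟩, ⟨e⟩⟩ := C.exists_splitting X
    let A : s → LinCat.Total C.fib := fun a => ⟨a, ⟨Y a, hY a⟩⟩
    refine ⟨{ ι := s, obj := A, inc := fun a => b.ι a ≫ e.hom, pr := fun a => e.inv ≫ b.π a,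
              total := ?_, val := ⨁ fun a => (totFunctor T).obj (A a),
              inc' := Limits.biproduct.ι fun a => (totFunctor T).obj (A a),
              pr' := Limits.biproduct.π fun a => (totFunctor T).obj (A a),
              total' := Limits.IsBilimit.total
                (Limits.biproduct.isBilimit fun a => (totFunctor T).obj (A a)),
              compat := fun i j => ?_ },
            fun a ha => (h ⟨a, ha⟩).elim⟩
    · have : ∑ i, (e.inv ≫ b.π i) ≫ b.ι i ≫ e.hom = e.inv ≫ (∑ i, b.π i ≫ b.ι i) ≫ e.hom := by
        simp only [Preadditive.sum_comp, Preadditive.comp_sum, Category.assoc]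
      exact this.trans (by rw [Limits.IsBilimit.total hb, Category.id_comp, Iso.inv_hom_id])
    · have hb' : (b.ι i ≫ e.hom) ≫ e.inv ≫ b.π j = b.ι i ≫ b.π j := by
        rw [Category.assoc, Iso.hom_inv_id_assoc]
      refine Eq.trans ?_ (congrArg (extMap C.totIncl (totFunctor T) (X := A i) (Y := A j)) hb').symm
      by_cases h : i = j
      · subst h
        exact (Limits.biproduct.ι_π_self _ i).trans ((extMap_id (A i)).symm.trans
          (congrArg (extMap C.totIncl (totFunctor T) (X := A i) (Y := A i))
            (Limits.bicone_ι_π_self b i).symm))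
      · exact (Limits.biproduct.ι_π_ne _ h).trans ((extMap_zero (A i) (A j)).symm.trans
          (congrArg (extMap C.totIncl (totFunctor T) (X := A i) (Y := A j))
            (Limits.bicone_ι_π_ne b h).symm))

/-- The extension of functors on homogeneous objects. -/
noncomputable def extFunctor : C.carrier ⥤ D.carrier :=
  ExtAt.functor fun X => (exists_extAt T X).choose

instance : (extFunctor T).Additive := inferInstanceAs (ExtAt.functor _).Additive

instance : (extFunctor T).Linear k := ExtAt.functor_linear _

theorem deg_extFunctor {a : G} {X : C.carrier} (hX : C.deg a X) :
    D.deg a ((extFunctor T).obj X) :=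
  (exists_extAt T X).choose_spec a hX

/-- The extension agrees with the given functors on homogeneous objects. -/
noncomputable def extFunctorIso {a : G} (X : C.fib a) :
    ((T a).obj X).1 ≅ (extFunctor T).obj X.1 :=
  (ExtAt.functorIso fun X => (exists_extAt T X).choose).app ⟨a, X⟩

theorem extFunctorIso_naturality {a : G} {X Y : C.fib a} (f : X ⟶ Y) :
    ((T a).map f).hom ≫ (extFunctorIso T Y).hom =
      (extFunctorIso T X).hom ≫ (extFunctor T).map f.hom := by
  have := (ExtAt.functorIso fun X => (exists_extAt T X).choose).hom.naturality
    (LinCat.Total.inclMap f : (⟨a, X⟩ : LinCat.Total C.fib) ⟶ ⟨a, Y⟩)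
  rw [totFunctor_map, Functor.comp_map, totIncl_map] at this
  exact this

end Functor

end GGradedCat

/-! ### Extension in several variables -/

namespace GGradedCat

variable {k : Type w} [CommRing k] {G : Type u} [Group G] {C D : GGradedCat.{w, v, u} k G}

section

variable {E : Type*} [Category* E] [Preadditive E] {P Q : C.carrier ⥤ C.carrier ⥤ E} [P.Additive]
  [Q.Additive] [∀ X, (P.obj X).Additive] [∀ X, (Q.obj X).Additive]

/-- The extension of a natural isomorphism of functors of two variables from homogeneous
objects. -/
noncomputable def biExtIso
    (app : ∀ {a b : G} {X Y : C.carrier} (_ : C.deg a X) (_ : C.deg b Y),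
      (P.obj X).obj Y ≅ (Q.obj X).obj Y)
    (left : ∀ {a b : G} {X X' Y : C.carrier} (hX : C.deg a X) (hX' : C.deg a X')
      (hY : C.deg b Y) (x : X ⟶ X'),
      (P.map x).app Y ≫ (app hX' hY).hom = (app hX hY).hom ≫ (Q.map x).app Y)
    (right : ∀ {a b : G} {X Y Y' : C.carrier} (hX : C.deg a X) (hY : C.deg b Y)
      (hY' : C.deg b Y') (y : Y ⟶ Y'),
      (P.obj X).map y ≫ (app hX hY').hom = (app hX hY).hom ≫ (Q.obj X).map y) : P ≅ Q :=
  HomogNat.extIso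
    (fun hX => HomogNat.extIso (fun hY => app hX hY) (fun hY hY' y => right hX hY hY' y))
    (fun hX hX' x => nat_ext_homog fun hY => by
      rw [NatTrans.comp_app, NatTrans.comp_app, HomogNat.extIso_hom_app _ _ hY,
        HomogNat.extIso_hom_app _ _ hY, left hX hX' hY])

theorem biExtIso_hom_app_app (app left right) {a b : G} {X Y : C.carrier} (hX : C.deg a X)
    (hY : C.deg b Y) :
    ((biExtIso (P := P) (Q := Q) app left right).hom.app X).app Y = (app hX hY).hom := by
  rw [biExtIso, HomogNat.extIso_hom_app _ _ hX, HomogNat.extIso_hom_app _ _ hY]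

end

section

variable (P P' P'' : C.carrier ⥤ D.carrier) [P.Additive] [P'.Additive] [P''.Additive]

/-- Tensoring with a fixed object is additive, so `hom_ext_homog` applies to one variable at a time.
-/
theorem hom_ext_homog₂ {X Y : C.carrier} {W : D.carrier} {f g : P.obj X ⊗ P'.obj Y ⟶ W}
    (h : ∀ {a b : G} {A B : C.carrier} (_ : C.deg a A) (_ : C.deg b B) (x : A ⟶ X) (y : B ⟶ Y),
      (P.map x ⊗ₘ P'.map y) ≫ f = (P.map x ⊗ₘ P'.map y) ≫ g) : f = g :=
  hom_ext_homog (P ⋙ tensorRight (P'.obj Y)) fun {a A} hA x =>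
    hom_ext_homog (P' ⋙ tensorLeft (P.obj A)) fun {b B} hB y => by
      have := h hA hB x y
      rwa [tensorHom_def', Category.assoc, Category.assoc] at this

theorem hom_ext_homog₃ {X Y Z : C.carrier} {W : D.carrier}
    {f g : (P.obj X ⊗ P'.obj Y) ⊗ P''.obj Z ⟶ W}
    (h : ∀ {a b c : G} {A B E : C.carrier} (_ : C.deg a A) (_ : C.deg b B) (_ : C.deg c E)
      (x : A ⟶ X) (y : B ⟶ Y) (z : E ⟶ Z),
      ((P.map x ⊗ₘ P'.map y) ⊗ₘ P''.map z) ≫ f = ((P.map x ⊗ₘ P'.map y) ⊗ₘ P''.map z) ≫ g) :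
    f = g :=
  hom_ext_homog (P ⋙ tensorRight (P'.obj Y) ⋙ tensorRight (P''.obj Z)) fun {a A} hA x =>
    hom_ext_homog (P' ⋙ tensorLeft (P.obj A) ⋙ tensorRight (P''.obj Z)) fun {b B} hB y =>
      hom_ext_homog (P'' ⋙ tensorLeft (P.obj A ⊗ P'.obj B)) fun {c E} hE z => by
        have := h hA hB hE x y z
        rwa [tensorHom_def', tensorHom_def', MonoidalCategory.comp_whiskerRight, Category.assoc,
          Category.assoc, Category.assoc, Category.assoc] at this

end

section

variable (S : C.carrier ⥤ D.carrier) [S.Additive]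

/-- The functor `(X, Y) ↦ S X ⊗ S Y`. -/
@[simps]
def tensorOfImages : C.carrier ⥤ C.carrier ⥤ D.carrier where
  obj X := S ⋙ tensorLeft (S.obj X)
  map x := { app Y := S.map x ▷ S.obj Y
             naturality _ _ y := MonoidalCategory.whisker_exchange (S.map x) (S.map y) }

/-- The functor `(X, Y) ↦ S (X ⊗ Y)`. -/
@[simps]
def imageOfTensor : C.carrier ⥤ C.carrier ⥤ D.carrier where
  obj X := tensorLeft X ⋙ S
  map x := { app Y := S.map (x ▷ Y)
             naturality _ _ y := by
              change S.map (_ ◁ y) ≫ S.map (x ▷ _) = S.map (x ▷ _) ≫ S.map (_ ◁ y)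
              rw [← S.map_comp, ← S.map_comp, MonoidalCategory.whisker_exchange] }

instance : (tensorOfImages S).Additive where
  map_add {X Y f g} := by
    ext Z
    simp [MonoidalPreadditive.add_whiskerRight]
    rfl

instance : (imageOfTensor S).Additive where
  map_add {X Y f g} := by
    ext Z
    simp [MonoidalPreadditive.add_whiskerRight]
    rfl

instance (X : C.carrier) : ((tensorOfImages S).obj X).Additive :=
  inferInstanceAs (S ⋙ tensorLeft (S.obj X)).Additive

instance (X : C.carrier) : ((imageOfTensor S).obj X).Additive :=
  inferInstanceAs (tensorLeft X ⋙ S).Additive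

end

end GGradedCat

/-! ### 1-cells from constraints on homogeneous objects -/

namespace GBraidedCat

variable {k : Type w} [CommRing k] {G : Type u} [Group G]

/-- A `k`-linear functor with the constraints of a 1-cell of `G`-braided categories given on
homogeneous objects only. -/
structure HomogHom (C D : GBraidedCat.{w, v, u} k G) where
  functor : C.carrier ⥤ D.carrier
  [additive : functor.Additive]
  [linear : functor.Linear k]
  deg_obj {a : G} {X : C.carrier} (hX : C.deg a X) : D.deg a (functor.obj X)
  tensorIso {a b : G} {X Y : C.carrier} (hX : C.deg a X) (hY : C.deg b Y) :
    functor.obj X ⊗ functor.obj Y ≅ functor.obj (X ⊗ Y)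
  tensorIso_naturality {a b : G} {X X' Y Y' : C.carrier} (hX : C.deg a X) (hX' : C.deg a X')
    (hY : C.deg b Y) (hY' : C.deg b Y') (x : X ⟶ X') (y : Y ⟶ Y') :
    (functor.map x ⊗ₘ functor.map y) ≫ (tensorIso hX' hY').hom =
      (tensorIso hX hY).hom ≫ functor.map (x ⊗ₘ y)
  unitIso : 𝟙_ D.carrier ≅ functor.obj (𝟙_ C.carrier)
  associativity {a b c p q : G} {X Y Z : C.carrier} (hX : C.deg a X) (hY : C.deg b Y)
    (hZ : C.deg c Z) (hXY : C.deg p (X ⊗ Y)) (hYZ : C.deg q (Y ⊗ Z)) :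
    ((tensorIso hX hY).hom ⊗ₘ 𝟙 (functor.obj Z)) ≫ (tensorIso hXY hZ).hom ≫
        functor.map (α_ X Y Z).hom =
      (MonoidalCategoryStruct.associator _ _ _).hom ≫
        (𝟙 (functor.obj X) ⊗ₘ (tensorIso hY hZ).hom) ≫ (tensorIso hX hYZ).hom
  left_unitality {a : G} {X : C.carrier} (hX : C.deg a X) :
    (unitIso.hom ⊗ₘ 𝟙 (functor.obj X)) ≫ (tensorIso C.deg_unit hX).hom ≫
      functor.map (λ_ X).hom = (MonoidalCategoryStruct.leftUnitor _).hom
  right_unitality {a : G} {X : C.carrier} (hX : C.deg a X) :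
    (𝟙 (functor.obj X) ⊗ₘ unitIso.hom) ≫ (tensorIso hX C.deg_unit).hom ≫
      functor.map (ρ_ X).hom = (MonoidalCategoryStruct.rightUnitor _).hom
  crossIso (g : G) {a : G} {X : C.carrier} (hX : C.deg a X) :
    functor.obj ((C.φ g).obj X) ≅ (D.φ g).obj (functor.obj X)
  crossIso_naturality (g : G) {a : G} {X Y : C.carrier} (hX : C.deg a X) (hY : C.deg a Y)
    (f : X ⟶ Y) : functor.map ((C.φ g).map f) ≫ (crossIso g hY).hom =
      (crossIso g hX).hom ≫ (D.φ g).map (functor.map f)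
  crossIso_tensor (g : G) {a b a' b' p : G} {X Y : C.carrier} (hX : C.deg a X) (hY : C.deg b Y)
    (hX' : C.deg a' ((C.φ g).obj X)) (hY' : C.deg b' ((C.φ g).obj Y))
    (hXY : C.deg p (X ⊗ Y)) :
    (tensorIso hX' hY').hom ≫ functor.map (μ (C.φ g) X Y) ≫ (crossIso g hXY).hom =
      ((crossIso g hX).hom ⊗ₘ (crossIso g hY).hom) ≫
        μ (D.φ g) (functor.obj X) (functor.obj Y) ≫ (D.φ g).map (tensorIso hX hY).hom
  crossIso_unit (g : G) : unitIso.hom ≫ functor.map (Functor.LaxMonoidal.ε (C.φ g)) ≫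
      (crossIso g C.deg_unit).hom = Functor.LaxMonoidal.ε (D.φ g) ≫ (D.φ g).map unitIso.hom
  crossIso_comp {f g e : G} (h : g * f = e) {a b : G} {X : C.carrier} (hX : C.deg a X)
    (hX' : C.deg b ((C.φ g).obj X)) :
    functor.map (C.compIso h X).hom ≫ (crossIso e hX).hom =
      (crossIso f hX').hom ≫ (D.φ f).map (crossIso g hX).hom ≫
        (D.compIso h (functor.obj X)).hom
  crossIso_one {a : G} {X : C.carrier} (hX : C.deg a X) :
    functor.map (C.unitIso X).hom ≫ (crossIso 1 hX).hom = (D.unitIso (functor.obj X)).hom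
  invBraid {a b b' g : G} (hg : g * a = 1) {X Y : C.carrier} (hX : C.deg a X) (hY : C.deg b Y)
    (hY' : C.deg b' ((C.φ g).obj Y)) :
    ((crossIso g hY).hom ⊗ₘ 𝟙 (functor.obj X)) ≫
        (D.invBraid hg (functor.obj X) (functor.obj Y) (deg_obj hX)).hom ≫ (tensorIso hX hY).hom =
      (tensorIso hY' hX).hom ≫ functor.map (C.invBraid hg X Y hX).hom

attribute [instance] HomogHom.additive HomogHom.linear

namespace HomogHom

variable {C D : GBraidedCat.{w, v, u} k G} (S : HomogHom C D)

theorem tensorIso_naturality_left {a b : G} {X X' Y : C.carrier} (hX : C.deg a X)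
    (hX' : C.deg a X') (hY : C.deg b Y) (x : X ⟶ X') :
    S.functor.map x ▷ S.functor.obj Y ≫ (S.tensorIso hX' hY).hom =
      (S.tensorIso hX hY).hom ≫ S.functor.map (x ▷ Y) := by
  have := S.tensorIso_naturality hX hX' hY hY x (𝟙 Y)
  rwa [CategoryTheory.Functor.map_id, tensorHom_id, tensorHom_id] at this

theorem tensorIso_naturality_right {a b : G} {X Y Y' : C.carrier} (hX : C.deg a X)
    (hY : C.deg b Y) (hY' : C.deg b Y') (y : Y ⟶ Y') :
    S.functor.obj X ◁ S.functor.map y ≫ (S.tensorIso hX hY').hom =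
      (S.tensorIso hX hY).hom ≫ S.functor.map (X ◁ y) := by
  have := S.tensorIso_naturality hX hX hY hY' (𝟙 X) y
  rwa [CategoryTheory.Functor.map_id, id_tensorHom, id_tensorHom] at this

/-- The tensor constraint on all objects, as a natural isomorphism. -/
noncomputable def tensorNatIso :
    GGradedCat.tensorOfImages S.functor ≅ GGradedCat.imageOfTensor S.functor :=
  GGradedCat.biExtIso (fun hX hY => S.tensorIso hX hY) S.tensorIso_naturality_left
    S.tensorIso_naturality_right

/-- The tensor constraint on all objects. -/
noncomputable def μIso (X Y : C.carrier) :
    S.functor.obj X ⊗ S.functor.obj Y ≅ S.functor.obj (X ⊗ Y) :=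
  (S.tensorNatIso.app X).app Y

theorem μIso_eq {a b : G} {X Y : C.carrier} (hX : C.deg a X) (hY : C.deg b Y) :
    S.μIso X Y = S.tensorIso hX hY :=
  Iso.ext (GGradedCat.biExtIso_hom_app_app (P := GGradedCat.tensorOfImages S.functor)
    (Q := GGradedCat.imageOfTensor S.functor) (fun hX hY => S.tensorIso hX hY)
    S.tensorIso_naturality_left S.tensorIso_naturality_right hX hY)

theorem μIso_naturality_left {X X' : C.carrier} (x : X ⟶ X') (Y : C.carrier) :
    S.functor.map x ▷ S.functor.obj Y ≫ (S.μIso X' Y).hom =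
      (S.μIso X Y).hom ≫ S.functor.map (x ▷ Y) :=
  congrArg (fun z => NatTrans.app z Y) (S.tensorNatIso.hom.naturality x)

theorem μIso_naturality_right (X : C.carrier) {Y Y' : C.carrier} (y : Y ⟶ Y') :
    S.functor.obj X ◁ S.functor.map y ≫ (S.μIso X Y').hom =
      (S.μIso X Y).hom ≫ S.functor.map (X ◁ y) :=
  (S.tensorNatIso.hom.app X).naturality y

theorem μIso_naturality {X X' Y Y' : C.carrier} (x : X ⟶ X') (y : Y ⟶ Y') :
    (S.functor.map x ⊗ₘ S.functor.map y) ≫ (S.μIso X' Y').hom =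
      (S.μIso X Y).hom ≫ S.functor.map (x ⊗ₘ y) := by
  rw [MonoidalCategory.tensorHom_def, MonoidalCategory.tensorHom_def, Category.assoc,
    μIso_naturality_right, ← Category.assoc, μIso_naturality_left, Category.assoc,
    ← Functor.map_comp]

theorem μIso_naturality_assoc {X X' Y Y' : C.carrier} (x : X ⟶ X') (y : Y ⟶ Y') {W : D.carrier}
    (w : S.functor.obj (X' ⊗ Y') ⟶ W) :
    (S.functor.map x ⊗ₘ S.functor.map y) ≫ (S.μIso X' Y').hom ≫ w =
      (S.μIso X Y).hom ≫ S.functor.map (x ⊗ₘ y) ≫ w := by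
  rw [← Category.assoc, μIso_naturality, Category.assoc]

/-- The crossing constraint on all objects. -/
noncomputable def crossNatIso (g : G) : C.φ g ⋙ S.functor ≅ S.functor ⋙ D.φ g :=
  GGradedCat.HomogNat.extIso (fun hX => S.crossIso g hX)
    (fun hX hY f => S.crossIso_naturality g hX hY f)

/-- The crossing constraint on all objects. -/
noncomputable def χ (g : G) (X : C.carrier) :
    S.functor.obj ((C.φ g).obj X) ≅ (D.φ g).obj (S.functor.obj X) :=
  (S.crossNatIso g).app X

theorem χ_eq (g : G) {a : G} {X : C.carrier} (hX : C.deg a X) : S.χ g X = S.crossIso g hX :=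
  Iso.ext (GGradedCat.HomogNat.extIso_hom_app _ _ hX)

theorem χ_naturality (g : G) {X Y : C.carrier} (f : X ⟶ Y) :
    S.functor.map ((C.φ g).map f) ≫ (S.χ g Y).hom =
      (S.χ g X).hom ≫ (D.φ g).map (S.functor.map f) :=
  (S.crossNatIso g).hom.naturality f

theorem χ_naturality_assoc (g : G) {X Y : C.carrier} (f : X ⟶ Y) {W : D.carrier}
    (w : (D.φ g).obj (S.functor.obj Y) ⟶ W) :
    S.functor.map ((C.φ g).map f) ≫ (S.χ g Y).hom ≫ w =
      (S.χ g X).hom ≫ (D.φ g).map (S.functor.map f) ≫ w := by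
  rw [← Category.assoc, χ_naturality, Category.assoc]

theorem deg_φ' (C : GCrossedCat.{w, v, u} k G) (g : G) {a : G} {X : C.carrier} (hX : C.deg a X) :
    C.deg (g⁻¹ * a * g) ((C.φ g).obj X) :=
  C.deg_φ (by group) hX

/-- The monoidal structure on the functor. -/
noncomputable def coreMonoidal : S.functor.CoreMonoidal where
  εIso := S.unitIso
  μIso := S.μIso
  μIso_hom_natural_left := S.μIso_naturality_left
  μIso_hom_natural_right X y := S.μIso_naturality_right X y
  associativity X Y Z := by
    -- The extended constraints are natural in all objects and agree with the given ones on
    -- homogeneous objects. The axiom is therefore tested on morphisms from homogeneous objects, and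
    -- naturality carries them through.
    refine GGradedCat.hom_ext_homog₃ S.functor S.functor S.functor
      fun {a b c A B E} hA hB hE x y z => ?_
    have h := S.associativity hA hB hE (C.deg_tensor rfl hA hB) (C.deg_tensor rfl hB hE)
    rw [← S.μIso_eq, ← S.μIso_eq, ← S.μIso_eq, ← S.μIso_eq] at h
    rw [← tensorHom_id, ← id_tensorHom, tensorHom_comp_tensorHom_assoc, μIso_naturality,
      Category.comp_id, MonoidalCategory.associator_naturality_assoc,
      tensorHom_comp_tensorHom_assoc, μIso_naturality, Category.comp_id,
      ← Category.id_comp (S.functor.map z), ← tensorHom_comp_tensorHom_assoc,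
      μIso_naturality_assoc, ← Functor.map_comp, MonoidalCategory.associator_naturality,
      Functor.map_comp, reassoc_of% h, ← Category.id_comp (S.functor.map x),
      ← tensorHom_comp_tensorHom_assoc, μIso_naturality]
  left_unitality X := by
    refine GGradedCat.hom_ext_homog (S.functor ⋙ tensorLeft (𝟙_ _)) fun {a A} hA x => ?_
    have h := S.left_unitality hA
    rw [← S.μIso_eq] at h
    change 𝟙_ _ ◁ S.functor.map x ≫ _ = 𝟙_ _ ◁ S.functor.map x ≫ _
    rw [MonoidalCategory.leftUnitor_naturality, MonoidalCategory.whisker_exchange_assoc,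
      ← Category.assoc (MonoidalCategoryStruct.whiskerLeft _ _), μIso_naturality_right, Category.assoc, ← Functor.map_comp,
      MonoidalCategory.leftUnitor_naturality, Functor.map_comp, ← h, tensorHom_id]
    simp only [Category.assoc]
  right_unitality X := by
    refine GGradedCat.hom_ext_homog (S.functor ⋙ tensorRight (𝟙_ _)) fun {a A} hA x => ?_
    have h := S.right_unitality hA
    rw [← S.μIso_eq] at h
    change S.functor.map x ▷ 𝟙_ _ ≫ _ = S.functor.map x ▷ 𝟙_ _ ≫ _
    rw [MonoidalCategory.rightUnitor_naturality, ← MonoidalCategory.whisker_exchange_assoc,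
      ← Category.assoc (MonoidalCategoryStruct.whiskerRight _ _), μIso_naturality_left, Category.assoc, ← Functor.map_comp,
      MonoidalCategory.rightUnitor_naturality, Functor.map_comp, ← h, id_tensorHom]
    simp only [Category.assoc]

theorem χ_tensor (g : G) (X Y : C.carrier) :
    (S.μIso _ _).hom ≫ S.functor.map (μ (C.φ g) X Y) ≫ (S.χ g (X ⊗ Y)).hom =
      ((S.χ g X).hom ⊗ₘ (S.χ g Y).hom) ≫
        μ (D.φ g) (S.functor.obj X) (S.functor.obj Y) ≫ (D.φ g).map (S.μIso X Y).hom := by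
  refine GGradedCat.hom_ext_homog₂ (C.φ g ⋙ S.functor) (C.φ g ⋙ S.functor)
    fun {a b A B} hA hB x y => ?_
  have h := S.crossIso_tensor g hA hB (deg_φ' _ g hA) (deg_φ' _ g hB) (C.deg_tensor rfl hA hB)
  rw [← S.μIso_eq, ← S.μIso_eq, ← S.χ_eq, ← S.χ_eq, ← S.χ_eq] at h
  rw [Functor.comp_map, Functor.comp_map, μIso_naturality_assoc, ← Functor.map_comp_assoc,
    Functor.LaxMonoidal.μ_natural, Functor.map_comp_assoc, χ_naturality, reassoc_of% h,
    tensorHom_comp_tensorHom_assoc, χ_naturality, χ_naturality, ← tensorHom_comp_tensorHom_assoc,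
    Functor.LaxMonoidal.μ_natural_assoc, ← Functor.map_comp, ← Functor.map_comp, μIso_naturality]

theorem χ_unit (g : G) : S.unitIso.hom ≫ S.functor.map (Functor.LaxMonoidal.ε (C.φ g)) ≫
    (S.χ g (𝟙_ _)).hom = Functor.LaxMonoidal.ε (D.φ g) ≫ (D.φ g).map S.unitIso.hom := by
  rw [S.χ_eq g C.deg_unit, S.crossIso_unit]

theorem χ_comp {f g e : G} (h : g * f = e) (X : C.carrier) :
    S.functor.map (C.compIso h X).hom ≫ (S.χ e X).hom =
      (S.χ f ((C.φ g).obj X)).hom ≫ (D.φ f).map (S.χ g X).hom ≫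
        (D.compIso h (S.functor.obj X)).hom := by
  refine GGradedCat.hom_ext_homog (C.φ g ⋙ C.φ f ⋙ S.functor) fun {a A} hA x => ?_
  have h₁ := S.crossIso_comp h hA (deg_φ' _ g hA)
  rw [← S.χ_eq, ← S.χ_eq, ← S.χ_eq] at h₁
  rw [Functor.comp_map, Functor.comp_map, ← Functor.map_comp_assoc, C.compIso_naturality,
    Functor.map_comp_assoc, χ_naturality, reassoc_of% h₁, χ_naturality_assoc,
    ← Functor.map_comp_assoc, χ_naturality, Functor.map_comp_assoc, D.compIso_naturality]

theorem χ_one (X : C.carrier) :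
    S.functor.map (C.unitIso X).hom ≫ (S.χ 1 X).hom = (D.unitIso (S.functor.obj X)).hom := by
  refine GGradedCat.hom_ext_homog S.functor fun {a A} hA x => ?_
  have h₁ := S.crossIso_one hA
  rw [← S.χ_eq] at h₁
  rw [← Functor.map_comp_assoc, C.unitIso_naturality, Functor.map_comp_assoc, χ_naturality,
    reassoc_of% h₁, D.unitIso_naturality]

theorem χ_cancelIso {a x : G} (h : x * a = 1) (X : C.carrier) :
    (S.χ a ((C.φ x).obj X)).hom ≫ (D.φ a).map (S.χ x X).hom ≫
        (D.cancelIso h (S.functor.obj X)).hom = S.functor.map (C.cancelIso h X).hom := by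
  rw [← cancel_mono (D.unitIso (S.functor.obj X)).hom]
  simp only [Category.assoc]
  rw [GCrossedCat.cancelIso_unitIso, ← χ_comp, ← χ_one, ← Functor.map_comp_assoc,
    GCrossedCat.cancelIso_unitIso]

/-- Only `Y` has to be reduced to homogeneous objects: the inverse braiding already requires `X` to
be homogeneous. -/
theorem μIso_invBraid {a g : G} (hg : g * a = 1) {X : C.carrier} (hX : C.deg a X)
    (Y : C.carrier) :
    ((S.χ g Y).hom ⊗ₘ 𝟙 (S.functor.obj X)) ≫
        (D.invBraid hg (S.functor.obj X) (S.functor.obj Y) (S.deg_obj hX)).hom ≫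
          (S.μIso X Y).hom =
      (S.μIso _ X).hom ≫ S.functor.map (C.invBraid hg X Y hX).hom := by
  refine GGradedCat.hom_ext_homog (C.φ g ⋙ S.functor ⋙ tensorRight (S.functor.obj X))
    fun {b B} hB y => ?_
  have h := S.invBraid hg hX hB (deg_φ' _ g hB)
  rw [← S.μIso_eq, ← S.μIso_eq, ← S.χ_eq] at h
  have h₁ := D.invBraid_naturality hg (S.deg_obj hX) (S.deg_obj hX) (𝟙 _) (S.functor.map y)
  have h₂ := C.invBraid_naturality hg hX hX (𝟙 X) y
  change S.functor.map ((C.φ g).map y) ▷ S.functor.obj X ≫ _ =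
    S.functor.map ((C.φ g).map y) ▷ S.functor.obj X ≫ _
  rw [← Category.assoc (MonoidalCategoryStruct.whiskerRight _ _) (S.μIso _ X).hom, μIso_naturality_left, Category.assoc,
    ← Functor.map_comp, ← tensorHom_id (Y := X), h₂, Functor.map_comp, ← reassoc_of% h,
    ← μIso_naturality, ← tensorHom_id, tensorHom_comp_tensorHom_assoc, χ_naturality,
    ← tensorHom_comp_tensorHom_assoc, reassoc_of% h₁, CategoryTheory.Functor.map_id]

/-- By definition `invBraid` is the $G$-braiding at $\phi_gX$ followed by a cancellation. Removing
that cancellation from `μIso_invBraid` gives compatibility with the $G$-braiding for objects of the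
form $\phi_gX$. -/
theorem μIso_braid_φ {a g : G} (hg : g * a = 1) (X : C.carrier) {Y : C.carrier}
    (hY : C.deg a Y) :
    (S.μIso ((C.φ g).obj X) Y).hom ≫ S.functor.map (C.braid ((C.φ g).obj X) Y hY).hom =
      (D.braid (S.functor.obj ((C.φ g).obj X)) (S.functor.obj Y) (S.deg_obj hY)).hom ≫
        S.functor.obj Y ◁ (S.χ a ((C.φ g).obj X)).inv ≫ (S.μIso Y _).hom := by
  have h := S.μIso_invBraid hg hY X
  have h₁ := D.braid_naturality (S.deg_obj hY) (S.deg_obj hY) (S.χ g X).hom (𝟙 (S.functor.obj Y))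
  have h₂ : (D.φ a).map (S.χ g X).hom ≫ (D.cancelIso hg (S.functor.obj X)).hom =
      (S.χ a ((C.φ g).obj X)).inv ≫ S.functor.map (C.cancelIso hg X).hom := by
    rw [← χ_cancelIso, Iso.inv_hom_id_assoc]
  simp only [GBraidedCat.invBraid, Iso.trans_hom, MonoidalCategory.whiskerLeftIso_hom,
    Category.assoc, Functor.map_comp] at h
  rw [reassoc_of% h₁, id_tensorHom, ← MonoidalCategory.whiskerLeft_comp_assoc, h₂,
    MonoidalCategory.whiskerLeft_comp_assoc, μIso_naturality_right] at h
  rw [← cancel_mono (S.functor.map (Y ◁ (C.cancelIso hg X).hom))]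
  simp only [Category.assoc]
  exact h.symm

/-- Every `X` is isomorphic to $\phi_{b^{-1}}\phi_bX$, to which `μIso_braid_φ` applies; naturality
brings the result back to `X`. -/
theorem μIso_braid {b : G} (X : C.carrier) {Y : C.carrier} (hY : C.deg b Y) :
    (S.μIso X Y).hom ≫ S.functor.map (C.braid X Y hY).hom =
      (D.braid (S.functor.obj X) (S.functor.obj Y) (S.deg_obj hY)).hom ≫
        S.functor.obj Y ◁ (S.χ b X).inv ≫ (S.μIso Y ((C.φ b).obj X)).hom := by
  have h := S.μIso_braid_φ (inv_mul_cancel b) ((C.φ b).obj X) hY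
  have h₁ := C.braid_naturality hY hY (C.cancelIso (mul_inv_cancel b) X).inv (𝟙 Y)
  have h₂ := D.braid_naturality (S.deg_obj hY) (S.deg_obj hY)
    (S.functor.map (C.cancelIso (mul_inv_cancel b) X).inv) (𝟙 _)
  have h₃ := S.χ_naturality b (C.cancelIso (mul_inv_cancel b) X).inv
  have h₄ : (D.φ b).map (S.functor.map (C.cancelIso (mul_inv_cancel b) X).inv) ≫
      (S.χ b _).inv = (S.χ b X).inv ≫
        S.functor.map ((C.φ b).map (C.cancelIso (mul_inv_cancel b) X).inv) := by
    rw [Iso.comp_inv_eq, Category.assoc, h₃, Iso.inv_hom_id_assoc]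
  rw [tensorHom_id, id_tensorHom] at h₁ h₂
  rw [← cancel_mono (S.functor.map (Y ◁ (C.φ b).map (C.cancelIso (mul_inv_cancel b) X).inv))]
  simp only [Category.assoc]
  rw [← Functor.map_comp, ← h₁, Functor.map_comp, ← Category.assoc, ← μIso_naturality_left,
    Category.assoc, h, reassoc_of% h₂, ← μIso_naturality_right,
    ← MonoidalCategory.whiskerLeft_comp_assoc, h₄, MonoidalCategory.whiskerLeft_comp_assoc]

/-- The 1-cell determined by constraints on homogeneous objects. -/
noncomputable def toHom : Hom C D :=
  letI : S.functor.Monoidal := S.coreMonoidal.toMonoidal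
  { functor := S.functor
    deg_obj := S.deg_obj
    crossIso := S.χ
    crossIso_naturality := fun g _ _ f => S.χ_naturality g f
    crossIso_tensor := fun g X Y => by exact S.χ_tensor g X Y
    crossIso_unit := fun g => by exact S.χ_unit g
    crossIso_comp := fun h X => S.χ_comp h X
    crossIso_one := S.χ_one
    braid := fun X _ hY => by exact S.μIso_braid X hY }

end HomogHom

end GBraidedCat

/-! ### Essential surjectivity on hom-categories -/

namespace GBraidedCat

variable {k : Type w} [CommRing k] {G : Type u} [Group G] {C D : GBraidedCat.{w, v, u} k G}
  (T : BraidedMonoidale.Hom C.toBraidedMonoidale D.toBraidedMonoidale)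

namespace FibHom

/-- The value on a homogeneous object. -/
def ob {a : G} {X : C.carrier} (hX : C.deg a X) : D.carrier :=
  ((PsGAut.comp T.trans a).obj ⟨X, hX⟩).1

theorem deg_ob {a : G} {X : C.carrier} (hX : C.deg a X) : D.deg a (ob T hX) :=
  ((PsGAut.comp T.trans a).obj ⟨X, hX⟩).2

/-- The value on a morphism of homogeneous objects. -/
def mp {a : G} {X Y : C.carrier} (hX : C.deg a X) (hY : C.deg a Y) (f : X ⟶ Y) :
    ob T hX ⟶ ob T hY :=
  ((PsGAut.comp T.trans a).map ((C.deg a).homMk (X := ⟨X, hX⟩) (Y := ⟨Y, hY⟩) f)).hom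

theorem mp_id {a : G} {X : C.carrier} (hX : C.deg a X) : mp T hX hX (𝟙 X) = 𝟙 _ :=
  congrArg (fun f => f.hom) ((PsGAut.comp T.trans a).map_id ⟨X, hX⟩)

theorem mp_comp {a : G} {X Y Z : C.carrier} (hX : C.deg a X) (hY : C.deg a Y) (hZ : C.deg a Z)
    (f : X ⟶ Y) (g : Y ⟶ Z) : mp T hX hZ (f ≫ g) = mp T hX hY f ≫ mp T hY hZ g :=
  congrArg (fun f => f.hom) ((PsGAut.comp T.trans a).map_comp
    ((C.deg a).homMk (X := ⟨X, hX⟩) (Y := ⟨Y, hY⟩) f)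
    ((C.deg a).homMk (X := ⟨Y, hY⟩) (Y := ⟨Z, hZ⟩) g))

/-- The tensor constraint on homogeneous objects. -/
def τ {a b c : G} (h : a * b = c) {X Y : C.carrier} (hX : C.deg a X) (hY : C.deg b Y) :
    ob T hX ⊗ ob T hY ≅ ob T (C.deg_tensor h hX hY) :=
  (D.deg c).ι.mapIso (T.tensorIso h ⟨X, hX⟩ ⟨Y, hY⟩)

/-- The unit constraint. -/
def un : 𝟙_ D.carrier ≅ ob T C.deg_unit :=
  (D.deg 1).ι.mapIso T.unitIso

/-- The crossing constraint on homogeneous objects. -/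
def ch {g a b : G} (h : g * a = b * g) {X : C.carrier} (hX : C.deg a X)
    (hX' : C.deg b ((C.φ g⁻¹).obj X)) : ob T hX' ≅ (D.φ g⁻¹).obj (ob T hX) :=
  (D.deg b).ι.mapIso (PsGAut.compAct T.trans g h ⟨X, hX⟩)

/-- This and the following equations are the axioms of `T` read in the ambient category `D`, with
the proofs of homogeneity as explicit arguments. -/
theorem τ_naturality {a b c : G} (h : a * b = c) {X X' Y Y' : C.carrier} (hX : C.deg a X)
    (hX' : C.deg a X') (hY : C.deg b Y) (hY' : C.deg b Y') (x : X ⟶ X') (y : Y ⟶ Y') :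
    (mp T hX hX' x ⊗ₘ mp T hY hY' y) ≫ (τ T h hX' hY').hom =
      (τ T h hX hY).hom ≫ mp T (C.deg_tensor h hX hY) (C.deg_tensor h hX' hY') (x ⊗ₘ y) :=
  congrArg (fun f => f.hom) (T.tensorIso_naturality h
    ((C.deg a).homMk (X := ⟨X, hX⟩) (Y := ⟨X', hX'⟩) x)
    ((C.deg b).homMk (X := ⟨Y, hY⟩) (Y := ⟨Y', hY'⟩) y))

theorem τ_assoc {a b c p q s : G} (hp : a * b = p) (hpc : p * c = s) (hq : b * c = q)
    (haq : a * q = s) {X Y Z : C.carrier} (hX : C.deg a X) (hY : C.deg b Y) (hZ : C.deg c Z) :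
    ((τ T hp hX hY).hom ⊗ₘ 𝟙 (ob T hZ)) ≫ (τ T hpc (C.deg_tensor hp hX hY) hZ).hom ≫
        mp T (C.deg_tensor hpc (C.deg_tensor hp hX hY) hZ)
          (C.deg_tensor haq hX (C.deg_tensor hq hY hZ)) (α_ X Y Z).hom =
      (MonoidalCategoryStruct.associator _ _ _).hom ≫ (𝟙 (ob T hX) ⊗ₘ (τ T hq hY hZ).hom) ≫
        (τ T haq hX (C.deg_tensor hq hY hZ)).hom :=
  congrArg (fun f => f.hom) (T.assoc hp hpc hq haq ⟨X, hX⟩ ⟨Y, hY⟩ ⟨Z, hZ⟩)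

theorem un_left {a : G} (h : 1 * a = a) {X : C.carrier} (hX : C.deg a X) :
    ((un T).hom ⊗ₘ 𝟙 (ob T hX)) ≫ (τ T h C.deg_unit hX).hom ≫
      mp T (C.deg_tensor h C.deg_unit hX) hX (λ_ X).hom =
        (MonoidalCategoryStruct.leftUnitor _).hom :=
  congrArg (fun f => f.hom) (T.leftUnit h ⟨X, hX⟩)

theorem un_right {a : G} (h : a * 1 = a) {X : C.carrier} (hX : C.deg a X) :
    (𝟙 (ob T hX) ⊗ₘ (un T).hom) ≫ (τ T h hX C.deg_unit).hom ≫
      mp T (C.deg_tensor h hX C.deg_unit) hX (ρ_ X).hom =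
        (MonoidalCategoryStruct.rightUnitor _).hom :=
  congrArg (fun f => f.hom) (T.rightUnit h ⟨X, hX⟩)

theorem ch_naturality {g a b : G} (h : g * a = b * g) {X Y : C.carrier} (hX : C.deg a X)
    (hX' : C.deg b ((C.φ g⁻¹).obj X)) (hY : C.deg a Y) (hY' : C.deg b ((C.φ g⁻¹).obj Y))
    (f : X ⟶ Y) : mp T hX' hY' ((C.φ g⁻¹).map f) ≫ (ch T h hY hY').hom =
      (ch T h hX hX').hom ≫ (D.φ g⁻¹).map (mp T hX hY f) :=
  congrArg (fun f => f.hom) (PsGAut.compAct_naturality T.trans g h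
    ((C.deg a).homMk (X := ⟨X, hX⟩) (Y := ⟨Y, hY⟩) f))

theorem ch_τ {a b c a' b' c' g : G} (h : a * b = c) (h' : a' * b' = c') (ha : g * a = a' * g)
    (hb : g * b = b' * g) (hc : g * c = c' * g) {X Y : C.carrier} (hX : C.deg a X)
    (hY : C.deg b Y) (hX' : C.deg a' ((C.φ g⁻¹).obj X)) (hY' : C.deg b' ((C.φ g⁻¹).obj Y))
    (hXY : C.deg c' ((C.φ g⁻¹).obj (X ⊗ Y))) :
    ((ch T ha hX hX').hom ⊗ₘ (ch T hb hY hY').hom) ≫ μ (D.φ g⁻¹) _ _ ≫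
        (D.φ g⁻¹).map (τ T h hX hY).hom =
      (τ T h' hX' hY').hom ≫ mp T (C.deg_tensor h' hX' hY') hXY (μ (C.φ g⁻¹) X Y) ≫
        (ch T hc (C.deg_tensor h hX hY) hXY).hom :=
  congrArg (fun f => f.hom) (T.tensorIso_act h h' ha hb hc ⟨X, hX⟩ ⟨Y, hY⟩)

theorem un_ch {g : G} (h : g * 1 = 1 * g) (h₁ : C.deg 1 ((C.φ g⁻¹).obj (𝟙_ C.carrier))) :
    Functor.LaxMonoidal.ε (D.φ g⁻¹) ≫ (D.φ g⁻¹).map (un T).hom =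
      (un T).hom ≫ mp T C.deg_unit h₁ (Functor.LaxMonoidal.ε (C.φ g⁻¹)) ≫
        (ch T h C.deg_unit h₁).hom :=
  congrArg (fun f => f.hom) (T.unitIso_act h)

theorem ch_comp {a b c f g e : G} (hf : f * a = b * f) (hg : g * b = c * g)
    (he : e * a = c * e) (hm : g * f = e) (hm' : f⁻¹ * g⁻¹ = e⁻¹) {X : C.carrier}
    (hX : C.deg a X) (hX₁ : C.deg b ((C.φ f⁻¹).obj X))
    (hX₂ : C.deg c ((C.φ g⁻¹).obj ((C.φ f⁻¹).obj X))) (hX₃ : C.deg c ((C.φ e⁻¹).obj X)) :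
    (ch T hg hX₁ hX₂).hom ≫ (D.φ g⁻¹).map (ch T hf hX hX₁).hom ≫
        (D.compIso hm' (ob T hX)).hom =
      mp T hX₂ hX₃ (C.compIso hm' X).hom ≫ (ch T he hX hX₃).hom := by
  have h := PsGAut.compAct_mul T.trans hf hg he hm ⟨X, hX⟩
  change _ ≫ _ ≫ (D.toPs.actMul hf hg he hm _).hom =
    (PsGAut.comp T.trans c).map (C.toPs.actMul hf hg he hm _).hom ≫ _ at h
  erw [toPs_actMul, toPs_actMul] at h
  exact congrArg (fun f => f.hom) h

theorem ch_one {a : G} (h : (1 : G) * a = a * 1) {X : C.carrier} (hX : C.deg a X)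
    (hX' : C.deg a ((C.φ (1 : G)⁻¹).obj X)) :
    (ch T h hX hX').hom ≫ (D.oneIso inv_one (ob T hX)).hom =
      mp T hX' hX (C.oneIso inv_one X).hom := by
  have h₁ := PsGAut.compAct_one T.trans h ⟨X, hX⟩
  change _ ≫ (D.toPs.actOne h _).hom = (PsGAut.comp T.trans a).map (C.toPs.actOne h _).hom at h₁
  erw [toPs_actOne, toPs_actOne] at h₁
  exact congrArg (fun f => f.hom) h₁

theorem τ_invBraid {a b b' c : G} (h : a * b = c) (hb : a * b = b' * a) (h' : b' * a = c)
    {X Y : C.carrier} (hX : C.deg a X) (hY : C.deg b Y) (hY' : C.deg b' ((C.φ a⁻¹).obj Y)) :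
    (τ T h hX hY).hom ≫ mp T (C.deg_tensor h hX hY) (C.deg_tensor h' hY' hX)
        (C.invBraid (inv_mul_cancel a) X Y hX).inv =
      (D.invBraid (inv_mul_cancel a) (ob T hX) (ob T hY)
          (deg_ob T hX)).inv ≫
        ((ch T hb hY hY').inv ⊗ₘ 𝟙 (ob T hX)) ≫ (τ T h' hY' hX).hom :=
  congrArg (fun f => f.hom) (T.braid h hb h' ⟨X, hX⟩ ⟨Y, hY⟩)

/-- The components, as functors between categories of homogeneous objects. -/
abbrev functors (a : G) : C.fib a ⥤ D.fib a := PsGAut.comp T.trans a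

instance (a : G) : (functors T a).Additive := inferInstanceAs (PsGAut.comp T.trans a).Additive

instance (a : G) : (functors T a).Linear k := inferInstanceAs ((PsGAut.comp T.trans a).Linear k)

/-- The extension to all objects. -/
noncomputable def ext : C.carrier ⥤ D.carrier := GGradedCat.extFunctor (functors T)

theorem deg_ext {a : G} {X : C.carrier} (hX : C.deg a X) : D.deg a ((ext T).obj X) :=
  GGradedCat.deg_extFunctor (functors T) hX

instance : (ext T).Additive := inferInstanceAs (GGradedCat.extFunctor _).Additive

instance : (ext T).Linear k := inferInstanceAs ((GGradedCat.extFunctor (functors T)).Linear k)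

/-- The extension agrees with the given functors on homogeneous objects. -/
noncomputable def κ {a : G} {X : C.carrier} (hX : C.deg a X) : ob T hX ≅ (ext T).obj X :=
  GGradedCat.extFunctorIso (functors T) ⟨X, hX⟩

theorem κ_map {a : G} {X Y : C.carrier} (hX : C.deg a X) (hY : C.deg a Y) (f : X ⟶ Y) :
    (κ T hX).hom ≫ (ext T).map f = mp T hX hY f ≫ (κ T hY).hom :=
  (GGradedCat.extFunctorIso_naturality (functors T)
    ((C.deg a).homMk (X := ⟨X, hX⟩) (Y := ⟨Y, hY⟩) f)).symm

theorem κ_map_assoc {a : G} {X Y : C.carrier} (hX : C.deg a X) (hY : C.deg a Y) (f : X ⟶ Y)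
    {W : D.carrier} (w : (ext T).obj Y ⟶ W) :
    (κ T hX).hom ≫ (ext T).map f ≫ w = mp T hX hY f ≫ (κ T hY).hom ≫ w := by
  rw [← Category.assoc, κ_map T hX hY, Category.assoc]

/-- The tensor constraint of the extension. -/
noncomputable def extTensor {a b c : G} (h : a * b = c) {X Y : C.carrier} (hX : C.deg a X)
    (hY : C.deg b Y) : (ext T).obj X ⊗ (ext T).obj Y ≅ (ext T).obj (X ⊗ Y) :=
  ((κ T hX).symm ⊗ᵢ (κ T hY).symm) ≪≫ τ T h hX hY ≪≫ κ T (C.deg_tensor h hX hY)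

theorem extTensor_eq {a b c : G} (h : a * b = c) {X Y : C.carrier} (hX : C.deg a X)
    (hY : C.deg b Y) : extTensor T rfl hX hY = extTensor T h hX hY := by
  subst h
  rfl

theorem κ_extTensor {a b c : G} (h : a * b = c) {X Y : C.carrier} (hX : C.deg a X)
    (hY : C.deg b Y) :
    ((κ T hX).hom ⊗ₘ (κ T hY).hom) ≫ (extTensor T rfl hX hY).hom =
      (τ T h hX hY).hom ≫ (κ T (C.deg_tensor h hX hY)).hom := by
  rw [extTensor_eq T h, extTensor]
  simp only [Iso.trans_hom, tensorIso_hom, Iso.symm_hom]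
  rw [tensorHom_comp_tensorHom_assoc, Iso.hom_inv_id, Iso.hom_inv_id, id_tensorHom_id,
    Category.id_comp]

theorem κ_extTensor_assoc {a b c : G} (h : a * b = c) {X Y : C.carrier} (hX : C.deg a X)
    (hY : C.deg b Y) {W : D.carrier} (w : (ext T).obj (X ⊗ Y) ⟶ W) :
    ((κ T hX).hom ⊗ₘ (κ T hY).hom) ≫ (extTensor T rfl hX hY).hom ≫ w =
      (τ T h hX hY).hom ≫ (κ T (C.deg_tensor h hX hY)).hom ≫ w := by
  rw [← Category.assoc, κ_extTensor T h, Category.assoc]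

/-- The crossing constraint of the extension. -/
noncomputable def extCross {g x a b : G} (hx : g⁻¹ = x) (h : g * a = b * g) {X : C.carrier}
    (hX : C.deg a X) : (ext T).obj ((C.φ x).obj X) ≅ (D.φ x).obj ((ext T).obj X) :=
  hx ▸ ((κ T (C.deg_φ (show g⁻¹ * b = a * g⁻¹ by
    rw [inv_mul_eq_iff_eq_mul, ← mul_assoc, h, mul_inv_cancel_right]) hX)).symm ≪≫
      ch T h hX _ ≪≫ (D.φ g⁻¹).mapIso (κ T hX))

/-- The crossing constraint of the extension. -/
noncomputable def extCross' (x : G) {a : G} {X : C.carrier} (hX : C.deg a X) :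
    (ext T).obj ((C.φ x).obj X) ≅ (D.φ x).obj ((ext T).obj X) :=
  extCross T (inv_inv x) (show x⁻¹ * a = (x⁻¹ * a * x) * x⁻¹ by group) hX

/-- The acting element is determined by its inverse and the target degree by the source, so the
constraint does not depend on the names used to define it. -/
theorem extCross'_eq {g a b : G} (h : g * a = b * g) {X : C.carrier} (hX : C.deg a X) :
    extCross' T g⁻¹ hX = extCross T rfl h hX := by
  have key : ∀ {g g' b b' x : G} (hx : g⁻¹ = x) (hx' : g'⁻¹ = x) (h : g * a = b * g)
      (h' : g' * a = b' * g'), extCross T hx h hX = extCross T hx' h' hX := by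
    intro g g' b b' x hx hx' h h'
    obtain rfl : g = g' := inv_injective (hx.trans hx'.symm)
    obtain rfl : b = b' := mul_right_cancel (h.symm.trans h')
    rfl
  exact key _ _ _ _

theorem κ_extCross' {g a b : G} (h : g * a = b * g) {X : C.carrier} (hX : C.deg a X)
    (hX' : C.deg b ((C.φ g⁻¹).obj X)) :
    (κ T hX').hom ≫ (extCross' T g⁻¹ hX).hom =
      (ch T h hX hX').hom ≫ (D.φ g⁻¹).map (κ T hX).hom := by
  rw [extCross'_eq T h]
  change (κ T hX').hom ≫ (κ T hX').inv ≫ _ = _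
  rw [Iso.hom_inv_id_assoc]
  rfl

theorem κ_extCross'_assoc {g a b : G} (h : g * a = b * g) {X : C.carrier} (hX : C.deg a X)
    (hX' : C.deg b ((C.φ g⁻¹).obj X)) {W : D.carrier} (w : (D.φ g⁻¹).obj ((ext T).obj X) ⟶ W) :
    (κ T hX').hom ≫ (extCross' T g⁻¹ hX).hom ≫ w =
      (ch T h hX hX').hom ≫ (D.φ g⁻¹).map (κ T hX).hom ≫ w := by
  rw [← Category.assoc, κ_extCross' T h, Category.assoc]

/-- Crossed objects lie over the conjugate degree, and degrees are unique by disjointness. It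
supplies the equations between degrees that the constraints of `T` require. -/
theorem deg_eq {C : GCrossedCat.{w, v, u} k G} {g a b : G} {X : C.carrier} (hX : C.deg a X)
    (hX' : C.deg b ((C.φ g⁻¹).obj X)) : g * a = b * g := by
  have := C.deg_disjoint hX' (C.deg_φ (show g⁻¹ * (g * a * g⁻¹) = a * g⁻¹ by group) hX)
  rw [this]
  group

/-- The extension, with its constraints on homogeneous objects. -/
noncomputable def homogHom : HomogHom C D where
  functor := ext T
  deg_obj := deg_ext T
  tensorIso hX hY := extTensor T rfl hX hY
  tensorIso_naturality {a b X X' Y Y'} hX hX' hY hY' x y := by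
    -- Precomposition with the comparisons `κ` turns every constraint of the extension into the one
    -- of `T`. All axioms below are proved in this way.
    rw [← cancel_epi ((κ T hX).hom ⊗ₘ (κ T hY).hom), tensorHom_comp_tensorHom_assoc,
      κ_map T hX hX', κ_map T hY hY', ← tensorHom_comp_tensorHom_assoc, κ_extTensor T rfl,
      κ_extTensor_assoc T rfl, κ_map T _ (C.deg_tensor rfl hX' hY'),
      ← Category.assoc, τ_naturality, Category.assoc]
  unitIso := un T ≪≫ κ T C.deg_unit
  associativity {a b c p q X Y Z} hX hY hZ hXY hYZ := by
    -- Disjointness forces `p` to be the product of the degrees of the factors.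
    obtain rfl := C.deg_disjoint hXY (C.deg_tensor rfl hX hY)
    obtain rfl := C.deg_disjoint hYZ (C.deg_tensor rfl hY hZ)
    have h := τ_assoc T rfl rfl rfl (mul_assoc a b c).symm hX hY hZ
    rw [← cancel_epi (((κ T hX).hom ⊗ₘ (κ T hY).hom) ⊗ₘ (κ T hZ).hom),
      tensorHom_comp_tensorHom_assoc, κ_extTensor T rfl, Category.comp_id,
      ← Category.id_comp (κ T hZ).hom, ← tensorHom_comp_tensorHom_assoc, κ_extTensor_assoc T rfl,
      κ_map T _ (C.deg_tensor (mul_assoc a b c).symm hX (C.deg_tensor rfl hY hZ)),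
      reassoc_of% h, MonoidalCategory.associator_naturality_assoc, Category.id_comp,
      tensorHom_comp_tensorHom_assoc, κ_extTensor T rfl, Category.comp_id,
      ← Category.id_comp (κ T hX).hom, ← tensorHom_comp_tensorHom_assoc,
      κ_extTensor T (mul_assoc a b c).symm]
  left_unitality {a X} hX := by
    have h := un_left T (one_mul a) hX
    rw [← cancel_epi (𝟙 _ ⊗ₘ (κ T hX).hom), Iso.trans_hom, tensorHom_comp_tensorHom_assoc,
      Category.id_comp, Category.comp_id, ← Category.id_comp (κ T hX).hom,
      ← tensorHom_comp_tensorHom_assoc, κ_extTensor_assoc T (one_mul a), κ_map T _ hX,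
      reassoc_of% h, Category.id_comp, id_tensorHom, MonoidalCategory.leftUnitor_naturality]
  right_unitality {a X} hX := by
    have h := un_right T (mul_one a) hX
    rw [← cancel_epi ((κ T hX).hom ⊗ₘ 𝟙 _), Iso.trans_hom, tensorHom_comp_tensorHom_assoc,
      Category.id_comp, Category.comp_id, ← Category.id_comp (κ T hX).hom,
      ← tensorHom_comp_tensorHom_assoc, κ_extTensor_assoc T (mul_one a), κ_map T _ hX,
      reassoc_of% h, Category.id_comp, tensorHom_id, MonoidalCategory.rightUnitor_naturality]
  crossIso g _ _ hX := extCross' T g hX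
  crossIso_naturality g {a X Y} hX hY f := by
    -- The constraint of `T` at `g` concerns `φ g⁻¹`, so the crossing element is written as an
    -- inverse.
    obtain ⟨g, rfl⟩ := inv_surjective g
    have hX' := HomogHom.deg_φ' C.toGCrossedCat g⁻¹ hX
    have hY' := HomogHom.deg_φ' C.toGCrossedCat g⁻¹ hY
    rw [← cancel_epi (κ T hX').hom, κ_map_assoc T hX' hY', κ_extCross' T (deg_eq hY hY') hY,
      κ_extCross'_assoc T (deg_eq hX hX') hX, ← Functor.map_comp, κ_map T hX hY,
      Functor.map_comp, ← Category.assoc, ch_naturality, Category.assoc]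
  crossIso_tensor g {a b a' b' p X Y} hX hY hX' hY' hXY := by
    obtain ⟨g, rfl⟩ := inv_surjective g
    obtain rfl := C.deg_disjoint hXY (C.deg_tensor rfl hX hY)
    have ha := deg_eq hX hX'
    have hb := deg_eq hY hY'
    have hc : g * (a * b) = (a' * b') * g := by rw [← mul_assoc, ha, mul_assoc, hb, mul_assoc]
    have hXY' : C.deg (a' * b') ((C.φ g⁻¹).obj (X ⊗ Y)) :=
      C.deg_φ (by rw [inv_mul_eq_iff_eq_mul, ← mul_assoc, hc, mul_inv_cancel_right]) hXY
    have h := ch_τ T rfl rfl ha hb hc hX hY hX' hY' hXY'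
    rw [← cancel_epi ((κ T hX').hom ⊗ₘ (κ T hY').hom), κ_extTensor_assoc T rfl,
      κ_map_assoc T _ hXY', κ_extCross' T hc, ← reassoc_of% h, tensorHom_comp_tensorHom_assoc,
      κ_extCross' T ha, κ_extCross' T hb, ← tensorHom_comp_tensorHom_assoc,
      Functor.LaxMonoidal.μ_natural_assoc, ← Functor.map_comp, ← Functor.map_comp,
      κ_extTensor T rfl]
  crossIso_unit g := by
    obtain ⟨g, rfl⟩ := inv_surjective g
    have h₁ : C.deg 1 ((C.φ g⁻¹).obj (𝟙_ C.carrier)) :=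
      C.deg_φ (show g⁻¹ * 1 = 1 * g⁻¹ by group) C.deg_unit
    have hg : g * 1 = 1 * g := by group
    have h := un_ch T hg h₁
    rw [Iso.trans_hom, Category.assoc, κ_map_assoc T _ h₁, κ_extCross' T hg, Functor.map_comp,
      reassoc_of% h]
  crossIso_comp {f g e} h {a b X} hX hX' := by
    obtain ⟨f, rfl⟩ := inv_surjective f
    obtain ⟨g, rfl⟩ := inv_surjective g
    obtain ⟨e, rfl⟩ := inv_surjective e
    have hX₂ := HomogHom.deg_φ' C.toGCrossedCat f⁻¹ hX'
    have hm : f * g = e := by rw [← inv_inj, mul_inv_rev, h]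
    have hg := deg_eq hX hX'
    have hf := deg_eq hX' hX₂
    have he := (congrArg (· * a) hm).symm.trans ((mul_assoc f g a).trans
      ((congrArg (f * ·) hg).trans ((mul_assoc f b g).symm.trans ((congrArg (· * g) hf).trans
        ((mul_assoc _ f g).trans (congrArg (_ * ·) hm))))))
    have hX₃ : C.deg _ ((C.φ e⁻¹).obj X) := C.deg_φ
      (by rw [inv_mul_eq_iff_eq_mul, ← mul_assoc, he, mul_inv_cancel_right]) hX
    have h₁ := ch_comp T hg hf he hm h hX hX' hX₂ hX₃
    rw [← cancel_epi (κ T hX₂).hom, κ_map_assoc T hX₂ hX₃, κ_extCross' T he, ← reassoc_of% h₁,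
      κ_extCross'_assoc T hf, ← Functor.map_comp_assoc, κ_extCross' T hg, Functor.map_comp_assoc,
      D.compIso_naturality]
  crossIso_one {a X} hX := by
    -- The unit law of `T` concerns `φ 1⁻¹`. Stating it for every `e` equal to `1` allows passing
    -- from `1⁻¹` to `1` by substitution.
    have key : ∀ {e : G} (he : e = 1), (extCross' T e hX).hom ≫
        (D.oneIso he ((ext T).obj X)).hom = (ext T).map (C.oneIso he X).hom := by
      suffices (extCross' T (1 : G)⁻¹ hX).hom ≫ (D.oneIso inv_one ((ext T).obj X)).hom =
          (ext T).map (C.oneIso inv_one X).hom by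
        intro e he
        obtain rfl : e = (1 : G)⁻¹ := he.trans inv_one.symm
        exact this
      have h : (1 : G) * a = a * 1 := by group
      have hX' : C.deg a ((C.φ (1 : G)⁻¹).obj X) := C.deg_φ (by group) hX
      rw [← cancel_epi (κ T hX').hom, κ_extCross'_assoc T h, κ_map T hX' hX, ← ch_one T h,
        Category.assoc, D.oneIso_naturality]
    have h := key rfl
    rw [GCrossedCat.oneIso_one, GCrossedCat.oneIso_one, Iso.symm_hom, Iso.symm_hom,
      Iso.comp_inv_eq] at h
    rw [h, ← Functor.map_comp_assoc, Iso.hom_inv_id, CategoryTheory.Functor.map_id,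
      Category.id_comp]
  invBraid {a b b' g} hg {X Y} hX hY hY' := by
    obtain rfl := eq_inv_of_mul_eq_one_left hg
    have hb := deg_eq hY hY'
    have h := τ_invBraid T rfl hb hb.symm hX hY hY'
    have h₁ := D.invBraid_naturality (inv_mul_cancel a)
      (deg_ob T hX) (deg_ext T hX)
      (κ T hX).hom (κ T hY).hom
    -- The braiding axiom of `T`, solved for `invBraid` instead of its inverse.
    have h₂ : (τ T hb.symm hY' hX).hom ≫ mp T (C.deg_tensor hb.symm hY' hX)
        (C.deg_tensor rfl hX hY) (C.invBraid hg X Y hX).hom =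
      ((ch T hb hY hY').hom ⊗ₘ 𝟙 (ob T hX)) ≫
        (D.invBraid hg (ob T hX) (ob T hY) (deg_ob T hX)).hom ≫
          (τ T rfl hX hY).hom := by
      have e : (τ T rfl hX hY).hom = (D.invBraid (inv_mul_cancel a) (ob T hX) (ob T hY)
          (deg_ob T hX)).inv ≫
        ((ch T hb hY hY').inv ⊗ₘ 𝟙 (ob T hX)) ≫ (τ T hb.symm hY' hX).hom ≫
          mp T (C.deg_tensor hb.symm hY' hX)
            (C.deg_tensor rfl hX hY) (C.invBraid hg X Y hX).hom := by
        rw [← reassoc_of% h, ← mp_comp, Iso.inv_hom_id, mp_id, Category.comp_id]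
      rw [e, Iso.hom_inv_id_assoc, tensorHom_comp_tensorHom_assoc, Iso.hom_inv_id,
        Category.comp_id, id_tensorHom_id, Category.id_comp]
    rw [← cancel_epi ((κ T hY').hom ⊗ₘ (κ T hX).hom), κ_extTensor_assoc T hb.symm,
      κ_map T _ (C.deg_tensor rfl hX hY), reassoc_of% h₂, tensorHom_comp_tensorHom_assoc,
      κ_extCross' T hb, Category.comp_id, ← Category.id_comp (κ T hX).hom,
      ← tensorHom_comp_tensorHom_assoc, reassoc_of% h₁, κ_extTensor T rfl]

/-- The extension restricts to the given morphism of braided monoidales. -/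
noncomputable def isoToBraidedMonoidale :
    (show C.toBraidedMonoidale ⟶ D.toBraidedMonoidale from T) ≅
      (show C.toBraidedMonoidale ⟶ D.toBraidedMonoidale from
        (homogHom T).toHom.toBraidedMonoidale) :=
  BraidedMonoidale.isoMk
    (PsGAut.mkModIso
      (fun a => NatIso.ofComponents
        (fun X => (D.deg a).isoMk (X := (PsGAut.comp T.trans a).obj X)
          (Y := ((homogHom T).toHom.fibFunctor a).obj X) (κ T X.2))
        fun {X Y} f => ObjectProperty.hom_ext _ (κ_map T X.2 Y.2 f.hom).symm)
      (fun {a b} g h A => ObjectProperty.hom_ext _ (by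
        have hA : C.deg b ((C.φ g⁻¹).obj A.1) := ((C.actFunctor g h).obj A).2
        change (κ T hA).hom ≫ ((homogHom T).χ g⁻¹ A.1).hom =
          (ch T h A.2 hA).hom ≫ (D.φ g⁻¹).map (κ T A.2).hom
        rw [(homogHom T).χ_eq g⁻¹ A.2]
        exact κ_extCross' T h A.2 hA)))
    (fun {a b c} h A B => ObjectProperty.hom_ext _ (by
      change (τ T h A.2 B.2).hom ≫ (κ T (C.deg_tensor h A.2 B.2)).hom =
        ((κ T A.2).hom ⊗ₘ (κ T B.2).hom) ≫ ((homogHom T).μIso A.1 B.1).hom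
      rw [(homogHom T).μIso_eq A.2 B.2]
      exact (κ_extTensor T h A.2 B.2).symm))
    (ObjectProperty.hom_ext _ rfl)

end FibHom

/-- Every morphism of braided monoidales between `G`-braided categories comes from a 1-cell. -/
instance (C D : GBraidedCat.{w, v, u} k G) :
    ((toBraidedMonoidaleFunctor k G).mapFunctor C D).EssSurj where
  mem_essImage T := ⟨(FibHom.homogHom T).toHom, ⟨(FibHom.isoToBraidedMonoidale T).symm⟩⟩

/-! ### Full faithfulness on hom-categories -/

instance (C D : GBraidedCat.{w, v, u} k G) :
    ((toBraidedMonoidaleFunctor k G).mapFunctor C D).Faithful where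
  map_injective {S S' η θ} h := hom₂_ext (GGradedCat.nat_ext_homog fun {a X} hX => by
    have : PsGAut.modApp (BraidedMonoidale.Hom₂.mod (Hom₂.toBraidedMonoidale η))
          (⟨X, hX⟩ : C.toPs.fib a) =
        PsGAut.modApp (BraidedMonoidale.Hom₂.mod (Hom₂.toBraidedMonoidale θ))
          (⟨X, hX⟩ : C.toPs.fib a) :=
      congrArg (fun z => PsGAut.modApp (BraidedMonoidale.Hom₂.mod z) (⟨X, hX⟩ : C.toPs.fib a)) h
    exact congrArg (fun f => f.hom) this)

section Full

variable {S S' : Hom C D}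
  (θ : BraidedMonoidale.Hom₂ S.toBraidedMonoidale S'.toBraidedMonoidale)

/-- The natural transformation of a 2-cell of braided monoidales. -/
noncomputable def natOfMod : S.functor ⟶ S'.functor :=
  GGradedCat.HomogNat.ext
    { app := fun {a X} hX => (PsGAut.modApp θ.mod (⟨X, hX⟩ : C.toPs.fib a)).hom
      naturality := fun {a X Y} hX hY f => congrArg (fun f => f.hom)
        (PsGAut.modApp_naturality θ.mod
          ((C.deg a).homMk (X := ⟨X, hX⟩) (Y := ⟨Y, hY⟩) f)) }

theorem natOfMod_app {a : G} {X : C.carrier} (hX : C.deg a X) :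
    (natOfMod θ).app X = (PsGAut.modApp θ.mod (⟨X, hX⟩ : C.toPs.fib a)).hom :=
  GGradedCat.HomogNat.extApp_eq _ hX

/-- The 2-cell of `G`-braided categories of a 2-cell of braided monoidales. -/
noncomputable def homOfMod : Hom₂ S S' where
  nat := natOfMod θ
  isMonoidal :=
    { unit := by
        refine Eq.trans ?_ (congrArg (fun f => f.hom) θ.unit)
        exact congrArg (_ ≫ ·) (natOfMod_app θ C.deg_unit)
      tensor := fun X Y => by
        -- On homogeneous objects monoidality is the tensor axiom of `θ`. Since `natOfMod` is
        -- natural, this is enough.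
        refine GGradedCat.hom_ext_homog₂ S.functor S.functor fun {a b A B} hA hB x y => ?_
        have h : μ S.functor A B ≫ (natOfMod θ).app (A ⊗ B) =
            ((natOfMod θ).app A ⊗ₘ (natOfMod θ).app B) ≫ μ S'.functor A B := by
          have h₁ := congrArg (fun f => f.hom) (θ.tensor rfl ⟨A, hA⟩ ⟨B, hB⟩)
          rw [natOfMod_app θ hA, natOfMod_app θ hB, natOfMod_app θ (C.deg_tensor rfl hA hB)]
          exact h₁
        rw [Functor.LaxMonoidal.μ_natural_assoc, NatTrans.naturality, reassoc_of% h,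
          tensorHom_comp_tensorHom_assoc, NatTrans.naturality, NatTrans.naturality,
          ← tensorHom_comp_tensorHom_assoc, Functor.LaxMonoidal.μ_natural] }
  cross g X := by
    refine GGradedCat.hom_ext_homog (C.φ g ⋙ S.functor) fun {a A} hA x => ?_
    have h : (natOfMod θ).app ((C.φ g).obj A) ≫ (S'.crossIso g A).hom =
        (S.crossIso g A).hom ≫ (D.φ g).map ((natOfMod θ).app A) := by
      obtain ⟨g, rfl⟩ := inv_surjective g
      have hg : g * a = (g * a * g⁻¹) * g := by group
      have h₁ := congrArg (fun f => f.hom) (PsGAut.modApp_act θ.mod g hg ⟨A, hA⟩)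
      have hA' : C.deg (g * a * g⁻¹) ((C.φ g⁻¹).obj A) :=
        ((C.actFunctor g hg).obj ⟨A, hA⟩).2
      rw [natOfMod_app θ hA, natOfMod_app θ hA']
      exact h₁
    rw [Functor.comp_map, NatTrans.naturality_assoc, S'.crossIso_naturality, reassoc_of% h,
      reassoc_of% S.crossIso_naturality, ← Functor.map_comp, ← Functor.map_comp,
      NatTrans.naturality]

end Full

instance (C D : GBraidedCat.{w, v, u} k G) :
    ((toBraidedMonoidaleFunctor k G).mapFunctor C D).Full where
  map_surjective θ := ⟨homOfMod θ, hom_ext_braidedMonoidale fun A => natOfMod_app θ A.2⟩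

instance (C D : GBraidedCat.{w, v, u} k G) :
    ((toBraidedMonoidaleFunctor k G).mapFunctor C D).IsEquivalence where

end GBraidedCat

/-! ### Inverting a 1-cell whose components are equivalences -/

instance LinCat.BilinFunctor.isIso_map {k : Type w} [CommRing k] {A B C : LinCat.{w, v, u} k}
    (F : BilinFunctor A B C) {X X' : A} {Y Y' : B} (f : X ⟶ X') (g : Y ⟶ Y') [IsIso f] [IsIso g] :
    IsIso (F.map f g) :=
  ⟨F.map (inv f) (inv g), by
    rw [← F.map_comp, IsIso.hom_inv_id, IsIso.hom_inv_id, F.map_id], by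
    rw [← F.map_comp, IsIso.inv_hom_id, IsIso.inv_hom_id, F.map_id]⟩

namespace BraidedMonoidale.Hom

variable {k : Type w} [CommRing k] {G : Type u} [Group G] {M N : BraidedMonoidale.{w, v, u} k G}
  (T : Hom M N)

/-- The component of a 1-cell at `a`. -/
abbrev fn (a : G) : M.ps.fib a ⥤ N.ps.fib a := PsGAut.comp T.trans a

variable [∀ a, (T.fn a).IsEquivalence]

/-- The inverse functors. -/
noncomputable def invFn (a : G) : N.ps.fib a ⥤ M.ps.fib a := (T.fn a).inv

/-- The counit `T (R B) ≅ B`. -/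
noncomputable def counitIso {a : G} (B : N.ps.fib a) : (T.fn a).obj ((T.invFn a).obj B) ≅ B :=
  (T.fn a).asEquivalence.counitIso.app B

theorem counitIso_naturality {a : G} {B B' : N.ps.fib a} (f : B ⟶ B') :
    (T.fn a).map ((T.invFn a).map f) ≫ (T.counitIso B').hom = (T.counitIso B).hom ≫ f :=
  (T.fn a).asEquivalence.counitIso.hom.naturality f

/-- The quasi-inverse is chosen merely as a functor. Its additivity is reflected by the faithful
additive functor `T.fn a`, by naturality of the counit. -/
instance (a : G) : (T.invFn a).Additive where
  map_add {B B' f f'} := (T.fn a).map_injective (by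
    rw [← cancel_mono (T.counitIso B').hom, (T.fn a).map_add, Preadditive.add_comp]
    simp only [counitIso_naturality]
    rw [Preadditive.comp_add])

instance (a : G) : (T.invFn a).Linear k where
  map_smul {_ B'} f r := (T.fn a).map_injective (by
    rw [← cancel_mono (T.counitIso B').hom, (T.fn a).map_smul, Linear.smul_comp]
    simp only [counitIso_naturality]
    rw [Linear.comp_smul])

/-- The pseudonaturality constraint of the inverse. -/
noncomputable def invAct {a b : G} (g : G) (h : g * a = b * g) (A : N.ps.fib a) :
    (T.invFn b).obj ((N.ps.act g h).obj A) ≅ (M.ps.act g h).obj ((T.invFn a).obj A) :=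
  (T.fn b).preimageIso (T.counitIso _ ≪≫ (N.ps.act g h).mapIso (T.counitIso A).symm ≪≫
    (PsGAut.compAct T.trans g h _).symm)

/-- The constraint of the inverse is the one that `T` and the counit force. This equation and the
analogous ones for tensor product and unit are all that is used of the definitions. -/
theorem map_invAct {a b : G} (g : G) (h : g * a = b * g) (A : N.ps.fib a) :
    (T.fn b).map (T.invAct g h A).hom ≫ (PsGAut.compAct T.trans g h ((T.invFn a).obj A)).hom ≫
      (N.ps.act g h).map (T.counitIso A).hom = (T.counitIso _).hom := by
  rw [invAct, Functor.preimageIso_hom, Functor.map_preimage]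
  simp only [Iso.trans_hom, Iso.symm_hom, Functor.mapIso_hom, Category.assoc]
  rw [Iso.inv_hom_id_assoc, ← Functor.map_comp, Iso.inv_hom_id, CategoryTheory.Functor.map_id,
    Category.comp_id]

theorem map_invAct_assoc {a b : G} (g : G) (h : g * a = b * g) (A : N.ps.fib a) {W : N.ps.fib b}
    (w : (N.ps.act g h).obj A ⟶ W) :
    (T.fn b).map (T.invAct g h A).hom ≫ (PsGAut.compAct T.trans g h ((T.invFn a).obj A)).hom ≫
      (N.ps.act g h).map (T.counitIso A).hom ≫ w = (T.counitIso _).hom ≫ w := by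
  rw [← map_invAct, Category.assoc, Category.assoc]

theorem map_invAct_inv {a b : G} (g : G) (h : g * a = b * g) (A : N.ps.fib a) :
    (T.fn b).map (T.invAct g h A).inv ≫ (T.counitIso _).hom =
      (PsGAut.compAct T.trans g h ((T.invFn a).obj A)).hom ≫
        (N.ps.act g h).map (T.counitIso A).hom := by
  rw [← map_invAct, ← Functor.map_comp_assoc, Iso.inv_hom_id, CategoryTheory.Functor.map_id,
    Category.id_comp]

/-- Morphisms to `g (R A)` agree if they do after `T`, as morphisms to `g A`. -/
theorem hom_ext_act {a b g : G} {h : g * a = b * g} {A : N.ps.fib a} {X : M.ps.fib b}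
    {x y : X ⟶ (M.ps.act g h).obj ((T.invFn a).obj A)}
    (e : (T.fn b).map x ≫ (PsGAut.compAct T.trans g h ((T.invFn a).obj A)).hom ≫
        (N.ps.act g h).map (T.counitIso A).hom =
      (T.fn b).map y ≫ (PsGAut.compAct T.trans g h ((T.invFn a).obj A)).hom ≫
        (N.ps.act g h).map (T.counitIso A).hom) : x = y :=
  (T.fn b).map_injective (by
    rwa [← cancel_mono ((PsGAut.compAct T.trans g h ((T.invFn a).obj A)).hom ≫
      (N.ps.act g h).map (T.counitIso A).hom)])

/-- Morphisms to `R A` agree if they do after `T`, as morphisms to `A`. -/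
theorem hom_ext_inv {a : G} {A : N.ps.fib a} {X : M.ps.fib a} {x y : X ⟶ (T.invFn a).obj A}
    (e : (T.fn a).map x ≫ (T.counitIso A).hom = (T.fn a).map y ≫ (T.counitIso A).hom) : x = y :=
  (T.fn a).map_injective (by rwa [← cancel_mono (T.counitIso A).hom])

/-- The pseudonatural transformation underlying the inverse. -/
noncomputable def invTrans : N.ps ⟶ M.ps :=
  PsGAut.mkTrans T.invFn
    (fun {a b} g h => NatIso.ofComponents (fun A => T.invAct g h A) fun {A B} f =>
      T.hom_ext_act (by
        have h₁ := PsGAut.compAct_naturality T.trans g h ((T.invFn a).map f)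
        simp only [Functor.comp_map, Functor.map_comp, Category.assoc, map_invAct]
        rw [counitIso_naturality, reassoc_of% h₁, ← Functor.map_comp, counitIso_naturality,
          Functor.map_comp, map_invAct_assoc]))
    (fun {a} h A => T.hom_ext_inv (by
      have h₁ := PsGAut.compAct_one T.trans h ((T.invFn a).obj A)
      rw [counitIso_naturality, Functor.map_comp, Category.assoc, ← h₁, Category.assoc,
        ← PsGAut.actOne_naturality]
      exact T.map_invAct_assoc 1 h A _))
    (fun {a b c f g e} hf hg he hm A => T.hom_ext_act (by
      have h₁ := PsGAut.compAct_mul T.trans hf hg he hm ((T.invFn a).obj A)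
      have h₂ := PsGAut.compAct_naturality T.trans g hg (T.invAct f hf A).hom
      simp only [NatIso.ofComponents_hom_app, Functor.map_comp, Category.assoc]
      rw [map_invAct, counitIso_naturality, ← reassoc_of% h₁, ← PsGAut.actMul_naturality,
        reassoc_of% h₂, ← Functor.map_comp_assoc, ← Functor.map_comp_assoc, Category.assoc,
        map_invAct, map_invAct_assoc]))

/-- The tensor constraint of the inverse. -/
noncomputable def invTensor {a b c : G} (h : a * b = c) (A : N.ps.fib a) (B : N.ps.fib b) :
    (M.tensor h).obj ((T.invFn a).obj A) ((T.invFn b).obj B) ≅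
      (T.invFn c).obj ((N.tensor h).obj A B) :=
  (T.fn c).preimageIso ((T.tensorIso h _ _).symm ≪≫
    (N.tensor h).mapIso (T.counitIso A) (T.counitIso B) ≪≫ (T.counitIso _).symm)

/-- After the tensor constraint of `T` and the counit, the tensor constraint of the inverse is just
the tensor product of the counits. Axioms for the inverse thereby become naturality of the
constraints of `N`. -/
theorem map_invTensor {a b c : G} (h : a * b = c) (A : N.ps.fib a) (B : N.ps.fib b) :
    (T.tensorIso h _ _).hom ≫ (T.fn c).map (T.invTensor h A B).hom ≫ (T.counitIso _).hom =
      (N.tensor h).map (T.counitIso A).hom (T.counitIso B).hom := by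
  rw [invTensor, Functor.preimageIso_hom, Functor.map_preimage]
  simp only [Iso.trans_hom, Iso.symm_hom, Category.assoc]
  rw [Iso.hom_inv_id_assoc, Iso.inv_hom_id, Category.comp_id]
  rfl

theorem map_invTensor_assoc {a b c : G} (h : a * b = c) (A : N.ps.fib a) (B : N.ps.fib b)
    {W : N.ps.fib c} (w : (N.tensor h).obj A B ⟶ W) :
    (T.tensorIso h _ _).hom ≫ (T.fn c).map (T.invTensor h A B).hom ≫ (T.counitIso _).hom ≫ w =
      (N.tensor h).map (T.counitIso A).hom (T.counitIso B).hom ≫ w := by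
  rw [← map_invTensor, Category.assoc, Category.assoc]

/-- The unit constraint of the inverse. -/
noncomputable def invUnit : M.unit ≅ (T.invFn 1).obj N.unit :=
  (T.fn 1).preimageIso (T.unitIso.symm ≪≫ (T.counitIso _).symm)

theorem map_invUnit :
    T.unitIso.hom ≫ (T.fn 1).map T.invUnit.hom ≫ (T.counitIso _).hom = 𝟙 _ := by
  rw [invUnit, Functor.preimageIso_hom, Functor.map_preimage]
  simp

theorem map_invUnit_assoc {W : N.ps.fib 1} (w : N.unit ⟶ W) :
    T.unitIso.hom ≫ (T.fn 1).map T.invUnit.hom ≫ (T.counitIso _).hom ≫ w = w := by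
  rw [← Category.assoc ((T.fn 1).map _), ← Category.assoc, map_invUnit, Category.id_comp]

/-- The inverse of a 1-cell whose components are equivalences. -/
noncomputable def inverse : Hom N M where
  trans := T.invTrans
  tensorIso h A B := T.invTensor h A B
  tensorIso_naturality {a b c} h {A A' B B'} x y := T.hom_ext_inv (by
    change (T.fn c).map ((M.tensor h).map ((T.invFn a).map x) ((T.invFn b).map y) ≫
      (T.invTensor h A' B').hom) ≫ (T.counitIso _).hom =
        (T.fn c).map ((T.invTensor h A B).hom ≫ (T.invFn c).map ((N.tensor h).map x y)) ≫
          (T.counitIso _).hom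
    have h₁ := T.tensorIso_naturality h ((T.invFn a).map x) ((T.invFn b).map y)
    rw [← cancel_epi (T.tensorIso h _ _).hom, Functor.map_comp, Functor.map_comp, Category.assoc,
      Category.assoc, counitIso_naturality, map_invTensor_assoc, ← reassoc_of% h₁, map_invTensor,
      ← LinCat.BilinFunctor.map_comp, counitIso_naturality, counitIso_naturality,
      LinCat.BilinFunctor.map_comp])
  unitIso := T.invUnit
  tensorIso_act {a b c a' b' c' g} h h' ha hb hc A B := T.hom_ext_act (by
    change (T.fn c').map ((M.tensor h').map (T.invAct g ha A).hom (T.invAct g hb B).hom ≫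
        (M.tensorAct h h' ha hb hc _ _).hom ≫ (M.ps.act g hc).map (T.invTensor h A B).hom) ≫ _ =
      (T.fn c').map ((T.invTensor h' _ _).hom ≫
        (T.invFn c').map (N.tensorAct h h' ha hb hc A B).hom ≫ (T.invAct g hc _).hom) ≫ _
    have h₁ := T.tensorIso_naturality h' (T.invAct g ha A).hom (T.invAct g hb B).hom
    have h₂ := T.tensorIso_act h h' ha hb hc ((T.invFn a).obj A) ((T.invFn b).obj B)
    have h₃ := PsGAut.compAct_naturality T.trans g hc (T.invTensor h A B).hom
    have h₄ := N.tensorAct_naturality h h' ha hb hc (T.counitIso A).hom (T.counitIso B).hom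
    rw [← cancel_epi (T.tensorIso h' _ _).hom]
    simp only [Functor.map_comp, Category.assoc]
    rw [map_invAct, counitIso_naturality, map_invTensor_assoc, ← reassoc_of% h₁, reassoc_of% h₃,
      ← reassoc_of% h₂, ← Functor.map_comp, ← Functor.map_comp, map_invTensor, ← h₄,
      ← LinCat.BilinFunctor.map_comp_assoc, ← LinCat.BilinFunctor.map_comp_assoc,
      Category.assoc, Category.assoc, map_invAct, map_invAct])
  unitIso_act {g} h := T.hom_ext_act (by
    change (T.fn 1).map ((M.unitAct h).hom ≫ (M.ps.act g h).map T.invUnit.hom) ≫ _ =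
      (T.fn 1).map (T.invUnit.hom ≫ (T.invFn 1).map (N.unitAct h).hom ≫
        (T.invAct g h N.unit).hom) ≫ _
    have h₁ := T.unitIso_act h
    have h₃ := PsGAut.compAct_naturality T.trans g h T.invUnit.hom
    rw [← cancel_epi T.unitIso.hom]
    simp only [Functor.map_comp, Category.assoc]
    rw [map_invAct, counitIso_naturality, map_invUnit_assoc, reassoc_of% h₃, ← reassoc_of% h₁,
      ← Functor.map_comp, ← Functor.map_comp, map_invUnit, CategoryTheory.Functor.map_id,
      Category.comp_id])
  assoc {a b c p q s} hp hpc hq haq A B E := T.hom_ext_inv (by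
    change (T.fn s).map ((M.tensor hpc).map (T.invTensor hp A B).hom (𝟙 _) ≫
        (T.invTensor hpc _ E).hom ≫ (T.invFn s).map (N.assoc hp hpc hq haq A B E).hom) ≫ _ =
      (T.fn s).map ((M.assoc hp hpc hq haq _ _ _).hom ≫
        (M.tensor haq).map (𝟙 _) (T.invTensor hq B E).hom ≫ (T.invTensor haq A _).hom) ≫ _
    have h₁ := T.assoc hp hpc hq haq ((T.invFn a).obj A) ((T.invFn b).obj B) ((T.invFn c).obj E)
    have h₂ := T.tensorIso_naturality hpc (T.invTensor hp A B).hom (𝟙 ((T.invFn c).obj E))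
    have h₃ := T.tensorIso_naturality haq (𝟙 ((T.invFn a).obj A)) (T.invTensor hq B E).hom
    have h₄ := N.assoc_naturality hp hpc hq haq (T.counitIso A).hom (T.counitIso B).hom
      (T.counitIso E).hom
    -- The tensor constraints of `T` are put in front so that `map_invTensor` can be used. Their
    -- images under the tensor product of `N` can be cancelled by `isIso_map`.
    rw [← cancel_epi (T.tensorIso hpc _ _).hom,
      ← cancel_epi ((N.tensor hpc).map (T.tensorIso hp _ _).hom (𝟙 _))]
    simp only [Functor.map_comp, Category.assoc]
    rw [counitIso_naturality, ← reassoc_of% h₂, map_invTensor_assoc, reassoc_of% h₁,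
      ← reassoc_of% h₃, map_invTensor, ← LinCat.BilinFunctor.map_comp_assoc,
      ← LinCat.BilinFunctor.map_comp_assoc, ← LinCat.BilinFunctor.map_comp,
      ← LinCat.BilinFunctor.map_comp, CategoryTheory.Functor.map_id,
      CategoryTheory.Functor.map_id]
    simp only [Category.assoc, Category.id_comp]
    rw [map_invTensor, map_invTensor, h₄])
  leftUnit {a} h A := T.hom_ext_inv (by
    change (T.fn a).map ((M.tensor h).map T.invUnit.hom (𝟙 _) ≫ (T.invTensor h _ A).hom ≫
      (T.invFn a).map (N.leftUnit h A).hom) ≫ _ =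
        (T.fn a).map (M.leftUnit h ((T.invFn a).obj A)).hom ≫ _
    have h₁ := T.leftUnit h ((T.invFn a).obj A)
    have h₂ := T.tensorIso_naturality h T.invUnit.hom (𝟙 ((T.invFn a).obj A))
    have h₃ := N.leftUnit_naturality h (T.counitIso A).hom
    rw [← cancel_epi (T.tensorIso h _ _).hom,
      ← cancel_epi ((N.tensor h).map T.unitIso.hom (𝟙 _))]
    simp only [Functor.map_comp, Category.assoc]
    rw [counitIso_naturality, ← reassoc_of% h₂, map_invTensor_assoc, reassoc_of% h₁, ← h₃,
      ← LinCat.BilinFunctor.map_comp_assoc, ← LinCat.BilinFunctor.map_comp_assoc,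
      CategoryTheory.Functor.map_id]
    simp only [Category.assoc, Category.id_comp]
    rw [map_invUnit])
  rightUnit {a} h A := T.hom_ext_inv (by
    change (T.fn a).map ((M.tensor h).map (𝟙 _) T.invUnit.hom ≫ (T.invTensor h A _).hom ≫
      (T.invFn a).map (N.rightUnit h A).hom) ≫ _ =
        (T.fn a).map (M.rightUnit h ((T.invFn a).obj A)).hom ≫ _
    have h₁ := T.rightUnit h ((T.invFn a).obj A)
    have h₂ := T.tensorIso_naturality h (𝟙 ((T.invFn a).obj A)) T.invUnit.hom
    have h₃ := N.rightUnit_naturality h (T.counitIso A).hom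
    rw [← cancel_epi (T.tensorIso h _ _).hom,
      ← cancel_epi ((N.tensor h).map (𝟙 ((T.fn a).obj ((T.invFn a).obj A))) T.unitIso.hom)]
    simp only [Functor.map_comp, Category.assoc]
    rw [counitIso_naturality, ← reassoc_of% h₂, map_invTensor_assoc, reassoc_of% h₁, ← h₃,
      ← LinCat.BilinFunctor.map_comp_assoc, ← LinCat.BilinFunctor.map_comp_assoc,
      CategoryTheory.Functor.map_id]
    simp only [Category.assoc, Category.id_comp]
    rw [map_invUnit])
  braid {a b b' c} h hb h' A B := T.hom_ext_inv (by
    change (T.fn c).map ((T.invTensor h A B).hom ≫ (T.invFn c).map (N.braid h hb h' A B).hom) ≫ _ =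
      (T.fn c).map ((M.braid h hb h' _ _).hom ≫ (M.tensor h').map (T.invAct a hb B).inv (𝟙 _) ≫
        (T.invTensor h' _ A).hom) ≫ _
    have h₁ := T.braid h hb h' ((T.invFn a).obj A) ((T.invFn b).obj B)
    have h₂ := T.tensorIso_naturality h' (T.invAct a hb B).inv (𝟙 ((T.invFn a).obj A))
    have h₃ := N.braid_naturality h hb h' (T.counitIso A).hom (T.counitIso B).hom
    rw [← cancel_epi (T.tensorIso h _ _).hom]
    simp only [Functor.map_comp, Category.assoc]
    rw [counitIso_naturality, map_invTensor_assoc, reassoc_of% h₁, ← reassoc_of% h₂, map_invTensor,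
      h₃, ← LinCat.BilinFunctor.map_comp, ← LinCat.BilinFunctor.map_comp,
      CategoryTheory.Functor.map_id]
    simp only [Category.id_comp]
    rw [map_invAct_inv, Iso.inv_hom_id_assoc])

/-- The counit of the equivalence. -/
noncomputable def inverseCompIso :
    (show N ⟶ M from T.inverse) ≫ (show M ⟶ N from T) ≅ 𝟙 N :=
  BraidedMonoidale.isoMk
    (PsGAut.mkModIso (fun a => (T.fn a).asEquivalence.counitIso) (fun {a b} g h A => by
      have h₁ := PsGAut.compAct_comp T.invTrans T.trans g h A
      have h₂ := T.map_invAct g h A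
      refine (congrArg (_ ≫ ·) (PsGAut.compAct_id g h A)).trans ((Category.comp_id _).trans ?_)
      refine Eq.trans ?_ (congrArg (· ≫ _) h₁).symm
      exact h₂.symm.trans (Category.assoc _ _ _).symm))
    (fun {a b c} h A B => by
      have h₁ := T.map_invTensor h A B
      refine (Category.assoc _ _ _).trans (h₁.trans (Category.comp_id _).symm))
    (by
      refine (Category.assoc _ _ _).trans T.map_invUnit)

/-- The unit `A ≅ R (T A)`. -/
noncomputable def invFnIso {a : G} (A : M.ps.fib a) : A ≅ (T.invFn a).obj ((T.fn a).obj A) :=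
  (T.fn a).preimageIso (T.counitIso _).symm

theorem map_invFnIso {a : G} (A : M.ps.fib a) :
    (T.fn a).map (T.invFnIso A).hom ≫ (T.counitIso _).hom = 𝟙 _ := by
  rw [invFnIso, Functor.preimageIso_hom, Functor.map_preimage, Iso.symm_hom, Iso.inv_hom_id]

theorem map_invFnIso_assoc {a : G} (A : M.ps.fib a) {W : N.ps.fib a} (w : (T.fn a).obj A ⟶ W) :
    (T.fn a).map (T.invFnIso A).hom ≫ (T.counitIso _).hom ≫ w = w := by
  rw [← Category.assoc, map_invFnIso, Category.id_comp]

theorem invFnIso_naturality {a : G} {A B : M.ps.fib a} (f : A ⟶ B) :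
    f ≫ (T.invFnIso B).hom = (T.invFnIso A).hom ≫ (T.invFn a).map ((T.fn a).map f) :=
  T.hom_ext_inv (by
    simp only [Functor.map_comp, Category.assoc]
    rw [map_invFnIso, counitIso_naturality, map_invFnIso_assoc, Category.comp_id])

/-- The unit of the equivalence. -/
noncomputable def compInverseIso :
    𝟙 M ≅ (show M ⟶ N from T) ≫ (show N ⟶ M from T.inverse) :=
  BraidedMonoidale.isoMk
    (PsGAut.mkModIso
      (fun a => NatIso.ofComponents (F := 𝟭 _) (G := T.fn a ⋙ T.invFn a) (fun A => T.invFnIso A)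
        fun f => T.invFnIso_naturality f)
      (fun {a b} g h A => T.hom_ext_act (by
        have h₁ := PsGAut.compAct_comp T.trans T.invTrans g h A
        have h₂ := PsGAut.compAct_naturality T.trans g h (T.invFnIso A).hom
        -- The required equation, with the constraint of the composite of `T` and its inverse
        -- written out.
        have key : (T.fn b).map ((T.invFnIso ((M.ps.act g h).obj A)).hom ≫
            (T.invFn b).map (PsGAut.compAct T.trans g h A).hom ≫
              (T.invAct g h ((T.fn a).obj A)).hom) ≫
              (PsGAut.compAct T.trans g h _).hom ≫ (N.ps.act g h).map (T.counitIso _).hom =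
            (T.fn b).map ((M.ps.act g h).map (T.invFnIso A).hom) ≫
              (PsGAut.compAct T.trans g h _).hom ≫ (N.ps.act g h).map (T.counitIso _).hom := by
          simp only [Functor.map_comp, Category.assoc]
          rw [map_invAct, counitIso_naturality, map_invFnIso_assoc, reassoc_of% h₂,
            ← Functor.map_comp, map_invFnIso, CategoryTheory.Functor.map_id, Category.comp_id]
        refine Eq.trans ?_ (key.trans ?_)
        · exact congrArg (fun z => (T.fn b).map (_ ≫ z) ≫ _) h₁
        · exact congrArg (fun z => (T.fn b).map z ≫ _)
            ((congrArg (· ≫ _) (PsGAut.compAct_id g h A)).trans (Category.id_comp _)).symm)))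
    (fun {a b c} h A B => T.hom_ext_inv (by
      have h₁ := T.tensorIso_naturality h (T.invFnIso A).hom (T.invFnIso B).hom
      have key : (T.fn c).map (T.invFnIso ((M.tensor h).obj A B)).hom ≫ (T.counitIso _).hom =
          (T.fn c).map ((M.tensor h).map (T.invFnIso A).hom (T.invFnIso B).hom ≫
            (T.invTensor h _ _).hom ≫ (T.invFn c).map (T.tensorIso h A B).hom) ≫
              (T.counitIso _).hom := by
        rw [map_invFnIso, ← cancel_epi (T.tensorIso h A B).hom]
        simp only [Functor.map_comp, Category.assoc]
        rw [counitIso_naturality, ← reassoc_of% h₁, map_invTensor_assoc,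
          ← LinCat.BilinFunctor.map_comp_assoc, map_invFnIso, map_invFnIso,
          LinCat.BilinFunctor.map_id, Category.id_comp, Category.comp_id]
      exact (congrArg (fun z => (T.fn c).map z ≫ _) (Category.id_comp _)).trans key))
    (T.hom_ext_inv (by
      have key : (T.fn 1).map (T.invFnIso M.unit).hom ≫ (T.counitIso _).hom =
          (T.fn 1).map (T.invUnit.hom ≫ (T.invFn 1).map T.unitIso.hom) ≫
              (T.counitIso _).hom := by
        rw [map_invFnIso, ← cancel_epi T.unitIso.hom]
        simp only [Functor.map_comp, Category.assoc]
        rw [counitIso_naturality, map_invUnit_assoc, Category.comp_id]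
      exact (congrArg (fun z => (T.fn 1).map z ≫ _) (Category.id_comp _)).trans key))

/-- A 1-cell whose components are equivalences is an equivalence. -/
noncomputable def equivalence : M ≌ N :=
  -- The triangle identity need not be checked: the counit is replaced by one that satisfies it.
  Bicategory.Equivalence.mkOfAdjointifyCounit T.compInverseIso T.inverseCompIso

end BraidedMonoidale.Hom

/-! ### Finite direct sums in the values, and the theorem -/

namespace BraidedMonoidale

variable {k : Type w} [CommRing k] {G : Type u} [Group G] {M N : BraidedMonoidale.{w, v, u} k G}

/-- The components of an equivalence are equivalences. -/
noncomputable def fibEquivalence (e : M ≌ N) (a : G) :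
    CategoryTheory.Equivalence (M.ps.fib a) (N.ps.fib a) :=
  CategoryTheory.Equivalence.mk (PsGAut.comp (Hom.trans e.hom) a) (PsGAut.comp (Hom.trans e.inv) a)
    (NatIso.ofComponents
      (F := 𝟭 _) (G := PsGAut.comp (Hom.trans e.hom) a ⋙ PsGAut.comp (Hom.trans e.inv) a)
      (fun A =>
        { hom := PsGAut.modApp (Hom₂.mod e.unit.hom) A
          inv := PsGAut.modApp (Hom₂.mod e.unit.inv) A
          hom_inv_id := congrArg (fun z => PsGAut.modApp (Hom₂.mod z) A) e.unit.hom_inv_id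
          inv_hom_id := congrArg (fun z => PsGAut.modApp (Hom₂.mod z) A) e.unit.inv_hom_id })
      fun f => PsGAut.modApp_naturality (Hom₂.mod e.unit.hom) f)
    (NatIso.ofComponents
      (F := PsGAut.comp (Hom.trans e.inv) a ⋙ PsGAut.comp (Hom.trans e.hom) a) (G := 𝟭 _)
      (fun A =>
        { hom := PsGAut.modApp (Hom₂.mod e.counit.hom) A
          inv := PsGAut.modApp (Hom₂.mod e.counit.inv) A
          hom_inv_id := congrArg (fun z => PsGAut.modApp (Hom₂.mod z) A) e.counit.hom_inv_id
          inv_hom_id := congrArg (fun z => PsGAut.modApp (Hom₂.mod z) A) e.counit.inv_hom_id })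
      fun f => PsGAut.modApp_naturality (Hom₂.mod e.counit.hom) f)

/-- Finite products pass along an equivalence of categories, and in a preadditive category they are
biproducts. -/
theorem hasFiniteBiproducts_of_equivalence (e : M ≌ N) (a : G)
    [Limits.HasFiniteBiproducts (N.ps.fib a)] : Limits.HasFiniteBiproducts (M.ps.fib a) :=
  have : Limits.HasFiniteProducts (M.ps.fib a) :=
    ⟨fun _ => Adjunction.hasLimitsOfShape_of_equivalence (fibEquivalence e a).functor⟩
  Limits.HasFiniteBiproducts.of_hasFiniteProducts

/-- The embedding is fully faithful, and each object of the target is a direct sum of objects in its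
image. Being additive, it preserves the direct sums of the source, so that object is the image of a
direct sum. -/
theorem embFunctor_isEquivalence (M : BraidedMonoidale.{w, v, u} k G) (a : G)
    [Limits.HasFiniteBiproducts (M.ps.fib a)] : (M.embFunctor a).IsEquivalence where
  essSurj := ⟨fun Y => by
    obtain ⟨n, X, b, ⟨hb⟩, ⟨e⟩⟩ := M.embFunctor_isDirectSum Y
    exact ⟨⨁ X, ⟨(M.embFunctor a).mapBiproduct X ≪≫
      (Limits.biproduct.uniqueUpToIso _ hb).symm ≪≫ e⟩⟩⟩

end BraidedMonoidale

end

theorem mainTheorem3 {k : Type w} [CommRing k] {G : Type u} [Group G] :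
    ∃ F : Pseudofunctor (GBraidedCat.{w, v, u} k G) (BraidedMonoidale.{w, v, u} k G),
      (∀ (C : GBraidedCat.{w, v, u} k G) (a : G),
        (F.obj C).ps.fib a = LinCat.of k (C.deg a).FullSubcategory) ∧
      (∀ C D : GBraidedCat.{w, v, u} k G, (F.mapFunctor C D).IsEquivalence) ∧
      (∀ M : BraidedMonoidale.{w, v, u} k G,
        (∃ C : GBraidedCat.{w, v, u} k G, Nonempty (M ≌ F.obj C)) ↔
          ∀ a : G, Limits.HasFiniteBiproducts (M.ps.fib a)) ∧
      (∀ M : BraidedMonoidale.{w, v, u} k G,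
        ∃ (C : GBraidedCat.{w, v, u} k G) (η : M ⟶ F.obj C), ∀ a : G,
          (PsGAut.comp (BraidedMonoidale.Hom.trans η) a).Full ∧
          (PsGAut.comp (BraidedMonoidale.Hom.trans η) a).Faithful ∧
          ∀ Y : (F.obj C).ps.fib a, ∃ (n : ℕ) (X : Fin n → M.ps.fib a),
            IsDirectSum Y fun i => (PsGAut.comp (BraidedMonoidale.Hom.trans η) a).obj (X i)) := by
  refine ⟨GBraidedCat.toBraidedMonoidaleFunctor k G, fun C a => rfl, fun C D => inferInstance,
    fun M => ⟨?_, fun _ => ?_⟩, fun M => ?_⟩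
  · rintro ⟨C, ⟨e⟩⟩ a
    have : Limits.HasFiniteBiproducts
        (((GBraidedCat.toBraidedMonoidaleFunctor k G).obj C).ps.fib a) :=
      C.deg_hasFiniteBiproducts a
    exact BraidedMonoidale.hasFiniteBiproducts_of_equivalence e a
  -- The completion of `M` serves as the $G$-braided category: direct sums in the values make the
  -- embedding an equivalence in each degree, hence an equivalence of braided monoidales.
  · have : ∀ a, (M.emb.fn a).IsEquivalence := fun a => M.embFunctor_isEquivalence a
    exact ⟨M.compl, ⟨M.emb.equivalence⟩⟩
  · exact ⟨M.compl, M.emb, fun a => ⟨inferInstanceAs (M.embFunctor a).Full,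
      inferInstanceAs (M.embFunctor a).Faithful, M.embFunctor_isDirectSum⟩⟩
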